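/- **Setting.** Let $d\ge 3$, $L>0$, $\Lambda=[-\sqrt{2\pi}L/2,\sqrt{2\pi}L/2]^d$ and $\Lambda^*=(\sqrt{2\pi}L^{-1}\mathbb Z)^d$. On $\Lambda^*$ write $\int dk:=L^{-d}\sum_{k\in\Lambda^*}$, $\delta(k):=L^d\mathbf 1(k=0)$, $\chi(k):=\mathbf 1(k=0)$; on $\mathbb R^d$, $dk$ is Lebesgue measure divided by $(2\pi)^{d/2}$. Let $\langle k\rangle=(k^2+1)^{1/2}$. Let $e,\omega,Q:\mathbb R^d\to\mathbb R$ be continuous, $\omega,Q$ even, $|Q(k)|\le C_7\langle k\rangle^{-2d-12}$, and let $\beta>0$, $\mu,\lambda\in\mathbb R$ with $\omega(k)-\mu\beta^{-1}\ge C_6>0$ for all $k$. The electron space is $\mathcal H_e=L^2_{per}(\Lambda)$, and $\mathcal H_{ph}$ is the bosonic Fock space of the modes $k\in\Lambda^*$, with $[c_k,c^\dagger_{k'}]=\delta(k-k')$. On $\mathcal H_e\otimes\mathcal H_{ph}$ let $H_0=e(-i\nabla)+\int\omega(k)c_k^\dagger c_k\,dk$ and let the interaction be $i\lambda\int Q(k)e^{-ik\cdot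 x}b_k\,dk$ with $b_k=c_k^\dagger-c_{-k}$. Assume that $Z_\Lambda=\mathrm{Tr}\exp(\int[-\beta\omega(k)+\mu]c_k^\dagger c_k\,dk)$ is finite for every $L$, and put $\gamma_{ph}=Z_\Lambda^{-1}\exp(\int[-\beta\omega(k)+\mu]c_k^\dagger c_k\,dk)$. For every $L$ let $\gamma_e$ be a density matrix on $\mathcal H_e$ (positive, trace one) with momentum kernel $\widehat\gamma_e(p,q)$, normalized by $\int\widehat\gamma_e(p,p)\,dp=1$, and let $\Gamma_0=\gamma_e\otimes\gamma_{ph}$. Write $\int_0^{t*}[ds_j]_0^N=\int_{[0,t]^{N+1}}\prod_j ds_j\,\delta(t-\sum_j s_j)$ and $$\mathcal B(t,\underline k,N)=\lambda^N\int_0^{t*}[ds_j]_0^N\,e^{-is_0H_0}\prod_{j=1}^N\Big(Q(k_j)e^{-ik_j\cdot x}b_{k_j}e^{-is_jH_0}\Big).$$ Let $\mathcal M(n,N)$ be the set of $\underline m=(m_0,\dots,m_n)\in\mathbb N^{n+1}$ with $n+2\sum_jm_j=N$. Put $\mu(j)=j+2\sum_{i<j}m_i$, $I=\{\mu(1),\dots,\mu(n)\}$,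 $I_j=\{\mu(j)+1,\mu(j)+3,\dots,\mu(j)+2m_j-1\}$, $I_j^c=\{\mu(j),\mu(j)+2,\dots,\mu(j)+2m_j\}$, $J=\bigcup_jI_j$, and $$\mathcal E^0_{n,N}(t)=\sum_{\underline m\in\mathcal M(n,N)}\int dk_1\cdots dk_N\prod_{b\in J}\chi(k_b+k_{b+1})\prod_{b\ne b'\in I}\big(1-\chi(k_b+k_{b'})\big)\,\mathcal B(t,\underline k,N).$$ Let $\mathcal N=e^{-\beta\omega+\mu}/(1-e^{-\beta\omega+\mu})$, $M(k,\sigma)=|Q(k)|^2(\mathcal N(k)+\frac{\sigma+1}2)$, $\Phi_\sigma(p,k)=e(k+p)+\sigma\omega(k)$ for $\sigma=\pm1$, and $$\Theta(s,p,\Omega)=\sum_\sigma\int e^{-is[\Phi_\sigma(p,k)+\Omega]}M(k,\sigma)\,dk,\qquad \Upsilon_\eta(\alpha,p)=\sum_\sigma\int\frac{M(k,\sigma)\,dk}{\alpha-\Phi_\sigma(p,k)+i\eta}.$$ Here $dk$ is either the integration over $\Lambda^*$ or that over $\mathbb R^d$; both versions are considered. For $\underline m,\underline{\widetilde m}\in\mathcal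 M(n,N)$ and a permutation $\pi\in\Pi_n$ of $\{1,\dots,n\}$ let $$C_{\underline m,\underline{\widetilde m},\pi}(t)=\lambda^{2N}\sum_{\underline\sigma\in\{\pm1\}^n}\int\Big(\prod_{j=1}^nM(k_j,\sigma_j)\delta(k_j-\widetilde k_{\pi(j)})dk_jd\widetilde k_j\Big)dp_nd\widetilde p_n\,\delta(p_n-\widetilde p_n)\widehat\gamma_e(p_n,\widetilde p_n)\,Y,$$ the integrals being over $\Lambda^*$. With $p_j=p_n+\sum_{\ell>j}k_\ell$, $\widetilde p_j=\widetilde p_n+\sum_{\ell>j}\widetilde k_\ell$, $\Omega_j=\sum_{\ell>j}\sigma_\ell\omega(k_\ell)$, $\widetilde\Omega_j=\sum_{\ell>j}\sigma_{\pi^{-1}(\ell)}\omega(\widetilde k_\ell)$, and with $\widetilde I_j,\widetilde I_j^c$ the sets of $\underline{\widetilde m}$, $$Y=\int_0^{t*}[ds_b]_0^N\prod_{j=0}^n\Big[\prod_{b\in I_j^c}e^{-is_b[e(p_j)+\Omega_j]}\prod_{b\in I_j}\Theta(s_b,p_j,\Omega_j)\Big]\int_0^{t*}[d\widetilde s_b]_0^N\prod_{j=0}^n\Big[\prod_{b\in\widetilde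 I_j^c}e^{i\widetilde s_b[e(\widetilde p_j)+\widetilde\Omega_j]}\prod_{b\in\widetilde I_j}\overline{\Theta(\widetilde s_b,\widetilde p_j,\widetilde\Omega_j)}\Big].$$ **Proposition.** Let $n\le N$ with $N-n$ even, and $t>0$. (a) For each $L$ the series (sums over $\Lambda^*$ and over basis vectors) defining the trace below and $C_{\underline m,\underline{\widetilde m},\pi}(t)$ converge absolutely, and, with the integrations in $\Theta$ taken over $\Lambda^*$, $$\limsup_{L\to\infty}\Big|\mathrm{Tr}\Big(\mathcal E^0_{n,N}(t)\Gamma_0[\mathcal E^0_{n,N}(t)]^*\Big)-\sum_{\underline m,\underline{\widetilde m}\in\mathcal M(n,N)}\sum_{\pi\in\Pi_n}C_{\underline m,\underline{\widetilde m},\pi}(t)\Big|=0.$$ If moreover $\int\langle p\rangle^{3d+12}\widehat\gamma_e(p,p)\,dp\le C_8$ for some constant $C_8$ and all large $L$, the same holds with the integrations in $\Theta$ taken over $\mathbb R^d$. (b) In both versions, for every $\eta>0$ and all $\underline m$, $\underline{\widetilde m}$, $\pi$, $p_n$, $\widetilde p_n$, $\underline k$, $\underline{\widetilde k}$ (arbitrary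 vectors in $\mathbb R^d$) and $\underline\sigma$, $$Y=\frac{e^{2t\eta}}{(2\pi)^2}\int_{-\infty}^\infty d\alpha\,e^{-it\alpha}\prod_{j=0}^nR_j^{m_j+1}\Upsilon_\eta(\alpha-\Omega_j,p_j)^{m_j}\int_{-\infty}^\infty d\widetilde\alpha\,e^{it\widetilde\alpha}\prod_{j=0}^n\widetilde R_j^{\widetilde m_j+1}\overline{\Upsilon_\eta(\widetilde\alpha-\widetilde\Omega_j,\widetilde p_j)}^{\,\widetilde m_j},$$ $$R_j=\frac1{\alpha-e(p_j)-\Omega_j+i\eta},\qquad\widetilde R_j=\frac1{\widetilde\alpha-e(\widetilde p_j)-\widetilde\Omega_j-i\eta}.$$ The $\alpha$-integrals converge absolutely if $N\ge1$, and as improper integrals if $N=0$. -/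

import Mathlib

open MeasureTheory Filter Topology
open scoped ComplexConjugate

noncomputable section

namespace ElectronPhonon

/-! ### Momenta, volumes and integration conventions -/

/-- Momentum space `ℝ^d`. -/
abbrev Momentum (d : ℕ) : Type := EuclideanSpace ℝ (Fin d)

/-- Labels of the dual lattice: `z : ℤ^d` stands for the momentum `√(2π) L⁻¹ z`. -/
abbrev Mode (d : ℕ) : Type := Fin d → ℤ

/-- The point `√(2π) L⁻¹ z` of the dual lattice `Λ* = (√(2π) L⁻¹ ℤ)^d` of the box
`Λ = [-√(2π) L / 2, √(2π) L / 2]^d`. -/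
def latticePoint {d : ℕ} (L : ℝ) (z : Mode d) : Momentum d :=
  WithLp.toLp 2 (fun i => Real.sqrt (2 * Real.pi) / L * (z i : ℝ))

/-- The lattice delta function: `L^d` at the origin and `0` elsewhere. -/
def latticeDelta {d : ℕ} (L : ℝ) (z : Mode d) : ℝ := if z = 0 then L ^ d else 0

/-- The characteristic function of the origin of the dual lattice. -/
def chi {d : ℕ} (z : Mode d) : ℝ := if z = 0 then 1 else 0

/-- Finite volume momentum integration `∫ f(k) dk = L^{-d} ∑_{k ∈ Λ*} f(k)`, as a measure. -/
def latticeMeasure (d : ℕ) (L : ℝ) : Measure (Momentum d) :=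
  ENNReal.ofReal ((L ^ d)⁻¹) • Measure.sum (fun z : Mode d => Measure.dirac (latticePoint L z))

/-- Infinite volume momentum integration: Lebesgue measure divided by `(2π)^{d/2}`. -/
def spaceMeasure (d : ℕ) : Measure (Momentum d) :=
  ENNReal.ofReal ((Real.sqrt (2 * Real.pi) ^ d)⁻¹) • (volume : Measure (Momentum d))

/-- `⟨k⟩ = (k² + 1)^{1/2}`. -/
def bracket {d : ℕ} (k : Momentum d) : ℝ := Real.sqrt (‖k‖ ^ 2 + 1)

/-- The entry number `b` of the tuple `(u_1, …, u_N)`, entries being counted from `1`. -/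
def entry {X : Type*} [Zero X] {N : ℕ} (u : Fin N → X) (b : ℕ) : X :=
  if h : 1 ≤ b ∧ b ≤ N then u ⟨b - 1, by omega⟩ else 0

/-- The point `(s_0, s_1, …, s_N)` with `s_j = u_j` for `j ≥ 1` and `∑_j s_j = t`. -/
def durations {N : ℕ} (t : ℝ) (u : Fin N → ℝ) (b : ℕ) : ℝ :=
  if b = 0 then t - ∑ j, u j else entry u b

/-- `∫_0^t ⋯ ∫_0^t (∏_{j=0}^N ds_j) δ(t - ∑_{j=0}^N s_j) F(s_0, …, s_N)`: the variable `s_0` is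
eliminated by the delta function and `(s_1, …, s_N)` runs over the simplex
`s_j ≥ 0`, `∑_{j ≥ 1} s_j ≤ t`. -/
def simplexIntegral (N : ℕ) (t : ℝ) (F : (ℕ → ℝ) → ℂ) : ℂ :=
  ∫ u in {u : Fin N → ℝ | (∀ j, 0 ≤ u j) ∧ ∑ j, u j ≤ t}, F (durations t u)

/-- The improper integral `∫_{-∞}^{∞} f(α) dα` converges and equals `I`. -/
def HasImproperIntegral (f : ℝ → ℂ) (I : ℂ) : Prop :=
  Tendsto (fun x : ℝ × ℝ => ∫ α in x.1..x.2, f α) (atBot ×ˢ atTop) (𝓝 I)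

/-! ### The model -/

/-- The data of the electron-phonon system: electron dispersion `e`, phonon dispersion `ω`,
form factor `Q`, inverse temperature `β`, chemical potential `μ`, coupling constant `λ`. -/
structure Model (d : ℕ) where
  e : Momentum d → ℝ
  ω : Momentum d → ℝ
  Q : Momentum d → ℝ
  β : ℝ
  chem : ℝ
  coupling : ℝ

/-- Labels of the orthonormal basis `|p⟩ ⊗ |n⟩` of the total space `ℋ_e ⊗ ℋ_ph` in momentum
representation: `p` is the electron momentum (plane wave in `L²_per(Λ)`), and `n` is the
configuration of phonon occupation numbers (finitely many phonons). -/
abbrev Label (d : ℕ) : Type := Mode d × (Mode d →₀ ℕ)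

/-- Finite linear combinations of the basis vectors. -/
abbrev FiniteVec (d : ℕ) : Type := Label d →₀ ℂ

/-- Operators on finite linear combinations; the product is composition. -/
abbrev Op (d : ℕ) : Type := Module.End ℂ (FiniteVec d)

/-- The matrix element `⟨f| T |a⟩`. -/
def matrixElement {d : ℕ} (T : Op d) (f a : Label d) : ℂ := T (Finsupp.single a 1) f

/-- The creation operator `c†_k = L^{d/2} a†_k`, where
`a†_k |p, n⟩ = (n_k + 1)^{1/2} |p, n + 1_k⟩`. -/
def create {d : ℕ} (L : ℝ) (k : Mode d) : Op d :=
  Finsupp.linearCombination ℂ (fun a : Label d =>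
    Finsupp.single (a.1, a.2 + Finsupp.single k 1)
      ((Real.sqrt (L ^ d) * Real.sqrt ((a.2 k : ℝ) + 1) : ℝ) : ℂ))

/-- The annihilation operator `c_k = L^{d/2} a_k`, where
`a_k |p, n⟩ = (n_k)^{1/2} |p, n - 1_k⟩`. -/
def annihilate {d : ℕ} (L : ℝ) (k : Mode d) : Op d :=
  Finsupp.linearCombination ℂ (fun a : Label d =>
    Finsupp.single (a.1, a.2 - Finsupp.single k 1)
      ((Real.sqrt (L ^ d) * Real.sqrt (a.2 k : ℝ) : ℝ) : ℂ))

/-- Multiplication by `e^{-i k·x}` on the electron space: it maps `|p⟩` to `|p - k⟩`. -/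
def planeWave {d : ℕ} (k : Mode d) : Op d :=
  Finsupp.linearCombination ℂ (fun a : Label d => Finsupp.single (a.1 - k, a.2) (1 : ℂ))

/-- `b_k = c†_k - c_{-k}`. -/
def bOp {d : ℕ} (L : ℝ) (k : Mode d) : Op d := create L k - annihilate L (-k)

namespace Model

variable {d : ℕ} (P : Model d)

/-- The eigenvalue of `H_ph` on `|n⟩`. -/
def phononEnergy (L : ℝ) (n : Mode d →₀ ℕ) : ℝ :=
  n.sum fun k j => (j : ℝ) * P.ω (latticePoint L k)

/-- The free evolution `e^{-isH_0}`, `H_0 = H_e + H_ph`. -/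
def freeEvolution (L s : ℝ) : Op d :=
  Finsupp.linearCombination ℂ (fun a : Label d =>
    Finsupp.single a (Complex.exp (-Complex.I *
      ((s * (P.e (latticePoint L a.1) + P.phononEnergy L a.2) : ℝ) : ℂ))))

/-- `Q(k) e^{-i k·x} b_k`, so that `H_{e-p} = iλ ∫ Q(k) e^{-i k·x} b_k dk`. -/
def vertex (L : ℝ) (k : Mode d) : Op d :=
  ((P.Q (latticePoint L k) : ℝ) : ℂ) • (planeWave k * bOp L k)

/-- `e^{-is_0H_0} ∏_{j=1}^N (Q(k_j) e^{-i k_j·x} b_{k_j} e^{-is_jH_0})`, ordered from left to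
right. -/
def history (L : ℝ) {N : ℕ} (k : Fin N → Mode d) (s : ℕ → ℝ) : Op d :=
  P.freeEvolution L (s 0) *
    (List.ofFn fun j : Fin N => P.vertex L (k j) * P.freeEvolution L (s (j + 1))).prod

/-- The matrix elements of
`ℬ(t, k, N) = λ^N ∫_0^{t*} [ds_j]_0^N e^{-is_0H_0} ∏_j Q(k_j) b_{k_j} e^{-is_jH_0}`. -/
def duhamelTerm (L t : ℝ) {N : ℕ} (k : Fin N → Mode d) (f a : Label d) : ℂ :=
  (P.coupling : ℂ) ^ N *
    simplexIntegral N t (fun s => matrixElement (P.history L k s) f a)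

end Model

/-! ### Immediate reabsorption patterns -/

/-- `ℳ(n, N)`: the tuples `m = (m_0, …, m_n)` of natural numbers with `n + 2|m| = N`. -/
def patterns (n N : ℕ) : Finset (Fin (n + 1) → ℕ) :=
  (Fintype.piFinset fun _ => Finset.range (N + 1)).filter fun m => n + 2 * ∑ j, m j = N

theorem mem_patterns {n N : ℕ} {m : Fin (n + 1) → ℕ} :
    m ∈ patterns n N ↔ n + 2 * ∑ j, m j = N := by
  simp only [patterns, Finset.mem_filter, Fintype.mem_piFinset, Finset.mem_range,
    and_iff_right_iff_imp]
  intro h j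
  have := Finset.single_le_sum (f := m) (fun i _ => Nat.zero_le _) (Finset.mem_univ j)
  omega

/-- `μ(j) = j + 2 ∑_{i<j} m_i`, for `j = 0, …, n + 1`. -/
def position {n : ℕ} (m : Fin (n + 1) → ℕ) (j : ℕ) : ℕ :=
  j + 2 * ∑ i with (i : Fin (n + 1)).val < j, m i

/-- `I(m) = {μ(1), …, μ(n)}`, the indices of the external phonon momenta. -/
def external {n : ℕ} (m : Fin (n + 1) → ℕ) : Finset ℕ := (Finset.Icc 1 n).image (position m)

/-- `I_j(m) = {μ(j) + 1, μ(j) + 3, …, μ(j) + 2m_j - 1}`. -/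
def blockInner {n : ℕ} (m : Fin (n + 1) → ℕ) (j : Fin (n + 1)) : Finset ℕ :=
  (Finset.range (m j)).image fun i => position m j + 2 * i + 1

/-- `I_j^c(m) = {μ(j), μ(j) + 2, …, μ(j) + 2m_j}`. -/
def blockOuter {n : ℕ} (m : Fin (n + 1) → ℕ) (j : Fin (n + 1)) : Finset ℕ :=
  (Finset.range (m j + 1)).image fun i => position m j + 2 * i

/-- `J(m) = ⋃_j I_j(m)`. -/
def innerIndices {n : ℕ} (m : Fin (n + 1) → ℕ) : Finset ℕ := Finset.univ.biUnion (blockInner m)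

/-- The restriction of the sum over `k = (k_1, …, k_N)` by the pattern `m`:
`∏_{b ∈ J} χ(k_b + k_{b+1}) ∏_{b ≠ b' ∈ I} (1 - χ(k_b + k_{b'}))`. -/
def patternWeight {d n N : ℕ} (m : Fin (n + 1) → ℕ) (k : Fin N → Mode d) : ℝ :=
  (∏ b ∈ innerIndices m, chi (entry k b + entry k (b + 1))) *
    ∏ x ∈ (external m).offDiag, (1 - chi (entry k x.1 + entry k x.2))

namespace Model

variable {d : ℕ} (P : Model d)

/-- The contribution of `(k_1, …, k_N)` and of the pattern `m` to the matrix element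
`⟨f| ℰ⁰_{n,N}(t) |a⟩`. -/
def expandedSummand (L t : ℝ) {n N : ℕ} (m : Fin (n + 1) → ℕ) (f a : Label d)
    (k : Fin N → Mode d) : ℂ :=
  (((L ^ d)⁻¹ ^ N * patternWeight m k : ℝ) : ℂ) * P.duhamelTerm L t k f a

/-- The matrix elements of the fully expanded term
`ℰ⁰_{n,N}(t) = ∑_{m ∈ ℳ(n,N)} ∫^{(m)} dk ℬ(t, k, N)`. -/
def expanded (L t : ℝ) (n N : ℕ) (f a : Label d) : ℂ :=
  ∑ m ∈ patterns n N, ∑' k : Fin N → Mode d, P.expandedSummand L t m f a k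

/-! ### Density matrices and the trace -/

/-- The eigenvalue of `exp(-β H_ph + μ ∫ N_k dk)` on `|n⟩`. -/
def gibbsWeight (L : ℝ) (n : Mode d →₀ ℕ) : ℝ :=
  Real.exp (n.sum fun k j => (j : ℝ) * (-P.β * P.ω (latticePoint L k) + P.chem))

/-- The normalization `Z = Tr exp(-β H_ph + μ ∫ N_k dk)`. -/
def partitionFunction (L : ℝ) : ℝ := ∑' n : Mode d →₀ ℕ, P.gibbsWeight L n

end Model

/-- The electron space `ℋ_e = L²_per(Λ)` in momentum representation. -/
abbrev ElectronSpace (d : ℕ) : Type := lp (fun _ : Mode d => ℂ) 2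

/-- The matrix element `⟨p| γ |q⟩` of an electron operator between normalized plane waves. -/
def electronElement {d : ℕ} (γ : ElectronSpace d →L[ℂ] ElectronSpace d) (p q : Mode d) : ℂ :=
  inner ℂ (lp.single 2 p (1 : ℂ)) (γ (lp.single 2 q (1 : ℂ)))

/-- An electron density matrix: a positive operator of trace `1`. -/
def IsDensityMatrix {d : ℕ} (γ : ElectronSpace d →L[ℂ] ElectronSpace d) : Prop :=
  γ.IsPositive ∧ HasSum (fun p : Mode d => electronElement γ p p) 1

/-- The momentum kernel `γ̂(p, q) = L^d ⟨p| γ |q⟩`, so that `Tr γ = ∫ γ̂(p, p) dp`. -/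
def momentumKernel {d : ℕ} (L : ℝ) (γ : ElectronSpace d →L[ℂ] ElectronSpace d)
    (p q : Mode d) : ℂ := ((L ^ d : ℝ) : ℂ) * electronElement γ p q

/-- The matrix of a product of operators. -/
def kernelMul {ι : Type*} (A B : ι → ι → ℂ) (x y : ι) : ℂ := ∑' z, A x z * B z y

/-- The matrix of the adjoint operator. -/
def kernelAdjoint {ι : Type*} (A : ι → ι → ℂ) (x y : ι) : ℂ := conj (A y x)

/-- The trace of an operator given by its matrix. -/
def kernelTrace {ι : Type*} (A : ι → ι → ℂ) : ℂ := ∑' x, A x x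

namespace Model

variable {d : ℕ} (P : Model d)

open Classical in
/-- The matrix of the initial state `Γ_0 = γ_e ⊗ γ_ph`, where
`γ_ph = Z⁻¹ exp(-β H_ph + μ ∫ N_k dk)`. -/
def initialState (L : ℝ) (γ : ElectronSpace d →L[ℂ] ElectronSpace d) (a a' : Label d) : ℂ :=
  electronElement γ a.1 a'.1 *
    (if a.2 = a'.2 then ((P.gibbsWeight L a.2 / P.partitionFunction L : ℝ) : ℂ) else 0)

/-- `Tr_{e+ph} (ℰ⁰_{n,N}(t) Γ_0 ℰ⁰_{n,N}(t)^*)`. -/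
def expandedTrace (L : ℝ) (γ : ElectronSpace d →L[ℂ] ElectronSpace d) (t : ℝ) (n N : ℕ) : ℂ :=
  kernelTrace (kernelMul (kernelMul (P.expanded L t n N) (P.initialState L γ))
    (kernelAdjoint (P.expanded L t n N)))

/-- All the series in `Tr_{e+ph} (ℰ⁰_{n,N}(t) Γ_0 ℰ⁰_{n,N}(t)^*)` converge absolutely. -/
def ExpandedTraceConverges (L : ℝ) (γ : ElectronSpace d →L[ℂ] ElectronSpace d) (t : ℝ)
    (n N : ℕ) : Prop :=
  (∀ m ∈ patterns n N, ∀ f a : Label d,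
    Summable (fun k : Fin N → Mode d => P.expandedSummand L t m f a k)) ∧
  Summable (fun x : Label d × Label d × Label d =>
    P.expanded L t n N x.1 x.2.1 * P.initialState L γ x.2.1 x.2.2 *
      conj (P.expanded L t n N x.1 x.2.2))

/-! ### The functions in the representation formula

The measure `κ` is the momentum integration `dk`: either `latticeMeasure d L` or
`spaceMeasure d`. The set of signs `{±}` is `ℤˣ = {1, -1}`. -/

/-- `𝒩(k)`, the expected occupation number of the mode `k`. -/
def occupation (k : Momentum d) : ℝ :=
  Real.exp (-P.β * P.ω k + P.chem) / (1 - Real.exp (-P.β * P.ω k + P.chem))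

/-- `M(k, σ) = |Q(k)|² (𝒩(k) + (σ + 1)/2)`. -/
def M (k : Momentum d) (σ : ℤˣ) : ℝ :=
  |P.Q k| ^ 2 * (P.occupation k + (((σ : ℤ) : ℝ) + 1) / 2)

/-- `Φ_σ(p, k) = e(k + p) + σ ω(k)`. -/
def Phi (σ : ℤˣ) (p k : Momentum d) : ℝ := P.e (k + p) + ((σ : ℤ) : ℝ) * P.ω k

/-- `Θ(s, p, Ω) = ∑_σ ∫ e^{-is(Φ_σ(p, k) + Ω)} M(k, σ) dk`. -/
def Theta (κ : Measure (Momentum d)) (s : ℝ) (p : Momentum d) (Ω : ℝ) : ℂ :=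
  ∑ σ : ℤˣ, ∫ k, Complex.exp (-Complex.I * ((s * (P.Phi σ p k + Ω) : ℝ) : ℂ)) *
    ((P.M k σ : ℝ) : ℂ) ∂κ

/-- `Υ_η(α, p) = ∑_σ ∫ M(k, σ) dk / (α - Φ_σ(p, k) + iη)`. -/
def Upsilon (κ : Measure (Momentum d)) (η α : ℝ) (p : Momentum d) : ℂ :=
  ∑ σ : ℤˣ, ∫ k, ((P.M k σ : ℝ) : ℂ) /
    (((α - P.Phi σ p k : ℝ) : ℂ) + Complex.I * (η : ℂ)) ∂κ

/-- `p_j = p_n + ∑_{ℓ=j+1}^n k_ℓ`; the momentum `k_ℓ` is `k ⟨ℓ - 1, _⟩`. -/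
def electronMomentum {n : ℕ} (p : Momentum d) (k : Fin n → Momentum d) (j : ℕ) : Momentum d :=
  p + ∑ l with j ≤ (l : Fin n).val, k l

/-- `Ω_j(k, σ) = ∑_{ℓ=j+1}^n σ_ℓ ω(k_ℓ)`. -/
def Omega {n : ℕ} (k : Fin n → Momentum d) (σ : Fin n → ℤˣ) (j : ℕ) : ℝ :=
  ∑ l with j ≤ (l : Fin n).val, ((σ l : ℤ) : ℝ) * P.ω (k l)

/-- `Y_{m,m̃,π}`, as a product of two time integrals. -/
def Y (κ : Measure (Momentum d)) {n : ℕ} (N : ℕ) (m m' : Fin (n + 1) → ℕ)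
    (π : Equiv.Perm (Fin n)) (t : ℝ) (p p' : Momentum d) (k k' : Fin n → Momentum d)
    (σ : Fin n → ℤˣ) : ℂ :=
  simplexIntegral N t (fun s => ∏ j : Fin (n + 1),
    ((∏ b ∈ blockOuter m j, Complex.exp (-Complex.I *
        ((s b * (P.e (electronMomentum p k j) + P.Omega k σ j) : ℝ) : ℂ))) *
      ∏ b ∈ blockInner m j, P.Theta κ (s b) (electronMomentum p k j) (P.Omega k σ j))) *
  simplexIntegral N t (fun s => ∏ j : Fin (n + 1),
    ((∏ b ∈ blockOuter m' j, Complex.exp (Complex.I *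
        ((s b * (P.e (electronMomentum p' k' j) + P.Omega k' (σ ∘ π.symm) j) : ℝ) : ℂ))) *
      ∏ b ∈ blockInner m' j,
        conj (P.Theta κ (s b) (electronMomentum p' k' j) (P.Omega k' (σ ∘ π.symm) j))))

/-- `R_j = 1 / (α - e(p_j) - Ω_j + iη)`; the second resolvent `R̃_j` has `-η` in place of `η`. -/
def R {n : ℕ} (η α : ℝ) (p : Momentum d) (k : Fin n → Momentum d) (σ : Fin n → ℤˣ) (j : ℕ) : ℂ :=
  1 / (((α - P.e (electronMomentum p k j) - P.Omega k σ j : ℝ) : ℂ) + Complex.I * (η : ℂ))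

/-- The integrand `e^{-itα} ∏_j R_j^{m_j+1} Υ_η(α - Ω_j, p_j)^{m_j}`. -/
def resolventIntegrand (κ : Measure (Momentum d)) {n : ℕ} (m : Fin (n + 1) → ℕ) (η t : ℝ)
    (p : Momentum d) (k : Fin n → Momentum d) (σ : Fin n → ℤˣ) (α : ℝ) : ℂ :=
  Complex.exp (-Complex.I * ((t * α : ℝ) : ℂ)) * ∏ j : Fin (n + 1),
    (P.R η α p k σ j ^ (m j + 1) *
      P.Upsilon κ η (α - P.Omega k σ j) (electronMomentum p k j) ^ m j)

/-- The integrand `e^{itα̃} ∏_j R̃_j^{m̃_j+1} (conj Υ_η(α̃ - Ω̃_j, p̃_j))^{m̃_j}`. -/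
def resolventIntegrandTilde (κ : Measure (Momentum d)) {n : ℕ} (m' : Fin (n + 1) → ℕ) (η t : ℝ)
    (p' : Momentum d) (k' : Fin n → Momentum d) (σ' : Fin n → ℤˣ) (α : ℝ) : ℂ :=
  Complex.exp (Complex.I * ((t * α : ℝ) : ℂ)) * ∏ j : Fin (n + 1),
    (P.R (-η) α p' k' σ' j ^ (m' j + 1) *
      conj (P.Upsilon κ η (α - P.Omega k' σ' j) (electronMomentum p' k' j)) ^ m' j)

/-- Integration variables `((p_n, p̃_n), (k, k̃))` of the measure `ν_π`. -/
abbrev Variables (d n : ℕ) : Type :=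
  (Mode d × Mode d) × ((Fin n → Mode d) × (Fin n → Mode d))

/-- The density of the measure
`dν_π = (∏_j M(k_j, σ_j) δ(k_j - k̃_{π(j)}) dk_j dk̃_j) dp_n dp̃_n δ(p_n - p̃_n) γ̂_e(p_n, p̃_n)`
with respect to counting, each `dk` contributing a factor `L^{-d}`. -/
def nuDensity (L : ℝ) (γ : ElectronSpace d →L[ℂ] ElectronSpace d) {n : ℕ}
    (π : Equiv.Perm (Fin n)) (σ : Fin n → ℤˣ) (x : Variables d n) : ℂ :=
  ((∏ j : Fin n, (P.M (latticePoint L (x.2.1 j)) (σ j) *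
      latticeDelta L (x.2.1 j - x.2.2 (π j)) * (L ^ d)⁻¹ * (L ^ d)⁻¹) : ℝ) : ℂ) *
    (((L ^ d)⁻¹ * (L ^ d)⁻¹ * latticeDelta L (x.1.1 - x.1.2) : ℝ) : ℂ) *
      momentumKernel L γ x.1.1 x.1.2

/-- The summand `ν_π(p_n, p̃_n, k, k̃, σ) Y_{m,m̃,π}(t; p_n, p̃_n, k, k̃, σ)`. -/
def CSummand (κ : Measure (Momentum d)) (L : ℝ) (γ : ElectronSpace d →L[ℂ] ElectronSpace d)
    {n : ℕ} (N : ℕ) (m m' : Fin (n + 1) → ℕ) (π : Equiv.Perm (Fin n)) (t : ℝ)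
    (σ : Fin n → ℤˣ) (x : Variables d n) : ℂ :=
  P.nuDensity L γ π σ x *
    P.Y κ N m m' π t (latticePoint L x.1.1) (latticePoint L x.1.2)
      (fun j => latticePoint L (x.2.1 j)) (fun j => latticePoint L (x.2.2 j)) σ

/-- `C_{m,m̃,π}(t) = λ^{2N} ∑_σ ∫ dν_π Y_{m,m̃,π}`. -/
def C (κ : Measure (Momentum d)) (L : ℝ) (γ : ElectronSpace d →L[ℂ] ElectronSpace d)
    {n : ℕ} (N : ℕ) (m m' : Fin (n + 1) → ℕ) (π : Equiv.Perm (Fin n)) (t : ℝ) : ℂ :=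
  (P.coupling : ℂ) ^ (2 * N) * ∑ σ : Fin n → ℤˣ, ∑' x : Variables d n,
    P.CSummand κ L γ N m m' π t σ x

/-- `∑_{m,m̃ ∈ ℳ(n,N)} ∑_{π ∈ Π_n} C_{m,m̃,π}(t)`. -/
def sumC (κ : Measure (Momentum d)) (L : ℝ) (γ : ElectronSpace d →L[ℂ] ElectronSpace d)
    (t : ℝ) (n N : ℕ) : ℂ :=
  ∑ m ∈ patterns n N, ∑ m' ∈ patterns n N, ∑ π : Equiv.Perm (Fin n), P.C κ L γ N m m' π t

end Model

end ElectronPhonon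

end

open ElectronPhonon

noncomputable section

namespace ElectronPhonon

/-! ### Block structure of the patterns -/

/-! The resolvent formula is Fourier inversion. Multiplied by e^{-ηt}, each time integral is an
(N+1)-fold convolution of functions e^{-ηs} g_b(s) on the half line, so its transform is a product
of one-sided transforms: a phase e^{-isE} gives i/(α - E + iη) and Θ gives iΥ_η (`oneSided_exp`,
`Model.Regular.oneSided_Theta`, `simplexIntegral_eq_integral`). For N ≥ 1 the resolvents of the
first and last time slots make the product integrable. For N = 0 an integration by parts reduces the
single resolvent to its square. Finally Y is one such integral times the conjugate of another.

For the trace, every vertex is split into its creation part (sign +1) and its annihilation part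
(sign -1), so a matrix element becomes a sum over paths of N legs, a leg being a momentum -k
together with a sign. The trace is then a sum over pairs of paths of a common factor (L^{-dN}, form
factors, time integrals) times a weight made of the pattern restrictions and of the Gibbs
expectation of the occupation number amplitudes (`Model.Regular.expandedTrace_eq`). Momentum
conservation leaves only the diagonal of γ_e. Expanding Θ over the lattice writes the sum of the C's
in the same way, with the same common factor and another weight (`Model.Regular.cInner_lattice`).

Comparing the two weights takes the place of Wick's theorem. Two paths from the same basis vector to
the same target change all occupation numbers alike, so every momentum, taken up to sign, occurs at
least twice among the 2N legs. If there are at least N such classes, counting leaves exactly two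
legs in each, and these cancel. When the pattern restrictions hold, exactly one permutation then
matches the external legs. The contracted modes are distinct, and independence of the modes in the
Gibbs state produces the factors 𝒩 + (σ+1)/2: the weights agree exactly
(`Model.Regular.traceWeight_eq`). The other, degenerate pairs have fewer than N free momenta. Each
free sum costs L^d, so against L^{-dN} they contribute O(L^{-d}), uniformly in the electron
momentum, because both weights are bounded independently of L (`Model.Regular.tsum_degenerate_le`,
`Model.Regular.norm_trace_sub_cTotal_le`).

For Θ over ℝ^d, the lattice integration is the image of the normalized Lebesgue measure under the
nearest point map, so the block integrals converge locally uniformly in the external variables by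
dominated convergence. Large momenta are controlled by a weight ⟨p⟩∏⟨k_j⟩, paid for by the moment
assumption on γ_e and by the decay of M (`Model.Regular.tendsto_sumC_sub`). -/

theorem position_zero {n : ℕ} (m : Fin (n + 1) → ℕ) : position m 0 = 0 := by
  simp [position]

theorem position_succ {n : ℕ} (m : Fin (n + 1) → ℕ) (j : Fin (n + 1)) :
    position m (j + 1) = position m j + 2 * m j + 1 := by
  have : (Finset.univ.filter fun i : Fin (n + 1) => i.val < j.val + 1) =
      insert j (Finset.univ.filter fun i : Fin (n + 1) => i.val < j.val) := by
    ext i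
    simp only [Finset.mem_filter, Finset.mem_univ, true_and, Finset.mem_insert, Fin.ext_iff]
    omega
  rw [position, position, this, Finset.sum_insert (by simp)]
  ring

theorem position_strictMono {n : ℕ} (m : Fin (n + 1) → ℕ) : StrictMono (position m) := by
  intro i j hij
  have : ∑ l with (l : Fin (n + 1)).val < i, m l ≤ ∑ l with (l : Fin (n + 1)).val < j, m l :=
    Finset.sum_le_sum_of_subset fun l hl => by
      simp only [Finset.mem_filter, Finset.mem_univ, true_and] at hl ⊢
      omega
  unfold position
  omega

theorem position_last {n N : ℕ} {m : Fin (n + 1) → ℕ} (hm : m ∈ patterns n N) :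
    position m (n + 1) = N + 1 := by
  rw [mem_patterns] at hm
  have : (Finset.univ.filter fun i : Fin (n + 1) => i.val < n + 1) = Finset.univ :=
    Finset.filter_true_of_mem fun i _ => i.isLt
  rw [position, this]
  omega

theorem prod_range_two_mul_add_one {M : Type*} [CommMonoid M] (f : ℕ → M) (k : ℕ) :
    ∏ i ∈ Finset.range (2 * k + 1), f i =
      (∏ i ∈ Finset.range (k + 1), f (2 * i)) * ∏ i ∈ Finset.range k, f (2 * i + 1) := by
  induction k with
  | zero => simp
  | succ k ih =>
    rw [show 2 * (k + 1) + 1 = 2 * k + 1 + 1 + 1 by ring, Finset.prod_range_succ,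
      Finset.prod_range_succ, ih, Finset.prod_range_succ (fun i => f (2 * i)) (k + 1),
      Finset.prod_range_succ (fun i => f (2 * i + 1)) k, show 2 * k + 1 + 1 = 2 * (k + 1) by ring]
    ac_rfl

theorem prod_blockOuter {n : ℕ} {M : Type*} [CommMonoid M] (m : Fin (n + 1) → ℕ)
    (j : Fin (n + 1)) (f : ℕ → M) :
    ∏ b ∈ blockOuter m j, f b = ∏ i ∈ Finset.range (m j + 1), f (position m j + 2 * i) :=
  Finset.prod_image fun a _ b _ h => by simpa using h

theorem prod_blockInner {n : ℕ} {M : Type*} [CommMonoid M] (m : Fin (n + 1) → ℕ)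
    (j : Fin (n + 1)) (f : ℕ → M) :
    ∏ b ∈ blockInner m j, f b = ∏ i ∈ Finset.range (m j), f (position m j + 2 * i + 1) :=
  Finset.prod_image fun a _ b _ h => by simpa using h

/-- The half-open intervals from `position m j` to `position m (j + 1)` tile 0, …, N. Each has odd
length 2m_j + 1, its even offsets being outer and its odd offsets inner. -/
theorem prod_blocks {n N : ℕ} {M : Type*} [CommMonoid M] {m : Fin (n + 1) → ℕ}
    (hm : m ∈ patterns n N) (f : ℕ → M) :
    ∏ b ∈ Finset.range (N + 1), f b =
      ∏ j : Fin (n + 1), ((∏ b ∈ blockOuter m j, f b) * ∏ b ∈ blockInner m j, f b) := by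
  have key : ∀ l ≤ n + 1, ∏ b ∈ Finset.range (position m l), f b =
      ∏ j : Fin (n + 1) with j.val < l,
        ((∏ b ∈ blockOuter m j, f b) * ∏ b ∈ blockInner m j, f b) := by
    intro l
    induction l with
    | zero => simp [position_zero]
    | succ l ih =>
      intro hl
      have hs := position_succ m ⟨l, hl⟩
      have : (Finset.univ.filter fun i : Fin (n + 1) => i.val < l + 1) =
          insert ⟨l, hl⟩ (Finset.univ.filter fun i : Fin (n + 1) => i.val < l) := by
        ext i
        simp only [Finset.mem_filter, Finset.mem_univ, true_and, Finset.mem_insert, Fin.ext_iff]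
        omega
      rw [this, Finset.prod_insert (by simp), ← ih (by omega)]
      simp only at hs
      rw [hs, show position m l + 2 * m ⟨l, hl⟩ + 1 = position m l + (2 * m ⟨l, hl⟩ + 1) by ring,
        Finset.prod_range_add, prod_range_two_mul_add_one (fun x => f (position m l + x)),
        prod_blockOuter, prod_blockInner, mul_comm]
      rfl
  have h := key (n + 1) le_rfl
  rw [position_last hm] at h
  rw [h, Finset.filter_true_of_mem fun i _ => i.isLt]

open Classical in
/-- The block containing the index `b`. -/
def blockIndex {n : ℕ} (m : Fin (n + 1) → ℕ) (b : ℕ) : Fin (n + 1) :=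
  if h : ∃ j : Fin (n + 1), position m j ≤ b ∧ b < position m (j + 1) then h.choose else 0

theorem blockIndex_eq {n : ℕ} {m : Fin (n + 1) → ℕ} {b : ℕ} {j : Fin (n + 1)}
    (h₁ : position m j ≤ b) (h₂ : b < position m (j + 1)) : blockIndex m b = j := by
  have h : ∃ j : Fin (n + 1), position m j ≤ b ∧ b < position m (j + 1) := ⟨j, h₁, h₂⟩
  rw [blockIndex, dif_pos h]
  obtain ⟨h₃, h₄⟩ := h.choose_spec
  generalize h.choose = i at *
  by_contra hne
  rcases lt_or_gt_of_ne hne with hlt | hlt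
  · have := (position_strictMono m).monotone (show i.val + 1 ≤ j.val from hlt)
    omega
  · have := (position_strictMono m).monotone (show j.val + 1 ≤ i.val from hlt)
    omega

theorem blockIndex_of_mem_blockOuter {n : ℕ} {m : Fin (n + 1) → ℕ} {b : ℕ} {j : Fin (n + 1)}
    (h : b ∈ blockOuter m j) : blockIndex m b = j := by
  obtain ⟨i, hi, rfl⟩ := Finset.mem_image.1 h
  rw [Finset.mem_range] at hi
  exact blockIndex_eq (by omega) (by rw [position_succ]; omega)

theorem blockIndex_of_mem_blockInner {n : ℕ} {m : Fin (n + 1) → ℕ} {b : ℕ} {j : Fin (n + 1)}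
    (h : b ∈ blockInner m j) : blockIndex m b = j := by
  obtain ⟨i, hi, rfl⟩ := Finset.mem_image.1 h
  rw [Finset.mem_range] at hi
  exact blockIndex_eq (by omega) (by rw [position_succ]; omega)

/-- Membership in the complement of `J`, for indices up to `N`. -/
def IsOuter {n : ℕ} (m : Fin (n + 1) → ℕ) (b : ℕ) : Prop :=
  b ∈ blockOuter m (blockIndex m b)

instance {n : ℕ} (m : Fin (n + 1) → ℕ) (b : ℕ) : Decidable (IsOuter m b) := by
  unfold IsOuter; infer_instance

theorem isOuter_of_mem {n : ℕ} {m : Fin (n + 1) → ℕ} {b : ℕ} {j : Fin (n + 1)}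
    (h : b ∈ blockOuter m j) : IsOuter m b := by
  rw [IsOuter, blockIndex_of_mem_blockOuter h]; exact h

theorem not_isOuter_of_mem {n : ℕ} {m : Fin (n + 1) → ℕ} {b : ℕ} {j : Fin (n + 1)}
    (h : b ∈ blockInner m j) : ¬ IsOuter m b := by
  rw [IsOuter, blockIndex_of_mem_blockInner h]
  intro h'
  obtain ⟨i, hi, rfl⟩ := Finset.mem_image.1 h
  obtain ⟨i', hi', h''⟩ := Finset.mem_image.1 h'
  omega

theorem card_blockOuter {n : ℕ} (m : Fin (n + 1) → ℕ) (j : Fin (n + 1)) :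
    (blockOuter m j).card = m j + 1 := by
  rw [blockOuter, Finset.card_image_of_injective _ fun a b h => by simpa using h,
    Finset.card_range]

theorem card_blockInner {n : ℕ} (m : Fin (n + 1) → ℕ) (j : Fin (n + 1)) :
    (blockInner m j).card = m j := by
  rw [blockInner, Finset.card_image_of_injective _ fun a b h => by simpa using h,
    Finset.card_range]

/-- A product over the time indices of factors depending on the block and on the kind of the
index. -/
theorem prod_blocks_ite {n N : ℕ} {M : Type*} [CommMonoid M] {m : Fin (n + 1) → ℕ}
    (hm : m ∈ patterns n N) (A B : Fin (n + 1) → ℕ → M) :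
    ∏ b ∈ Finset.range (N + 1), (if IsOuter m b then A (blockIndex m b) b
        else B (blockIndex m b) b) =
      ∏ j : Fin (n + 1), ((∏ b ∈ blockOuter m j, A j b) * ∏ b ∈ blockInner m j, B j b) := by
  rw [prod_blocks hm]
  refine Finset.prod_congr rfl fun j _ => ?_
  congr 1
  · refine Finset.prod_congr rfl fun b hb => ?_
    rw [if_pos (isOuter_of_mem hb), blockIndex_of_mem_blockOuter hb]
  · refine Finset.prod_congr rfl fun b hb => ?_
    rw [if_neg (not_isOuter_of_mem hb), blockIndex_of_mem_blockInner hb]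

/-! ### Time integrals -/

theorem continuous_durations {N : ℕ} (b : ℕ) :
    Continuous fun x : ℝ × (Fin N → ℝ) => durations x.1 x.2 b := by
  unfold durations entry
  split_ifs <;> fun_prop

/-- The time simplex in the variables `(s_1, …, s_N)`. -/
def timeSimplex (N : ℕ) (t : ℝ) : Set (Fin N → ℝ) := {u | (∀ j, 0 ≤ u j) ∧ ∑ j, u j ≤ t}

theorem simplexIntegral_eq (N : ℕ) (t : ℝ) (F : (ℕ → ℝ) → ℂ) :
    simplexIntegral N t F = ∫ u in timeSimplex N t, F (durations t u) := rfl

theorem isClosed_timeSimplex (N : ℕ) (t : ℝ) : IsClosed (timeSimplex N t) := by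
  have : timeSimplex N t = (⋂ j, {u | 0 ≤ u j}) ∩ {u | ∑ j, u j ≤ t} := by
    ext; simp [timeSimplex]
  rw [this]
  refine (isClosed_iInter fun j => isClosed_le continuous_const (continuous_apply j)).inter
    (isClosed_le (by fun_prop) continuous_const)

theorem timeSimplex_subset (N : ℕ) (t : ℝ) :
    timeSimplex N t ⊆ Set.Icc (fun _ => 0) (fun _ => t) := fun u hu =>
  ⟨hu.1, fun j => (Finset.single_le_sum (fun i _ => hu.1 i) (Finset.mem_univ j)).trans hu.2⟩

theorem isCompact_timeSimplex (N : ℕ) (t : ℝ) : IsCompact (timeSimplex N t) :=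
  (isCompact_Icc (α := Fin N → ℝ)).of_isClosed_subset (isClosed_timeSimplex N t)
    (timeSimplex_subset N t)

theorem measurableSet_timeSimplex (N : ℕ) (t : ℝ) : MeasurableSet (timeSimplex N t) :=
  (isClosed_timeSimplex N t).measurableSet

theorem volume_timeSimplex_le (N : ℕ) {t : ℝ} (ht : 0 ≤ t) :
    (volume : Measure (Fin N → ℝ)).real (timeSimplex N t) ≤ t ^ N := by
  have h : volume.real (Set.Icc (fun _ : Fin N => (0 : ℝ)) (fun _ => t)) = t ^ N := by
    rw [Measure.real, Real.volume_Icc_pi_toReal (fun _ => ht)]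
    simp
  rw [← h]
  exact measureReal_mono (timeSimplex_subset N t) (isCompact_Icc.measure_lt_top.ne)

theorem volume_timeSimplex_lt_top (N : ℕ) (t : ℝ) :
    (volume : Measure (Fin N → ℝ)) (timeSimplex N t) < ⊤ :=
  (isCompact_timeSimplex N t).measure_lt_top

theorem norm_simplexIntegral_le {N : ℕ} {t : ℝ} (ht : 0 ≤ t) {F : (ℕ → ℝ) → ℂ} {B : ℝ}
    (hF : ∀ s : ℕ → ℝ, ‖F s‖ ≤ B) : ‖simplexIntegral N t F‖ ≤ B * t ^ N := by
  have hB : 0 ≤ B := (norm_nonneg _).trans (hF 0)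
  rw [simplexIntegral_eq]
  refine (norm_setIntegral_le_of_norm_le_const (volume_timeSimplex_lt_top N t)
    fun _ _ => hF _).trans ?_
  exact mul_le_mul_of_nonneg_left (volume_timeSimplex_le N ht) hB

theorem conj_simplexIntegral (N : ℕ) (t : ℝ) (F : (ℕ → ℝ) → ℂ) :
    conj (simplexIntegral N t F) = simplexIntegral N t fun s => conj (F s) :=
  (integral_conj ..).symm

theorem durations_succ {N : ℕ} (t : ℝ) (u : Fin N → ℝ) (i : Fin N) :
    durations t u (i + 1) = u i := by
  simp [durations, entry, i.isLt]

theorem durations_zero {N : ℕ} (t : ℝ) (u : Fin N → ℝ) :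
    durations t u 0 = t - ∑ j, u j := by
  simp [durations]

theorem sum_durations {N : ℕ} (t : ℝ) (u : Fin N → ℝ) :
    ∑ b ∈ Finset.range (N + 1), durations t u b = t := by
  rw [Finset.sum_range_succ', Finset.sum_range fun i => durations t u (i + 1), durations_zero]
  simp only [durations_succ]
  ring

/-! ### Time integrals as Fourier integrals -/

/-- The function `s ↦ e^{-ηs} g(s)` on the half line. -/
def damped (η : ℝ) (g : ℝ → ℂ) : ℝ → ℂ :=
  (Set.Ici 0).indicator fun s => (Real.exp (-(η * s)) : ℂ) * g s

theorem integrable_exp_neg_mul {η : ℝ} (hη : 0 < η) :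
    IntegrableOn (fun s : ℝ => Real.exp (-(η * s))) (Set.Ici 0) := by
  rw [integrableOn_Ici_iff_integrableOn_Ioi]
  simpa using exp_neg_integrableOn_Ioi 0 hη

theorem integrable_damped {η : ℝ} (hη : 0 < η) {g : ℝ → ℂ} (hg : Continuous g) {B : ℝ}
    (hB : ∀ s, ‖g s‖ ≤ B) : Integrable (damped η g) := by
  unfold damped
  rw [integrable_indicator_iff measurableSet_Ici]
  refine Integrable.mul_bdd (c := B) ?_ hg.aestronglyMeasurable (ae_of_all _ hB)
  exact (integrable_exp_neg_mul hη).ofReal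

/-- The integrand of the time integral in product coordinates `(s_0, (s_1, …, s_N))`. -/
def dampedProd (η : ℝ) {N : ℕ} (g : ℕ → ℝ → ℂ) (x : ℝ × (Fin N → ℝ)) : ℂ :=
  damped η (g 0) x.1 * ∏ j : Fin N, damped η (g (j + 1)) (x.2 j)

/-- This is the substitution s_0 = t - ∑ s_j, which turns integrals over t of a convolution into
integrals of a product. -/
theorem measurePreserving_shear (N : ℕ) :
    MeasurePreserving (fun x : ℝ × (Fin N → ℝ) => (x.1 - ∑ j, x.2 j, x.2)) := by
  have h : MeasurePreserving (fun x : (Fin N → ℝ) × ℝ => (x.1, x.2 - ∑ j, x.1 j)) := by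
    refine MeasurePreserving.skew_product (f := id) (g := fun (a : Fin N → ℝ) (c : ℝ) => c - ∑ j, a j)
      (MeasurePreserving.id _) (by fun_prop) (ae_of_all _ fun a => ?_)
    exact (measurePreserving_sub_right volume _).map_eq
  exact (Measure.measurePreserving_swap.comp h).comp Measure.measurePreserving_swap

/-- The half-line indicators cut out exactly the time simplex, and the damping factors multiply to
e^{-ηt} because the durations add up to t. -/
theorem dampedProd_shear (η : ℝ) {N : ℕ} (g : ℕ → ℝ → ℂ) (t : ℝ) (u : Fin N → ℝ) :
    dampedProd η g (t - ∑ j, u j, u) = (timeSimplex N t).indicator (fun u =>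
      (Real.exp (-(η * t)) : ℂ) * ∏ b ∈ Finset.range (N + 1), g b (durations t u b)) u := by
  by_cases hu : u ∈ timeSimplex N t
  · rw [Set.indicator_of_mem hu, dampedProd, damped,
      Set.indicator_of_mem (by simpa using hu.2)]
    have : ∀ j : Fin N, damped η (g (j + 1)) (u j) =
        (Real.exp (-(η * u j)) : ℂ) * g (j + 1) (u j) := fun j =>
      Set.indicator_of_mem (by simpa using hu.1 j) _
    simp only [this]
    rw [Finset.prod_range_succ', Finset.prod_range fun i => g (i + 1) (durations t u (i + 1)),
      durations_zero]
    simp only [durations_succ, Finset.prod_mul_distrib]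
    rw [← Complex.ofReal_prod, ← Real.exp_sum]
    have : Real.exp (-(η * t)) =
        Real.exp (-(η * (t - ∑ j, u j))) * Real.exp (∑ j, -(η * u j)) := by
      rw [← Real.exp_add, Finset.sum_neg_distrib, ← Finset.mul_sum]
      ring_nf
    rw [this]
    push_cast
    ring
  · rw [Set.indicator_of_notMem hu, dampedProd]
    have : ¬ ((∀ j, 0 ≤ u j) ∧ ∑ j, u j ≤ t) := hu
    rw [not_and_or, not_forall] at this
    rcases this with ⟨j, hj⟩ | h
    · rw [Finset.prod_eq_zero (Finset.mem_univ j), mul_zero]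
      exact Set.indicator_of_notMem (by simpa using hj) _
    · rw [damped, Set.indicator_of_notMem (by simpa using h), zero_mul]

theorem integral_dampedProd (η : ℝ) {N : ℕ} (g : ℕ → ℝ → ℂ) (t : ℝ) :
    ∫ u : Fin N → ℝ, dampedProd η g (t - ∑ j, u j, u) =
      (Real.exp (-(η * t)) : ℂ) *
        simplexIntegral N t fun s => ∏ b ∈ Finset.range (N + 1), g b (s b) := by
  simp only [dampedProd_shear]
  rw [integral_indicator (measurableSet_timeSimplex N t), integral_const_mul, simplexIntegral_eq]

theorem integrable_dampedProd {η : ℝ} (hη : 0 < η) {N : ℕ} {g : ℕ → ℝ → ℂ}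
    (hg : ∀ b, Continuous (g b)) {B : ℕ → ℝ} (hB : ∀ b s, ‖g b s‖ ≤ B b) :
    Integrable (dampedProd (N := N) η g) :=
  (integrable_damped hη (hg 0) (hB 0)).mul_prod
    (Integrable.fintype_prod (f := fun j : Fin N => damped η (g (j + 1)))
      fun _ => integrable_damped hη (hg _) (hB _))

/-- The one-sided transform `∫_0^∞ e^{iαs - ηs} g(s) ds`. -/
def oneSided (η : ℝ) (g : ℝ → ℂ) (α : ℝ) : ℂ :=
  ∫ s, Complex.exp (Complex.I * ((α * s : ℝ) : ℂ)) * damped η g s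

-- Rescaling to the unit simplex moves all dependence on t into a power of t and a jointly
-- continuous integrand over a fixed compact set.
open scoped Pointwise in
theorem continuousAt_simplexIntegral (N : ℕ) {g : ℕ → ℝ → ℂ} (hg : ∀ b, Continuous (g b))
    {t : ℝ} (ht : 0 < t) :
    ContinuousAt (fun t => simplexIntegral N t fun s =>
      ∏ b ∈ Finset.range (N + 1), g b (s b)) t := by
  have h : ∀ᶠ r in 𝓝 t, simplexIntegral N r (fun s => ∏ b ∈ Finset.range (N + 1), g b (s b)) =
      (r ^ N : ℂ) * ∫ v in timeSimplex N 1,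
        ∏ b ∈ Finset.range (N + 1), g b (durations r (r • v) b) := by
    filter_upwards [lt_mem_nhds ht] with r hr
    have hset : r • timeSimplex N 1 = timeSimplex N r := by
      ext u
      rw [Set.mem_smul_set_iff_inv_smul_mem₀ hr.ne']
      simp only [timeSimplex, Set.mem_ofPred_eq, Pi.smul_apply, smul_eq_mul, ← Finset.mul_sum]
      refine and_congr (forall_congr' fun j => ?_) ?_
      · exact mul_nonneg_iff_of_pos_left (inv_pos.2 hr)
      · rw [inv_mul_le_iff₀ hr, mul_one]
    have := Measure.setIntegral_comp_smul volume
      (fun u : Fin N → ℝ => ∏ b ∈ Finset.range (N + 1), g b (durations r u b))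
      (timeSimplex N 1) hr.ne'
    rw [this, hset, simplexIntegral_eq, Module.finrank_fin_fun, abs_of_pos (by positivity),
      Complex.real_smul]
    have : (r : ℂ) ^ N ≠ 0 := pow_ne_zero _ (by exact_mod_cast hr.ne')
    push_cast
    rw [← mul_assoc, mul_inv_cancel₀ this, one_mul]
  refine ContinuousAt.congr ?_ (h.mono fun _ => Eq.symm)
  refine Continuous.continuousAt ?_
  refine Continuous.mul (by fun_prop) ?_
  refine continuous_parametric_integral_of_continuous ?_ (isCompact_timeSimplex N 1)
  refine continuous_finsetProd _ fun b _ => (hg b).comp ?_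
  exact (continuous_durations b).comp (by fun_prop :
    Continuous fun x : ℝ × (Fin N → ℝ) => (x.1, x.1 • x.2))

/-- The damped time integral is a convolution, so its Fourier transform is the product of the
one-sided transforms, and Fourier inversion at t recovers it. Integrability of the product is left
as a hypothesis, since it fails for a single resolvent. -/
theorem simplexIntegral_eq_integral {N : ℕ} {g : ℕ → ℝ → ℂ} (hg : ∀ b, Continuous (g b))
    {B : ℕ → ℝ} (hB : ∀ b s, ‖g b s‖ ≤ B b) {η : ℝ} (hη : 0 < η) {t : ℝ} (ht : 0 < t)
    (hint : Integrable fun α => ∏ b ∈ Finset.range (N + 1), oneSided η (g b) α) :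
    simplexIntegral N t (fun s => ∏ b ∈ Finset.range (N + 1), g b (s b)) =
      (Real.exp (t * η) / (2 * Real.pi) : ℂ) *
        ∫ α : ℝ, Complex.exp (-Complex.I * ((t * α : ℝ) : ℂ)) *
          ∏ b ∈ Finset.range (N + 1), oneSided η (g b) α := by
  set G : ℝ → ℂ := fun t => (Real.exp (-(η * t)) : ℂ) *
    simplexIntegral N t fun s => ∏ b ∈ Finset.range (N + 1), g b (s b) with hG
  have hG' : G = fun t => ∫ u : Fin N → ℝ, dampedProd η g (t - ∑ j, u j, u) :=
    funext fun t => (integral_dampedProd η g t).symm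
  have hH := integrable_dampedProd (N := N) hη hg hB
  have hH' : Integrable fun x : ℝ × (Fin N → ℝ) => dampedProd η g (x.1 - ∑ j, x.2 j, x.2) :=
    (measurePreserving_shear N).integrable_comp_of_integrable hH
  have hGint : Integrable G := by rw [hG']; exact hH'.integral_prod_left
  have hF : ∀ w : ℝ, FourierTransform.fourier G w =
      ∏ b ∈ Finset.range (N + 1), oneSided η (g b) (-(2 * Real.pi * w)) := by
    intro w
    -- The Fourier kernel is e^{-2πivw}, while the one-sided transforms use e^{iαs}.
    set α := -(2 * Real.pi * w) with hα
    rw [Real.fourier_real_eq_integral_exp_smul]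
    have h1 : ∀ v : ℝ, Complex.exp (((-2 * Real.pi * v * w : ℝ) : ℂ) * Complex.I) • G v =
        ∫ u : Fin N → ℝ, Complex.exp (Complex.I * ((α * v : ℝ) : ℂ)) *
          dampedProd η g (v - ∑ j, u j, u) := by
      intro v
      rw [integral_const_mul, hG', smul_eq_mul]
      congr 2
      rw [hα]; push_cast; ring
    simp only [h1]
    set K : ℝ × (Fin N → ℝ) → ℂ := fun x =>
      Complex.exp (Complex.I * ((α * (x.1 + ∑ j, x.2 j) : ℝ) : ℂ)) * dampedProd η g x with hK
    have hKint : Integrable K := by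
      refine Integrable.bdd_mul (c := 1) hH (by fun_prop) (ae_of_all _ fun x => ?_)
      rw [mul_comm, Complex.norm_exp_ofReal_mul_I]
    have hKint' := (measurePreserving_shear N).integrable_comp_of_integrable hKint
    -- Undoing the shear replaces v by s_0 + ∑ s_j, so the phase e^{iαv} factorizes over the time
    -- variables.
    have h2 : ∫ x, K x = ∫ v : ℝ, ∫ u : Fin N → ℝ, K (v - ∑ j, u j, u) := by
      rw [← (measurePreserving_shear N).integral_comp' (f := MeasurableEquiv.mk
        ⟨fun x : ℝ × (Fin N → ℝ) => (x.1 - ∑ j, x.2 j, x.2),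
          fun x => (x.1 + ∑ j, x.2 j, x.2), fun x => by simp, fun x => by simp⟩
        (by simp only [Equiv.coe_fn_mk]; fun_prop) (by simp only [Equiv.coe_fn_symm_mk]; fun_prop)) K]
      exact integral_prod _ hKint'
    have h3 : ∀ (v : ℝ) (u : Fin N → ℝ), K (v - ∑ j, u j, u) =
        Complex.exp (Complex.I * ((α * v : ℝ) : ℂ)) * dampedProd η g (v - ∑ j, u j, u) := by
      intro v u
      simp [hK]
    simp only [h3] at h2
    rw [← h2]
    have h4 : ∀ x, K x = (Complex.exp (Complex.I * ((α * x.1 : ℝ) : ℂ)) * damped η (g 0) x.1) *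
        ∏ j : Fin N, (Complex.exp (Complex.I * ((α * x.2 j : ℝ) : ℂ)) *
          damped η (g (j + 1)) (x.2 j)) := by
      intro x
      rw [Finset.prod_mul_distrib, ← Complex.exp_sum]
      simp only [hK, dampedProd]
      have : Complex.exp (Complex.I * ((α * (x.1 + ∑ j, x.2 j) : ℝ) : ℂ)) =
          Complex.exp (Complex.I * ((α * x.1 : ℝ) : ℂ)) *
            Complex.exp (∑ j, Complex.I * ((α * x.2 j : ℝ) : ℂ)) := by
        rw [← Complex.exp_add]
        congr 1
        push_cast
        rw [← Finset.mul_sum, ← Finset.mul_sum]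
        ring
      rw [this]
      ring
    simp only [h4]
    have h5 := integral_prod_mul (μ := (volume : Measure ℝ)) (ν := (volume : Measure (Fin N → ℝ)))
      (fun s : ℝ => Complex.exp (Complex.I * ((α * s : ℝ) : ℂ)) * damped η (g 0) s)
      (fun u : Fin N → ℝ => ∏ j : Fin N, (Complex.exp (Complex.I * ((α * u j : ℝ) : ℂ)) *
          damped η (g (j + 1)) (u j)))
    have h6 := integral_fintype_prod_eq_prod (μ := fun _ : Fin N => (volume : Measure ℝ))
      (fun (j : Fin N) (s : ℝ) => Complex.exp (Complex.I * ((α * s : ℝ) : ℂ)) *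
          damped η (g (j + 1)) s)
    rw [volume_pi] at h5
    rw [h6] at h5
    rw [Measure.volume_eq_prod, volume_pi, h5, Finset.prod_range_succ',
      Finset.prod_range fun i => oneSided η (g (i + 1)) α, mul_comm]
    rfl
  have hFint : Integrable (FourierTransform.fourier G) := by
    have h := hint.comp_mul_left' (R := -(2 * Real.pi)) (by simp [Real.pi_ne_zero])
    refine h.congr (ae_of_all _ fun w => ?_)
    simp only [hF, neg_mul]
  -- Inversion is pointwise and needs continuity at t only. Positivity of t matters here: for N = 0
  -- the function may jump at zero.
  have hcont : ContinuousAt G t := by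
    refine ContinuousAt.mul (by fun_prop) (continuousAt_simplexIntegral N hg ht)
  have hinv := hGint.fourierInv_fourier_eq hFint hcont
  rw [Real.fourierInv_eq'] at hinv
  have h7 : (∫ v : ℝ, Complex.exp (((2 * Real.pi * inner ℝ v t : ℝ) : ℂ) * Complex.I) •
      FourierTransform.fourier G v) = ((2 * Real.pi)⁻¹ : ℂ) *
        ∫ α : ℝ, Complex.exp (-Complex.I * ((t * α : ℝ) : ℂ)) *
          ∏ b ∈ Finset.range (N + 1), oneSided η (g b) α := by
    have := Measure.integral_comp_mul_left (fun α : ℝ =>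
      Complex.exp (-Complex.I * ((t * α : ℝ) : ℂ)) *
          ∏ b ∈ Finset.range (N + 1), oneSided η (g b) α) (-(2 * Real.pi))
    rw [abs_inv, abs_neg, abs_of_pos (by positivity), Complex.real_smul] at this
    push_cast at this ⊢
    rw [← this]
    refine integral_congr_ae (ae_of_all _ fun w => ?_)
    simp only [hF, neg_mul, smul_eq_mul, RCLike.inner_apply, conj_trivial]
    congr 2
    push_cast; ring
  rw [h7, hG] at hinv
  have he : (Real.exp (t * η) : ℂ) * (Real.exp (-(η * t)) : ℂ) = 1 := by
    rw [← Complex.ofReal_mul, ← Real.exp_add]; simp [mul_comm]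
  have := congrArg (fun z => (Real.exp (t * η) : ℂ) * z) hinv
  simp only at this
  rw [← mul_assoc, ← mul_assoc, he, one_mul] at this
  rw [← this]
  rfl

/-! ### The bracket -/

section Bracket

variable {d : ℕ}

theorem one_le_bracket (k : Momentum d) : 1 ≤ bracket k := by
  rw [bracket, Real.one_le_sqrt]
  nlinarith [sq_nonneg ‖k‖]

theorem bracket_pos (k : Momentum d) : 0 < bracket k := zero_lt_one.trans_le (one_le_bracket k)

theorem continuous_bracket : Continuous (bracket : Momentum d → ℝ) := by
  unfold bracket; fun_prop

theorem norm_le_bracket (k : Momentum d) : ‖k‖ ≤ bracket k :=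
  Real.le_sqrt_of_sq_le (by linarith)

theorem bracket_le_of_norm_sub_le {k q : Momentum d} {δ : ℝ} (h : ‖k - q‖ ≤ δ) :
    bracket k ≤ (1 + δ) * bracket q := by
  have hδ : 0 ≤ δ := (norm_nonneg _).trans h
  have h1 : ‖k‖ ≤ ‖q‖ + δ := by
    have := norm_add_le (k - q) q
    rw [sub_add_cancel] at this
    linarith
  have h2 := norm_le_bracket q
  have h3 := one_le_bracket q
  have h4 : bracket q ^ 2 = ‖q‖ ^ 2 + 1 := Real.sq_sqrt (by positivity)
  refine (Real.sqrt_le_left (by positivity)).2 ?_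
  have h5 : ‖k‖ ^ 2 ≤ (‖q‖ + δ) ^ 2 := pow_le_pow_left₀ (norm_nonneg _) h1 2
  nlinarith [mul_nonneg hδ (sub_nonneg.2 h2), mul_nonneg hδ (sub_nonneg.2 h3), norm_nonneg q,
    mul_nonneg (mul_nonneg hδ (sub_nonneg.2 h2)) (norm_nonneg q),
    mul_nonneg (mul_nonneg hδ (bracket_pos q).le) (sub_nonneg.2 h3),
    mul_nonneg (mul_nonneg hδ hδ) (mul_nonneg (sub_nonneg.2 h3) (by linarith : 0 ≤ bracket q + 1))]

/-- The reference decay `⟨k⟩^{-(d+1)}`. -/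
def decay (k : Momentum d) : ℝ := (bracket k ^ (d + 1))⁻¹

theorem decay_pos (k : Momentum d) : 0 < decay k := inv_pos.2 (pow_pos (bracket_pos k) _)

theorem continuous_decay : Continuous (decay : Momentum d → ℝ) :=
  (continuous_bracket.pow _).inv₀ fun k => (pow_pos (bracket_pos k) _).ne'

/-- The reference decay varies slowly, so sampling it at the nearest lattice point instead of at k
costs only a constant factor. -/
theorem decay_le_of_norm_sub_le {k q : Momentum d} {δ : ℝ} (h : ‖q - k‖ ≤ δ) :
    decay k ≤ (1 + δ) ^ (d + 1) * decay q := by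
  have hδ : 0 ≤ δ := (norm_nonneg _).trans h
  have := pow_le_pow_left₀ (bracket_pos q).le (bracket_le_of_norm_sub_le h) (d + 1)
  rw [mul_pow] at this
  unfold decay
  rw [← div_eq_mul_inv, inv_eq_one_div, div_le_div_iff₀ (pow_pos (bracket_pos k) _)
    (pow_pos (bracket_pos q) _), one_mul]
  exact this

theorem integrable_decay_volume : Integrable (decay : Momentum d → ℝ) := by
  have := integrable_rpow_neg_one_add_norm_sq (E := Momentum d) (μ := volume) (r := d + 1)
    (by simp)
  refine this.congr (ae_of_all _ fun k => ?_)
  have h : (0 : ℝ) ≤ 1 + ‖k‖ ^ 2 := by positivity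
  simp only [decay, bracket]
  rw [Real.sqrt_eq_rpow, ← Real.rpow_natCast (_ ^ (1 / 2 : ℝ)) (d + 1),
    ← Real.rpow_mul (by positivity), ← Real.rpow_neg (by positivity), add_comm]
  congr 1
  push_cast
  ring

theorem integrable_decay_spaceMeasure : Integrable (decay : Momentum d → ℝ) (spaceMeasure d) :=
  integrable_decay_volume.smul_measure ENNReal.ofReal_ne_top

end Bracket

/-! ### Lattice sums -/

section Lattice

variable {d : ℕ}

/-- The label of the lattice point nearest to `k`. -/
def nearest (L : ℝ) (k : Momentum d) : Mode d := fun i => round (L / Real.sqrt (2 * Real.pi) * k i)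

theorem measurable_nearest (L : ℝ) : Measurable (nearest L : Momentum d → Mode d) := by
  refine measurable_pi_lambda _ fun i => ?_
  have : (fun k : Momentum d => nearest L k i) =
      fun k => ⌊L / Real.sqrt (2 * Real.pi) * k i + 1 / 2⌋ :=
    funext fun k => round_eq _
  rw [this]
  refine Int.measurable_floor.comp ?_
  fun_prop

theorem sqrt_two_pi_pos : 0 < Real.sqrt (2 * Real.pi) := Real.sqrt_pos.2 (by positivity)

theorem norm_sub_nearest_le {L : ℝ} (hL : 0 < L) (k : Momentum d) :
    ‖k - latticePoint L (nearest L k)‖ ≤ d * (Real.sqrt (2 * Real.pi) / L) := by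
  have ha := sqrt_two_pi_pos
  have h : ∀ i, ‖(k - latticePoint L (nearest L k)) i‖ ≤ Real.sqrt (2 * Real.pi) / L := by
    intro i
    have h1 := abs_sub_round (L / Real.sqrt (2 * Real.pi) * k i)
    have h2 : (k - latticePoint L (nearest L k)) i = Real.sqrt (2 * Real.pi) / L *
        (L / Real.sqrt (2 * Real.pi) * k i - round (L / Real.sqrt (2 * Real.pi) * k i)) := by
      simp only [latticePoint, nearest, PiLp.sub_apply]
      field_simp
    rw [h2, Real.norm_eq_abs, abs_mul, abs_of_pos (by positivity)]
    exact mul_le_of_le_one_right (by positivity) (h1.trans (by norm_num))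
  rw [EuclideanSpace.norm_eq]
  refine (Real.sqrt_le_left (by positivity)).2 ?_
  calc ∑ i, ‖(k - latticePoint L (nearest L k)) i‖ ^ 2
      ≤ ∑ _i : Fin d, (Real.sqrt (2 * Real.pi) / L) ^ 2 :=
        Finset.sum_le_sum fun i _ => pow_le_pow_left₀ (norm_nonneg _) (h i) 2
    _ = d * (Real.sqrt (2 * Real.pi) / L) ^ 2 := by simp
    _ ≤ (d * (Real.sqrt (2 * Real.pi) / L)) ^ 2 := by
        rw [mul_pow]
        refine mul_le_mul_of_nonneg_right ?_ (by positivity)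
        rcases Nat.eq_zero_or_pos d with rfl | hd
        · simp
        · have : (1 : ℝ) ≤ d := by exact_mod_cast hd
          nlinarith

/-- The cell of a label is a cube of side √(2π)/L. Its Lebesgue volume divided by (2π)^{d/2} is
exactly L^{-d}. -/
theorem map_nearest {L : ℝ} (hL : 0 < L) :
    (spaceMeasure d).map (nearest L) = ENNReal.ofReal ((L ^ d)⁻¹) • Measure.count := by
  refine Measure.ext_of_singleton fun z => ?_
  have ha := sqrt_two_pi_pos
  set a := Real.sqrt (2 * Real.pi) with hadef
  rw [Measure.map_apply (measurable_nearest L) (measurableSet_singleton z), spaceMeasure]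
  have hset : nearest L ⁻¹' {z} = (WithLp.ofLp : Momentum d → Fin d → ℝ) ⁻¹'
      (Set.univ.pi fun i => Set.Ico (a / L * (z i - 1 / 2)) (a / L * (z i + 1 / 2))) := by
    ext k
    simp only [Set.mem_preimage, Set.mem_singleton_iff, Set.mem_univ_pi, Set.mem_Ico,
      funext_iff, nearest, round_eq, Int.floor_eq_iff]
    refine forall_congr' fun i => ?_
    rw [← hadef]
    have e1 : L / a * k i = (a / L)⁻¹ * k i := by rw [inv_div]
    rw [e1, ← sub_le_iff_le_add, ← lt_sub_iff_add_lt, le_inv_mul_iff₀ (by positivity),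
      inv_mul_lt_iff₀ (by positivity)]
    ring_nf
  rw [hset, Measure.smul_apply, Measure.smul_apply,
    (PiLp.volume_preserving_ofLp (Fin d)).measure_preimage
      (MeasurableSet.univ_pi fun i => measurableSet_Ico).nullMeasurableSet, Real.volume_pi_Ico]
  have : ∀ i, a / L * (z i + 1 / 2) - a / L * (z i - 1 / 2) = a / L := fun i => by ring
  simp only [this, Finset.prod_const, Finset.card_univ, Fintype.card_fin,
    Measure.count_singleton, smul_eq_mul, mul_one]
  rw [← ENNReal.ofReal_pow (by positivity), ← ENNReal.ofReal_mul (by positivity)]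
  congr 1
  field_simp
  rw [← hadef, ← mul_pow, div_mul_cancel₀ _ hL.ne']

theorem measurable_latticePoint (L : ℝ) : Measurable (latticePoint L : Mode d → Momentum d) :=
  measurable_of_countable _

theorem latticeMeasure_eq_map_count (L : ℝ) : latticeMeasure d L =
    (ENNReal.ofReal ((L ^ d)⁻¹) • (Measure.count : Measure (Mode d))).map (latticePoint L) := by
  rw [Measure.map_smul, latticeMeasure, Measure.count, Measure.map_sum
    (measurable_latticePoint L).aemeasurable]
  simp only [Measure.map_dirac]

/-- Lattice sums become integrals over a fixed measure space of functions sampled at the nearest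
lattice point. Both the bounds uniform in L and the limit L → ∞ rest on this identity. -/
theorem latticeMeasure_eq_map {L : ℝ} (hL : 0 < L) : latticeMeasure d L =
    (spaceMeasure d).map fun k => latticePoint L (nearest L k) := by
  rw [latticeMeasure_eq_map_count, ← map_nearest hL,
    Measure.map_map (measurable_latticePoint L) (measurable_nearest L)]
  rfl

theorem measurable_latticePoint_nearest (L : ℝ) :
    Measurable fun k : Momentum d => latticePoint L (nearest L k) :=
  (measurable_latticePoint L).comp (measurable_nearest L)

theorem measurableEmbedding_latticePoint {L : ℝ} (hL : 0 < L) :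
    MeasurableEmbedding (latticePoint L : Mode d → Momentum d) := by
  refine (measurable_latticePoint L).measurableEmbedding fun z z' h => ?_
  ext i
  have := congrArg (fun k : Momentum d => k i) h
  simp only [latticePoint] at this
  have ha := sqrt_two_pi_pos
  rw [mul_right_inj' (by positivity)] at this
  exact_mod_cast this

theorem integral_latticeMeasure {E : Type*} [NormedAddCommGroup E] [NormedSpace ℝ E]
    [CompleteSpace E] {L : ℝ} (hL : 0 < L)
    {f : Momentum d → E} (hf : Integrable f (latticeMeasure d L)) :
    ∫ k, f k ∂latticeMeasure d L = (L ^ d)⁻¹ • ∑' z, f (latticePoint L z) := by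
  rw [latticeMeasure_eq_map_count, (measurableEmbedding_latticePoint hL).integral_map,
    integral_smul_measure, ENNReal.toReal_ofReal (by positivity)]
  rw [latticeMeasure_eq_map_count, (measurableEmbedding_latticePoint hL).integrable_map_iff] at hf
  rw [integrable_smul_measure (by simp; positivity) (by simp)] at hf
  change Integrable (fun z => f (latticePoint L z)) _ at hf
  rw [integral_countable hf]
  simp [Measure.real]

theorem summable_norm_of_integrable_latticeMeasure {E : Type*} [NormedAddCommGroup E] {L : ℝ}
    (hL : 0 < L) {f : Momentum d → E} (hf : Integrable f (latticeMeasure d L)) :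
    Summable fun z => ‖f (latticePoint L z)‖ := by
  rw [latticeMeasure_eq_map_count, (measurableEmbedding_latticePoint hL).integrable_map_iff] at hf
  rw [integrable_smul_measure (by simp; positivity) (by simp)] at hf
  exact (integrable_count_iff.1 hf)

theorem decay_le_decay_nearest {L : ℝ} (hL : 0 < L) (k : Momentum d) :
    decay (latticePoint L (nearest L k)) ≤
      (1 + d * (Real.sqrt (2 * Real.pi) / L)) ^ (d + 1) * decay k :=
  decay_le_of_norm_sub_le (norm_sub_nearest_le hL k)

theorem integrable_decay_latticeMeasure {L : ℝ} (hL : 0 < L) :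
    Integrable (decay : Momentum d → ℝ) (latticeMeasure d L) := by
  rw [latticeMeasure_eq_map hL, integrable_map_measure
    continuous_decay.aestronglyMeasurable (measurable_latticePoint_nearest L).aemeasurable]
  refine (integrable_decay_spaceMeasure.const_mul
    ((1 + d * (Real.sqrt (2 * Real.pi) / L)) ^ (d + 1))).mono'
    (continuous_decay.measurable.comp (measurable_latticePoint_nearest L)).aestronglyMeasurable
    (ae_of_all _ fun k => ?_)
  rw [Function.comp_apply, Real.norm_of_nonneg (decay_pos _).le]
  exact decay_le_decay_nearest hL k

theorem decay_nearest_le {L : ℝ} (hL : 1 ≤ L) (k : Momentum d) :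
    decay (latticePoint L (nearest L k)) ≤
      (1 + d * Real.sqrt (2 * Real.pi)) ^ (d + 1) * decay k := by
  refine (decay_le_decay_nearest (by linarith) k).trans ?_
  have ha := sqrt_two_pi_pos
  gcongr
  · exact (decay_pos _).le
  · exact div_le_self ha.le hL

/-- A bound on the lattice sums of `decay`, uniform for large volumes. -/
def decayBound (d : ℕ) : ℝ :=
  (1 + d * Real.sqrt (2 * Real.pi)) ^ (d + 1) * ∫ k, decay k ∂spaceMeasure d

theorem integral_decay_latticeMeasure_le {L : ℝ} (hL : 1 ≤ L) :
    ∫ k, decay k ∂latticeMeasure d L ≤ decayBound d := by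
  have hL0 : 0 < L := by linarith
  rw [latticeMeasure_eq_map hL0, integral_map
    (measurable_latticePoint_nearest L).aemeasurable continuous_decay.aestronglyMeasurable,
    decayBound, ← integral_const_mul]
  refine integral_mono ?_ (integrable_decay_spaceMeasure.const_mul _) (decay_nearest_le hL)
  have := integrable_decay_latticeMeasure (d := d) hL0
  rw [latticeMeasure_eq_map hL0, integrable_map_measure
    continuous_decay.aestronglyMeasurable (measurable_latticePoint_nearest L).aemeasurable] at this
  exact this

theorem summable_decay {L : ℝ} (hL : 0 < L) :
    Summable fun z : Mode d => decay (latticePoint L z) := by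
  refine (summable_norm_of_integrable_latticeMeasure hL
    (integrable_decay_latticeMeasure hL)).congr fun z => ?_
  exact Real.norm_of_nonneg (decay_pos _).le

theorem tsum_decay_le {L : ℝ} (hL : 1 ≤ L) :
    ∑' z : Mode d, decay (latticePoint L z) ≤ L ^ d * decayBound d := by
  have hL0 : 0 < L := by linarith
  have h := integral_decay_latticeMeasure_le (d := d) hL
  rw [integral_latticeMeasure hL0 (integrable_decay_latticeMeasure hL0), smul_eq_mul,
    inv_mul_le_iff₀ (by positivity)] at h
  exact h

theorem tendsto_latticePoint_nearest (k : Momentum d) :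
    Tendsto (fun L : ℝ => latticePoint L (nearest L k)) atTop (𝓝 k) := by
  rw [tendsto_iff_norm_sub_tendsto_zero]
  have h : Tendsto (fun L : ℝ => d * (Real.sqrt (2 * Real.pi) / L)) atTop (𝓝 0) := by
    simpa using (tendsto_const_nhds.div_atTop tendsto_id).const_mul (d : ℝ)
  refine squeeze_zero' (Eventually.of_forall fun _ => norm_nonneg _) ?_ h
  filter_upwards [eventually_gt_atTop 0] with L hL
  rw [norm_sub_rev]
  exact norm_sub_nearest_le hL k

end Lattice

theorem norm_exp_neg_I_mul (x : ℝ) : ‖Complex.exp (-Complex.I * (x : ℂ))‖ = 1 := by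
  rw [show -Complex.I * (x : ℂ) = ((-x : ℝ) : ℂ) * Complex.I by push_cast; ring,
    Complex.norm_exp_ofReal_mul_I]

namespace Model

variable {d : ℕ}

/-- The standing assumptions on the model, with a bound `q < 1` for the Boltzmann factors. -/
structure Regular (P : Model d) (c q : ℝ) : Prop where
  cont_e : Continuous P.e
  cont_ω : Continuous P.ω
  even_ω : ∀ k, P.ω (-k) = P.ω k
  cont_Q : Continuous P.Q
  even_Q : ∀ k, P.Q (-k) = P.Q k
  Q_le : ∀ k, |P.Q k| ≤ c * (bracket k ^ (2 * d + 12))⁻¹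
  boltzmann_le : ∀ k, Real.exp (-P.β * P.ω k + P.chem) ≤ q
  q_lt : q < 1

namespace Regular

variable {P : Model d} {c q : ℝ}

theorem c_nonneg (h : P.Regular c q) : 0 ≤ c := by
  have := (abs_nonneg _).trans (h.Q_le 0)
  exact nonneg_of_mul_nonneg_left this (inv_pos.2 (pow_pos (bracket_pos _) _))

theorem q_pos (h : P.Regular c q) : 0 < q := (Real.exp_pos _).trans_le (h.boltzmann_le 0)

theorem boltzmann_lt (h : P.Regular c q) (k : Momentum d) :
    Real.exp (-P.β * P.ω k + P.chem) < 1 := (h.boltzmann_le k).trans_lt h.q_lt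

theorem occupation_nonneg (h : P.Regular c q) (k : Momentum d) : 0 ≤ P.occupation k :=
  div_nonneg (Real.exp_pos _).le (by linarith [h.boltzmann_lt k])

theorem occupation_le (h : P.Regular c q) (k : Momentum d) :
    P.occupation k ≤ q / (1 - q) :=
  div_le_div₀ h.q_pos.le (h.boltzmann_le k) (by linarith [h.q_lt]) (by linarith [h.boltzmann_le k])

theorem continuous_occupation (h : P.Regular c q) : Continuous P.occupation := by
  have hω := h.cont_ω
  refine Continuous.div (by fun_prop) (by fun_prop) fun k => ?_
  linarith [h.boltzmann_lt k]

theorem occupation_neg (h : P.Regular c q) (k : Momentum d) :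
    P.occupation (-k) = P.occupation k := by
  simp only [occupation, h.even_ω]

theorem sign_term (σ : ℤˣ) : ((((σ : ℤ) : ℝ) + 1) / 2) ∈ Set.Icc (0 : ℝ) 1 := by
  rcases Int.units_eq_one_or σ with rfl | rfl <;> norm_num

theorem continuous_M (h : P.Regular c q) (σ : ℤˣ) : Continuous fun k => P.M k σ := by
  have h1 := h.continuous_occupation
  have h2 := h.cont_Q
  unfold M
  fun_prop

theorem M_nonneg (h : P.Regular c q) (k : Momentum d) (σ : ℤˣ) : 0 ≤ P.M k σ :=
  mul_nonneg (by positivity) (add_nonneg (h.occupation_nonneg k) (sign_term σ).1)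

theorem occupation_add_le (h : P.Regular c q) (k : Momentum d) (σ : ℤˣ) :
    P.occupation k + (((σ : ℤ) : ℝ) + 1) / 2 ≤ (1 - q)⁻¹ := by
  have h1 := h.occupation_le k
  have h2 := (sign_term σ).2
  have h3 : 0 < 1 - q := by linarith [h.q_lt]
  have : q / (1 - q) + 1 = (1 - q)⁻¹ := by field_simp; ring
  linarith

theorem inv_bracket_pow_le (k : Momentum d) {i j : ℕ} (hij : i ≤ j) :
    (bracket k ^ j)⁻¹ ≤ (bracket k ^ i)⁻¹ :=
  inv_anti₀ (pow_pos (bracket_pos k) i) (pow_le_pow_right₀ (one_le_bracket k) hij)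

theorem Q_le_decay (h : P.Regular c q) (k : Momentum d) : |P.Q k| ≤ c * decay k :=
  (h.Q_le k).trans (mul_le_mul_of_nonneg_left (inv_bracket_pow_le k (by omega)) h.c_nonneg)

theorem Q_le_const (h : P.Regular c q) (k : Momentum d) : |P.Q k| ≤ c := by
  refine (h.Q_le k).trans (mul_le_of_le_one_right h.c_nonneg ?_)
  exact inv_le_one_of_one_le₀ (one_le_pow₀ (one_le_bracket k))

/-- One of the two factors Q in M supplies the whole decay, with a spare power of the bracket. That
spare power pays for the tail weight in the infinite volume limit. -/
theorem bracket_mul_M_le (h : P.Regular c q) (k : Momentum d) (σ : ℤˣ) :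
    bracket k * P.M k σ ≤ c ^ 2 * (1 - q)⁻¹ * decay k := by
  have h3 : 0 < 1 - q := by linarith [h.q_lt]
  have hb := bracket_pos k
  have h4 : bracket k * |P.Q k| ≤ c * decay k := by
    have h5 : |P.Q k| ≤ c * (bracket k ^ (d + 1 + 1))⁻¹ :=
      (h.Q_le k).trans (mul_le_mul_of_nonneg_left (inv_bracket_pow_le k (by omega)) h.c_nonneg)
    calc bracket k * |P.Q k| ≤ bracket k * (c * (bracket k ^ (d + 1 + 1))⁻¹) :=
          mul_le_mul_of_nonneg_left h5 hb.le
      _ = c * decay k := by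
          rw [decay, pow_succ _ (d + 1)]
          field_simp
  calc bracket k * P.M k σ = (bracket k * |P.Q k|) * |P.Q k| *
        (P.occupation k + (((σ : ℤ) : ℝ) + 1) / 2) := by rw [M]; ring
    _ ≤ (c * decay k) * c * (1 - q)⁻¹ := by
        refine mul_le_mul (mul_le_mul h4 (h.Q_le_const k) (abs_nonneg _) ?_)
          (h.occupation_add_le k σ) (add_nonneg (h.occupation_nonneg k) (sign_term σ).1) ?_
        · exact mul_nonneg h.c_nonneg (decay_pos k).le
        · exact mul_nonneg (mul_nonneg h.c_nonneg (decay_pos k).le) h.c_nonneg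
    _ = c ^ 2 * (1 - q)⁻¹ * decay k := by ring

theorem M_le_decay (h : P.Regular c q) (k : Momentum d) (σ : ℤˣ) :
    P.M k σ ≤ c ^ 2 * (1 - q)⁻¹ * decay k :=
  (le_mul_of_one_le_left (h.M_nonneg k σ) (one_le_bracket k)).trans (h.bracket_mul_M_le k σ)

theorem integrable_M (h : P.Regular c q) {κ : Measure (Momentum d)} (hκ : Integrable decay κ)
    (σ : ℤˣ) : Integrable (fun k => P.M k σ) κ := by
  refine (hκ.const_mul (c ^ 2 * (1 - q)⁻¹)).mono' (h.continuous_M σ).aestronglyMeasurable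
    (ae_of_all _ fun k => ?_)
  rw [Real.norm_of_nonneg (h.M_nonneg k σ)]
  exact h.M_le_decay k σ

/-- The total mass of `M` for the momentum integration `κ`. -/
def _root_.ElectronPhonon.Model.massM (P : Model d) (κ : Measure (Momentum d)) : ℝ :=
  ∑ σ : ℤˣ, ∫ k, P.M k σ ∂κ

theorem massM_nonneg (h : P.Regular c q) (κ : Measure (Momentum d)) : 0 ≤ P.massM κ :=
  Finset.sum_nonneg fun σ _ => integral_nonneg fun k => h.M_nonneg k σ

theorem norm_Theta_le (h : P.Regular c q) {κ : Measure (Momentum d)} (s : ℝ) (p : Momentum d)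
    (Ω : ℝ) : ‖P.Theta κ s p Ω‖ ≤ P.massM κ := by
  refine (norm_sum_le _ _).trans (Finset.sum_le_sum fun σ _ => ?_)
  refine (norm_integral_le_integral_norm _).trans (le_of_eq ?_)
  refine integral_congr_ae (ae_of_all _ fun k => ?_)
  simp only
  rw [norm_mul, norm_exp_neg_I_mul, one_mul, Complex.norm_of_nonneg (h.M_nonneg k σ)]

theorem continuous_Phi (h : P.Regular c q) (σ : ℤˣ) :
    Continuous fun x : Momentum d × Momentum d => P.Phi σ x.1 x.2 := by
  have h1 := h.cont_e
  have h2 := h.cont_ω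
  unfold Phi
  fun_prop

theorem continuous_Theta (h : P.Regular c q) {κ : Measure (Momentum d)} (hκ : Integrable decay κ)
    (p : Momentum d) (Ω : ℝ) : Continuous fun s => P.Theta κ s p Ω := by
  refine continuous_finsetSum _ fun σ _ => ?_
  have hΦ : Continuous fun k => P.Phi σ p k := (h.continuous_Phi σ).comp (continuous_const.prodMk continuous_id)
  have hM := h.continuous_M σ
  refine continuous_of_dominated (bound := fun k => P.M k σ) (fun s => ?_)
    (fun s => ae_of_all _ fun k => ?_) (h.integrable_M hκ σ) (ae_of_all _ fun k => ?_)
  · exact Continuous.aestronglyMeasurable (by fun_prop)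
  · rw [norm_mul, norm_exp_neg_I_mul, one_mul, Complex.norm_of_nonneg (h.M_nonneg k σ)]
  · fun_prop

end Regular

end Model

/-! ### One-sided transforms -/

theorem oneSided_eq (η : ℝ) (g : ℝ → ℂ) (α : ℝ) : oneSided η g α =
    ∫ s in Set.Ici (0 : ℝ), Complex.exp ((Complex.I * α - η) * s) * g s := by
  rw [oneSided, ← integral_indicator measurableSet_Ici]
  refine integral_congr_ae (ae_of_all _ fun s => ?_)
  simp only [damped, Set.indicator_apply]
  split_ifs
  · rw [← mul_assoc, Complex.ofReal_exp, ← Complex.exp_add]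
    congr 2
    push_cast; ring
  · simp

theorem integrable_damped_exp {η : ℝ} (hη : 0 < η) (α : ℝ) :
    IntegrableOn (fun s : ℝ => Complex.exp ((Complex.I * α - η) * s)) (Set.Ici 0) := by
  rw [integrableOn_Ici_iff_integrableOn_Ioi]
  refine integrableOn_exp_mul_complex_Ioi ?_ 0
  simpa using hη

theorem integral_damped_exp {η : ℝ} (hη : 0 < η) (α : ℝ) :
    ∫ s in Set.Ici (0 : ℝ), Complex.exp ((Complex.I * α - η) * s) =
      Complex.I / ((α : ℂ) + Complex.I * η) := by
  rw [integral_Ici_eq_integral_Ioi, integral_exp_mul_complex_Ioi (by simpa using hη)]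
  have h1 : (α : ℂ) + Complex.I * η ≠ 0 := fun h => by
    have := congrArg Complex.im h; simp at this; exact hη.ne' this
  have h2 : Complex.I * α - η = Complex.I * ((α : ℂ) + Complex.I * η) := by
    linear_combination (-(η : ℂ)) * Complex.I_mul_I
  rw [h2]
  simp only [Complex.ofReal_zero, mul_zero, Complex.exp_zero]
  have := Complex.I_ne_zero
  rw [div_eq_div_iff (mul_ne_zero this h1) h1]
  linear_combination (-((α : ℂ) + Complex.I * η)) * Complex.I_mul_I

theorem oneSided_exp {η : ℝ} (hη : 0 < η) (E α : ℝ) :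
    oneSided η (fun s => Complex.exp (-Complex.I * ((s * E : ℝ) : ℂ))) α =
      Complex.I / (((α - E : ℝ) : ℂ) + Complex.I * η) := by
  rw [oneSided_eq, ← integral_damped_exp hη]
  refine integral_congr_ae (ae_of_all _ fun s => ?_)
  simp only
  rw [← Complex.exp_add]
  congr 1
  push_cast; ring

theorem continuous_oneSided {η : ℝ} {g : ℝ → ℂ} (hg : Integrable (damped η g)) :
    Continuous (oneSided η g) := by
  refine continuous_of_dominated (bound := fun s => ‖damped η g s‖) (fun α => ?_)
    (fun α => ae_of_all _ fun s => ?_) hg.norm (ae_of_all _ fun s => ?_)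
  · exact AEStronglyMeasurable.mul (Continuous.aestronglyMeasurable (by fun_prop)) hg.1
  · rw [norm_mul, mul_comm Complex.I, Complex.norm_exp_ofReal_mul_I, one_mul]
  · fun_prop

theorem norm_oneSided_le {η : ℝ} {g : ℝ → ℂ} (α : ℝ) :
    ‖oneSided η g α‖ ≤ ∫ s, ‖damped η g s‖ := by
  refine (norm_integral_le_integral_norm _).trans (le_of_eq ?_)
  refine integral_congr_ae (ae_of_all _ fun s => ?_)
  simp only
  rw [norm_mul, mul_comm Complex.I, Complex.norm_exp_ofReal_mul_I, one_mul]

/-- Fubini in (s, k) puts the one-sided transform of a pure phase under the momentum integral, at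
the frequency α - Ω - Φ. The damping and the integrability of M justify the exchange. -/
theorem Model.Regular.oneSided_Theta {d : ℕ} {P : Model d} {c q : ℝ} (h : P.Regular c q)
    {κ : Measure (Momentum d)} [SFinite κ]
    (hκ : Integrable decay κ) {η : ℝ} (hη : 0 < η) (p : Momentum d) (Ω α : ℝ) :
    oneSided η (fun s => P.Theta κ s p Ω) α = Complex.I * P.Upsilon κ η (α - Ω) p := by
  rw [oneSided_eq]
  have hterm : ∀ σ : ℤˣ, Integrable (fun x : ℝ × Momentum d =>
      Complex.exp ((Complex.I * α - η) * x.1) *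
      (Complex.exp (-Complex.I * ((x.1 * (P.Phi σ p x.2 + Ω) : ℝ) : ℂ)) * ((P.M x.2 σ : ℝ) : ℂ)))
      ((volume.restrict (Set.Ici 0)).prod κ) := by
    intro σ
    have hΦ : Continuous fun k => P.Phi σ p k := (h.continuous_Phi σ).comp (continuous_const.prodMk continuous_id)
    have hM := h.continuous_M σ
    have h1 := (integrable_damped_exp hη α).mul_prod ((h.integrable_M hκ σ).ofReal (𝕜 := ℂ))
    refine h1.mono (Continuous.aestronglyMeasurable (by fun_prop)) (ae_of_all _ fun x => ?_)
    simp only [norm_mul, norm_exp_neg_I_mul, one_mul]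
    exact le_rfl
  have hsum : ∀ s : ℝ, Complex.exp ((Complex.I * α - η) * s) * P.Theta κ s p Ω =
      ∑ σ : ℤˣ, ∫ k, Complex.exp ((Complex.I * α - η) * s) *
        (Complex.exp (-Complex.I * ((s * (P.Phi σ p k + Ω) : ℝ) : ℂ)) * ((P.M k σ : ℝ) : ℂ)) ∂κ := by
    intro s
    simp only [Model.Theta, Finset.mul_sum, integral_const_mul]
  simp only [hsum]
  rw [integral_finsetSum _ fun σ _ => (hterm σ).integral_prod_left, Model.Upsilon, Finset.mul_sum]
  refine Finset.sum_congr rfl fun σ _ => ?_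
  rw [integral_integral_swap (hterm σ), ← integral_const_mul]
  refine integral_congr_ae (ae_of_all _ fun k => ?_)
  simp only
  have h2 := integral_damped_exp hη (α - (P.Phi σ p k + Ω))
  have h3 : Complex.I * (((P.M k σ : ℝ) : ℂ) /
      (((α - Ω - P.Phi σ p k : ℝ) : ℂ) + Complex.I * η)) = ((P.M k σ : ℝ) : ℂ) *
      (Complex.I / (((α - (P.Phi σ p k + Ω) : ℝ) : ℂ) + Complex.I * η)) := by
    rw [show α - Ω - P.Phi σ p k = α - (P.Phi σ p k + Ω) by ring]
    ring
  rw [h3, ← h2, ← integral_const_mul]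
  refine integral_congr_ae (ae_of_all _ fun s => ?_)
  simp only
  rw [mul_left_comm, ← mul_assoc, mul_comm, ← Complex.exp_add]
  congr 2
  push_cast; ring

/-! ### The resolvent formula -/

namespace Model

variable {d : ℕ} (P : Model d)

/-- The time integral of one of the two sides of `Y`. -/
def blockIntegral (κ : Measure (Momentum d)) {n : ℕ} (N : ℕ) (m : Fin (n + 1) → ℕ) (t : ℝ)
    (p : Momentum d) (k : Fin n → Momentum d) (σ : Fin n → ℤˣ) : ℂ :=
  simplexIntegral N t (fun s => ∏ j : Fin (n + 1),
    ((∏ b ∈ blockOuter m j, Complex.exp (-Complex.I *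
        ((s b * (P.e (electronMomentum p k j) + P.Omega k σ j) : ℝ) : ℂ))) *
      ∏ b ∈ blockInner m j, P.Theta κ (s b) (electronMomentum p k j) (P.Omega k σ j)))

theorem Y_eq (κ : Measure (Momentum d)) {n : ℕ} (N : ℕ) (m m' : Fin (n + 1) → ℕ)
    (π : Equiv.Perm (Fin n)) (t : ℝ) (p p' : Momentum d) (k k' : Fin n → Momentum d)
    (σ : Fin n → ℤˣ) : P.Y κ N m m' π t p p' k k' σ =
      P.blockIntegral κ N m t p k σ * conj (P.blockIntegral κ N m' t p' k' (σ ∘ π.symm)) := by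
  rw [Y, blockIntegral, blockIntegral, conj_simplexIntegral]
  congr 2
  funext s
  simp only [map_prod, map_mul, ← Complex.exp_conj, map_neg, Complex.conj_I, neg_neg,
    Complex.conj_ofReal]

/-- The factor of the time integral carrying the time variable `s_b`. -/
def blockFactor (κ : Measure (Momentum d)) {n : ℕ} (m : Fin (n + 1) → ℕ)
    (p : Momentum d) (k : Fin n → Momentum d) (σ : Fin n → ℤˣ) (b : ℕ) (s : ℝ) : ℂ :=
  if IsOuter m b then Complex.exp (-Complex.I * ((s *
    (P.e (electronMomentum p k (blockIndex m b)) + P.Omega k σ (blockIndex m b)) : ℝ) : ℂ))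
  else P.Theta κ s (electronMomentum p k (blockIndex m b)) (P.Omega k σ (blockIndex m b))

theorem blockIntegral_eq (κ : Measure (Momentum d)) {n N : ℕ} {m : Fin (n + 1) → ℕ}
    (hm : m ∈ patterns n N) (t : ℝ) (p : Momentum d) (k : Fin n → Momentum d)
    (σ : Fin n → ℤˣ) : P.blockIntegral κ N m t p k σ =
      simplexIntegral N t fun s => ∏ b ∈ Finset.range (N + 1), P.blockFactor κ m p k σ b (s b) := by
  unfold blockIntegral blockFactor
  congr 1
  funext s
  rw [prod_blocks_ite hm (fun j b => Complex.exp (-Complex.I *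
        ((s b * (P.e (electronMomentum p k j) + P.Omega k σ j) : ℝ) : ℂ)))
      (fun j b => P.Theta κ (s b) (electronMomentum p k j) (P.Omega k σ j))]

namespace Regular

variable {P : Model d} {c q : ℝ}

theorem continuous_blockFactor (h : P.Regular c q) {κ : Measure (Momentum d)}
    (hκ : Integrable decay κ) {n : ℕ} (m : Fin (n + 1) → ℕ)
    (p : Momentum d) (k : Fin n → Momentum d) (σ : Fin n → ℤˣ) (b : ℕ) :
    Continuous (P.blockFactor κ m p k σ b) := by
  unfold blockFactor
  split_ifs
  · fun_prop
  · exact h.continuous_Theta hκ _ _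

theorem norm_blockFactor_le (h : P.Regular c q) {κ : Measure (Momentum d)}
    {n : ℕ} (m : Fin (n + 1) → ℕ)
    (p : Momentum d) (k : Fin n → Momentum d) (σ : Fin n → ℤˣ) (b : ℕ) (s : ℝ) :
    ‖P.blockFactor κ m p k σ b s‖ ≤ 1 + P.massM κ := by
  have h0 := h.massM_nonneg κ
  unfold blockFactor
  split_ifs
  · rw [norm_exp_neg_I_mul]
    linarith
  · exact (h.norm_Theta_le _ _ _).trans (by linarith)

theorem norm_blockIntegral_le (h : P.Regular c q) {κ : Measure (Momentum d)} {n N : ℕ}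
    {m : Fin (n + 1) → ℕ} (hm : m ∈ patterns n N) {t : ℝ} (ht : 0 ≤ t) (p : Momentum d)
    (k : Fin n → Momentum d) (σ : Fin n → ℤˣ) :
    ‖P.blockIntegral κ N m t p k σ‖ ≤ (1 + P.massM κ) ^ (N + 1) * t ^ N := by
  rw [P.blockIntegral_eq κ hm]
  refine norm_simplexIntegral_le ht fun s => ?_
  rw [norm_prod]
  refine (Finset.prod_le_prod (fun b _ => norm_nonneg _)
    fun b _ => h.norm_blockFactor_le m p k σ b (s b)).trans (le_of_eq ?_)
  simp

end Regular

theorem oneSided_blockFactor {P : Model d} {c q : ℝ} (h : P.Regular c q)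
    {κ : Measure (Momentum d)} [SFinite κ]
    (hκ : Integrable decay κ) {n : ℕ} (m : Fin (n + 1) → ℕ)
    (p : Momentum d) (k : Fin n → Momentum d) (σ : Fin n → ℤˣ) (b : ℕ) {η : ℝ} (hη : 0 < η)
    (α : ℝ) : oneSided η (P.blockFactor κ m p k σ b) α =
      if IsOuter m b then Complex.I * P.R η α p k σ (blockIndex m b)
      else Complex.I * P.Upsilon κ η (α - P.Omega k σ (blockIndex m b))
        (electronMomentum p k (blockIndex m b)) := by
  unfold blockFactor
  split_ifs
  · rw [oneSided_exp hη, R, mul_one_div, sub_sub]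
  · exact h.oneSided_Theta hκ hη _ _ _

/-- Each of the N + 1 time slots carries a factor i. Block j contributes m_j + 1 resolvents and m_j
factors Υ, and 2∑m_j + n + 1 = N + 1. -/
theorem prod_oneSided_blockFactor {P : Model d} {c q : ℝ} (h : P.Regular c q)
    {κ : Measure (Momentum d)} [SFinite κ]
    (hκ : Integrable decay κ) {n N : ℕ} {m : Fin (n + 1) → ℕ} (hm : m ∈ patterns n N)
    (p : Momentum d) (k : Fin n → Momentum d) (σ : Fin n → ℤˣ) {η : ℝ} (hη : 0 < η)
    (t α : ℝ) : Complex.exp (-Complex.I * ((t * α : ℝ) : ℂ)) *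
      ∏ b ∈ Finset.range (N + 1), oneSided η (P.blockFactor κ m p k σ b) α =
      Complex.I ^ (N + 1) * P.resolventIntegrand κ m η t p k σ α := by
  simp only [oneSided_blockFactor h hκ m p k σ _ hη]
  rw [prod_blocks_ite hm (fun j _ => Complex.I * P.R η α p k σ j)
    (fun j _ => Complex.I * P.Upsilon κ η (α - P.Omega k σ j) (electronMomentum p k j)),
    resolventIntegrand, mul_left_comm]
  simp only [Finset.prod_const, card_blockOuter, card_blockInner, mul_pow]
  have : ∀ j, Complex.I ^ (m j + 1) * P.R η α p k σ j ^ (m j + 1) * (Complex.I ^ m j *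
      P.Upsilon κ η (α - P.Omega k σ j) (electronMomentum p k j) ^ m j) =
      Complex.I ^ (2 * m j + 1) * (P.R η α p k σ j ^ (m j + 1) *
        P.Upsilon κ η (α - P.Omega k σ j) (electronMomentum p k j) ^ m j) := fun j => by ring
  simp only [this]
  rw [Finset.prod_mul_distrib, Finset.prod_pow_eq_pow_sum, Finset.sum_add_distrib,
    ← Finset.mul_sum]
  have hN : 2 * ∑ j, m j + ∑ _j : Fin (n + 1), 1 = N + 1 := by
    have := mem_patterns.1 hm
    simp
    omega
  rw [hN]

theorem zero_mem_blockOuter {n : ℕ} (m : Fin (n + 1) → ℕ) : 0 ∈ blockOuter m 0 :=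
  Finset.mem_image.2 ⟨0, by simp, by simp [position_zero]⟩

theorem last_mem_blockOuter {n N : ℕ} {m : Fin (n + 1) → ℕ} (hm : m ∈ patterns n N) :
    N ∈ blockOuter m (Fin.last n) := by
  refine Finset.mem_image.2 ⟨m (Fin.last n), by simp, ?_⟩
  have h1 := position_succ m (Fin.last n)
  have h2 := position_last hm
  simp only [Fin.val_last] at h1 ⊢
  omega

theorem integrable_norm_R_sq (P : Model d) {n : ℕ} {η : ℝ} (hη : 0 < η) (p : Momentum d)
    (k : Fin n → Momentum d) (σ : Fin n → ℤˣ) (j : ℕ) :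
    Integrable fun α => ‖P.R η α p k σ j‖ ^ 2 := by
  have h1 := (((integrable_inv_one_add_sq).comp_mul_left' (R := η⁻¹)
    (inv_ne_zero hη.ne')).const_mul (η⁻¹ ^ 2)).comp_sub_right
      (P.e (electronMomentum p k j) + P.Omega k σ j)
  refine h1.congr (ae_of_all _ fun α => ?_)
  simp only [R]
  rw [norm_div, norm_one, div_pow, one_pow, ← Complex.normSq_eq_norm_sq, mul_comm Complex.I,
    Complex.normSq_add_mul_I]
  have h2 : η ^ 2 + (α - (P.e (electronMomentum p k j) + P.Omega k σ j)) ^ 2 ≠ 0 := by positivity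
  rw [show α - P.e (electronMomentum p k j) - P.Omega k σ j =
    α - (P.e (electronMomentum p k j) + P.Omega k σ j) by ring]
  field_simp
  ring

/-- The slots 0 and N are outer and distinct once N ≥ 1. Their two resolvents are square integrable
in α, their product is dominated by the sum of the squares, and all other transforms are bounded. -/
theorem integrable_prod_oneSided {P : Model d} {c q : ℝ} (h : P.Regular c q)
    {κ : Measure (Momentum d)} [SFinite κ]
    (hκ : Integrable decay κ) {n N : ℕ} {m : Fin (n + 1) → ℕ} (hm : m ∈ patterns n N)
    (hN : 1 ≤ N) (p : Momentum d) (k : Fin n → Momentum d) (σ : Fin n → ℤˣ) {η : ℝ}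
    (hη : 0 < η) :
    Integrable fun α => ∏ b ∈ Finset.range (N + 1), oneSided η (P.blockFactor κ m p k σ b) α := by
  have hdamp : ∀ b, Integrable (damped η (P.blockFactor κ m p k σ b)) := fun b =>
    integrable_damped hη (h.continuous_blockFactor hκ m p k σ b)
      (h.norm_blockFactor_le m p k σ b)
  have hcont : ∀ b, Continuous (oneSided η (P.blockFactor κ m p k σ b)) := fun b =>
    continuous_oneSided (hdamp b)
  obtain ⟨N, rfl⟩ : ∃ N', N = N' + 1 := ⟨N - 1, by omega⟩
  have h0 : ∀ b j, b ∈ blockOuter m j →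
      Integrable fun α => ‖oneSided η (P.blockFactor κ m p k σ b) α‖ ^ 2 := by
    intro b j hb
    refine (integrable_norm_R_sq P hη p k σ j).congr (ae_of_all _ fun α => ?_)
    simp only
    rw [oneSided_blockFactor h hκ m p k σ b hη, if_pos (isOuter_of_mem hb),
      blockIndex_of_mem_blockOuter hb, norm_mul, Complex.norm_I, one_mul]
  have h1 := (h0 0 0 (zero_mem_blockOuter m)).add (h0 _ _ (last_mem_blockOuter hm))
  set C := ∏ b ∈ Finset.range N, ∫ s, ‖damped η (P.blockFactor κ m p k σ (b + 1)) s‖ with hC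
  refine (h1.const_mul C).mono'
    (continuous_finsetProd _ fun b _ => hcont b).aestronglyMeasurable (ae_of_all _ fun α => ?_)
  rw [Finset.prod_range_succ, Finset.prod_range_succ', norm_mul, norm_mul, norm_prod, mul_assoc]
  refine mul_le_mul (Finset.prod_le_prod (fun _ _ => norm_nonneg _)
    fun b _ => norm_oneSided_le α) ?_ (by positivity)
    (Finset.prod_nonneg fun b _ => integral_nonneg fun s => norm_nonneg _)
  simp only [Pi.add_apply]
  nlinarith [sq_nonneg (‖oneSided η (P.blockFactor κ m p k σ 0) α‖ -
    ‖oneSided η (P.blockFactor κ m p k σ (N + 1)) α‖),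
    sq_nonneg ‖oneSided η (P.blockFactor κ m p k σ 0) α‖,
    sq_nonneg ‖oneSided η (P.blockFactor κ m p k σ (N + 1)) α‖]

theorem I_pow_mul_neg_I_pow (j : ℕ) : Complex.I ^ j * (-Complex.I) ^ j = 1 := by
  rw [← mul_pow]; simp

theorem integrable_resolventIntegrand {P : Model d} {c q : ℝ} (h : P.Regular c q)
    {κ : Measure (Momentum d)} [SFinite κ]
    (hκ : Integrable decay κ) {n N : ℕ} {m : Fin (n + 1) → ℕ} (hm : m ∈ patterns n N)
    (hN : 1 ≤ N) (p : Momentum d) (k : Fin n → Momentum d) (σ : Fin n → ℤˣ) {η : ℝ}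
    (hη : 0 < η) (t : ℝ) : Integrable (P.resolventIntegrand κ m η t p k σ) := by
  have h1 := integrable_prod_oneSided h hκ hm hN p k σ hη
  have h2 : Integrable fun α => (-Complex.I) ^ (N + 1) *
      (Complex.exp (-Complex.I * ((t * α : ℝ) : ℂ)) *
        ∏ b ∈ Finset.range (N + 1), oneSided η (P.blockFactor κ m p k σ b) α) := by
    refine (h1.bdd_mul (c := 1) (Continuous.aestronglyMeasurable (by fun_prop))
      (ae_of_all _ fun α => ?_)).const_mul _
    rw [norm_exp_neg_I_mul]
  refine h2.congr (ae_of_all _ fun α => ?_)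
  simp only
  rw [prod_oneSided_blockFactor h hκ hm p k σ hη, ← mul_assoc, mul_comm (_ ^ _) (Complex.I ^ _),
    I_pow_mul_neg_I_pow, one_mul]

theorem hasImproperIntegral_of_integrable {f : ℝ → ℂ} (hf : Integrable f) :
    HasImproperIntegral f (∫ α, f α) :=
  intervalIntegral_tendsto_integral hf tendsto_fst tendsto_snd

theorem simplexIntegral_one_const {t : ℝ} (ht : 0 ≤ t) (E : ℝ) :
    simplexIntegral 1 t (fun s => ∏ b ∈ Finset.range 2,
      Complex.exp (-Complex.I * ((s b * E : ℝ) : ℂ))) =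
      t * Complex.exp (-Complex.I * ((t * E : ℝ) : ℂ)) := by
  have h1 : ∀ u : Fin 1 → ℝ, ∏ b ∈ Finset.range 2,
      Complex.exp (-Complex.I * ((durations t u b * E : ℝ) : ℂ)) =
      Complex.exp (-Complex.I * ((t * E : ℝ) : ℂ)) := by
    intro u
    rw [← Complex.exp_sum, ← Finset.mul_sum, ← Complex.ofReal_sum, ← Finset.sum_mul]
    rw [sum_durations t u]
  rw [simplexIntegral_eq]
  simp only [h1]
  rw [setIntegral_const]
  have h2 : timeSimplex 1 t = Set.Icc (fun _ => 0) (fun _ => t) := by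
    refine Set.Subset.antisymm (timeSimplex_subset 1 t) fun u hu => ⟨hu.1, ?_⟩
    simpa using hu.2 0
  rw [h2, Measure.real, Real.volume_Icc_pi_toReal (fun _ => ht)]
  simp

theorem ofReal_add_I_mul_ne_zero {η : ℝ} (hη : 0 < η) (x : ℝ) :
    (x : ℂ) + Complex.I * η ≠ 0 := fun h => by
  have := congrArg Complex.im h; simp at this; exact hη.ne' this

theorem integrable_inv_sq_resolvent {η : ℝ} (hη : 0 < η) (E : ℝ) :
    Integrable fun α : ℝ => ((((α - E : ℝ) : ℂ) + Complex.I * η) ^ 2)⁻¹ := by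
  have hne := ofReal_add_I_mul_ne_zero hη
  have h1 := (((integrable_inv_one_add_sq).comp_mul_left' (R := η⁻¹)
    (inv_ne_zero hη.ne')).const_mul (η⁻¹ ^ 2)).comp_sub_right E
  refine h1.mono' (Continuous.aestronglyMeasurable
    ((by fun_prop : Continuous fun α : ℝ => (((α - E : ℝ) : ℂ) + Complex.I * η) ^ 2).inv₀
      fun α => pow_ne_zero 2 (hne _))) (ae_of_all _ fun α => le_of_eq ?_)
  rw [norm_inv, norm_pow, ← Complex.normSq_eq_norm_sq, mul_comm Complex.I,
    Complex.normSq_add_mul_I]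
  have h2 : η ^ 2 + (α - E) ^ 2 ≠ 0 := by positivity
  field_simp
  ring

/-- This is the residue at a double pole, obtained without contours: the case N = 1 of the Fourier
formula with both energies equal to E, where the time integral is t e^{-itE}. -/
theorem integral_inv_sq_resolvent {t η : ℝ} (ht : 0 < t) (hη : 0 < η) (E : ℝ) :
    ∫ α : ℝ, Complex.exp (-Complex.I * ((t * α : ℝ) : ℂ)) *
      ((((α - E : ℝ) : ℂ) + Complex.I * η) ^ 2)⁻¹ =
      -(2 * Real.pi * t) * Complex.exp (-Complex.I * ((t * E : ℝ) : ℂ)) *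
        Real.exp (-(t * η)) := by
  have h0 : ∀ α : ℝ, ∏ b ∈ Finset.range (1 + 1),
      oneSided η ((fun (_ : ℕ) (s : ℝ) => Complex.exp (-Complex.I * ((s * E : ℝ) : ℂ))) b) α =
      -((((α - E : ℝ) : ℂ) + Complex.I * η) ^ 2)⁻¹ := by
    intro α
    rw [Finset.prod_const, Finset.card_range, oneSided_exp hη, div_pow, Complex.I_sq,
      neg_div, one_div]
  have h1 := simplexIntegral_eq_integral (N := 1)
    (g := fun _ s => Complex.exp (-Complex.I * ((s * E : ℝ) : ℂ))) (fun b => by fun_prop)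
    (B := fun _ => 1) (fun b s => (norm_exp_neg_I_mul _).le) hη ht
    (by simp only [h0]; exact (integrable_inv_sq_resolvent hη E).neg)
  rw [simplexIntegral_one_const ht.le E] at h1
  simp only [h0, mul_neg, integral_neg] at h1
  have hexp : (Real.exp (t * η) : ℂ) * Real.exp (-(t * η)) = 1 := by
    rw [← Complex.ofReal_mul, ← Real.exp_add]; simp
  have hpi : (2 * Real.pi : ℂ) ≠ 0 := by simp [Real.pi_ne_zero]
  rw [div_mul_eq_mul_div, ← neg_div, eq_div_iff hpi] at h1
  linear_combination (Real.exp (-(t * η)) : ℂ) * h1 - (∫ α : ℝ,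
    Complex.exp (-Complex.I * ((t * α : ℝ) : ℂ)) *
      ((((α - E : ℝ) : ℂ) + Complex.I * η) ^ 2)⁻¹) * hexp

theorem tendsto_resolvent_zero (η E : ℝ) {l : Filter ℝ}
    (hl : Tendsto (fun x => |x|) l atTop) (φ : ℝ → ℂ) {C : ℝ} (hφ : ∀ x, ‖φ x‖ ≤ C) :
    Tendsto (fun α => φ α * (((α - E : ℝ) : ℂ) + Complex.I * η)⁻¹) l (𝓝 0) := by
  have h1 : Tendsto (fun α : ℝ => C * (|α| - |E|)⁻¹) l (𝓝 0) := by
    simpa [sub_eq_add_neg] using (tendsto_inv_atTop_zero.comp (tendsto_atTop_add_const_right _ (-|E|) hl)).const_mul C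
  refine squeeze_zero_norm' ?_ h1
  filter_upwards [hl.eventually_gt_atTop |E|] with α hα
  rw [norm_mul, norm_inv]
  have h2 : |α| - |E| ≤ ‖((α - E : ℝ) : ℂ) + Complex.I * η‖ := by
    have h3 := Complex.abs_re_le_norm (((α - E : ℝ) : ℂ) + Complex.I * η)
    simp only [Complex.add_re, Complex.ofReal_re, Complex.mul_re, Complex.I_re, Complex.I_im,
      Complex.ofReal_im] at h3
    have := abs_sub_abs_le_abs_sub α E
    simp only [zero_mul, mul_zero, sub_zero, add_zero] at h3
    linarith
  exact mul_le_mul (hφ α) (inv_anti₀ (by linarith) h2) (by positivity)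
    ((norm_nonneg _).trans (hφ α))

/-- A single resolvent is not absolutely integrable. Integrating the oscillating factor by parts
replaces it by its square, and the boundary terms vanish because the resolvent tends to zero at both
ends. -/
theorem hasImproperIntegral_resolvent {t η : ℝ} (ht : 0 < t) (hη : 0 < η) (E : ℝ) :
    HasImproperIntegral (fun α => Complex.exp (-Complex.I * ((t * α : ℝ) : ℂ)) *
      (((α - E : ℝ) : ℂ) + Complex.I * η)⁻¹)
      (-(2 * Real.pi * Complex.I) * Complex.exp (-Complex.I * ((t * E : ℝ) : ℂ)) *
        Real.exp (-(t * η))) := by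
  set z : ℝ → ℂ := fun α => ((α - E : ℝ) : ℂ) + Complex.I * η with hz
  have hne : ∀ α, z α ≠ 0 := fun α => ofReal_add_I_mul_ne_zero hη _
  have htI : (-Complex.I * t : ℂ) ≠ 0 := by simp [ht.ne']
  set ψ : ℝ → ℂ := fun α => (-Complex.I * t)⁻¹ * Complex.exp (-Complex.I * ((t * α : ℝ) : ℂ))
    with hψ
  have hψd : ∀ α : ℝ, HasDerivAt ψ (Complex.exp (-Complex.I * ((t * α : ℝ) : ℂ))) α := by
    intro α
    have h1 : HasDerivAt (fun α : ℝ => -Complex.I * ((t * α : ℝ) : ℂ)) (-Complex.I * t) α := by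
      have := ((hasDerivAt_id α).const_mul t).ofReal_comp.const_mul (-Complex.I)
      simpa using this
    have h2 := h1.cexp.const_mul ((-Complex.I * t)⁻¹)
    rw [mul_comm (Complex.exp _), ← mul_assoc, inv_mul_cancel₀ htI, one_mul] at h2
    exact h2
  have hzd : ∀ α : ℝ, HasDerivAt (fun α => (z α)⁻¹) (-1 / z α ^ 2) α := by
    intro α
    have h1 : HasDerivAt z 1 α := by
      have := (((hasDerivAt_id α).sub_const E).ofReal_comp).add_const (Complex.I * η)
      simpa [hz] using this
    exact h1.inv (hne α)
  have hzc : Continuous z := by fun_prop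
  have hψc : Continuous ψ := by fun_prop
  have hint2 : Integrable fun α => ψ α * (-1 / z α ^ 2) := by
    have h1 := (integrable_inv_sq_resolvent hη E).neg.bdd_mul (c := ‖(-Complex.I * t : ℂ)⁻¹‖)
      hψc.aestronglyMeasurable (ae_of_all _ fun α => by
        rw [hψ, norm_mul, norm_exp_neg_I_mul, mul_one])
    refine h1.congr (ae_of_all _ fun α => ?_)
    simp only [Pi.neg_apply, hz]
    rw [neg_div, one_div]
  have hparts : ∀ a b : ℝ, ∫ α in a..b, Complex.exp (-Complex.I * ((t * α : ℝ) : ℂ)) * (z α)⁻¹ =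
      ψ b * (z b)⁻¹ - ψ a * (z a)⁻¹ - ∫ α in a..b, ψ α * (-1 / z α ^ 2) := by
    intro a b
    have h1 := intervalIntegral.integral_deriv_mul_eq_sub (a := a) (b := b) (u := ψ)
      (v := fun α => (z α)⁻¹) (fun α _ => hψd α) (fun α _ => hzd α)
      (Continuous.intervalIntegrable (by fun_prop) _ _)
      (Continuous.intervalIntegrable
        (Continuous.div (by fun_prop) (by fun_prop) fun α => pow_ne_zero 2 (hne α)) _ _)
    rw [intervalIntegral.integral_add] at h1
    · rw [← h1]; ring
    · exact Continuous.intervalIntegrable (Continuous.mul (by fun_prop) (hzc.inv₀ hne)) _ _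
    · exact hint2.intervalIntegrable
  have hψb : ∀ α, ‖ψ α‖ ≤ ‖(-Complex.I * t : ℂ)⁻¹‖ := fun α => by
    rw [hψ, norm_mul, norm_exp_neg_I_mul, mul_one]
  have hb := (tendsto_resolvent_zero η E tendsto_abs_atTop_atTop ψ hψb).comp
    (tendsto_snd (f := (atBot : Filter ℝ)))
  have ha := (tendsto_resolvent_zero η E tendsto_abs_atBot_atTop ψ hψb).comp
    (tendsto_fst (g := (atTop : Filter ℝ)))
  have hlim := (hb.sub ha).sub (hasImproperIntegral_of_integrable hint2)
  have hval : ∫ α, ψ α * (-1 / z α ^ 2) = 2 * Real.pi * Complex.I *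
      Complex.exp (-Complex.I * ((t * E : ℝ) : ℂ)) * Real.exp (-(t * η)) := by
    have h1 : ∀ α, ψ α * (-1 / z α ^ 2) = -(-Complex.I * t)⁻¹ *
        (Complex.exp (-Complex.I * ((t * α : ℝ) : ℂ)) *
          ((((α - E : ℝ) : ℂ) + Complex.I * η) ^ 2)⁻¹) := by
      intro α
      simp only [hψ, hz]
      ring
    simp only [h1]
    rw [integral_const_mul, integral_inv_sq_resolvent ht hη E]
    have hI : (-Complex.I * t : ℂ)⁻¹ * t = Complex.I := by
      have : (t : ℂ) ≠ 0 := by exact_mod_cast ht.ne'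
      rw [mul_inv, mul_assoc, inv_mul_cancel₀ this, mul_one, inv_neg, Complex.inv_I, neg_neg]
    linear_combination (2 * Real.pi * Complex.exp (-Complex.I * ((t * E : ℝ) : ℂ)) *
      Real.exp (-(t * η))) * hI
  rw [hval] at hlim
  refine Tendsto.congr (fun x => (hparts x.1 x.2).symm) ?_
  rw [sub_zero, zero_sub, ← neg_mul, ← neg_mul] at hlim
  exact hlim

/-- The value of the resolvent integral in terms of the time integral. -/
theorem hasImproperIntegral_resolventIntegrand {P : Model d} {c q : ℝ} (h : P.Regular c q)
    {κ : Measure (Momentum d)} [SFinite κ]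
    (hκ : Integrable decay κ) {n N : ℕ} {m : Fin (n + 1) → ℕ} (hm : m ∈ patterns n N)
    (p : Momentum d) (k : Fin n → Momentum d) (σ : Fin n → ℤˣ) {η : ℝ}
    (hη : 0 < η) {t : ℝ} (ht : 0 < t) : ∃ A : ℂ,
      HasImproperIntegral (P.resolventIntegrand κ m η t p k σ) A ∧
      P.blockIntegral κ N m t p k σ =
        (Real.exp (t * η) / (2 * Real.pi) : ℂ) * (Complex.I ^ (N + 1) * A) := by
  -- For N = 0 the pattern is n = 0, m_0 = 0 and the integrand is one resolvent. Otherwise the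
  -- integral is absolutely convergent and the Fourier formula applies.
  rcases Nat.eq_zero_or_pos N with rfl | hN
  · have hn : n = 0 := by have := mem_patterns.1 hm; omega
    subst hn
    have hm0 : m 0 = 0 := by have := mem_patterns.1 hm; simpa using this
    set E := P.e (electronMomentum p k 0) + P.Omega k σ 0 with hE
    have h1 := hasImproperIntegral_resolvent ht hη E
    have h2 : P.resolventIntegrand κ m η t p k σ = fun α =>
        Complex.exp (-Complex.I * ((t * α : ℝ) : ℂ)) *
          (((α - E : ℝ) : ℂ) + Complex.I * η)⁻¹ := by
      funext α
      simp [resolventIntegrand, R, hm0, hE, sub_sub]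
    refine ⟨_, by rw [h2]; exact h1, ?_⟩
    have hexp : (Real.exp (t * η) : ℂ) * Real.exp (-(t * η)) = 1 := by
      rw [← Complex.ofReal_mul, ← Real.exp_add]; simp
    have h3 : P.blockIntegral κ 0 m t p k σ =
        Complex.exp (-Complex.I * ((t * E : ℝ) : ℂ)) := by
      rw [blockIntegral_eq P κ hm, simplexIntegral_eq]
      have h4 : ∀ u : Fin 0 → ℝ, ∏ b ∈ Finset.range (0 + 1),
          P.blockFactor κ m p k σ b (durations t u b) =
          Complex.exp (-Complex.I * ((t * E : ℝ) : ℂ)) := by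
        intro u
        rw [zero_add, Finset.prod_range_one, blockFactor,
          if_pos (isOuter_of_mem (zero_mem_blockOuter m)),
          blockIndex_of_mem_blockOuter (zero_mem_blockOuter m), durations_zero]
        simp [hE]
      simp only [h4]
      have h5 : timeSimplex 0 t = Set.univ := by
        ext u; simp [timeSimplex, ht.le]
      rw [h5, setIntegral_const]
      simp [Measure.real, volume_pi]
    rw [h3]
    have hpi : (2 * Real.pi : ℂ) ≠ 0 := by simp [Real.pi_ne_zero]
    rw [div_mul_eq_mul_div, eq_div_iff hpi]
    linear_combination (-(2 * Real.pi * Complex.exp (-Complex.I * ((t * E : ℝ) : ℂ)))) * hexp +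
      (Real.exp (t * η) * (2 * Real.pi) * Complex.exp (-Complex.I * ((t * E : ℝ) : ℂ)) *
        Real.exp (-(t * η))) * Complex.I_mul_I
  · refine ⟨_, hasImproperIntegral_of_integrable
      (integrable_resolventIntegrand h hκ hm hN p k σ hη t), ?_⟩
    rw [blockIntegral_eq P κ hm, simplexIntegral_eq_integral
      (h.continuous_blockFactor hκ m p k σ) (h.norm_blockFactor_le m p k σ) hη ht
      (integrable_prod_oneSided h hκ hm hN p k σ hη)]
    simp only [prod_oneSided_blockFactor h hκ hm p k σ hη]
    rw [integral_const_mul]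

theorem resolventIntegrandTilde_eq_conj (P : Model d) (κ : Measure (Momentum d)) {n : ℕ}
    (m : Fin (n + 1) → ℕ) (η t : ℝ) (p : Momentum d) (k : Fin n → Momentum d) (σ : Fin n → ℤˣ)
    (α : ℝ) : P.resolventIntegrandTilde κ m η t p k σ α =
      conj (P.resolventIntegrand κ m η t p k σ α) := by
  simp only [resolventIntegrandTilde, resolventIntegrand, R, map_mul, map_prod, map_pow,
    ← Complex.exp_conj, map_neg, Complex.conj_I, neg_neg, Complex.conj_ofReal, map_div₀, map_one,
    map_add, neg_mul, Complex.ofReal_neg, mul_neg]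

theorem hasImproperIntegral_conj {f : ℝ → ℂ} {A : ℂ} (hf : HasImproperIntegral f A) :
    HasImproperIntegral (fun α => conj (f α)) (conj A) := by
  have h1 := (Complex.continuous_conj.tendsto A).comp hf
  refine h1.congr fun x => ?_
  simp only [Function.comp_apply, intervalIntegral, map_sub, integral_conj]

/-- The resolvent formula for `Y`. -/
theorem resolvent_formula {P : Model d} {c q : ℝ} (h : P.Regular c q)
    {κ : Measure (Momentum d)} [SFinite κ]
    (hκ : Integrable decay κ) {n N : ℕ} {m m' : Fin (n + 1) → ℕ} (hm : m ∈ patterns n N)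
    (hm' : m' ∈ patterns n N) (π : Equiv.Perm (Fin n))
    (p p' : Momentum d) (k k' : Fin n → Momentum d) (σ : Fin n → ℤˣ) {η : ℝ}
    (hη : 0 < η) {t : ℝ} (ht : 0 < t) :
    (1 ≤ N →
      MeasureTheory.Integrable (P.resolventIntegrand κ m η t p k σ) ∧
      MeasureTheory.Integrable (P.resolventIntegrandTilde κ m' η t p' k' (σ ∘ π.symm))) ∧
    ∃ A A' : ℂ,
      HasImproperIntegral (P.resolventIntegrand κ m η t p k σ) A ∧
      HasImproperIntegral (P.resolventIntegrandTilde κ m' η t p' k' (σ ∘ π.symm)) A' ∧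
      P.Y κ N m m' π t p p' k k' σ =
        ((Real.exp (2 * t * η) / (2 * Real.pi) ^ 2 : ℝ) : ℂ) * A * A' := by
  have htilde : P.resolventIntegrandTilde κ m' η t p' k' (σ ∘ π.symm) =
      fun α => conj (P.resolventIntegrand κ m' η t p' k' (σ ∘ π.symm) α) :=
    funext fun α => resolventIntegrandTilde_eq_conj ..
  rw [htilde]
  refine ⟨fun hN => ⟨integrable_resolventIntegrand h hκ hm hN p k σ hη t, ?_⟩, ?_⟩
  · have := integrable_resolventIntegrand h hκ hm' hN p' k' (σ ∘ π.symm) hη t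
    exact Complex.conjCLE.toContinuousLinearMap.integrable_comp this
  · obtain ⟨A, hA, hA'⟩ := hasImproperIntegral_resolventIntegrand h hκ hm p k σ hη ht
    obtain ⟨B, hB, hB'⟩ :=
      hasImproperIntegral_resolventIntegrand h hκ hm' p' k' (σ ∘ π.symm) hη ht
    refine ⟨A, conj B, hA, hasImproperIntegral_conj hB, ?_⟩
    rw [Y_eq, hA', hB']
    have h2 : Real.exp (2 * t * η) = Real.exp (t * η) * Real.exp (t * η) := by
      rw [← Real.exp_add]; ring_nf
    rw [h2]
    simp only [map_mul, map_div₀, map_pow, Complex.conj_I, Complex.conj_ofReal, map_ofNat]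
    simp only [Complex.ofReal_mul, Complex.ofReal_div, Complex.ofReal_pow, Complex.ofReal_ofNat]
    -- The factor i^{N+1} of the first integral cancels against the (-i)^{N+1} of the conjugate one.
    linear_combination (Real.exp (t * η) * Real.exp (t * η) / (2 * Real.pi) ^ 2 * A * conj B : ℂ) *
      I_pow_mul_neg_I_pow (N + 1)

end Model

/-! ### Expansion of the histories into paths -/

section Paths

variable {d : ℕ}

/-- The mode whose occupation number is changed by the part `τ` of the vertex `k`. -/
def touched (k : Mode d) (τ : ℤˣ) : Mode d := (τ : ℤ) • k

theorem touched_one (k : Mode d) : touched k 1 = k := by simp [touched]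

theorem touched_neg_one (k : Mode d) : touched k (-1) = -k := by simp [touched]

/-- The basis vector reached from `a` by the part `τ` of the vertex `k`. -/
def stepLabel (k : Mode d) (τ : ℤˣ) (a : Label d) : Label d :=
  if τ = 1 then (a.1 - k, a.2 + Finsupp.single k 1) else (a.1 - k, a.2 - Finsupp.single (-k) 1)

/-- The amplitude of the part `τ` of the vertex `k`, without the volume factor. -/
def stepAmp (k : Mode d) (τ : ℤˣ) (n : Mode d →₀ ℕ) : ℝ :=
  Real.sqrt ((n (touched k τ) : ℝ) + (((τ : ℤ) : ℝ) + 1) / 2)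

theorem units_neg_one_ne_one : (-1 : ℤˣ) ≠ 1 := by decide

theorem sum_intUnits {M : Type*} [AddCommMonoid M] (f : ℤˣ → M) :
    ∑ τ : ℤˣ, f τ = f 1 + f (-1) := by
  have : (Finset.univ : Finset ℤˣ) = {1, -1} := by decide
  rw [this, Finset.sum_pair (by decide)]

/-- The sign in b_k = c†_k - c_{-k} is τ itself, and (τ + 1)/2 distinguishes the amplitude √(n + 1)
of creation from the √n of annihilation. -/
theorem Model.vertex_single (P : Model d) (L : ℝ) (k : Mode d) (a : Label d) (c : ℂ) :
    P.vertex L k (Finsupp.single a c) = ∑ τ : ℤˣ, Finsupp.single (stepLabel k τ a)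
      (((P.Q (latticePoint L k) * ((τ : ℤ) : ℝ) * (Real.sqrt (L ^ d) * stepAmp k τ a.2) : ℝ) : ℂ)
        * c) := by
  rw [sum_intUnits]
  simp only [Model.vertex, bOp, planeWave, create, annihilate, LinearMap.smul_apply,
    Module.End.mul_apply, LinearMap.sub_apply, Finsupp.linearCombination_single, map_sub,
    Finsupp.smul_single, stepLabel, stepAmp, touched_one, touched_neg_one, if_true,
    units_neg_one_ne_one, if_false]
  rw [smul_sub, sub_eq_add_neg, ← smul_neg, ← Finsupp.single_neg]
  simp only [Finsupp.smul_single, smul_eq_mul]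
  congr 2
  · push_cast; norm_num; ring
  · push_cast; norm_num; ring

theorem Model.freeEvolution_single (P : Model d) (L s : ℝ) (a : Label d) (c : ℂ) :
    P.freeEvolution L s (Finsupp.single a c) = Finsupp.single a (Complex.exp (-Complex.I *
      ((s * (P.e (latticePoint L a.1) + P.phononEnergy L a.2) : ℝ) : ℂ)) * c) := by
  rw [Model.freeEvolution, Finsupp.linearCombination_single, Finsupp.smul_single, smul_eq_mul,
    mul_comm]

theorem Model.history_succ (P : Model d) (L : ℝ) {N : ℕ} (k : Fin (N + 1) → Mode d)
    (s : ℕ → ℝ) : P.history L k s =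
      P.freeEvolution L (s 0) * (P.vertex L (k 0) *
        P.history L (fun j => k j.succ) fun b => s (b + 1)) := by
  simp only [Model.history, List.ofFn_succ, List.prod_cons, mul_assoc]
  rfl

/-- The basis vector reached from `a` by the vertices `(k_j, τ_j)`, applied from right to left. -/
def pathLabel : {N : ℕ} → (Fin N → Mode d) → (Fin N → ℤˣ) → Label d → Label d
  | 0, _, _, a => a
  | _ + 1, k, τ, a => stepLabel (k 0) (τ 0) (pathLabel (fun j => k j.succ) (fun j => τ j.succ) a)

/-- The product of the amplitudes of the vertices of a path. -/
def pathAmp : {N : ℕ} → (Fin N → Mode d) → (Fin N → ℤˣ) → Label d → ℝ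
  | 0, _, _, _ => 1
  | _ + 1, k, τ, a => stepAmp (k 0) (τ 0)
      (pathLabel (fun j => k j.succ) (fun j => τ j.succ) a).2 *
        pathAmp (fun j => k j.succ) (fun j => τ j.succ) a

/-- The phase collected along a path. -/
def Model.pathPhase (P : Model d) (L : ℝ) :
    {N : ℕ} → (Fin N → Mode d) → (Fin N → ℤˣ) → (ℕ → ℝ) → Label d → ℂ
  | 0, _, _, s, a => Complex.exp (-Complex.I *
      ((s 0 * (P.e (latticePoint L a.1) + P.phononEnergy L a.2) : ℝ) : ℂ))
  | _ + 1, k, τ, s, a => Complex.exp (-Complex.I *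
      ((s 0 * (P.e (latticePoint L (pathLabel k τ a).1) +
        P.phononEnergy L (pathLabel k τ a).2) : ℝ) : ℂ)) *
      Model.pathPhase P L (fun j => k j.succ) (fun j => τ j.succ) (fun b => s (b + 1)) a

theorem Model.history_single (P : Model d) (L : ℝ) {N : ℕ} (k : Fin N → Mode d) (s : ℕ → ℝ)
    (a : Label d) : P.history L k s (Finsupp.single a 1) = ∑ τ : Fin N → ℤˣ,
      Finsupp.single (pathLabel k τ a)
        ((((∏ j, (P.Q (latticePoint L (k j)) * ((τ j : ℤ) : ℝ) * Real.sqrt (L ^ d))) *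
          pathAmp k τ a : ℝ) : ℂ) * P.pathPhase L k τ s a) := by
  induction N generalizing s with
  | zero =>
    simp [Model.history, Model.freeEvolution_single, pathLabel, pathAmp, Model.pathPhase]
  | succ N ih =>
    rw [Model.history_succ, Module.End.mul_apply, Module.End.mul_apply, ih]
    simp only [map_sum, Model.vertex_single, Model.freeEvolution_single]
    rw [Finset.sum_comm, ← (Fin.consEquiv fun _ => ℤˣ).sum_comp, Fintype.sum_prod_type]
    refine Finset.sum_congr rfl fun τ₀ _ => Finset.sum_congr rfl fun τ _ => ?_
    simp only [Fin.consEquiv_apply, pathLabel, pathAmp, Model.pathPhase, Fin.cons_zero,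
      Fin.cons_succ, Fin.prod_univ_succ]
    congr 1
    push_cast
    ring

/-- The change of the occupation number of the mode `κ` by the vertices with index at least
`b`. -/
def net {N : ℕ} (k : Fin N → Mode d) (τ : Fin N → ℤˣ) (b : ℕ) (κ : Mode d) : ℤ :=
  ∑ l : Fin N, if b ≤ l.val ∧ touched (k l) (τ l) = κ then (τ l : ℤ) else 0

theorem net_succ {N : ℕ} (k : Fin (N + 1) → Mode d) (τ : Fin (N + 1) → ℤˣ) (b : ℕ) (κ : Mode d) :
    net k τ (b + 1) κ = net (fun j => k j.succ) (fun j => τ j.succ) b κ := by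
  simp [net, Fin.sum_univ_succ]

theorem net_zero_succ {N : ℕ} (k : Fin (N + 1) → Mode d) (τ : Fin (N + 1) → ℤˣ) (κ : Mode d) :
    net k τ 0 κ = (if touched (k 0) (τ 0) = κ then (τ 0 : ℤ) else 0) +
      net (fun j => k j.succ) (fun j => τ j.succ) 0 κ := by
  simp [net, Fin.sum_univ_succ]

/-- The product of the amplitudes of a path in closed form. -/
def amplitude {N : ℕ} (k : Fin N → Mode d) (τ : Fin N → ℤˣ) (n : Mode d →₀ ℕ) : ℝ :=
  ∏ u : Fin N, Real.sqrt ((n (touched (k u) (τ u)) : ℝ) +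
    net k τ (u.val + 1) (touched (k u) (τ u)) + (((τ u : ℤ) : ℝ) + 1) / 2)

theorem amplitude_nonneg {N : ℕ} (k : Fin N → Mode d) (τ : Fin N → ℤˣ) (n : Mode d →₀ ℕ) :
    0 ≤ amplitude k τ n := Finset.prod_nonneg fun _ _ => Real.sqrt_nonneg _

theorem pathLabel_fst {N : ℕ} (k : Fin N → Mode d) (τ : Fin N → ℤˣ) (a : Label d) :
    (pathLabel k τ a).1 = a.1 - ∑ j, k j := by
  induction N with
  | zero => simp [pathLabel]
  | succ N ih =>
    have h : ∀ (κ : Mode d) (τ : ℤˣ) (a : Label d), (stepLabel κ τ a).1 = a.1 - κ := by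
      intro κ τ a; unfold stepLabel; split_ifs <;> rfl
    rw [pathLabel, h, ih, Fin.sum_univ_succ]
    abel

/-- Annihilation uses truncated subtraction on occupation numbers. A nonzero amplitude guarantees
that the mode is occupied, so the subtraction is genuine. -/
theorem stepLabel_snd {k : Mode d} {τ : ℤˣ} {a : Label d} (h : stepAmp k τ a.2 ≠ 0) (κ : Mode d) :
    ((stepLabel k τ a).2 κ : ℤ) = a.2 κ + if touched k τ = κ then (τ : ℤ) else 0 := by
  rcases Int.units_eq_one_or τ with rfl | rfl
  · rw [touched_one, stepLabel, if_pos rfl]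
    rw [Finsupp.add_apply, Finsupp.single_apply]
    split_ifs <;> simp
  · rw [touched_neg_one, stepLabel, if_neg units_neg_one_ne_one]
    simp only [stepAmp, touched_neg_one] at h
    have h1 : 0 < a.2 (-k) := by
      by_contra h0
      apply h
      simp [Nat.eq_zero_of_not_pos h0]
    simp only [Finsupp.tsub_apply, Finsupp.single_apply]
    split_ifs with h2
    · subst h2
      push_cast [Nat.cast_sub h1]
      omega
    · simp

theorem pathLabel_snd {N : ℕ} (k : Fin N → Mode d) (τ : Fin N → ℤˣ) (a : Label d)
    (h : pathAmp k τ a ≠ 0) (κ : Mode d) :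
    ((pathLabel k τ a).2 κ : ℤ) = a.2 κ + net k τ 0 κ := by
  induction N with
  | zero => simp [pathLabel, net]
  | succ N ih =>
    rw [pathAmp] at h
    rw [pathLabel, stepLabel_snd (left_ne_zero_of_mul h), ih _ _ (right_ne_zero_of_mul h),
      net_zero_succ]
    ring

/-- Vertices act from right to left, so the occupation seen by a vertex is the initial one plus the
net change due to larger indices. This is valid only while the amplitude so far is nonzero; when it
vanishes, so do both sides. -/
theorem pathAmp_eq {N : ℕ} (k : Fin N → Mode d) (τ : Fin N → ℤˣ) (a : Label d) :
    pathAmp k τ a = amplitude k τ a.2 := by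
  induction N with
  | zero => simp [pathAmp, amplitude]
  | succ N ih =>
    rw [pathAmp, amplitude, Fin.prod_univ_succ]
    have h1 : ∏ u : Fin N, Real.sqrt ((a.2 (touched (k u.succ) (τ u.succ)) : ℝ) +
        net k τ (u.succ.val + 1) (touched (k u.succ) (τ u.succ)) +
          (((τ u.succ : ℤ) : ℝ) + 1) / 2) =
        pathAmp (fun j => k j.succ) (fun j => τ j.succ) a := by
      rw [ih, amplitude]
      refine Finset.prod_congr rfl fun u _ => ?_
      rw [Fin.val_succ, net_succ]
    rw [h1]
    by_cases h0 : pathAmp (fun j => k j.succ) (fun j => τ j.succ) a = 0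
    · rw [h0, mul_zero, mul_zero]
    · have h2 := pathLabel_snd _ _ _ h0 (touched (k 0) (τ 0))
      have h3 : ((pathLabel (fun j => k j.succ) (fun j => τ j.succ) a).2
          (touched (k 0) (τ 0)) : ℝ) = (a.2 (touched (k 0) (τ 0)) : ℝ) +
          net (fun j => k j.succ) (fun j => τ j.succ) 0 (touched (k 0) (τ 0)) := by
        exact_mod_cast h2
      rw [stepAmp, h3, Fin.val_zero, net_succ]

theorem Model.phononEnergy_add_single (P : Model d) (L : ℝ) (n : Mode d →₀ ℕ) (k : Mode d) :
    P.phononEnergy L (n + Finsupp.single k 1) = P.phononEnergy L n + P.ω (latticePoint L k) := by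
  rw [Model.phononEnergy, Finsupp.sum_add_index' (by simp) (by intros; push_cast; ring),
    Finsupp.sum_single_index (by simp)]
  simp [Model.phononEnergy]

theorem latticePoint_neg (L : ℝ) (z : Mode d) : latticePoint L (-z) = -latticePoint L z := by
  ext i; simp [latticePoint]

theorem latticePoint_add (L : ℝ) (z w : Mode d) :
    latticePoint L (z + w) = latticePoint L z + latticePoint L w := by
  ext i; simp [latticePoint, mul_add]

theorem latticePoint_zero (L : ℝ) : latticePoint L (0 : Mode d) = 0 := by
  ext i; simp [latticePoint]

theorem latticePoint_sum (L : ℝ) {ι : Type*} (s : Finset ι) (z : ι → Mode d) :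
    latticePoint L (∑ i ∈ s, z i) = ∑ i ∈ s, latticePoint L (z i) := by
  classical
  induction s using Finset.induction_on with
  | empty => simp [latticePoint_zero]
  | insert i s hi ih => rw [Finset.sum_insert hi, Finset.sum_insert hi, latticePoint_add, ih]

/-- Creation acts on the mode k and annihilation on -k. Evenness of ω lets both changes of energy be
written with the same ω(k). -/
theorem Model.phononEnergy_stepLabel {P : Model d} (hω : ∀ k, P.ω (-k) = P.ω k) (L : ℝ)
    {k : Mode d} {τ : ℤˣ} {a : Label d} (h : stepAmp k τ a.2 ≠ 0) :
    P.phononEnergy L (stepLabel k τ a).2 =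
      P.phononEnergy L a.2 + ((τ : ℤ) : ℝ) * P.ω (latticePoint L k) := by
  rcases Int.units_eq_one_or τ with rfl | rfl
  · rw [stepLabel, if_pos rfl, Model.phononEnergy_add_single]
    simp
  · rw [stepLabel, if_neg units_neg_one_ne_one]
    simp only [stepAmp, touched_neg_one] at h
    have h1 : 1 ≤ a.2 (-k) := by
      by_contra h0
      apply h
      simp [Nat.eq_zero_of_not_pos h0]
    have h2 : a.2 = a.2 - Finsupp.single (-k) 1 + Finsupp.single (-k) 1 := by
      rw [tsub_add_cancel_of_le]
      rwa [Finsupp.single_le_iff]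
    conv_rhs => rw [h2, Model.phononEnergy_add_single, latticePoint_neg, hω]
    simp

/-- The energy of the electron and of the phonons created or absorbed by the vertices with index
at least `b`. -/
def Model.energyAt (P : Model d) {N : ℕ} (p : Momentum d) (k : Fin N → Momentum d)
    (τ : Fin N → ℤˣ) (b : ℕ) : ℝ := P.e (Model.electronMomentum p k b) + P.Omega k τ b

theorem electronMomentum_succ {N : ℕ} (p : Momentum d) (k : Fin (N + 1) → Momentum d) (b : ℕ) :
    Model.electronMomentum p k (b + 1) = Model.electronMomentum p (fun j => k j.succ) b := by
  simp [Model.electronMomentum, Finset.sum_filter, Fin.sum_univ_succ]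

theorem Model.Omega_succ (P : Model d) {N : ℕ} (k : Fin (N + 1) → Momentum d)
    (τ : Fin (N + 1) → ℤˣ) (b : ℕ) :
    P.Omega k τ (b + 1) = P.Omega (fun j => k j.succ) (fun j => τ j.succ) b := by
  simp [Model.Omega, Finset.sum_filter, Fin.sum_univ_succ]

theorem Model.phononEnergy_pathLabel {P : Model d} (hω : ∀ k, P.ω (-k) = P.ω k) (L : ℝ) {N : ℕ}
    (k : Fin N → Mode d) (τ : Fin N → ℤˣ) (a : Label d) (h : pathAmp k τ a ≠ 0) :
    P.phononEnergy L (pathLabel k τ a).2 =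
      P.Omega (fun l => latticePoint L (-(k l))) τ 0 + P.phononEnergy L a.2 := by
  induction N with
  | zero => simp [pathLabel, Model.Omega]
  | succ N ih =>
    rw [pathAmp] at h
    rw [pathLabel, Model.phononEnergy_stepLabel hω L (left_ne_zero_of_mul h),
      ih _ _ (right_ne_zero_of_mul h)]
    simp only [Model.Omega, Nat.zero_le, Finset.filter_true, Fin.sum_univ_succ]
    rw [latticePoint_neg, hω]
    ring

/-- The factor e^{-ik·x} lowers the electron momentum by k. With legs -k the running momentum and
energy take the form of p_j and Ω_j in the representation formula, plus the initial phonon energy.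
-/
theorem Model.pathPhase_eq {P : Model d} (hω : ∀ k, P.ω (-k) = P.ω k) (L : ℝ) {N : ℕ}
    (k : Fin N → Mode d) (τ : Fin N → ℤˣ) (s : ℕ → ℝ) (a : Label d) (h : pathAmp k τ a ≠ 0) :
    P.pathPhase L k τ s a = ∏ b ∈ Finset.range (N + 1), Complex.exp (-Complex.I *
      ((s b * (P.energyAt (latticePoint L a.1) (fun l => latticePoint L (-(k l))) τ b +
        P.phononEnergy L a.2) : ℝ) : ℂ)) := by
  induction N generalizing s with
  | zero =>
    simp [Model.pathPhase, Model.energyAt, Model.electronMomentum, Model.Omega]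
  | succ N ih =>
    have h' := h
    rw [pathAmp] at h
    rw [Model.pathPhase, ih _ _ _ (right_ne_zero_of_mul h), Finset.prod_range_succ' _ (N + 1), mul_comm]
    congr 1
    · refine Finset.prod_congr rfl fun b _ => ?_
      rw [Model.energyAt, Model.energyAt, electronMomentum_succ, Model.Omega_succ]
    · rw [Model.phononEnergy_pathLabel hω L k τ a h', pathLabel_fst, Model.energyAt]
      have : latticePoint L (a.1 - ∑ j, k j) =
          Model.electronMomentum (latticePoint L a.1) (fun l => latticePoint L (-(k l))) 0 := by
        rw [Model.electronMomentum]
        simp only [Nat.zero_le, Finset.filter_true]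
        rw [← latticePoint_sum, ← latticePoint_add, Finset.sum_neg_distrib, sub_eq_add_neg]
      rw [this, add_assoc]

/-- The time integral of the phases of a path. -/
def Model.phaseIntegral (P : Model d) {N : ℕ} (t : ℝ) (p : Momentum d) (k : Fin N → Momentum d)
    (τ : Fin N → ℤˣ) : ℂ :=
  simplexIntegral N t fun s => ∏ b ∈ Finset.range (N + 1), Complex.exp (-Complex.I *
    ((s b * P.energyAt p k τ b : ℝ) : ℂ))

theorem Model.norm_phaseIntegral_le (P : Model d) {N : ℕ} {t : ℝ} (ht : 0 ≤ t) (p : Momentum d)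
    (k : Fin N → Momentum d) (τ : Fin N → ℤˣ) : ‖P.phaseIntegral t p k τ‖ ≤ t ^ N := by
  have := norm_simplexIntegral_le (N := N) ht (B := 1)
    (F := fun s => ∏ b ∈ Finset.range (N + 1), Complex.exp (-Complex.I *
      ((s b * P.energyAt p k τ b : ℝ) : ℂ))) fun s => by
    rw [norm_prod]
    simp only [norm_exp_neg_I_mul, Finset.prod_const_one, le_refl]
  rwa [one_mul] at this

/-- The coefficient of a path. -/
def Model.pathWeight (P : Model d) (L t : ℝ) {N : ℕ} (k : Fin N → Mode d) (τ : Fin N → ℤˣ)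
    (a : Label d) : ℂ :=
  (P.coupling : ℂ) ^ N * (((∏ j, (P.Q (latticePoint L (k j)) * ((τ j : ℤ) : ℝ) *
    Real.sqrt (L ^ d))) * amplitude k τ a.2 : ℝ) : ℂ) *
    (Complex.exp (-Complex.I * ((t * P.phononEnergy L a.2 : ℝ) : ℂ)) *
      P.phaseIntegral t (latticePoint L a.1) (fun l => latticePoint L (-(k l))) τ)

open Classical in
theorem Model.duhamelTerm_eq {P : Model d} (hω : ∀ k, P.ω (-k) = P.ω k) (L t : ℝ) {N : ℕ}
    (k : Fin N → Mode d) (f a : Label d) : P.duhamelTerm L t k f a =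
      ∑ τ : Fin N → ℤˣ, if f = pathLabel k τ a then P.pathWeight L t k τ a else 0 := by
  have h1 : ∀ s : ℕ → ℝ, matrixElement (P.history L k s) f a = ∑ τ : Fin N → ℤˣ,
      if f = pathLabel k τ a then (((∏ j, (P.Q (latticePoint L (k j)) * ((τ j : ℤ) : ℝ) *
        Real.sqrt (L ^ d))) * amplitude k τ a.2 : ℝ) : ℂ) *
        ∏ b ∈ Finset.range (N + 1), Complex.exp (-Complex.I *
      ((s b * (P.energyAt (latticePoint L a.1) (fun l => latticePoint L (-(k l))) τ b +
        P.phononEnergy L a.2) : ℝ) : ℂ)) else 0 := by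
    intro s
    rw [matrixElement, Model.history_single, Finsupp.finsetSum_apply]
    refine Finset.sum_congr rfl fun τ _ => ?_
    rw [Finsupp.single_apply, ← pathAmp_eq]
    simp only [eq_comm (a := f)]
    split_ifs
    · by_cases h0 : pathAmp k τ a = 0
      · simp [h0]
      · rw [Model.pathPhase_eq hω L k τ s a h0]
    · rfl
  rw [Model.duhamelTerm, simplexIntegral_eq]
  simp only [h1]
  rw [integral_finsetSum, Finset.mul_sum]
  · refine Finset.sum_congr rfl fun τ _ => ?_
    split_ifs
    · rw [integral_const_mul, Model.pathWeight, Model.phaseIntegral, simplexIntegral_eq, mul_assoc]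
      congr 2
      rw [← integral_const_mul]
      refine integral_congr_ae (ae_of_all _ fun u => ?_)
      simp only [mul_add, Complex.ofReal_add, Complex.exp_add, Finset.prod_mul_distrib]
      rw [mul_comm]
      congr 1
      -- The initial phonon energy accompanies every duration. Since the durations sum to t, it
      -- contributes one global phase, which later cancels against its conjugate.
      rw [← Complex.exp_sum, ← Finset.mul_sum, ← Complex.ofReal_sum, ← Finset.sum_mul,
        sum_durations]
    · simp
  · intro τ _
    split_ifs
    · refine (Continuous.continuousOn ?_).integrableOn_compact (isCompact_timeSimplex N t)
      refine continuous_const.mul (continuous_finsetProd _ fun b _ => ?_)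
      have : Continuous fun u : Fin N → ℝ => durations t u b :=
        (continuous_durations b).comp (continuous_const.prodMk continuous_id)
      fun_prop
    · simp

end Paths

/-! ### Expectations in the Gibbs state -/

open scoped ENNReal

theorem hasSum_of_tsum_ofReal {ι : Type*} {g : ι → ℝ} {v : ℝ} (hg : ∀ i, 0 ≤ g i) (hv : 0 ≤ v)
    (h : ∑' i, ENNReal.ofReal (g i) = ENNReal.ofReal v) : HasSum g v := by
  have h1 := ENNReal.hasSum_toReal (f := fun i => ENNReal.ofReal (g i))
    (by rw [h]; exact ENNReal.ofReal_ne_top)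
  rw [← ENNReal.tsum_toReal_eq fun _ => ENNReal.ofReal_ne_top, h, ENNReal.toReal_ofReal hv] at h1
  simpa only [ENNReal.toReal_ofReal (hg _)] using h1

section Gibbs

variable {d : ℕ}

/-- The occupation number of the mode `κ`, and the remaining occupation numbers. -/
def splitMode (κ : Mode d) : (Mode d →₀ ℕ) ≃ ℕ × {n : Mode d →₀ ℕ // n κ = 0} where
  toFun n := (n κ, ⟨n.erase κ, Finsupp.erase_same⟩)
  invFun x := x.2.1 + Finsupp.single κ x.1
  left_inv n := Finsupp.erase_add_single κ n
  right_inv x := by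
    rcases x with ⟨j, n, hn⟩
    refine Prod.ext (by simp [hn]) (Subtype.ext ?_)
    ext κ'
    by_cases h : κ' = κ
    · subst h; simp [hn]
    · simp [Finsupp.erase_ne h]

/-- The Boltzmann factor of a mode. -/
def Model.boltzmann (P : Model d) (L : ℝ) (κ : Mode d) : ℝ :=
  Real.exp (-P.β * P.ω (latticePoint L κ) + P.chem)

theorem Model.boltzmann_nonneg (P : Model d) (L : ℝ) (κ : Mode d) : 0 ≤ P.boltzmann L κ :=
  (Real.exp_pos _).le

theorem Model.gibbsWeight_pos (P : Model d) (L : ℝ) (n : Mode d →₀ ℕ) : 0 < P.gibbsWeight L n :=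
  Real.exp_pos _

theorem Model.gibbsWeight_add_single (P : Model d) (L : ℝ) (κ : Mode d) (n : Mode d →₀ ℕ)
    (j : ℕ) : P.gibbsWeight L (n + Finsupp.single κ j) =
      P.boltzmann L κ ^ j * P.gibbsWeight L n := by
  rw [Model.gibbsWeight, Finsupp.sum_add_index' (by simp) (by intros; push_cast; ring),
    Finsupp.sum_single_index (by simp), Real.exp_add, mul_comm, Real.exp_nat_mul]
  rfl

/-- The Gibbs weight is multiplicative over modes, so one mode can be split off from a function that
depends on it only through one factor. In extended nonnegative reals no summability has to be
carried along. -/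
theorem Model.tsum_gibbs_split (P : Model d) (L : ℝ) (κ : Mode d) (f : ℕ → ℝ≥0∞)
    (h : (Mode d →₀ ℕ) → ℝ≥0∞) (hh : ∀ n j, h (n + Finsupp.single κ j) = h n) :
    ∑' n, ENNReal.ofReal (P.gibbsWeight L n) * (f (n κ) * h n) =
      (∑' j, ENNReal.ofReal (P.boltzmann L κ) ^ j * f j) *
        ∑' n : {n : Mode d →₀ ℕ // n κ = 0}, ENNReal.ofReal (P.gibbsWeight L n) * h n := by
  rw [← (splitMode κ).symm.tsum_eq, ENNReal.tsum_prod', ← ENNReal.tsum_mul_right]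
  refine tsum_congr fun j => ?_
  rw [← ENNReal.tsum_mul_left]
  refine tsum_congr fun n => ?_
  have h1 : (splitMode κ).symm (j, n) = n.1 + Finsupp.single κ j := rfl
  rw [h1, Model.gibbsWeight_add_single, hh, Finsupp.add_apply, Finsupp.single_eq_same, n.2,
    zero_add, ENNReal.ofReal_mul (pow_nonneg (P.boltzmann_nonneg L κ) _),
    ENNReal.ofReal_pow (P.boltzmann_nonneg L κ)]
  ring

/-- Dropping the constraint that the split mode be empty in the remaining sum loses only the
normalization of the geometric law, which is harmless for an upper bound. -/
theorem Model.tsum_gibbs_le (P : Model d) (L : ℝ) (κ : Mode d) (f : ℕ → ℝ≥0∞) :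
    ∑' n, ENNReal.ofReal (P.gibbsWeight L n) * f (n κ) ≤
      (∑' j, ENNReal.ofReal (P.boltzmann L κ) ^ j * f j) *
        ∑' n, ENNReal.ofReal (P.gibbsWeight L n) := by
  have h1 := P.tsum_gibbs_split L κ f (fun _ => 1) fun _ _ => rfl
  simp only [mul_one] at h1
  rw [h1]
  gcongr
  exact ENNReal.tsum_comp_le_tsum_of_injective Subtype.val_injective _

/-- Up to normalization this is the mean of j + c under the geometric law. With x the Boltzmann
factor, x/(1 - x) is the expected occupation 𝒩. The trailing factor 1 keeps the form of the split
sum with constant observable. -/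
theorem tsum_geometric_affine {x : ℝ} (hx0 : 0 ≤ x) (hx1 : x < 1) {c : ℝ} (hc : 0 ≤ c) :
    ∑' j : ℕ, ENNReal.ofReal x ^ j * ENNReal.ofReal (j + c) =
      ENNReal.ofReal (x / (1 - x) + c) * ∑' j : ℕ, ENNReal.ofReal x ^ j * 1 := by
  have hx : 0 < 1 - x := by linarith
  have h1 : ∀ j : ℕ, ENNReal.ofReal x ^ j * ENNReal.ofReal (j + c) =
      ENNReal.ofReal (x ^ j * (j + c)) := fun j => by
    rw [ENNReal.ofReal_mul (by positivity), ENNReal.ofReal_pow hx0]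
  have h2 : HasSum (fun j : ℕ => x ^ j * (j + c)) (x / (1 - x) ^ 2 + (1 - x)⁻¹ * c) := by
    have := (hasSum_coe_mul_geometric_of_norm_lt_one (r := x) (by
      rwa [Real.norm_of_nonneg hx0])).add ((hasSum_geometric_of_lt_one hx0 hx1).mul_right c)
    refine this.congr_fun fun j => ?_
    ring
  simp only [h1]
  rw [← ENNReal.ofReal_tsum_of_nonneg (fun j => by positivity) h2.summable, h2.tsum_eq]
  simp only [mul_one, ← ENNReal.ofReal_pow hx0]
  rw [← ENNReal.ofReal_tsum_of_nonneg (fun j => by positivity)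
    (summable_geometric_of_lt_one hx0 hx1), tsum_geometric_of_lt_one hx0 hx1,
    ← ENNReal.ofReal_mul (by positivity)]
  congr 1
  field_simp

/-- The normalized Gibbs weight. -/
def Model.gibbsProb (P : Model d) (L : ℝ) (n : Mode d →₀ ℕ) : ℝ :=
  P.gibbsWeight L n / P.partitionFunction L

section

variable {P : Model d} {L : ℝ}

theorem Model.partitionFunction_pos (hZ : Summable (P.gibbsWeight L)) :
    0 < P.partitionFunction L :=
  hZ.tsum_pos (fun n => (P.gibbsWeight_pos L n).le) 0 (P.gibbsWeight_pos L 0)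

theorem Model.gibbsProb_nonneg (hZ : Summable (P.gibbsWeight L)) (n : Mode d →₀ ℕ) :
    0 ≤ P.gibbsProb L n :=
  div_nonneg (P.gibbsWeight_pos L n).le (Model.partitionFunction_pos hZ).le

theorem Model.tsum_ofReal_gibbsWeight (hZ : Summable (P.gibbsWeight L)) :
    ∑' n, ENNReal.ofReal (P.gibbsWeight L n) = ENNReal.ofReal (P.partitionFunction L) :=
  (ENNReal.ofReal_tsum_of_nonneg (fun n => (P.gibbsWeight_pos L n).le) hZ).symm

theorem Model.tsum_gibbsProb_mul (hZ : Summable (P.gibbsWeight L))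
    (f : (Mode d →₀ ℕ) → ℝ≥0∞) : ∑' n, ENNReal.ofReal (P.gibbsProb L n) * f n =
      (ENNReal.ofReal (P.partitionFunction L))⁻¹ *
        ∑' n, ENNReal.ofReal (P.gibbsWeight L n) * f n := by
  rw [← ENNReal.tsum_mul_left]
  refine tsum_congr fun n => ?_
  rw [Model.gibbsProb, div_eq_mul_inv, ENNReal.ofReal_mul (P.gibbsWeight_pos L n).le,
    ENNReal.ofReal_inv_of_pos (Model.partitionFunction_pos hZ)]
  ring

theorem Model.ofReal_partitionFunction_inv_mul (hZ : Summable (P.gibbsWeight L)) :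
    (ENNReal.ofReal (P.partitionFunction L))⁻¹ * ENNReal.ofReal (P.partitionFunction L) = 1 :=
  ENNReal.inv_mul_cancel (ENNReal.ofReal_pos.2 (Model.partitionFunction_pos hZ)).ne'
    ENNReal.ofReal_ne_top

theorem Model.tsum_ofReal_gibbsProb (hZ : Summable (P.gibbsWeight L)) :
    ∑' n, ENNReal.ofReal (P.gibbsProb L n) = 1 := by
  have := Model.tsum_gibbsProb_mul hZ fun _ => 1
  simp only [mul_one] at this
  rw [this, Model.tsum_ofReal_gibbsWeight hZ, Model.ofReal_partitionFunction_inv_mul hZ]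

/-- Distinct modes are independent. Splitting off one mode with its affine factor, and again with
the factor 1, leaves the same remainder, so the affine factor may be replaced by its mean. -/
theorem Model.tsum_gibbs_prod {c q : ℝ} (h : P.Regular c q) {ι : Type*} (s : Finset ι)
    (κ : ι → Mode d) (hκ : Set.InjOn κ s) (r : ι → ℝ) (hr : ∀ i, 0 ≤ r i) :
    ∑' n, ENNReal.ofReal (P.gibbsWeight L n) *
        ∏ i ∈ s, ENNReal.ofReal ((n (κ i) : ℝ) + r i) =
      (∏ i ∈ s, ENNReal.ofReal (P.occupation (latticePoint L (κ i)) + r i)) *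
        ∑' n, ENNReal.ofReal (P.gibbsWeight L n) := by
  classical
  induction s using Finset.induction_on with
  | empty => simp
  | insert i s hi ih =>
    simp only [Finset.prod_insert hi]
    have hind : ∀ (n : Mode d →₀ ℕ) (j : ℕ),
        ∏ l ∈ s, ENNReal.ofReal (((n + Finsupp.single (κ i) j) (κ l) : ℝ) + r l) =
          ∏ l ∈ s, ENNReal.ofReal ((n (κ l) : ℝ) + r l) := by
      intro n j
      refine Finset.prod_congr rfl fun l hl => ?_
      have : κ i ≠ κ l := fun e => hi (by
        rw [hκ (Finset.mem_insert_self i s) (Finset.mem_insert_of_mem hl) e]; exact hl)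
      simp [this]
    have h1 := P.tsum_gibbs_split L (κ i) (fun j => ENNReal.ofReal ((j : ℝ) + r i))
      (fun n => ∏ l ∈ s, ENNReal.ofReal ((n (κ l) : ℝ) + r l)) hind
    have h2 := P.tsum_gibbs_split L (κ i) (fun _ => 1)
      (fun n => ∏ l ∈ s, ENNReal.ofReal ((n (κ l) : ℝ) + r l)) hind
    have hx := h.boltzmann_lt (latticePoint L (κ i))
    rw [h1, Model.boltzmann, tsum_geometric_affine (Real.exp_pos _).le hx (hr i), mul_assoc]
    simp only [one_mul] at h2
    rw [Model.boltzmann] at h2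
    rw [← h2, ih (hκ.mono (Finset.coe_subset.2 (Finset.subset_insert i s))), mul_assoc]
    rfl

theorem Model.hasSum_gibbsProb_prod {c q : ℝ} (h : P.Regular c q)
    (hZ : Summable (P.gibbsWeight L)) {ι : Type*} (s : Finset ι)
    (κ : ι → Mode d) (hκ : Set.InjOn κ s) (r : ι → ℝ) (hr : ∀ i, 0 ≤ r i) :
    HasSum (fun n => P.gibbsProb L n * ∏ i ∈ s, ((n (κ i) : ℝ) + r i))
      (∏ i ∈ s, (P.occupation (latticePoint L (κ i)) + r i)) := by
  have hp : ∀ n : Mode d →₀ ℕ, 0 ≤ ∏ i ∈ s, ((n (κ i) : ℝ) + r i) := fun n =>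
    Finset.prod_nonneg fun i _ => add_nonneg (Nat.cast_nonneg _) (hr i)
  have ho : ∀ i, 0 ≤ P.occupation (latticePoint L (κ i)) + r i := fun i =>
    add_nonneg (h.occupation_nonneg _) (hr i)
  refine hasSum_of_tsum_ofReal (fun n => mul_nonneg (Model.gibbsProb_nonneg hZ n) (hp n))
    (Finset.prod_nonneg fun i _ => ho i) ?_
  simp only [ENNReal.ofReal_mul (Model.gibbsProb_nonneg hZ _)]
  rw [Model.tsum_gibbsProb_mul hZ]
  have h1 : ∀ n : Mode d →₀ ℕ, ENNReal.ofReal (∏ i ∈ s, ((n (κ i) : ℝ) + r i)) =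
      ∏ i ∈ s, ENNReal.ofReal ((n (κ i) : ℝ) + r i) := fun n =>
    ENNReal.ofReal_prod_of_nonneg fun i _ => add_nonneg (Nat.cast_nonneg _) (hr i)
  simp only [h1]
  rw [Model.tsum_gibbs_prod h s κ hκ r hr, Model.tsum_ofReal_gibbsWeight hZ, mul_left_comm,
    Model.ofReal_partitionFunction_inv_mul hZ, mul_one,
    ENNReal.ofReal_prod_of_nonneg fun i _ => ho i]

/-- A bound for the moments of the occupation numbers. -/
def gibbsMoment (q : ℝ) (N : ℕ) : ℝ := ∑' j : ℕ, q ^ j * ((j : ℝ) + N) ^ N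

theorem summable_gibbsMoment {q : ℝ} (hq0 : 0 < q) (hq1 : q < 1) (N : ℕ) :
    Summable fun j : ℕ => q ^ j * ((j : ℝ) + N) ^ N := by
  have h1 : Summable fun j : ℕ => ((j : ℝ) ^ N * q ^ j) :=
    summable_pow_mul_geometric_of_norm_lt_one N (by rwa [Real.norm_of_nonneg hq0.le])
  have h2 := ((summable_nat_add_iff N).2 h1).mul_left (q ^ N)⁻¹
  refine h2.congr fun j => ?_
  rw [pow_add]
  push_cast
  field_simp

theorem gibbsMoment_nonneg {q : ℝ} (hq0 : 0 < q) (N : ℕ) : 0 ≤ gibbsMoment q N :=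
  tsum_nonneg fun _ => by positivity

theorem Model.tsum_gibbsProb_pow_le {c q : ℝ} (h : P.Regular c q)
    (hZ : Summable (P.gibbsWeight L)) (κ : Mode d) (N : ℕ) :
    ∑' n, ENNReal.ofReal (P.gibbsProb L n) * ENNReal.ofReal (((n κ : ℝ) + N) ^ N) ≤
      ENNReal.ofReal (gibbsMoment q N) := by
  rw [Model.tsum_gibbsProb_mul hZ]
  calc (ENNReal.ofReal (P.partitionFunction L))⁻¹ *
        ∑' n, ENNReal.ofReal (P.gibbsWeight L n) * ENNReal.ofReal (((n κ : ℝ) + N) ^ N)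
      ≤ (ENNReal.ofReal (P.partitionFunction L))⁻¹ *
        ((∑' j : ℕ, ENNReal.ofReal (P.boltzmann L κ) ^ j * ENNReal.ofReal (((j : ℝ) + N) ^ N)) *
          ∑' n, ENNReal.ofReal (P.gibbsWeight L n)) := by
        gcongr
        exact P.tsum_gibbs_le L κ fun j => ENNReal.ofReal (((j : ℝ) + N) ^ N)
    _ = ∑' j : ℕ, ENNReal.ofReal (P.boltzmann L κ) ^ j * ENNReal.ofReal (((j : ℝ) + N) ^ N) := by
        rw [Model.tsum_ofReal_gibbsWeight hZ, mul_left_comm,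
          Model.ofReal_partitionFunction_inv_mul hZ, mul_one]
    _ ≤ ∑' j : ℕ, ENNReal.ofReal (q ^ j * ((j : ℝ) + N) ^ N) := by
        refine ENNReal.tsum_le_tsum fun j => ?_
        rw [← ENNReal.ofReal_pow (P.boltzmann_nonneg L κ), ← ENNReal.ofReal_mul
          (pow_nonneg (P.boltzmann_nonneg L κ) _)]
        refine ENNReal.ofReal_le_ofReal (mul_le_mul_of_nonneg_right ?_ (by positivity))
        exact pow_le_pow_left₀ (P.boltzmann_nonneg L κ) (h.boltzmann_le _) _
    _ = ENNReal.ofReal (gibbsMoment q N) :=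
        (ENNReal.ofReal_tsum_of_nonneg (fun j => by have := h.q_pos; positivity)
          (summable_gibbsMoment h.q_pos h.q_lt N)).symm

end

end Gibbs

/-! ### Products of series -/

section Series

theorem integral_count_eq {Y E : Type*} [Countable Y] [MeasurableSpace Y]
    [MeasurableSingletonClass Y] [NormedAddCommGroup E] [NormedSpace ℝ E] [CompleteSpace E]
    {f : Y → E} (hf : Summable fun y => ‖f y‖) :
    ∫ y, f y ∂(Measure.count : Measure Y) = ∑' y, f y := by
  rw [integral_countable (integrable_count_iff.2 hf)]
  simp [Measure.real]

variable {ι X 𝕜 : Type*} [Fintype ι] [Countable X] [RCLike 𝕜]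

/-- Sums over tuples are integrals for a product of counting measures, so summability and
factorization of product series follow from the theorems on product integrals. -/
theorem pi_count_eq [MeasurableSpace X] [MeasurableSingletonClass X] :
    Measure.pi (fun _ : ι => (Measure.count : Measure X)) = Measure.count := by
  refine Measure.ext_of_singleton fun x => ?_
  rw [Measure.pi_singleton]
  simp

theorem summable_norm_prod {f : ι → X → 𝕜} (hf : ∀ i, Summable fun x => ‖f i x‖) :
    Summable fun x : ι → X => ‖∏ i, f i (x i)‖ := by
  let _ : MeasurableSpace X := ⊤
  have _ : MeasurableSingletonClass X := ⟨fun _ => trivial⟩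
  have h1 := Integrable.fintype_prod (μ := fun _ : ι => (Measure.count : Measure X)) (f := f)
    fun i => integrable_count_iff.2 (hf i)
  rw [pi_count_eq] at h1
  exact integrable_count_iff.1 h1

theorem tsum_prod_eq {f : ι → X → 𝕜} (hf : ∀ i, Summable fun x => ‖f i x‖) :
    ∑' x : ι → X, ∏ i, f i (x i) = ∏ i, ∑' x, f i x := by
  let _ : MeasurableSpace X := ⊤
  have _ : MeasurableSingletonClass X := ⟨fun _ => trivial⟩
  have h1 := integral_fintype_prod_eq_prod (μ := fun _ : ι => (Measure.count : Measure X)) f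
  rw [pi_count_eq] at h1
  have h3 : ∀ i, ∫ x, f i x ∂(Measure.count : Measure X) = ∑' x, f i x := fun i =>
    integral_count_eq (hf i)
  have h2 := integral_count_eq (f := fun x : ι → X => ∏ i, f i (x i)) (summable_norm_prod hf)
  rw [← h2, h1]
  exact Finset.prod_congr rfl fun i _ => h3 i

end Series

/-! ### The positions of the vertices -/

section Positions

variable {n N : ℕ} {m : Fin (n + 1) → ℕ}

/-- Labels of the immediate reabsorption pairs of a pattern. -/
abbrev Pairs (m : Fin (n + 1) → ℕ) : Type := Σ j : Fin (n + 1), Fin (m j)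

theorem card_pairs (m : Fin (n + 1) → ℕ) : Fintype.card (Pairs m) = ∑ j, m j := by
  simp [Fintype.card_sigma]

theorem position_add_le (hm : m ∈ patterns n N) (j : Fin (n + 1)) :
    position m j + 2 * m j ≤ N := by
  have h1 := position_succ m j
  have h2 := (position_strictMono m).monotone (show j.val + 1 ≤ n + 1 from j.isLt)
  rw [position_last hm] at h2
  omega

theorem position_pos (m : Fin (n + 1) → ℕ) (i : ℕ) : 0 < position m (i + 1) :=
  (Nat.zero_le _).trans_lt (position_strictMono m (Nat.lt_succ_self i))

/-- The index, counted from zero, of an external vertex. -/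
def extIndex (hm : m ∈ patterns n N) (i : Fin n) : Fin N :=
  ⟨position m (i + 1) - 1, by
    have h1 := position_strictMono m (show i.val + 1 < n + 1 by omega)
    have h2 := position_pos m i
    rw [position_last hm] at h1
    omega⟩

/-- The index of the left vertex of a pair. -/
def fstIndex (hm : m ∈ patterns n N) (r : Pairs m) : Fin N :=
  ⟨position m r.1 + 2 * r.2, by have := position_add_le hm r.1; have := r.2.isLt; omega⟩

/-- The index of the right vertex of a pair. -/
def sndIndex (hm : m ∈ patterns n N) (r : Pairs m) : Fin N :=
  ⟨position m r.1 + 2 * r.2 + 1, by have := position_add_le hm r.1; have := r.2.isLt; omega⟩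

theorem extIndex_mem (hm : m ∈ patterns n N) (i : Fin n) :
    (extIndex hm i).val + 1 = position m (i + 1) := by
  have := position_pos m i
  simp only [extIndex]
  omega

theorem blockIndex_ext (hm : m ∈ patterns n N) (i : Fin n) :
    blockIndex m ((extIndex hm i).val + 1) = i.succ := by
  rw [extIndex_mem]
  refine blockIndex_eq (by simp) ?_
  rw [position_succ]
  simp only [Fin.val_succ]
  omega

theorem blockIndex_fst (hm : m ∈ patterns n N) (r : Pairs m) :
    blockIndex m ((fstIndex hm r).val + 1) = r.1 := by
  have := r.2.isLt
  refine blockIndex_eq ?_ ?_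
  · simp only [fstIndex]; omega
  · rw [position_succ]; simp only [fstIndex]; omega

theorem blockIndex_snd (hm : m ∈ patterns n N) (r : Pairs m) :
    blockIndex m ((sndIndex hm r).val + 1) = r.1 := by
  have := r.2.isLt
  refine blockIndex_eq ?_ ?_
  · simp only [sndIndex]; omega
  · rw [position_succ]; simp only [sndIndex]; omega

/-- The position of a vertex, given by its kind. -/
def vertexIndex (hm : m ∈ patterns n N) : Fin n ⊕ (Pairs m ⊕ Pairs m) → Fin N :=
  Sum.elim (extIndex hm) (Sum.elim (fstIndex hm) (sndIndex hm))

theorem pairs_ext {r r' : Pairs m} (h1 : r.1 = r'.1) (h2 : r.2.val = r'.2.val) : r = r' := by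
  rcases r with ⟨j, i⟩
  rcases r' with ⟨j', i'⟩
  simp only at h1
  subst h1
  simp only at h2
  rw [Fin.ext h2]

/-- The block index recovers the block of a vertex. Inside a block, the external vertex sits just
before the pairs, and parity separates left from right vertices. -/
theorem vertexIndex_injective (hm : m ∈ patterns n N) :
    Function.Injective (vertexIndex hm) := by
  have hv : ∀ {u v : Fin N}, u = v → blockIndex m (u.val + 1) = blockIndex m (v.val + 1) := by
    rintro u v rfl; rfl
  rintro (i | r | r) (i' | r' | r') h <;>
    simp only [vertexIndex, Sum.elim_inl, Sum.elim_inr] at h <;> have hb := hv h <;>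
    simp only [blockIndex_ext, blockIndex_fst, blockIndex_snd] at hb
  · rw [Fin.succ_inj.1 hb]
  all_goals
    have hp := congrArg (fun j : Fin (n + 1) => position m j) hb
    have e := congrArg Fin.val h
    simp only [Fin.val_succ, fstIndex, sndIndex] at hp e
  · have := extIndex_mem hm i; omega
  · have := extIndex_mem hm i; omega
  · have := extIndex_mem hm i'; omega
  · rw [pairs_ext hb (by omega)]
  · omega
  · have := extIndex_mem hm i'; omega
  · omega
  · rw [pairs_ext hb (by omega)]

/-- The classification of the vertices of a pattern. -/
def vertexEquiv (hm : m ∈ patterns n N) : Fin n ⊕ (Pairs m ⊕ Pairs m) ≃ Fin N :=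
  Equiv.ofBijective (vertexIndex hm) <| by
    rw [Fintype.bijective_iff_injective_and_card]
    refine ⟨vertexIndex_injective hm, ?_⟩
    have := mem_patterns.1 hm
    simp only [Fintype.card_sum, Fintype.card_fin, card_pairs]
    omega

@[simp] theorem vertexEquiv_ext (hm : m ∈ patterns n N) (i : Fin n) :
    vertexEquiv hm (Sum.inl i) = extIndex hm i := rfl

@[simp] theorem vertexEquiv_fst (hm : m ∈ patterns n N) (r : Pairs m) :
    vertexEquiv hm (Sum.inr (Sum.inl r)) = fstIndex hm r := rfl

@[simp] theorem vertexEquiv_snd (hm : m ∈ patterns n N) (r : Pairs m) :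
    vertexEquiv hm (Sum.inr (Sum.inr r)) = sndIndex hm r := rfl

theorem prod_vertices {M : Type*} [CommMonoid M] (hm : m ∈ patterns n N) (g : Fin N → M) :
    ∏ u, g u = (∏ i, g (extIndex hm i)) *
      ∏ r : Pairs m, (g (fstIndex hm r) * g (sndIndex hm r)) := by
  rw [← (vertexEquiv hm).prod_comp, Fintype.prod_sum_type, Fintype.prod_sum_type,
    Finset.prod_mul_distrib]
  rfl

theorem sum_vertices {M : Type*} [AddCommMonoid M] (hm : m ∈ patterns n N) (g : Fin N → M) :
    ∑ u, g u = (∑ i, g (extIndex hm i)) +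
      ∑ r : Pairs m, (g (fstIndex hm r) + g (sndIndex hm r)) := by
  rw [← (vertexEquiv hm).sum_comp, Fintype.sum_sum_type, Fintype.sum_sum_type,
    Finset.sum_add_distrib]
  rfl

theorem vertex_cases (hm : m ∈ patterns n N) (u : Fin N) :
    (∃ i, u = extIndex hm i) ∨ (∃ r, u = fstIndex hm r) ∨ ∃ r, u = sndIndex hm r := by
  obtain ⟨x, rfl⟩ := (vertexEquiv hm).surjective u
  rcases x with i | r | r
  · exact Or.inl ⟨i, rfl⟩
  · exact Or.inr (Or.inl ⟨r, rfl⟩)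
  · exact Or.inr (Or.inr ⟨r, rfl⟩)

/-- The family with the values `x` at the external vertices, `y` at the right vertices of the
pairs and `flip (y r)` at the left ones. -/
def assemble {X : Type*} (hm : m ∈ patterns n N) (flip : X → X) (x : Fin n → X)
    (y : Pairs m → X) (u : Fin N) : X :=
  Sum.elim x (Sum.elim (fun r => flip (y r)) y) ((vertexEquiv hm).symm u)

section assemble

variable {X : Type*} (hm : m ∈ patterns n N) (flip : X → X) (x : Fin n → X) (y : Pairs m → X)

@[simp] theorem assemble_ext (i : Fin n) : assemble hm flip x y (extIndex hm i) = x i := by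
  rw [← vertexEquiv_ext, assemble, Equiv.symm_apply_apply]; rfl

@[simp] theorem assemble_fst (r : Pairs m) :
    assemble hm flip x y (fstIndex hm r) = flip (y r) := by
  rw [← vertexEquiv_fst, assemble, Equiv.symm_apply_apply]; rfl

@[simp] theorem assemble_snd (r : Pairs m) : assemble hm flip x y (sndIndex hm r) = y r := by
  rw [← vertexEquiv_snd, assemble, Equiv.symm_apply_apply]; rfl

theorem eq_assemble {z : Fin N → X}
    (hz : ∀ r, z (fstIndex hm r) = flip (z (sndIndex hm r))) :
    z = assemble hm flip (fun i => z (extIndex hm i)) (fun r => z (sndIndex hm r)) := by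
  funext u
  rcases vertex_cases hm u with ⟨i, rfl⟩ | ⟨r, rfl⟩ | ⟨r, rfl⟩ <;> simp [hz]

end assemble

/-- Partial sums over the vertices of a family whose pairs cancel. -/
theorem sum_later {A : Type*} [AddCommGroup A] (hm : m ∈ patterns n N) (g : Fin N → A)
    (hg : ∀ r, g (fstIndex hm r) = -g (sndIndex hm r)) {b : ℕ} (hb : b ≤ N) :
    ∑ u : Fin N, (if b ≤ u.val then g u else 0) =
      (∑ i : Fin n, if (blockIndex m b).val ≤ i.val then g (extIndex hm i) else 0) +
        ∑ r : Pairs m, if b = (fstIndex hm r).val + 1 then g (sndIndex hm r) else 0 := by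
  rw [sum_vertices hm]
  congr 1
  · refine Finset.sum_congr rfl fun i _ => ?_
    -- The block containing b is the first one whose end exceeds b.
    have hex : ∃ j : Fin (n + 1), position m j ≤ b ∧ b < position m (j + 1) := by
      classical
      have h0 : ∃ l, b < position m (l + 1) := ⟨n, by rw [position_last hm]; omega⟩
      have h1 := Nat.find_spec h0
      have h2 : Nat.find h0 ≤ n := Nat.find_min' h0 (by rw [position_last hm]; omega)
      refine ⟨⟨Nat.find h0, by omega⟩, ?_, h1⟩
      rcases Nat.eq_zero_or_pos (Nat.find h0) with h3 | h3
      · simp [h3, position_zero]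
      · have := Nat.find_min h0 (show Nat.find h0 - 1 < Nat.find h0 by omega)
        rw [Nat.sub_add_cancel h3] at this
        simpa using this
    obtain ⟨j, hj1, hj2⟩ := hex
    rw [blockIndex_eq hj1 hj2]
    have h3 := extIndex_mem hm i
    have : b ≤ (extIndex hm i).val ↔ j.val ≤ i.val := by
      constructor
      · intro h
        by_contra hlt
        have := (position_strictMono m).monotone (show i.val + 1 ≤ j.val by omega)
        omega
      · intro h
        have := (position_strictMono m).monotone (show j.val + 1 ≤ i.val + 1 by omega)
        omega
    simp only [this]
  · refine Finset.sum_congr rfl fun r _ => ?_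
    -- A pair occupies consecutive positions, so its two terms cancel unless the cut falls between
    -- them and only the right one is counted.
    have h1 : (sndIndex hm r).val = (fstIndex hm r).val + 1 := rfl
    rw [hg, h1]
    split_ifs with h2 h3 h4 h5 h6 <;> first | omega | simp

theorem fstIndex_add_one_mem_blockInner (hm : m ∈ patterns n N) (r : Pairs m) :
    (fstIndex hm r).val + 1 ∈ blockInner m r.1 :=
  Finset.mem_image.2 ⟨r.2, by simp, rfl⟩

theorem fstIndex_injective (hm : m ∈ patterns n N) : Function.Injective (fstIndex hm) :=
  fun r r' h => by
    have := vertexIndex_injective hm (a₁ := Sum.inr (Sum.inl r)) (a₂ := Sum.inr (Sum.inl r')) h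
    simpa using this

/-- An outer time slot separates no pair, so only the external vertices to its right contribute. -/
theorem sum_later_outer {A : Type*} [AddCommGroup A] (hm : m ∈ patterns n N) (g : Fin N → A)
    (hg : ∀ r, g (fstIndex hm r) = -g (sndIndex hm r)) {b : ℕ} (hb : b ≤ N) {j : Fin (n + 1)}
    (hbj : b ∈ blockOuter m j) :
    ∑ u : Fin N, (if b ≤ u.val then g u else 0) =
      ∑ i : Fin n, if j.val ≤ i.val then g (extIndex hm i) else 0 := by
  rw [sum_later hm g hg hb, blockIndex_of_mem_blockOuter hbj]
  refine add_eq_left.2 (Finset.sum_eq_zero fun r _ => ?_)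
  rw [if_neg]
  rintro rfl
  exact not_isOuter_of_mem (fstIndex_add_one_mem_blockInner hm r) (isOuter_of_mem hbj)

/-- The inner time slot of r lies between its two vertices, so exactly one uncancelled pair
contribution remains. -/
theorem sum_later_inner {A : Type*} [AddCommGroup A] (hm : m ∈ patterns n N) (g : Fin N → A)
    (hg : ∀ r, g (fstIndex hm r) = -g (sndIndex hm r)) (r : Pairs m) :
    ∑ u : Fin N, (if (fstIndex hm r).val + 1 ≤ u.val then g u else 0) =
      (∑ i : Fin n, if r.1.val ≤ i.val then g (extIndex hm i) else 0) + g (sndIndex hm r) := by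
  rw [sum_later hm g hg (by have := (fstIndex hm r).isLt; omega), blockIndex_fst,
    Finset.sum_eq_single r]
  · rw [if_pos rfl]
  · intro r' _ hne
    rw [if_neg]
    intro h
    exact hne (fstIndex_injective hm (Fin.ext (by omega)))
  · simp

theorem prod_pairs {M : Type*} [CommMonoid M] (hm : m ∈ patterns n N) (f : Fin (n + 1) → ℕ → M) :
    ∏ j, ∏ b ∈ blockInner m j, f j b = ∏ r : Pairs m, f r.1 ((fstIndex hm r).val + 1) := by
  rw [Fintype.prod_sigma]
  refine Finset.prod_congr rfl fun j _ => ?_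
  rw [prod_blockInner, Finset.prod_range fun i => f j (position m j + 2 * i + 1)]
  rfl

end Positions

/-! ### The lattice version of the block integrals -/

theorem summable_norm_prod_finite {A T E : Type*} [Fintype T] [NormedAddCommGroup E]
    {F : A × T → E} (hF : ∀ τ, Summable fun a => ‖F (a, τ)‖) : Summable fun x => ‖F x‖ := by
  rw [← (Equiv.prodComm T A).summable_iff]
  exact (summable_prod_of_nonneg (f := fun x : T × A => ‖F (x.2, x.1)‖) fun _ => norm_nonneg _).2
    ⟨fun τ => hF τ, (hasSum_fintype _).summable⟩

theorem tsum_prod_finite {A T E : Type*} [Fintype T] [NormedAddCommGroup E] [CompleteSpace E]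
    {F : A × T → E} (hF : ∀ τ, Summable fun a => ‖F (a, τ)‖) :
    ∑' x, F x = ∑ τ, ∑' a, F (a, τ) := by
  have h1 := (summable_norm_prod_finite hF).of_norm
  rw [← (Equiv.prodComm T A).tsum_eq]
  have h2 : Summable fun x : T × A => F (x.2, x.1) := (Equiv.prodComm T A).summable_iff.2 h1
  exact h2.tsum_prod.trans (tsum_fintype _)

/-- A lattice momentum together with a sign. -/
abbrev Leg (d : ℕ) : Type := Mode d × ℤˣ

section Expansion

variable {d : ℕ} {P : Model d} {c q : ℝ} {L : ℝ}

/-- The weight `L^{-d} M(k, σ)`. -/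
def Model.latticeM (P : Model d) (L : ℝ) (x : Leg d) : ℝ :=
  (L ^ d)⁻¹ * P.M (latticePoint L x.1) x.2

theorem Model.Regular.latticeM_nonneg (h : P.Regular c q) (hL : 0 < L) (x : Leg d) :
    0 ≤ P.latticeM L x := mul_nonneg (by positivity) (h.M_nonneg _ _)

theorem Model.Regular.summable_latticeM (h : P.Regular c q) (hL : 0 < L) :
    Summable fun x => ‖P.latticeM L x‖ := by
  refine summable_norm_prod_finite fun τ => ?_
  have h1 := summable_norm_of_integrable_latticeMeasure hL
    (h.integrable_M (integrable_decay_latticeMeasure hL) τ)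
  refine (h1.mul_left ‖(L ^ d)⁻¹‖).congr fun z => ?_
  rw [Model.latticeM, norm_mul]

theorem Model.Regular.tsum_latticeM (h : P.Regular c q) (hL : 0 < L) :
    ∑' x, P.latticeM L x = P.massM (latticeMeasure d L) := by
  have h0 : ∀ τ : ℤˣ, Summable fun z : Mode d => ‖P.latticeM L (z, τ)‖ := fun τ =>
    (h.summable_latticeM hL).comp_injective (fun z z' hz => by simpa using hz)
  rw [tsum_prod_finite h0, Model.massM]
  refine Finset.sum_congr rfl fun τ _ => ?_
  rw [integral_latticeMeasure hL (h.integrable_M (integrable_decay_latticeMeasure hL) τ),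
    smul_eq_mul, ← tsum_mul_left]
  rfl

/-- The contribution of one momentum and sign to `Θ`. -/
def Model.thetaTerm (P : Model d) (L s : ℝ) (p : Momentum d) (Ω : ℝ) (x : Leg d) : ℂ :=
  (P.latticeM L x : ℂ) *
    Complex.exp (-Complex.I * ((s * (P.Phi x.2 p (latticePoint L x.1) + Ω) : ℝ) : ℂ))

theorem Model.Regular.summable_thetaTerm (h : P.Regular c q) (hL : 0 < L) (s : ℝ)
    (p : Momentum d) (Ω : ℝ) : Summable fun x => ‖P.thetaTerm L s p Ω x‖ := by
  refine (h.summable_latticeM hL).congr fun x => ?_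
  rw [Model.thetaTerm, norm_mul, norm_exp_neg_I_mul, mul_one, Complex.norm_real]

theorem Model.Regular.Theta_lattice (h : P.Regular c q) (hL : 0 < L) (s : ℝ)
    (p : Momentum d) (Ω : ℝ) :
    P.Theta (latticeMeasure d L) s p Ω = ∑' x, P.thetaTerm L s p Ω x := by
  have h0 : ∀ τ : ℤˣ, Summable fun z : Mode d => ‖P.thetaTerm L s p Ω (z, τ)‖ := fun τ =>
    (h.summable_thetaTerm hL s p Ω).comp_injective (fun z z' hz => by simpa using hz)
  rw [tsum_prod_finite h0, Model.Theta]
  refine Finset.sum_congr rfl fun τ _ => ?_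
  have hΦ : Continuous fun k => P.Phi τ p k :=
    (h.continuous_Phi τ).comp (continuous_const.prodMk continuous_id)
  have hM := h.integrable_M (integrable_decay_latticeMeasure hL) τ
  rw [integral_latticeMeasure hL, ← tsum_const_smul'']
  · refine tsum_congr fun z => ?_
    rw [Model.thetaTerm, Model.latticeM, Complex.real_smul]
    push_cast
    ring
  · refine Integrable.bdd_mul (c := 1) hM.ofReal (Continuous.aestronglyMeasurable (by fun_prop))
      (ae_of_all _ fun k => (norm_exp_neg_I_mul _).le)

variable {n N : ℕ} {m : Fin (n + 1) → ℕ}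

theorem Model.energyAt_outer (hω : ∀ k, P.ω (-k) = P.ω k) (hm : m ∈ patterns n N)
    (p : Momentum d) (k : Fin n → Momentum d) (σ : Fin n → ℤˣ) (y : Pairs m → Momentum d)
    (ς : Pairs m → ℤˣ) {b : ℕ} (hb : b ≤ N) {j : Fin (n + 1)} (hbj : b ∈ blockOuter m j) :
    P.energyAt p (assemble hm Neg.neg k y) (assemble hm Neg.neg σ ς) b =
      P.e (Model.electronMomentum p k j) + P.Omega k σ j := by
  rw [Model.energyAt, Model.electronMomentum, Model.Omega, Model.electronMomentum, Model.Omega]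
  simp only [Finset.sum_filter]
  rw [sum_later_outer hm _ (by simp) hb hbj, sum_later_outer hm _ (by simp [hω]) hb hbj]
  simp only [assemble_ext]

/-- While a pair is open, the electron carries the additional momentum y and the phonons the
additional energy ±ω(y). This is where Φ comes from. -/
theorem Model.energyAt_inner (hω : ∀ k, P.ω (-k) = P.ω k) (hm : m ∈ patterns n N)
    (p : Momentum d) (k : Fin n → Momentum d) (σ : Fin n → ℤˣ) (y : Pairs m → Momentum d)
    (ς : Pairs m → ℤˣ) (r : Pairs m) :
    P.energyAt p (assemble hm Neg.neg k y) (assemble hm Neg.neg σ ς)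
        ((fstIndex hm r).val + 1) =
      P.Phi (ς r) (Model.electronMomentum p k r.1) (y r) + P.Omega k σ r.1 := by
  rw [Model.energyAt, Model.electronMomentum, Model.Omega, Model.electronMomentum, Model.Omega,
    Model.Phi]
  simp only [Finset.sum_filter]
  rw [sum_later_inner hm _ (by simp), sum_later_inner hm _ (by simp [hω])]
  simp only [assemble_ext, assemble_snd]
  rw [← add_assoc p, add_comm (y r)]
  ring

theorem mem_blockOuter_le (hm : m ∈ patterns n N) {j : Fin (n + 1)} {b : ℕ}
    (hb : b ∈ blockOuter m j) : b ≤ N := by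
  obtain ⟨i, hi, rfl⟩ := Finset.mem_image.1 hb
  have := position_add_le hm j
  rw [Finset.mem_range] at hi
  omega

theorem Model.prod_phase_assemble (hω : ∀ k, P.ω (-k) = P.ω k) (hm : m ∈ patterns n N)
    (p : Momentum d) (k : Fin n → Momentum d) (σ : Fin n → ℤˣ) (y : Pairs m → Momentum d)
    (ς : Pairs m → ℤˣ) (s : ℕ → ℝ) :
    ∏ b ∈ Finset.range (N + 1), Complex.exp (-Complex.I * ((s b *
      P.energyAt p (assemble hm Neg.neg k y) (assemble hm Neg.neg σ ς) b : ℝ) : ℂ)) =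
    (∏ j, ∏ b ∈ blockOuter m j, Complex.exp (-Complex.I *
        ((s b * (P.e (Model.electronMomentum p k j) + P.Omega k σ j) : ℝ) : ℂ))) *
      ∏ r : Pairs m, Complex.exp (-Complex.I * ((s ((fstIndex hm r).val + 1) *
        (P.Phi (ς r) (Model.electronMomentum p k r.1) (y r) + P.Omega k σ r.1) : ℝ) : ℂ)) := by
  rw [prod_blocks hm, Finset.prod_mul_distrib]
  congr 1
  · refine Finset.prod_congr rfl fun j _ => Finset.prod_congr rfl fun b hb => ?_
    rw [Model.energyAt_outer hω hm p k σ y ς (mem_blockOuter_le hm hb) hb]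
  · rw [prod_pairs hm fun _ b => Complex.exp (-Complex.I * ((s b *
      P.energyAt p (assemble hm Neg.neg k y) (assemble hm Neg.neg σ ς) b : ℝ) : ℂ))]
    refine Finset.prod_congr rfl fun r _ => ?_
    rw [Model.energyAt_inner hω]

theorem Model.Regular.summable_prod_latticeM (h : P.Regular c q) (hL : 0 < L) (ι : Type*)
    [Fintype ι] : Summable fun y : ι → Leg d => ∏ r, P.latticeM L (y r) :=
  (summable_norm_prod (f := fun (_ : ι) => P.latticeM L)
    fun _ => h.summable_latticeM hL).of_norm

/-- The block integral over the lattice as a sum over the momenta of the pairs. -/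
theorem Model.Regular.blockIntegral_lattice (h : P.Regular c q) (hL : 0 < L)
    (hm : m ∈ patterns n N) (t : ℝ)
    (p : Momentum d) (k : Fin n → Momentum d) (σ : Fin n → ℤˣ) :
    P.blockIntegral (latticeMeasure d L) N m t p k σ =
      ∑' y : Pairs m → Leg d, ((∏ r, P.latticeM L (y r) : ℝ) : ℂ) *
        P.phaseIntegral t p (assemble hm Neg.neg k fun r => latticePoint L (y r).1)
          (assemble hm Neg.neg σ fun r => (y r).2) := by
  have h1 : ∀ s : ℕ → ℝ, ∏ j : Fin (n + 1),
      ((∏ b ∈ blockOuter m j, Complex.exp (-Complex.I *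
        ((s b * (P.e (Model.electronMomentum p k j) + P.Omega k σ j) : ℝ) : ℂ))) *
      ∏ b ∈ blockInner m j, P.Theta (latticeMeasure d L) (s b) (Model.electronMomentum p k j)
        (P.Omega k σ j)) = ∑' y : Pairs m → Leg d, ((∏ r, P.latticeM L (y r) : ℝ) : ℂ) *
        ∏ b ∈ Finset.range (N + 1), Complex.exp (-Complex.I * ((s b *
          P.energyAt p (assemble hm Neg.neg k fun r => latticePoint L (y r).1)
            (assemble hm Neg.neg σ fun r => (y r).2) b : ℝ) : ℂ)) := by
    intro s
    rw [Finset.prod_mul_distrib, prod_pairs hm fun j b => P.Theta (latticeMeasure d L) (s b)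
      (Model.electronMomentum p k j) (P.Omega k σ j)]
    simp only [h.Theta_lattice hL]
    rw [← tsum_prod_eq fun r : Pairs m => h.summable_thetaTerm hL _ _ _, ← tsum_mul_left]
    refine tsum_congr fun y => ?_
    rw [Model.prod_phase_assemble h.even_ω]
    simp only [Model.thetaTerm, Finset.prod_mul_distrib]
    push_cast
    ring
  rw [Model.blockIntegral]
  simp only [h1, simplexIntegral_eq, Model.phaseIntegral]
  -- The phases have modulus one on a simplex of finite volume, so summability of the weights alone
  -- allows exchanging the lattice sums with the time integral.
  have h2 := hasSum_integral_of_summable_integral_norm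
    (μ := volume.restrict (timeSimplex N t))
    (F := fun (y : Pairs m → Leg d) (u : Fin N → ℝ) => ((∏ r, P.latticeM L (y r) : ℝ) : ℂ) *
        ∏ b ∈ Finset.range (N + 1), Complex.exp (-Complex.I * ((durations t u b *
          P.energyAt p (assemble hm Neg.neg k fun r => latticePoint L (y r).1)
            (assemble hm Neg.neg σ fun r => (y r).2) b : ℝ) : ℂ))) ?_ ?_
  · rw [← h2.tsum_eq]
    simp only [integral_const_mul]
  · intro y
    refine (Continuous.continuousOn ?_).integrableOn_compact (isCompact_timeSimplex N t)
    refine continuous_const.mul (continuous_finsetProd _ fun b _ => ?_)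
    have : Continuous fun u : Fin N → ℝ => durations t u b :=
      (continuous_durations b).comp (continuous_const.prodMk continuous_id)
    fun_prop
  · simp only [norm_mul, norm_prod, norm_exp_neg_I_mul, Finset.prod_const_one, mul_one,
      Complex.norm_real, integral_const, smul_eq_mul]
    exact ((h.summable_prod_latticeM hL (Pairs m)).norm.congr fun y => norm_prod _ _).mul_left _

end Expansion

/-! ### The terms of the representation formula as sums over pairs of paths -/

section Pairings

variable {d : ℕ} {P : Model d} {c q : ℝ} {L : ℝ} {n N : ℕ}

/-- The factor `𝒩(k) + (σ + 1)/2`. -/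
def Model.occPlus (P : Model d) (L : ℝ) (x : Leg d) : ℝ :=
  P.occupation (latticePoint L x.1) + (((x.2 : ℤ) : ℝ) + 1) / 2

theorem Model.latticeM_eq (P : Model d) (L : ℝ) (x : Leg d) :
    P.latticeM L x = (L ^ d)⁻¹ * (P.Q (latticePoint L x.1) ^ 2 * P.occPlus L x) := by
  rw [Model.latticeM, Model.M, sq_abs]
  rfl

/-- The time integral of the phase along a path. -/
def Model.pathIntegral (P : Model d) (L t : ℝ) (p : Mode d) (z : Fin N → Leg d) : ℂ :=
  P.phaseIntegral t (latticePoint L p) (fun u => latticePoint L (z u).1) fun u => (z u).2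

/-- The product of the form factors along a path. -/
def Model.formProduct (P : Model d) (L : ℝ) (z : Fin N → Leg d) : ℝ :=
  ∏ u, P.Q (latticePoint L (z u).1)

/-- The integral over the external momenta in `C_{m,m̃,π}`, at fixed electron momentum. -/
def Model.cInner (P : Model d) (κ : Measure (Momentum d)) (L : ℝ) (N : ℕ) (m m' : Fin (n + 1) → ℕ)
    (π : Equiv.Perm (Fin n)) (t : ℝ) (p : Mode d) : ℂ :=
  ∑' x : Fin n → Leg d, ((∏ j, P.latticeM L (x j) : ℝ) : ℂ) *
    (P.blockIntegral κ N m t (latticePoint L p) (fun j => latticePoint L (x j).1)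
        (fun j => (x j).2) *
      conj (P.blockIntegral κ N m' t (latticePoint L p)
        (fun j => latticePoint L (x (π.symm j)).1) fun j => (x (π.symm j)).2))

theorem Model.Regular.norm_cSummand_le (h : P.Regular c q) {κ : Measure (Momentum d)}
    {m m' : Fin (n + 1) → ℕ} (hm : m ∈ patterns n N) (hm' : m' ∈ patterns n N) {t : ℝ}
    (ht : 0 ≤ t) (p p' : Momentum d) (k k' : Fin n → Momentum d) (σ σ' : Fin n → ℤˣ) :
    ‖P.blockIntegral κ N m t p k σ * conj (P.blockIntegral κ N m' t p' k' σ')‖ ≤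
      ((1 + P.massM κ) ^ (N + 1) * t ^ N) ^ 2 := by
  rw [norm_mul, RCLike.norm_conj, sq]
  exact mul_le_mul (h.norm_blockIntegral_le hm ht _ _ _) (h.norm_blockIntegral_le hm' ht _ _ _)
    (norm_nonneg _) ((norm_nonneg _).trans (h.norm_blockIntegral_le hm ht p k σ))

theorem Model.Regular.summable_cInner (h : P.Regular c q) (hL : 0 < L) {κ : Measure (Momentum d)}
    {m m' : Fin (n + 1) → ℕ} (hm : m ∈ patterns n N) (hm' : m' ∈ patterns n N)
    (π : Equiv.Perm (Fin n)) {t : ℝ} (ht : 0 ≤ t) (p : Momentum d) :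
    Summable fun x : Fin n → Leg d => ‖((∏ j, P.latticeM L (x j) : ℝ) : ℂ) *
      (P.blockIntegral κ N m t p (fun j => latticePoint L (x j).1)
        (fun j => (x j).2) *
      conj (P.blockIntegral κ N m' t p
        (fun j => latticePoint L (x (π.symm j)).1) fun j => (x (π.symm j)).2))‖ := by
  refine Summable.of_nonneg_of_le (fun _ => norm_nonneg _) (fun x => ?_)
    ((h.summable_prod_latticeM hL (Fin n)).norm.mul_right
      (((1 + P.massM κ) ^ (N + 1) * t ^ N) ^ 2))
  rw [norm_mul, Complex.norm_real]
  exact mul_le_mul_of_nonneg_left (h.norm_cSummand_le hm hm' ht _ _ _ _ _ _) (norm_nonneg _)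

theorem Model.Regular.norm_cInner_le (h : P.Regular c q) (hL : 0 < L) {κ : Measure (Momentum d)}
    {m m' : Fin (n + 1) → ℕ} (hm : m ∈ patterns n N) (hm' : m' ∈ patterns n N)
    (π : Equiv.Perm (Fin n)) {t : ℝ} (ht : 0 ≤ t) (p : Mode d) :
    ‖P.cInner κ L N m m' π t p‖ ≤
      P.massM (latticeMeasure d L) ^ n * ((1 + P.massM κ) ^ (N + 1) * t ^ N) ^ 2 := by
  refine (norm_tsum_le_tsum_norm (h.summable_cInner hL hm hm' π ht _)).trans ?_
  have h1 : P.massM (latticeMeasure d L) ^ n = ∑' x : Fin n → Leg d, ∏ j, P.latticeM L (x j) := by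
    rw [tsum_prod_eq (f := fun _ : Fin n => P.latticeM L) fun _ => h.summable_latticeM hL,
      Finset.prod_const, Finset.card_univ, Fintype.card_fin, h.tsum_latticeM hL]
  rw [h1, ← tsum_mul_right]
  refine (h.summable_cInner hL hm hm' π ht _).tsum_le_tsum (fun x => ?_)
    ((h.summable_prod_latticeM hL (Fin n)).mul_right _)
  rw [norm_mul, Complex.norm_real, Real.norm_of_nonneg
    (Finset.prod_nonneg fun j _ => h.latticeM_nonneg hL _)]
  exact mul_le_mul_of_nonneg_left (h.norm_cSummand_le hm hm' ht _ _ _ _ _ _)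
    (Finset.prod_nonneg fun j _ => h.latticeM_nonneg hL _)

/-- The integration variables compatible with the delta functions of `ν_π`. -/
def diagonalVariables (π : Equiv.Perm (Fin n)) (x : Mode d × (Fin n → Mode d)) : Model.Variables d n :=
  ((x.1, x.1), (x.2, x.2 ∘ π.symm))

theorem diagonalVariables_injective (π : Equiv.Perm (Fin n)) :
    Function.Injective (diagonalVariables (d := d) π) := by
  rintro ⟨p, k⟩ ⟨p', k'⟩ h
  simp only [diagonalVariables, Prod.mk.injEq] at h
  rw [h.1.1, h.2.1]

theorem Model.CSummand_eq_zero (P : Model d) (κ : Measure (Momentum d)) (L : ℝ)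
    (γ : ElectronSpace d →L[ℂ] ElectronSpace d) (m m' : Fin (n + 1) → ℕ)
    (π : Equiv.Perm (Fin n)) (t : ℝ) (σ : Fin n → ℤˣ) {x : Model.Variables d n}
    (hx : x ∉ Set.range (diagonalVariables π)) : P.CSummand κ L γ N m m' π t σ x = 0 := by
  rw [Model.CSummand]
  refine mul_eq_zero_of_left ?_ _
  by_contra hne
  rw [Model.nuDensity] at hne
  have h1 := left_ne_zero_of_mul hne
  have h2 := left_ne_zero_of_mul h1
  have h3 := right_ne_zero_of_mul h1
  rw [Complex.ofReal_ne_zero, Finset.prod_ne_zero_iff] at h2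
  rw [Complex.ofReal_ne_zero] at h3
  have h4 : x.1.1 = x.1.2 := by
    by_contra hn
    exact h3 (by rw [latticeDelta, if_neg (sub_ne_zero.2 hn), mul_zero])
  have h5 : ∀ j, x.2.1 j = x.2.2 (π j) := by
    intro j
    by_contra hn
    exact h2 j (Finset.mem_univ _) (by rw [latticeDelta, if_neg (sub_ne_zero.2 hn)]; simp)
  refine hx ⟨(x.1.1, x.2.1), ?_⟩
  simp only [diagonalVariables]
  refine Prod.ext (Prod.ext rfl h4) (Prod.ext rfl (funext fun j => ?_))
  simp [h5]

/-- For each external momentum the volume factors combine to L^d · L^{-2d} = L^{-d}. For the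
electron, L^{-2d}, the delta function L^d and the L^d in the momentum kernel cancel completely. -/
theorem Model.CSummand_diagonal (P : Model d) (κ : Measure (Momentum d)) (hL : 0 < L)
    (γ : ElectronSpace d →L[ℂ] ElectronSpace d) (m m' : Fin (n + 1) → ℕ)
    (π : Equiv.Perm (Fin n)) (t : ℝ) (σ : Fin n → ℤˣ) (x : Mode d × (Fin n → Mode d)) :
    P.CSummand κ L γ N m m' π t σ (diagonalVariables π x) =
      electronElement γ x.1 x.1 * (((∏ j, P.latticeM L (x.2 j, σ j) : ℝ) : ℂ) *
    (P.blockIntegral κ N m t (latticePoint L x.1) (fun j => latticePoint L (x.2 j)) σ *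
      conj (P.blockIntegral κ N m' t (latticePoint L x.1)
        (fun j => latticePoint L (x.2 (π.symm j))) (fun j => σ (π.symm j))))) := by
  have hD : (L ^ d : ℝ) ≠ 0 := by positivity
  rw [Model.CSummand, Model.Y_eq, Model.nuDensity]
  have h1 : ∀ j, P.M (latticePoint L (x.2 j)) (σ j) *
      latticeDelta L (x.2 j - (x.2 ∘ π.symm) (π j)) * (L ^ d)⁻¹ * (L ^ d)⁻¹ =
        P.latticeM L (x.2 j, σ j) := by
    intro j
    rw [latticeDelta, if_pos (by simp), Model.latticeM]
    field_simp
  simp only [diagonalVariables]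
  rw [Finset.prod_congr rfl fun j _ => h1 j, sub_self, latticeDelta, if_pos rfl, momentumKernel]
  simp only [Function.comp_def]
  have h2 : ((L ^ d)⁻¹ * (L ^ d)⁻¹ * L ^ d : ℝ) = (L ^ d)⁻¹ := by field_simp
  rw [h2]
  have h3 : (((L ^ d)⁻¹ : ℝ) : ℂ) * ((L ^ d : ℝ) : ℂ) = 1 := by
    rw [← Complex.ofReal_mul, inv_mul_cancel₀ hD, Complex.ofReal_one]
  linear_combination (electronElement γ x.1 x.1 * (((∏ j, P.latticeM L (x.2 j, σ j) : ℝ) : ℂ) *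
    (P.blockIntegral κ N m t (latticePoint L x.1) (fun j => latticePoint L (x.2 j)) σ *
      conj (P.blockIntegral κ N m' t (latticePoint L x.1)
        (fun j => latticePoint L (x.2 (π.symm j))) (fun j => σ (π.symm j)))))) * h3

/-! ### Diagonal elements of an electron density matrix -/

section density

open scoped ComplexOrder

variable {γ : ElectronSpace d →L[ℂ] ElectronSpace d}

theorem IsDensityMatrix.element_nonneg (hγ : IsDensityMatrix γ) (p : Mode d) :
    0 ≤ electronElement γ p p := by
  unfold electronElement
  exact hγ.1.inner_nonneg_right _

theorem IsDensityMatrix.element_eq (hγ : IsDensityMatrix γ) (p : Mode d) :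
    electronElement γ p p = ((electronElement γ p p).re : ℂ) :=
  Complex.eq_re_of_ofReal_le (r := 0) (by simpa using hγ.element_nonneg p)

theorem IsDensityMatrix.element_re_nonneg (hγ : IsDensityMatrix γ) (p : Mode d) :
    0 ≤ (electronElement γ p p).re := (Complex.le_def.1 (hγ.element_nonneg p)).1

theorem IsDensityMatrix.norm_element (hγ : IsDensityMatrix γ) (p : Mode d) :
    ‖electronElement γ p p‖ = (electronElement γ p p).re := by
  rw [hγ.element_eq, Complex.norm_real, Real.norm_of_nonneg (hγ.element_re_nonneg p),
    Complex.ofReal_re]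

theorem IsDensityMatrix.hasSum_re (hγ : IsDensityMatrix γ) :
    HasSum (fun p => (electronElement γ p p).re) 1 := by
  simpa using Complex.hasSum_re hγ.2

theorem IsDensityMatrix.hasSum_norm (hγ : IsDensityMatrix γ) :
    HasSum (fun p => ‖electronElement γ p p‖) 1 := by
  simpa only [hγ.norm_element] using hγ.hasSum_re

end density

variable {γ : ElectronSpace d →L[ℂ] ElectronSpace d}

theorem Model.Regular.summable_norm_diagonal (h : P.Regular c q) (hL : 0 < L)
    (hγ : IsDensityMatrix γ) {κ : Measure (Momentum d)}
    {m m' : Fin (n + 1) → ℕ} (hm : m ∈ patterns n N) (hm' : m' ∈ patterns n N)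
    (π : Equiv.Perm (Fin n)) {t : ℝ} (ht : 0 ≤ t) (σ : Fin n → ℤˣ) :
    Summable fun x : Mode d × (Fin n → Mode d) =>
      ‖P.CSummand κ L γ N m m' π t σ (diagonalVariables π x)‖ := by
  have h1 : Summable fun k : Fin n → Mode d => ∏ j, P.latticeM L (k j, σ j) :=
    (h.summable_prod_latticeM hL (Fin n)).comp_injective
      (i := fun (k : Fin n → Mode d) j => (k j, σ j)) fun k k' hk => by
        funext j
        exact congrArg Prod.fst (congrFun hk j)
  have h2 := (hγ.hasSum_norm.summable.mul_of_nonneg h1 (fun _ => norm_nonneg _)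
    (fun k => Finset.prod_nonneg fun j _ => h.latticeM_nonneg hL _)).mul_right
      (((1 + P.massM κ) ^ (N + 1) * t ^ N) ^ 2)
  refine Summable.of_nonneg_of_le (fun _ => norm_nonneg _) (fun x => ?_) h2
  rw [P.CSummand_diagonal κ hL, norm_mul, norm_mul, Complex.norm_real, Real.norm_of_nonneg
    (Finset.prod_nonneg fun j _ => h.latticeM_nonneg hL _), mul_assoc]
  gcongr
  · exact Finset.prod_nonneg fun j _ => h.latticeM_nonneg hL _
  · exact h.norm_cSummand_le hm hm' ht _ _ _ _ _ _

theorem Model.Regular.summable_CSummand (h : P.Regular c q) (hL : 0 < L)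
    (hγ : IsDensityMatrix γ) (κ : Measure (Momentum d))
    {m m' : Fin (n + 1) → ℕ} (hm : m ∈ patterns n N) (hm' : m' ∈ patterns n N)
    (π : Equiv.Perm (Fin n)) {t : ℝ} (ht : 0 ≤ t) (σ : Fin n → ℤˣ) :
    Summable fun x => P.CSummand κ L γ N m m' π t σ x := by
  rw [← (diagonalVariables_injective π).summable_iff fun x hx =>
    P.CSummand_eq_zero κ L γ m m' π t σ hx]
  exact (h.summable_norm_diagonal hL hγ hm hm' π ht σ).of_norm

/-- The electron enters only as an average against the probability weights γ(p, p). Estimates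
uniform in p for the inner sums therefore pass to C without loss. -/
theorem Model.Regular.C_eq (h : P.Regular c q) (hL : 0 < L)
    (hγ : IsDensityMatrix γ) (κ : Measure (Momentum d))
    {m m' : Fin (n + 1) → ℕ} (hm : m ∈ patterns n N) (hm' : m' ∈ patterns n N)
    (π : Equiv.Perm (Fin n)) {t : ℝ} (ht : 0 ≤ t) :
    P.C κ L γ N m m' π t = (P.coupling : ℂ) ^ (2 * N) *
      ∑' p, electronElement γ p p * P.cInner κ L N m m' π t p := by
  have h1 := fun σ => h.summable_norm_diagonal hL hγ (κ := κ) hm hm' π ht σ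
  rw [Model.C]
  congr 1
  have h2 : ∀ σ : Fin n → ℤˣ, ∑' x, P.CSummand κ L γ N m m' π t σ x =
      ∑' p, ∑' k, P.CSummand κ L γ N m m' π t σ (diagonalVariables π (p, k)) := by
    intro σ
    rw [← (diagonalVariables_injective π).tsum_eq]
    · exact (h1 σ).of_norm.tsum_prod
    · intro x hx
      by_contra hn
      exact hx (P.CSummand_eq_zero κ L γ m m' π t σ hn)
  simp only [h2]
  rw [← Summable.tsum_finsetSum fun σ _ => (h1 σ).of_norm.prod]
  refine tsum_congr fun p => ?_
  rw [Model.cInner, ← (Equiv.arrowProdEquivProdArrow (Fin n) (fun _ => Mode d)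
    fun _ => ℤˣ).symm.tsum_eq, tsum_prod_finite, Finset.mul_sum]
  · refine Finset.sum_congr rfl fun σ _ => ?_
    rw [← tsum_mul_left]
    refine tsum_congr fun k => ?_
    rw [P.CSummand_diagonal κ hL]
    rfl
  · intro σ
    refine ((h.summable_cInner hL hm hm' π ht (κ := κ) (latticePoint L p)).comp_injective
      (i := fun (k : Fin n → Mode d) j => (k j, σ j)) fun k k' hk => ?_)
    funext j
    exact congrArg Prod.fst (congrFun hk j)

/-! ### Collecting the momenta of the pairs -/

/-- The constraints imposed on a pair of paths by the patterns and the permutation. -/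
def Matched {m m' : Fin (n + 1) → ℕ} (hm : m ∈ patterns n N) (hm' : m' ∈ patterns n N)
    (π : Equiv.Perm (Fin n)) (z : (Fin N → Leg d) × (Fin N → Leg d)) : Prop :=
  (∀ r, z.1 (fstIndex hm r) = -z.1 (sndIndex hm r)) ∧
    (∀ r, z.2 (fstIndex hm' r) = -z.2 (sndIndex hm' r)) ∧
      ∀ i, z.2 (extIndex hm' (π i)) = z.1 (extIndex hm i)

open Classical in
/-- The weight of a pair of paths in the representation formula. -/
def Model.matchedWeight (P : Model d) (L : ℝ) {m m' : Fin (n + 1) → ℕ} (hm : m ∈ patterns n N)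
    (hm' : m' ∈ patterns n N) (π : Equiv.Perm (Fin n)) (z : (Fin N → Leg d) × (Fin N → Leg d)) :
    ℝ :=
  if Matched hm hm' π z then (∏ i, P.occPlus L (z.1 (extIndex hm i))) *
    (∏ r, P.occPlus L (z.1 (sndIndex hm r))) * ∏ r, P.occPlus L (z.2 (sndIndex hm' r)) else 0

/-- The factors common to all contributions of a pair of paths. -/
def Model.commonFactor (P : Model d) (L t : ℝ) (p : Mode d)
    (z : (Fin N → Leg d) × (Fin N → Leg d)) : ℂ :=
  (((L ^ d)⁻¹ ^ N * (P.formProduct L z.1 * P.formProduct L z.2) : ℝ) : ℂ) *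
    (P.pathIntegral L t p z.1 * conj (P.pathIntegral L t p z.2))

/-- The pair of paths determined by the external momenta and by the momenta of the pairs. -/
def matchedPaths {m m' : Fin (n + 1) → ℕ} (hm : m ∈ patterns n N) (hm' : m' ∈ patterns n N)
    (π : Equiv.Perm (Fin n)) (x : (Fin n → Leg d) × (Pairs m → Leg d) × (Pairs m' → Leg d)) :
    (Fin N → Leg d) × (Fin N → Leg d) :=
  (assemble hm Neg.neg x.1 x.2.1, assemble hm' Neg.neg (fun j => x.1 (π.symm j)) x.2.2)

section matched

variable {m m' : Fin (n + 1) → ℕ} (hm : m ∈ patterns n N) (hm' : m' ∈ patterns n N)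
  (π : Equiv.Perm (Fin n))

theorem matched_matchedPaths (x : (Fin n → Leg d) × (Pairs m → Leg d) × (Pairs m' → Leg d)) :
    Matched hm hm' π (matchedPaths hm hm' π x) := by
  refine ⟨fun r => ?_, fun r => ?_, fun i => ?_⟩ <;> simp [matchedPaths]

theorem matchedPaths_injective : Function.Injective (matchedPaths (d := d) hm hm' π) := by
  rintro ⟨x, y, y'⟩ ⟨w, v, v'⟩ h
  simp only [matchedPaths, Prod.mk.injEq] at h
  refine Prod.ext (funext fun i => ?_) (Prod.ext (funext fun r => ?_) (funext fun r => ?_))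
  · simpa using congrFun h.1 (extIndex hm i)
  · simpa using congrFun h.1 (sndIndex hm r)
  · simpa using congrFun h.2 (sndIndex hm' r)

theorem mem_range_matchedPaths {z : (Fin N → Leg d) × (Fin N → Leg d)}
    (hz : Matched hm hm' π z) : z ∈ Set.range (matchedPaths hm hm' π) := by
  refine ⟨(fun i => z.1 (extIndex hm i), fun r => z.1 (sndIndex hm r),
    fun r => z.2 (sndIndex hm' r)), Prod.ext (eq_assemble hm _ hz.1).symm ?_⟩
  rw [eq_assemble hm' _ hz.2.1]
  simp only [matchedPaths]
  congr 1
  · funext j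
    rw [← hz.2.2, Equiv.apply_symm_apply]
  · funext r
    simp

theorem assemble_fst_comp (x : Fin n → Leg d) (y : Pairs m → Leg d) (u : Fin N) :
    (assemble hm Neg.neg x y u).1 =
      assemble hm Neg.neg (fun i => (x i).1) (fun r => (y r).1) u := by
  rcases vertex_cases hm u with ⟨i, rfl⟩ | ⟨r, rfl⟩ | ⟨r, rfl⟩ <;> simp

theorem assemble_snd_comp (x : Fin n → Leg d) (y : Pairs m → Leg d) (u : Fin N) :
    (assemble hm Neg.neg x y u).2 =
      assemble hm Neg.neg (fun i => (x i).2) (fun r => (y r).2) u := by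
  rcases vertex_cases hm u with ⟨i, rfl⟩ | ⟨r, rfl⟩ | ⟨r, rfl⟩ <;> simp

theorem latticePoint_assemble (L : ℝ) (x : Fin n → Mode d) (y : Pairs m → Mode d) (u : Fin N) :
    latticePoint L (assemble hm Neg.neg x y u) =
      assemble hm Neg.neg (fun i => latticePoint L (x i)) (fun r => latticePoint L (y r)) u := by
  rcases vertex_cases hm u with ⟨i, rfl⟩ | ⟨r, rfl⟩ | ⟨r, rfl⟩ <;> simp [latticePoint_neg]

theorem Model.pathIntegral_assemble (P : Model d) (L t : ℝ) (p : Mode d) (x : Fin n → Leg d)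
    (y : Pairs m → Leg d) : P.pathIntegral L t p (assemble hm Neg.neg x y) =
      P.phaseIntegral t (latticePoint L p)
        (assemble hm Neg.neg (fun i => latticePoint L (x i).1) fun r => latticePoint L (y r).1)
        (assemble hm Neg.neg (fun i => (x i).2) fun r => (y r).2) := by
  rw [Model.pathIntegral]
  congr 1
  · funext u
    rw [assemble_fst_comp, latticePoint_assemble]
  · funext u
    rw [assemble_snd_comp]

theorem Model.Regular.formProduct_assemble (h : P.Regular c q) (x : Fin n → Leg d)
    (y : Pairs m → Leg d) : P.formProduct L (assemble hm Neg.neg x y) =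
      (∏ i, P.Q (latticePoint L (x i).1)) * ∏ r, P.Q (latticePoint L (y r).1) ^ 2 := by
  rw [Model.formProduct, prod_vertices hm]
  simp only [assemble_ext, assemble_fst, assemble_snd, Prod.fst_neg, latticePoint_neg, h.even_Q, sq]

theorem sum_patterns_eq {m m' : Fin (n + 1) → ℕ} (hm : m ∈ patterns n N)
    (hm' : m' ∈ patterns n N) : n + ∑ j, m j + ∑ j, m' j = N := by
  have h1 := mem_patterns.1 hm
  have h2 := mem_patterns.1 hm'
  omega

/-- Every contraction carries L^{-d}Q², and there are n + ∑m_j + ∑m'_j = N of them. Evenness of Q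
spreads the squares over all 2N vertices, leaving only the factors 𝒩 + (σ+1)/2 as weight. -/
theorem Model.Regular.prod_latticeM_matched (h : P.Regular c q)
    (x : (Fin n → Leg d) × (Pairs m → Leg d) × (Pairs m' → Leg d)) :
    (∏ j, P.latticeM L (x.1 j)) * (∏ r, P.latticeM L (x.2.1 r)) * ∏ r, P.latticeM L (x.2.2 r) =
      (L ^ d)⁻¹ ^ N * (P.formProduct L (matchedPaths hm hm' π x).1 *
        P.formProduct L (matchedPaths hm hm' π x).2) *
          P.matchedWeight L hm hm' π (matchedPaths hm hm' π x) := by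
  rw [Model.matchedWeight, if_pos (matched_matchedPaths hm hm' π x)]
  simp only [matchedPaths, h.formProduct_assemble, assemble_ext, assemble_snd]
  rw [Equiv.prod_comp π.symm fun i => P.Q (latticePoint L (x.1 i).1)]
  conv_rhs => rw [← sum_patterns_eq hm hm', pow_add, pow_add, ← card_pairs, ← card_pairs]
  simp only [Model.latticeM_eq, Finset.prod_mul_distrib, Finset.prod_const, Finset.card_univ,
    Fintype.card_fin, sq]
  ring

end matched

theorem Model.Regular.summable_matched (h : P.Regular c q) (hL : 0 < L)
    {m m' : Fin (n + 1) → ℕ} (hm : m ∈ patterns n N) (hm' : m' ∈ patterns n N)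
    (π : Equiv.Perm (Fin n)) {t : ℝ} (ht : 0 ≤ t) (p : Mode d) :
    Summable fun z : (Fin N → Leg d) × (Fin N → Leg d) =>
      ‖P.commonFactor L t p z * (P.matchedWeight L hm hm' π z : ℂ)‖ := by
  rw [← (matchedPaths_injective hm hm' π).summable_iff]
  · have h1 := (h.summable_prod_latticeM hL (Fin n)).norm.mul_norm
      ((h.summable_prod_latticeM hL (Pairs m)).norm.mul_norm
        (h.summable_prod_latticeM hL (Pairs m')).norm)
    refine Summable.of_nonneg_of_le (fun _ => norm_nonneg _) (fun x => ?_)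
      (h1.mul_right (t ^ N * t ^ N))
    rw [Function.comp_apply, Model.commonFactor, mul_right_comm, ← Complex.ofReal_mul,
      ← h.prod_latticeM_matched, norm_mul, Complex.norm_real, norm_mul (P.pathIntegral _ _ _ _),
      RCLike.norm_conj, mul_assoc, norm_mul, norm_mul]
    have h2 := fun k τ => P.norm_phaseIntegral_le (N := N) ht (latticePoint L p) k τ
    gcongr <;> exact h2 _ _
  · intro z hz
    rw [Model.matchedWeight, if_neg fun hz' => hz (mem_range_matchedPaths hm hm' π hz')]
    simp

/-- The external integral over the lattice as a sum over pairs of paths. -/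
theorem Model.Regular.cInner_lattice (h : P.Regular c q) (hL : 0 < L)
    {m m' : Fin (n + 1) → ℕ} (hm : m ∈ patterns n N) (hm' : m' ∈ patterns n N)
    (π : Equiv.Perm (Fin n)) {t : ℝ} (ht : 0 ≤ t) (p : Mode d) :
    P.cInner (latticeMeasure d L) L N m m' π t p =
      ∑' z : (Fin N → Leg d) × (Fin N → Leg d),
        P.commonFactor L t p z * (P.matchedWeight L hm hm' π z : ℂ) := by
  have h0 := (matchedPaths_injective hm hm' π).summable_iff (f := fun z =>
    P.commonFactor L t p z * (P.matchedWeight L hm hm' π z : ℂ)) fun z hz => by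
      rw [Model.matchedWeight, if_neg fun hz' => hz (mem_range_matchedPaths hm hm' π hz')]
      simp
  have h1 := h0.2 (h.summable_matched hL hm hm' π ht p).of_norm
  rw [← (matchedPaths_injective hm hm' π).tsum_eq]
  · refine Eq.trans ?_ h1.tsum_prod.symm
    rw [Model.cInner]
    refine tsum_congr fun x => ?_
    have hb : ∀ {m : Fin (n + 1) → ℕ} (hm : m ∈ patterns n N) (x : Fin n → Leg d),
        Summable fun y : Pairs m → Leg d => ‖((∏ r, P.latticeM L (y r) : ℝ) : ℂ) *
          P.pathIntegral L t p (assemble hm Neg.neg x y)‖ := by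
      intro m hm x
      refine Summable.of_nonneg_of_le (fun _ => norm_nonneg _) (fun y => ?_)
        ((h.summable_prod_latticeM hL (Pairs m)).norm.mul_right (t ^ N))
      rw [norm_mul, Complex.norm_real]
      exact mul_le_mul_of_nonneg_left (P.norm_phaseIntegral_le ht _ _ _) (norm_nonneg _)
    rw [h.blockIntegral_lattice hL hm, h.blockIntegral_lattice hL hm']
    simp only [← P.pathIntegral_assemble hm, ← P.pathIntegral_assemble hm' L t p
      (fun j => x (π.symm j))]
    -- The two block integrals have independent pair momenta, so their product is a single sum over
    -- both families.
    rw [Complex.conj_tsum, tsum_mul_tsum_of_summable_norm (hb hm x), ← tsum_mul_left]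
    · refine tsum_congr fun y => ?_
      rw [Function.comp_apply, Model.commonFactor,
        mul_right_comm (((L ^ d)⁻¹ ^ N * _ : ℝ) : ℂ), ← Complex.ofReal_mul,
        ← h.prod_latticeM_matched hm hm' π (x, y)]
      simp only [matchedPaths, map_mul, Complex.conj_ofReal, Complex.ofReal_mul]
      ring
    · simpa only [RCLike.norm_conj] using hb hm' fun j => x (π.symm j)
  · intro z hz
    by_contra hn
    refine hz ?_
    beta_reduce
    rw [Model.matchedWeight, if_neg fun hz' => hn (mem_range_matchedPaths hm hm' π hz')]
    simp

end Pairings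

/-! ### The trace as a sum over pairs of paths -/

section abstractTrace

variable {A F Z : Type*} [DecidableEq F]

/-- The contribution of a pair of paths to a weighted sum of squared matrix elements. -/
def pairTerm (T : Z → A → F) (V : Z → A → ℂ) (w : A → ℂ) (x : (A × (Z × Z)) × F) : ℂ :=
  w x.1.1 * ((if x.2 = T x.1.2.1 x.1.1 then V x.1.2.1 x.1.1 else 0) *
    conj (if x.2 = T x.1.2.2 x.1.1 then V x.1.2.2 x.1.1 else 0))

variable {T : Z → A → F} {V : Z → A → ℂ} {w : A → ℂ}

theorem pairTerm_eq_zero (y : A × (Z × Z)) {f : F} (hf : f ≠ T y.2.1 y.1) :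
    pairTerm T V w (y, f) = 0 := by
  simp [pairTerm, hf]

theorem summable_pairTerm
    (h2 : Summable fun y : A × (Z × Z) => ‖w y.1‖ * (‖V y.2.1 y.1‖ * ‖V y.2.2 y.1‖)) :
    Summable fun x => ‖pairTerm T V w x‖ := by
  have h0 : ∀ (y : A × (Z × Z)) (f : F), f ≠ T y.2.1 y.1 → ‖pairTerm T V w (y, f)‖ = 0 := by
    intro y f hf
    rw [pairTerm_eq_zero y hf, norm_zero]
  rw [summable_prod_of_nonneg fun _ => norm_nonneg _]
  refine ⟨fun y => (hasSum_single (T y.2.1 y.1) (h0 y)).summable,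
    Summable.of_nonneg_of_le (fun y => tsum_nonneg fun _ => norm_nonneg _) (fun y => ?_) h2⟩
  rw [tsum_eq_single (T y.2.1 y.1) (h0 y), pairTerm, norm_mul, norm_mul, RCLike.norm_conj]
  gcongr
  · split_ifs <;> simp
  · split_ifs <;> simp

theorem summable_pairTerm_comm
    (h2 : Summable fun y : A × (Z × Z) => ‖w y.1‖ * (‖V y.2.1 y.1‖ * ‖V y.2.2 y.1‖)) :
    Summable fun y : (F × A) × (Z × Z) => ‖pairTerm T V w ((y.1.2, y.2), y.1.1)‖ := by
  refine (summable_pairTerm (T := T) h2).comp_injective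
    (i := fun y : (F × A) × (Z × Z) => ((y.1.2, y.2), y.1.1)) ?_
  rintro ⟨⟨f, a⟩, z⟩ ⟨⟨f', a'⟩, z'⟩ h
  simp only [Prod.mk.injEq] at h ⊢
  tauto

theorem tsum_pairTerm (h1 : ∀ a, Summable fun z => ‖V z a‖) (f : F) (a : A) :
    ∑' z : Z × Z, pairTerm T V w ((a, z), f) =
      w a * ((∑' z, if f = T z a then V z a else 0) *
        conj (∑' z, if f = T z a then V z a else 0)) := by
  have h : Summable fun z => ‖if f = T z a then V z a else 0‖ := by
    refine Summable.of_nonneg_of_le (fun _ => norm_nonneg _) (fun z => ?_) (h1 a)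
    split_ifs <;> simp
  rw [Complex.conj_tsum, tsum_mul_tsum_of_summable_norm h
    (by simpa only [RCLike.norm_conj] using h), ← tsum_mul_left]
  rfl

theorem summable_weighted_square (h1 : ∀ a, Summable fun z => ‖V z a‖)
    (h2 : Summable fun y : A × (Z × Z) => ‖w y.1‖ * (‖V y.2.1 y.1‖ * ‖V y.2.2 y.1‖)) :
    Summable fun x : F × A => ‖w x.2 * ((∑' z, if x.1 = T z x.2 then V z x.2 else 0) *
        conj (∑' z, if x.1 = T z x.2 then V z x.2 else 0))‖ := by
  have h3 := summable_pairTerm_comm (T := T) h2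
  refine Summable.of_nonneg_of_le (fun _ => norm_nonneg _) (fun x => ?_) h3.prod
  rw [← tsum_pairTerm h1]
  exact norm_tsum_le_tsum_norm (h3.prod_factor x)

/-- Summing over the final state first leaves one term for each pair of paths, which is nonzero only
if both paths reach the same target. The majorant `h2` ignores targets and so justifies every
reordering. -/
theorem tsum_weighted_square (h1 : ∀ a, Summable fun z => ‖V z a‖)
    (h2 : Summable fun y : A × (Z × Z) => ‖w y.1‖ * (‖V y.2.1 y.1‖ * ‖V y.2.2 y.1‖)) :
    ∑' x : F × A, w x.2 * ((∑' z, if x.1 = T z x.2 then V z x.2 else 0) *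
        conj (∑' z, if x.1 = T z x.2 then V z x.2 else 0)) =
      ∑' y : A × (Z × Z), w y.1 *
        if T y.2.1 y.1 = T y.2.2 y.1 then V y.2.1 y.1 * conj (V y.2.2 y.1) else 0 := by
  have h3 := summable_pairTerm_comm (T := T) h2
  simp only [← tsum_pairTerm h1]
  let φ : (F × A) × (Z × Z) ≃ (A × (Z × Z)) × F :=
    { toFun := fun y => ((y.1.2, y.2), y.1.1)
      invFun := fun y => ((y.2, y.1.1), y.1.2)
      left_inv := fun _ => rfl
      right_inv := fun _ => rfl }
  refine h3.of_norm.tsum_prod.symm.trans ?_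
  refine (φ.tsum_eq (pairTerm T V w)).trans ?_
  rw [(summable_pairTerm h2).of_norm.tsum_prod]
  refine tsum_congr fun y => ?_
  rw [tsum_eq_single (T y.2.1 y.1) fun f hf => pairTerm_eq_zero y hf, pairTerm, if_pos rfl]
  split_ifs <;> simp

end abstractTrace

section Paths

variable {d : ℕ} {P : Model d} {c q : ℝ} {L : ℝ} {n N : ℕ}

/-! ### Paths of legs -/

/-- The basis vector reached from `a` along a path; the electron absorbs the leg momenta. -/
def pathTarget (z : Fin N → Leg d) (a : Label d) : Label d :=
  pathLabel (fun u => -(z u).1) (fun u => (z u).2) a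

/-- The amplitude of a path. -/
def pathAmplitude (z : Fin N → Leg d) (ν : Mode d →₀ ℕ) : ℝ :=
  amplitude (fun u => -(z u).1) (fun u => (z u).2) ν

/-- The mode whose occupation number is changed by a vertex of a path. -/
def pathMode (z : Fin N → Leg d) (u : Fin N) : Mode d := touched (-(z u).1) (z u).2

/-- The change of the occupation numbers along a path. -/
def pathNet (z : Fin N → Leg d) (κ : Mode d) : ℤ :=
  net (fun u => -(z u).1) (fun u => (z u).2) 0 κ

/-- The product of the signs of a path. -/
def pathSign (z : Fin N → Leg d) : ℝ := ∏ u, (((z u).2 : ℤ) : ℝ)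

/-- The sum of the restrictions of the momenta over the patterns. -/
def patternSum (n : ℕ) (z : Fin N → Leg d) : ℝ :=
  ∑ m ∈ patterns n N, patternWeight m fun u => -(z u).1

theorem chi_eq_zero_or_one (z : Mode d) : chi z = 0 ∨ chi z = 1 := by
  unfold chi; split_ifs <;> simp

theorem patternWeight_mem (m : Fin (n + 1) → ℕ) (k : Fin N → Mode d) :
    0 ≤ patternWeight m k ∧ patternWeight m k ≤ 1 := by
  have h1 : ∀ z : Mode d, 0 ≤ chi z ∧ chi z ≤ 1 := fun z => by
    rcases chi_eq_zero_or_one z with h | h <;> rw [h] <;> norm_num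
  have h2 : ∀ z : Mode d, 0 ≤ 1 - chi z ∧ 1 - chi z ≤ 1 := fun z =>
    ⟨by linarith [(h1 z).2], by linarith [(h1 z).1]⟩
  rw [patternWeight]
  have h3 := Finset.prod_nonneg (s := innerIndices m)
    (f := fun b => chi (entry k b + entry k (b + 1))) fun b _ => (h1 _).1
  have h4 := Finset.prod_nonneg (s := (external m).offDiag)
    (f := fun x => 1 - chi (entry k x.1 + entry k x.2)) fun x _ => (h2 _).1
  exact ⟨mul_nonneg h3 h4, mul_le_one₀ (Finset.prod_le_one (fun _ _ => (h1 _).1)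
    fun _ _ => (h1 _).2) h4 (Finset.prod_le_one (fun _ _ => (h2 _).1) fun _ _ => (h2 _).2)⟩

theorem patternSum_nonneg (z : Fin N → Leg d) : 0 ≤ patternSum n z :=
  Finset.sum_nonneg fun _ _ => (patternWeight_mem _ _).1

theorem patternSum_le (z : Fin N → Leg d) : patternSum n z ≤ (patterns n N).card := by
  refine (Finset.sum_le_sum fun _ _ => (patternWeight_mem _ _).2).trans ?_
  simp

theorem abs_unit (τ : ℤˣ) : |(((τ : ℤ) : ℝ))| = 1 := by
  rcases Int.units_eq_one_or τ with rfl | rfl <;> simp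

theorem abs_pathSign (z : Fin N → Leg d) : |pathSign z| = 1 := by
  rw [pathSign, Finset.abs_prod]
  simp [abs_unit]

/-- The vertex u itself is not among the indices counted, so at most N - 1 phonons have been added
before it acts. -/
theorem net_add_one_le (k : Fin N → Mode d) (τ : Fin N → ℤˣ) (u : Fin N) (κ : Mode d) :
    net k τ (u.val + 1) κ + 1 ≤ N := by
  classical
  have h1 : net k τ (u.val + 1) κ + 1 = ∑ l : Fin N,
      ((if u.val + 1 ≤ l.val ∧ touched (k l) (τ l) = κ then (τ l : ℤ) else 0) +
        if l = u then 1 else 0) := by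
    rw [Finset.sum_add_distrib, Finset.sum_ite_eq' Finset.univ u, if_pos (Finset.mem_univ _), net]
  rw [h1]
  refine (Finset.sum_le_sum (g := fun _ => (1 : ℤ)) fun l _ => ?_).trans (by simp)
  by_cases hl : l = u
  · subst hl
    simp
  · rw [if_neg hl, add_zero]
    split_ifs
    · rcases Int.units_eq_one_or (τ l) with h | h <;> rw [h] <;> simp
    · simp

theorem pathAmplitude_nonneg (z : Fin N → Leg d) (ν : Mode d →₀ ℕ) : 0 ≤ pathAmplitude z ν :=
  amplitude_nonneg _ _ _

theorem pathAmplitude_le (z : Fin N → Leg d) (ν : Mode d →₀ ℕ) :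
    pathAmplitude z ν ≤ ∏ u, Real.sqrt ((ν (pathMode z u) : ℝ) + N) := by
  rw [pathAmplitude, amplitude]
  refine Finset.prod_le_prod (fun _ _ => Real.sqrt_nonneg _) fun u _ => Real.sqrt_le_sqrt ?_
  have h1 := net_add_one_le (fun u => -(z u).1) (fun u => (z u).2) u
    (touched (-(z u).1) (z u).2)
  have h2 : (net (fun u => -(z u).1) (fun u => (z u).2) (u.val + 1)
    (touched (-(z u).1) (z u).2) : ℝ) + 1 ≤ N := by exact_mod_cast h1
  have h3 : ((((z u).2 : ℤ) : ℝ) + 1) / 2 ≤ 1 := by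
    rcases Int.units_eq_one_or (z u).2 with h | h <;> rw [h] <;> norm_num
  rw [pathMode]
  linarith

/-- A product of 2N square roots is at most the N-th power of the largest entry, hence at most the
sum of all N-th powers. Joint moments thus reduce to moments of single modes, even when modes
coincide. The 1 covers the empty product. -/
theorem prod_sqrt_le {ι : Type*} [Fintype ι] {x : ι → ℝ} (hx : ∀ i, 0 ≤ x i)
    (hι : Fintype.card ι = 2 * N) : ∏ i, Real.sqrt (x i) ≤ 1 + ∑ i, x i ^ N := by
  have hs : 0 ≤ ∑ i, x i ^ N := Finset.sum_nonneg fun i _ => pow_nonneg (hx i) _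
  rcases isEmpty_or_nonempty ι with h | h
  · simp
  · obtain ⟨i, -, hi⟩ := Finset.exists_max_image Finset.univ x Finset.univ_nonempty
    calc ∏ j, Real.sqrt (x j) ≤ ∏ _j : ι, Real.sqrt (x i) :=
          Finset.prod_le_prod (fun _ _ => Real.sqrt_nonneg _) fun j hj =>
            Real.sqrt_le_sqrt (hi j hj)
      _ = x i ^ N := by
          rw [Finset.prod_const, Finset.card_univ, hι, pow_mul, Real.sq_sqrt (hx i)]
      _ ≤ ∑ j, x j ^ N := Finset.single_le_sum (f := fun j => x j ^ N)
          (fun j _ => pow_nonneg (hx j) _) (Finset.mem_univ i)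
      _ ≤ 1 + ∑ j, x j ^ N := by linarith

/-- A bound for the expectation of a product of two amplitudes. -/
def momentBound (q : ℝ) (N : ℕ) : ℝ := 1 + 2 * N * gibbsMoment q N

theorem Model.hasSum_gibbsProb (hZ : Summable (P.gibbsWeight L)) : HasSum (P.gibbsProb L) 1 :=
  hasSum_of_tsum_ofReal (Model.gibbsProb_nonneg hZ) zero_le_one
    (by rw [Model.tsum_ofReal_gibbsProb hZ, ENNReal.ofReal_one])

theorem Model.Regular.hasSum_gibbsProb_pow (h : P.Regular c q) (hZ : Summable (P.gibbsWeight L))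
    (κ : Mode d) (N : ℕ) : ∃ v ≤ gibbsMoment q N,
      HasSum (fun ν => P.gibbsProb L ν * ((ν κ : ℝ) + N) ^ N) v := by
  have h1 := Model.tsum_gibbsProb_pow_le h hZ κ N
  have h2 : ∀ ν : Mode d →₀ ℕ, 0 ≤ P.gibbsProb L ν * ((ν κ : ℝ) + N) ^ N := fun ν =>
    mul_nonneg (Model.gibbsProb_nonneg hZ ν) (by positivity)
  simp only [← ENNReal.ofReal_mul (Model.gibbsProb_nonneg hZ _)] at h1
  refine ⟨_, ENNReal.toReal_le_of_le_ofReal (gibbsMoment_nonneg h.q_pos N) h1,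
    hasSum_of_tsum_ofReal h2 ENNReal.toReal_nonneg (ENNReal.ofReal_toReal ?_).symm⟩
  exact (h1.trans_lt ENNReal.ofReal_lt_top).ne

theorem pathAmplitude_mul_le (z z' : Fin N → Leg d) (ν : Mode d →₀ ℕ) :
    pathAmplitude z ν * pathAmplitude z' ν ≤
      1 + ∑ v : Fin N ⊕ Fin N, ((ν (Sum.elim (pathMode z) (pathMode z') v) : ℝ) + N) ^ N := by
  refine (mul_le_mul (pathAmplitude_le z ν) (pathAmplitude_le z' ν) (pathAmplitude_nonneg _ _)
    (Finset.prod_nonneg fun _ _ => Real.sqrt_nonneg _)).trans ?_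
  have := prod_sqrt_le (N := N) (ι := Fin N ⊕ Fin N)
    (x := fun v => (ν (Sum.elim (pathMode z) (pathMode z') v) : ℝ) + N)
    (fun v => by positivity) (by simp [two_mul])
  rwa [Fintype.prod_sum_type] at this

/-- The expectation of a product of two amplitudes in the Gibbs state. -/
def Model.pairMoment (P : Model d) (L : ℝ) (z z' : Fin N → Leg d) : ℝ :=
  ∑' ν, P.gibbsProb L ν * (pathAmplitude z ν * pathAmplitude z' ν)

/-- The bound depends on neither the paths nor L. This uniformity is what makes degenerate pairs
negligible by merely counting free momenta. -/
theorem Model.Regular.summable_pairMoment (h : P.Regular c q) (hZ : Summable (P.gibbsWeight L))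
    (z z' : Fin N → Leg d) :
    Summable (fun ν => P.gibbsProb L ν * (pathAmplitude z ν * pathAmplitude z' ν)) ∧
      P.pairMoment L z z' ≤ momentBound q N := by
  choose v hv1 hv2 using fun κ => h.hasSum_gibbsProb_pow hZ κ N
  have h1 := (Model.hasSum_gibbsProb hZ).add (hasSum_sum (s := Finset.univ)
    fun (x : Fin N ⊕ Fin N) _ => hv2 (Sum.elim (pathMode z) (pathMode z') x))
  have h2 : ∀ ν, P.gibbsProb L ν * (pathAmplitude z ν * pathAmplitude z' ν) ≤
      P.gibbsProb L ν + ∑ x : Fin N ⊕ Fin N, P.gibbsProb L ν *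
        ((ν (Sum.elim (pathMode z) (pathMode z') x) : ℝ) + N) ^ N := by
    intro ν
    rw [← Finset.mul_sum, ← mul_one_add]
    exact mul_le_mul_of_nonneg_left (pathAmplitude_mul_le z z' ν) (Model.gibbsProb_nonneg hZ ν)
  have h3 := Summable.of_nonneg_of_le (fun ν => mul_nonneg (Model.gibbsProb_nonneg hZ ν)
    (mul_nonneg (pathAmplitude_nonneg z ν) (pathAmplitude_nonneg z' ν))) h2 h1.summable
  refine ⟨h3, (h3.tsum_le_tsum h2 h1.summable).trans ?_⟩
  rw [h1.tsum_eq, momentBound]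
  have h4 := Finset.sum_le_sum (s := Finset.univ)
    fun (x : Fin N ⊕ Fin N) _ => hv1 (Sum.elim (pathMode z) (pathMode z') x)
  simp only [Finset.sum_const, Finset.card_univ, Fintype.card_sum, Fintype.card_fin,
    nsmul_eq_mul, Nat.cast_add] at h4
  linarith

theorem Model.Regular.pairMoment_nonneg (hZ : Summable (P.gibbsWeight L))
    (z z' : Fin N → Leg d) : 0 ≤ P.pairMoment L z z' :=
  tsum_nonneg fun ν => mul_nonneg (Model.gibbsProb_nonneg hZ ν)
    (mul_nonneg (pathAmplitude_nonneg z ν) (pathAmplitude_nonneg z' ν))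

/-! ### The form factors -/

theorem Model.Regular.summable_Q (h : P.Regular c q) (hL : 0 < L) :
    Summable fun x : Leg d => ‖P.Q (latticePoint L x.1)‖ := by
  refine summable_norm_prod_finite fun τ => ?_
  refine Summable.of_nonneg_of_le (fun _ => norm_nonneg _) (fun z => ?_)
    ((summable_decay hL).mul_left c)
  exact h.Q_le_decay _

theorem Model.Regular.summable_formProduct (h : P.Regular c q) (hL : 0 < L) :
    Summable fun z : Fin N → Leg d => |P.formProduct L z| :=
  summable_norm_prod (f := fun (_ : Fin N) (x : Leg d) => P.Q (latticePoint L x.1))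
    fun _ => h.summable_Q hL

/-! ### The matrix elements of the expanded term -/

/-- The contribution of a path and of a pattern to the matrix elements. -/
def Model.patternFactor (P : Model d) (L t : ℝ) (m : Fin (n + 1) → ℕ) (z : Fin N → Leg d)
    (a : Label d) : ℂ :=
  (((L ^ d)⁻¹ ^ N * patternWeight m (fun u => -(z u).1) : ℝ) : ℂ) *
    P.pathWeight L t (fun u => -(z u).1) (fun u => (z u).2) a

/-- The contribution of a path to the matrix elements. -/
def Model.pathFactor (P : Model d) (L t : ℝ) (n : ℕ) (z : Fin N → Leg d) (a : Label d) : ℂ :=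
  ∑ m ∈ patterns n N, P.patternFactor L t m z a

theorem Model.Regular.pathWeight_eq (h : P.Regular c q) (L t : ℝ) (z : Fin N → Leg d)
    (a : Label d) : P.pathWeight L t (fun u => -(z u).1) (fun u => (z u).2) a =
      (P.coupling : ℂ) ^ N * ((P.formProduct L z * pathSign z * Real.sqrt (L ^ d) ^ N *
        pathAmplitude z a.2 : ℝ) : ℂ) *
      (Complex.exp (-Complex.I * ((t * P.phononEnergy L a.2 : ℝ) : ℂ)) *
        P.pathIntegral L t a.1 z) := by
  simp only [Model.pathWeight, Model.pathIntegral, neg_neg, latticePoint_neg, h.even_Q,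
    Finset.prod_mul_distrib, Finset.prod_const, Finset.card_univ, Fintype.card_fin]
  rfl

/-- A bound for the volume dependent constants in the matrix elements. -/
def Model.pathBound (P : Model d) (L t : ℝ) (N : ℕ) : ℝ :=
  (L ^ d)⁻¹ ^ N * (|P.coupling| ^ N * (Real.sqrt (L ^ d) ^ N * t ^ N))

theorem Model.Regular.norm_patternFactor_le (h : P.Regular c q) (hL : 0 < L) {t : ℝ} (ht : 0 ≤ t)
    (m : Fin (n + 1) → ℕ) (z : Fin N → Leg d) (a : Label d) :
    ‖P.patternFactor L t m z a‖ ≤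
      P.pathBound L t N * (|P.formProduct L z| * pathAmplitude z a.2) := by
  rw [Model.patternFactor, h.pathWeight_eq]
  simp only [norm_mul, norm_exp_neg_I_mul, Complex.norm_real, norm_pow, one_mul, Real.norm_eq_abs,
    abs_pathSign, mul_one]
  rw [abs_of_nonneg (pathAmplitude_nonneg z a.2), abs_of_nonneg (patternWeight_mem _ _).1,
    abs_of_nonneg (by positivity : (0 : ℝ) ≤ (L ^ d)⁻¹), abs_of_nonneg (Real.sqrt_nonneg _),
    Model.pathBound]
  have h1 : ‖P.pathIntegral L t a.1 z‖ ≤ t ^ N := P.norm_phaseIntegral_le ht _ _ _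
  have h2 := pathAmplitude_nonneg z a.2
  calc _ ≤ (L ^ d)⁻¹ ^ N * 1 * (|P.coupling| ^ N * (|P.formProduct L z| *
        Real.sqrt (L ^ d) ^ N * pathAmplitude z a.2) * t ^ N) := by
        gcongr
        exact (patternWeight_mem _ _).2
    _ = _ := by ring

theorem Model.Regular.norm_pathFactor_le (h : P.Regular c q) (hL : 0 < L) {t : ℝ} (ht : 0 ≤ t)
    (n : ℕ) (z : Fin N → Leg d) (a : Label d) :
    ‖P.pathFactor L t n z a‖ ≤ (patterns n N).card * P.pathBound L t N *
      (|P.formProduct L z| * pathAmplitude z a.2) := by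
  refine (norm_sum_le_of_le _ fun m _ => h.norm_patternFactor_le hL ht m z a).trans ?_
  rw [Finset.sum_const, nsmul_eq_mul, mul_assoc]

/-- For a fixed initial state the total phonon number bounds the amplitudes of all paths at once,
which gives convergence of each matrix element. The trace needs moment bounds instead, the phonon
number being unbounded there. -/
theorem pathAmplitude_le_degree (z : Fin N → Leg d) (ν : Mode d →₀ ℕ) :
    pathAmplitude z ν ≤ Real.sqrt ((ν.degree : ℝ) + N) ^ N := by
  refine (pathAmplitude_le z ν).trans ?_
  refine (Finset.prod_le_prod (fun _ _ => Real.sqrt_nonneg _)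
    (g := fun _ => Real.sqrt ((ν.degree : ℝ) + N)) fun u _ => Real.sqrt_le_sqrt ?_).trans ?_
  · have := Finsupp.le_degree (pathMode z u) ν
    gcongr
  · simp

theorem Model.Regular.pathBound_nonneg (hL : 0 < L) {t : ℝ} (ht : 0 ≤ t) :
    0 ≤ P.pathBound L t N := by
  unfold Model.pathBound; positivity

theorem Model.Regular.summable_patternFactor (h : P.Regular c q) (hL : 0 < L) {t : ℝ}
    (ht : 0 ≤ t) (m : Fin (n + 1) → ℕ) (a : Label d) :
    Summable fun z : Fin N → Leg d => ‖P.patternFactor L t m z a‖ := by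
  refine Summable.of_nonneg_of_le (fun _ => norm_nonneg _)
    (fun z => (h.norm_patternFactor_le hL ht m z a).trans ?_)
    (((h.summable_formProduct hL).mul_right (Real.sqrt ((a.2.degree : ℝ) + N) ^ N)).mul_left
      (P.pathBound L t N))
  have := Model.Regular.pathBound_nonneg (P := P) (N := N) hL ht
  gcongr
  exact pathAmplitude_le_degree z a.2

theorem Model.Regular.summable_pathFactor (h : P.Regular c q) (hL : 0 < L) {t : ℝ}
    (ht : 0 ≤ t) (n : ℕ) (a : Label d) :
    Summable fun z : Fin N → Leg d => ‖P.pathFactor L t n z a‖ :=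
  Summable.of_nonneg_of_le (fun _ => norm_nonneg _) (fun _ => norm_sum_le _ _)
    (summable_sum fun m _ => h.summable_patternFactor hL ht m a)

/-- Momenta and signs of the vertices as a path of legs. -/
def legEquiv : (Fin N → Mode d) × (Fin N → ℤˣ) ≃ (Fin N → Leg d) where
  toFun x u := (-(x.1 u), x.2 u)
  invFun z := (fun u => -(z u).1, fun u => (z u).2)
  left_inv x := by simp
  right_inv z := by simp

theorem Model.patternFactor_legEquiv (P : Model d) (L t : ℝ) (m : Fin (n + 1) → ℕ)
    (k : Fin N → Mode d) (τ : Fin N → ℤˣ) (a : Label d) :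
    P.patternFactor L t m (legEquiv (k, τ)) a =
      (((L ^ d)⁻¹ ^ N * patternWeight m k : ℝ) : ℂ) * P.pathWeight L t k τ a := by
  simp [Model.patternFactor, legEquiv]

theorem pathTarget_legEquiv (k : Fin N → Mode d) (τ : Fin N → ℤˣ) (a : Label d) :
    pathTarget (legEquiv (k, τ)) a = pathLabel k τ a := by
  simp [pathTarget, legEquiv]

theorem Model.Regular.expandedSummand_eq (h : P.Regular c q) (L t : ℝ) (m : Fin (n + 1) → ℕ)
    (f a : Label d) (k : Fin N → Mode d) : P.expandedSummand L t m f a k =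
      ∑ τ : Fin N → ℤˣ, if f = pathTarget (legEquiv (k, τ)) a then
        P.patternFactor L t m (legEquiv (k, τ)) a else 0 := by
  rw [Model.expandedSummand, Model.duhamelTerm_eq h.even_ω, Finset.mul_sum]
  refine Finset.sum_congr rfl fun τ _ => ?_
  rw [P.patternFactor_legEquiv, pathTarget_legEquiv, mul_ite, mul_zero]

theorem Model.Regular.summable_target (h : P.Regular c q) (hL : 0 < L) {t : ℝ}
    (ht : 0 ≤ t) (m : Fin (n + 1) → ℕ) (f a : Label d) :
    Summable fun z : Fin N → Leg d =>
      ‖if f = pathTarget z a then P.patternFactor L t m z a else 0‖ := by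
  refine Summable.of_nonneg_of_le (fun _ => norm_nonneg _) (fun z => ?_)
    (h.summable_patternFactor hL ht m a)
  split_ifs <;> simp

theorem Model.Regular.hasSum_expandedSummand (h : P.Regular c q) (hL : 0 < L) {t : ℝ}
    (ht : 0 ≤ t) (m : Fin (n + 1) → ℕ) (f a : Label d) :
    HasSum (fun k : Fin N → Mode d => P.expandedSummand L t m f a k)
      (∑' z : Fin N → Leg d, if f = pathTarget z a then P.patternFactor L t m z a else 0) := by
  have h1 := h.summable_target hL (N := N) ht m f a
  have h2 := (legEquiv.summable_iff.2 h1.of_norm).hasSum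
  rw [← legEquiv.tsum_eq]
  simp only [h.expandedSummand_eq]
  exact h2.prod_fiberwise fun k => hasSum_fintype _

theorem Model.Regular.expanded_eq (h : P.Regular c q) (hL : 0 < L) {t : ℝ}
    (ht : 0 ≤ t) (n : ℕ) (f a : Label d) : P.expanded L t n N f a =
      ∑' z : Fin N → Leg d, if f = pathTarget z a then P.pathFactor L t n z a else 0 := by
  rw [Model.expanded, Finset.sum_congr rfl fun m _ =>
    (h.hasSum_expandedSummand hL ht m f a).tsum_eq,
    ← Summable.tsum_finsetSum fun m _ => (h.summable_target hL ht m f a).of_norm]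
  refine tsum_congr fun z => ?_
  split_ifs
  · rfl
  · simp

end Paths

section Trace

variable {d : ℕ} {P : Model d} {c q : ℝ} {L : ℝ} {n N : ℕ}

theorem summable_mul_prod {X Y : Type*} {f : X → ℝ} {g : Y → ℝ} (hf : Summable f)
    (hg : Summable g) (hf0 : ∀ x, 0 ≤ f x) (hg0 : ∀ x, 0 ≤ g x) :
    Summable fun z : X × Y => f z.1 * g z.2 :=
  hf.mul_of_nonneg hg hf0 hg0

/-! ### Conservation laws along a path -/

theorem pathTarget_fst (z : Fin N → Leg d) (a : Label d) :
    (pathTarget z a).1 = a.1 + ∑ u, (z u).1 := by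
  rw [pathTarget, pathLabel_fst, Finset.sum_neg_distrib, sub_neg_eq_add]

theorem pathTarget_snd (z : Fin N → Leg d) {a : Label d} (h : pathAmplitude z a.2 ≠ 0)
    (κ : Mode d) : ((pathTarget z a).2 κ : ℤ) = a.2 κ + pathNet z κ :=
  pathLabel_snd _ _ a (by rwa [pathAmp_eq]) κ

theorem unit_smul_pathMode (z : Fin N → Leg d) (u : Fin N) :
    ((z u).2 : ℤ) • pathMode z u = -(z u).1 := by
  rw [pathMode, touched, smul_smul]
  rcases Int.units_eq_one_or (z u).2 with h | h <;> rw [h] <;> simp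

/-- Momentum conservation: what the electron gains is minus the momentum ∑ net(κ)κ gained by the
phonons. -/
theorem sum_legs_eq (z : Fin N → Leg d) {S : Finset (Mode d)} (hS : ∀ u, pathMode z u ∈ S) :
    ∑ u, (z u).1 = -∑ κ ∈ S, pathNet z κ • κ := by
  classical
  rw [← Finset.sum_neg_distrib]
  have h1 : ∀ κ, -(pathNet z κ • κ) = ∑ u, if pathMode z u = κ then (z u).1 else 0 := by
    intro κ
    rw [pathNet, net, Finset.sum_smul, ← Finset.sum_neg_distrib]
    refine Finset.sum_congr rfl fun u _ => ?_
    by_cases hu : pathMode z u = κ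
    · rw [if_pos ⟨Nat.zero_le _, hu⟩, if_pos hu, ← hu, unit_smul_pathMode, neg_neg]
    · rw [if_neg fun hh => hu hh.2, if_neg hu, zero_smul, neg_zero]
  simp only [h1]
  rw [Finset.sum_comm]
  refine Finset.sum_congr rfl fun u _ => ?_
  rw [Finset.sum_ite_eq S, if_pos (hS u)]

theorem sum_legs_eq_of_pathNet_eq {z z' : Fin N → Leg d} (h : pathNet z = pathNet z') :
    ∑ u, (z u).1 = ∑ u, (z' u).1 := by
  classical
  rw [sum_legs_eq z (S := Finset.univ.image (pathMode z) ∪ Finset.univ.image (pathMode z'))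
      fun u => Finset.mem_union_left _ (Finset.mem_image_of_mem _ (Finset.mem_univ u)),
    sum_legs_eq z' (S := Finset.univ.image (pathMode z) ∪ Finset.univ.image (pathMode z'))
      fun u => Finset.mem_union_right _ (Finset.mem_image_of_mem _ (Finset.mem_univ u)), h]

theorem pathNet_eq_of_pathTarget_eq {z z' : Fin N → Leg d} {a a' : Label d}
    (ha : a.2 = a'.2) (hz : pathAmplitude z a.2 ≠ 0) (hz' : pathAmplitude z' a'.2 ≠ 0)
    (h : pathTarget z a = pathTarget z' a') : pathNet z = pathNet z' := by
  funext κ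
  have h1 := pathTarget_snd z hz κ
  rw [h, pathTarget_snd z' hz' κ, ha] at h1
  linarith

/-- Equal initial and final phonon configurations force equal net changes, hence equal momentum
transfer, hence equal initial electron momenta. -/
theorem eq_of_pathTarget_eq {z z' : Fin N → Leg d} {a a' : Label d}
    (ha : a.2 = a'.2) (hz : pathAmplitude z a.2 ≠ 0) (hz' : pathAmplitude z' a'.2 ≠ 0)
    (h : pathTarget z a = pathTarget z' a') : a = a' := by
  refine Prod.ext ?_ ha
  have h1 := congrArg Prod.fst h
  rw [pathTarget_fst, pathTarget_fst,
    sum_legs_eq_of_pathNet_eq (pathNet_eq_of_pathTarget_eq ha hz hz' h)] at h1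
  exact add_right_cancel h1

theorem pathTarget_eq_iff {z z' : Fin N → Leg d} {a : Label d}
    (hz : pathAmplitude z a.2 ≠ 0) (hz' : pathAmplitude z' a.2 ≠ 0) :
    pathTarget z a = pathTarget z' a ↔ pathNet z = pathNet z' := by
  refine ⟨pathNet_eq_of_pathTarget_eq rfl hz hz', fun h => Prod.ext ?_ (Finsupp.ext fun κ => ?_)⟩
  · rw [pathTarget_fst, pathTarget_fst, sum_legs_eq_of_pathNet_eq h]
  · have h1 := pathTarget_snd z hz κ
    rw [h, ← pathTarget_snd z' hz' κ] at h1
    exact_mod_cast h1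

/-! ### The trace -/

variable {γ : ElectronSpace d →L[ℂ] ElectronSpace d}

theorem Model.Regular.exists_of_expanded_ne_zero (h : P.Regular c q) (hL : 0 < L) {t : ℝ}
    (ht : 0 ≤ t) {f a : Label d} (hE : P.expanded L t n N f a ≠ 0) :
    ∃ z : Fin N → Leg d, f = pathTarget z a ∧ pathAmplitude z a.2 ≠ 0 := by
  by_contra! hn
  refine hE ?_
  rw [h.expanded_eq hL ht]
  refine (tsum_congr fun z => ?_).trans tsum_zero
  split_ifs with hz
  · have h1 := h.norm_pathFactor_le hL ht n z a
    rw [hn z hz, mul_zero, mul_zero] at h1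
    exact norm_le_zero_iff.1 h1
  · rfl

/-- The phonon state is diagonal, and momentum conservation then removes the off-diagonal electron
elements, so only γ_e(p, p) enters the trace. -/
theorem Model.Regular.expanded_mul_eq_zero (h : P.Regular c q) (hL : 0 < L) {t : ℝ}
    (ht : 0 ≤ t) {f a a' : Label d} (ha : a ≠ a') :
    P.expanded L t n N f a * P.initialState L γ a a' * conj (P.expanded L t n N f a') = 0 := by
  by_contra hne
  have h1 := left_ne_zero_of_mul hne
  have h2 : P.expanded L t n N f a' ≠ 0 := fun h0 =>
    right_ne_zero_of_mul hne (by rw [h0, map_zero])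
  obtain ⟨z, hz, hz1⟩ := h.exists_of_expanded_ne_zero hL ht (left_ne_zero_of_mul h1)
  obtain ⟨z', hz', hz1'⟩ := h.exists_of_expanded_ne_zero hL ht h2
  have h3 : a.2 = a'.2 := by
    by_contra hn
    refine right_ne_zero_of_mul h1 ?_
    rw [Model.initialState, if_neg hn, mul_zero]
  exact ha (eq_of_pathTarget_eq h3 hz1 hz1' (hz ▸ hz'))

/-- The diagonal matrix elements of the initial state. -/
def Model.stateWeight (P : Model d) (L : ℝ) (γ : ElectronSpace d →L[ℂ] ElectronSpace d)
    (a : Label d) : ℂ := electronElement γ a.1 a.1 * (P.gibbsProb L a.2 : ℂ)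

theorem Model.initialState_self (P : Model d) (L : ℝ)
    (γ : ElectronSpace d →L[ℂ] ElectronSpace d) (a : Label d) :
    P.initialState L γ a a = P.stateWeight L γ a := by
  rw [Model.initialState, if_pos rfl]
  rfl

/-- A pair of paths over a basis vector, regrouped by electron momentum. -/
def regroup {X : Type*} : (Label d × X) ≃ (Mode d × X) × (Mode d →₀ ℕ) where
  toFun y := ((y.1.1, y.2), y.1.2)
  invFun y := ((y.1.1, y.2), y.1.2)
  left_inv _ := rfl
  right_inv _ := rfl

/-- Summing over phonon configurations first makes the moment bound available. What remains is a
product of summable series in the electron momentum and in the legs. -/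
theorem Model.Regular.summable_majorant (h : P.Regular c q) (hL : 0 < L)
    (hZ : Summable (P.gibbsWeight L)) (hγ : IsDensityMatrix γ) :
    Summable fun y : Label d × ((Fin N → Leg d) × (Fin N → Leg d)) =>
      ‖electronElement γ y.1.1 y.1.1‖ * (|P.formProduct L y.2.1| * |P.formProduct L y.2.2|) *
        (P.gibbsProb L y.1.2 * (pathAmplitude y.2.1 y.1.2 * pathAmplitude y.2.2 y.1.2)) := by
  rw [← regroup.symm.summable_iff]
  have h0 : ∀ x : (Mode d × ((Fin N → Leg d) × (Fin N → Leg d))) × (Mode d →₀ ℕ),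
      0 ≤ ‖electronElement γ x.1.1 x.1.1‖ *
        (|P.formProduct L x.1.2.1| * |P.formProduct L x.1.2.2|) *
        (P.gibbsProb L x.2 * (pathAmplitude x.1.2.1 x.2 * pathAmplitude x.1.2.2 x.2)) := fun x =>
    mul_nonneg (by positivity) (mul_nonneg (Model.gibbsProb_nonneg hZ _)
      (mul_nonneg (pathAmplitude_nonneg _ _) (pathAmplitude_nonneg _ _)))
  refine (summable_prod_of_nonneg h0).2 ⟨fun x => ?_, ?_⟩
  · exact (h.summable_pairMoment hZ x.2.1 x.2.2).1.mul_left
      (‖electronElement γ x.1 x.1‖ * (|P.formProduct L x.2.1| * |P.formProduct L x.2.2|))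
  · have hf := h.summable_formProduct (N := N) hL
    have h1 := (hγ.hasSum_norm.summable.mul_of_nonneg
      (hf.mul_of_nonneg hf (fun _ => abs_nonneg _) fun _ => abs_nonneg _)
      (fun _ => norm_nonneg _) fun _ => mul_nonneg (abs_nonneg _) (abs_nonneg _)).mul_right
        (momentBound q N)
    refine Summable.of_nonneg_of_le (fun x => tsum_nonneg fun ν => h0 (x, ν)) (fun x => ?_) h1
    dsimp only
    rw [tsum_mul_left]
    exact mul_le_mul_of_nonneg_left (h.summable_pairMoment hZ x.2.1 x.2.2).2 (by positivity)

theorem Model.Regular.summable_paths (h : P.Regular c q) (hL : 0 < L)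
    (hZ : Summable (P.gibbsWeight L)) (hγ : IsDensityMatrix γ) {t : ℝ} (ht : 0 ≤ t) (n : ℕ) :
    Summable fun y : Label d × ((Fin N → Leg d) × (Fin N → Leg d)) =>
      ‖P.stateWeight L γ y.1‖ *
        (‖P.pathFactor L t n y.2.1 y.1‖ * ‖P.pathFactor L t n y.2.2 y.1‖) := by
  refine Summable.of_nonneg_of_le (fun _ => by positivity) (fun y => ?_)
    ((h.summable_majorant (N := N) hL hZ hγ).mul_left
      (((patterns n N).card * P.pathBound L t N) ^ 2))
  have h1 := h.norm_pathFactor_le hL ht n y.2.1 y.1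
  have h2 := h.norm_pathFactor_le hL ht n y.2.2 y.1
  rw [Model.stateWeight, norm_mul, Complex.norm_real,
    Real.norm_of_nonneg (Model.gibbsProb_nonneg hZ _)]
  have h3 := mul_le_mul h1 h2 (norm_nonneg _) ((norm_nonneg _).trans h1)
  have h4 : 0 ≤ ‖electronElement γ y.1.1 y.1.1‖ * P.gibbsProb L y.1.2 :=
    mul_nonneg (norm_nonneg _) (Model.gibbsProb_nonneg hZ _)
  refine (mul_le_mul_of_nonneg_left h3 h4).trans_eq ?_
  ring

theorem Model.Regular.expandedTraceConverges (h : P.Regular c q) (hL : 0 < L)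
    (hZ : Summable (P.gibbsWeight L)) (hγ : IsDensityMatrix γ) {t : ℝ} (ht : 0 ≤ t) (n N : ℕ) :
    P.ExpandedTraceConverges L γ t n N := by
  refine ⟨fun m _ f a => (h.hasSum_expandedSummand hL ht m f a).summable, ?_⟩
  let i : Label d × Label d → Label d × Label d × Label d := fun x => (x.1, x.2, x.2)
  have hi : Function.Injective i := by
    rintro ⟨f, a⟩ ⟨f', a'⟩ hx
    simp only [i, Prod.mk.injEq] at hx
    rw [hx.1, hx.2.1]
  rw [← hi.summable_iff]
  · have h1 := (summable_weighted_square (T := pathTarget)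
      (fun a => h.summable_pathFactor (N := N) hL ht n a)
      (h.summable_paths hL hZ hγ ht n)).of_norm
    refine h1.congr fun x => ?_
    simp only [Function.comp_apply, i, P.initialState_self, h.expanded_eq hL ht]
    ring
  · rintro ⟨f, a, a'⟩ hx
    refine h.expanded_mul_eq_zero hL ht fun ha => hx ⟨(f, a), ?_⟩
    simp only [i] at ha ⊢
    rw [ha]

open Classical in
/-- The combinatorial factor of a pair of paths in the trace. -/
def pairCoefficient (n : ℕ) (z : (Fin N → Leg d) × (Fin N → Leg d)) : ℝ :=
  if pathNet z.1 = pathNet z.2 then patternSum n z.1 * patternSum n z.2 *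
    (pathSign z.1 * pathSign z.2) else 0

theorem abs_pairCoefficient_le (n : ℕ) (z : (Fin N → Leg d) × (Fin N → Leg d)) :
    |pairCoefficient n z| ≤ (patterns n N).card ^ 2 := by
  rw [pairCoefficient]
  split_ifs
  · rw [abs_mul, abs_mul, abs_mul, abs_pathSign, abs_pathSign, mul_one, mul_one, sq,
      abs_of_nonneg (patternSum_nonneg _), abs_of_nonneg (patternSum_nonneg _)]
    exact mul_le_mul (patternSum_le _) (patternSum_le _) (patternSum_nonneg _) (Nat.cast_nonneg _)
  · rw [abs_zero]
    positivity

/-- The weight of a pair of paths in the trace. -/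
def Model.traceWeight (P : Model d) (L : ℝ) (n : ℕ) (z : (Fin N → Leg d) × (Fin N → Leg d)) : ℝ :=
  pairCoefficient n z * P.pairMoment L z.1 z.2

theorem Model.Regular.abs_traceWeight_le (h : P.Regular c q) (hZ : Summable (P.gibbsWeight L))
    (n : ℕ) (z : (Fin N → Leg d) × (Fin N → Leg d)) :
    |P.traceWeight L n z| ≤ (patterns n N).card ^ 2 * momentBound q N := by
  rw [Model.traceWeight, abs_mul, abs_of_nonneg (Model.Regular.pairMoment_nonneg hZ z.1 z.2)]
  exact mul_le_mul (abs_pairCoefficient_le n z) (h.summable_pairMoment hZ z.1 z.2).2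
    (Model.Regular.pairMoment_nonneg hZ _ _) (by positivity)

theorem Model.norm_commonFactor_le (P : Model d) (hL : 0 < L) {t : ℝ} (ht : 0 ≤ t) (p : Mode d)
    (z : (Fin N → Leg d) × (Fin N → Leg d)) : ‖P.commonFactor L t p z‖ ≤
      (L ^ d)⁻¹ ^ N * (t ^ N * t ^ N) * (|P.formProduct L z.1| * |P.formProduct L z.2|) := by
  rw [Model.commonFactor, norm_mul, norm_mul, RCLike.norm_conj, Complex.norm_real,
    Real.norm_eq_abs, abs_mul, abs_mul, abs_of_nonneg (by positivity : (0 : ℝ) ≤ (L ^ d)⁻¹ ^ N)]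
  have h1 : ∀ z : Fin N → Leg d, ‖P.pathIntegral L t p z‖ ≤ t ^ N := fun z =>
    P.norm_phaseIntegral_le ht _ _ _
  calc _ ≤ (L ^ d)⁻¹ ^ N * (|P.formProduct L z.1| * |P.formProduct L z.2|) * (t ^ N * t ^ N) := by
        gcongr
        · exact h1 _
        · exact h1 _
    _ = _ := by ring

theorem Model.Regular.summable_formProduct_mul (h : P.Regular c q) (hL : 0 < L) :
    Summable fun z : (Fin N → Leg d) × (Fin N → Leg d) =>
      |P.formProduct L z.1| * |P.formProduct L z.2| := by
  have hf := h.summable_formProduct (N := N) hL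
  have h1 := summable_mul_prod hf hf (fun _ => abs_nonneg _) fun _ => abs_nonneg _
  exact h1

theorem Model.Regular.summable_trace (h : P.Regular c q) (hL : 0 < L)
    (hZ : Summable (P.gibbsWeight L)) {t : ℝ} (ht : 0 ≤ t) (n : ℕ) (p : Mode d) :
    Summable fun z : (Fin N → Leg d) × (Fin N → Leg d) =>
      ‖P.commonFactor L t p z * (P.traceWeight L n z : ℂ)‖ := by
  refine Summable.of_nonneg_of_le (fun _ => norm_nonneg _) (fun z => ?_)
    (((h.summable_formProduct_mul (N := N) hL).mul_left ((L ^ d)⁻¹ ^ N * (t ^ N * t ^ N))).mul_right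
      (((patterns n N).card : ℝ) ^ 2 * momentBound q N))
  rw [norm_mul, Complex.norm_real, Real.norm_eq_abs]
  exact mul_le_mul (P.norm_commonFactor_le hL ht p z) (h.abs_traceWeight_le hZ n z)
    (abs_nonneg _) (by positivity)

theorem exp_mul_conj_exp (x : ℝ) :
    Complex.exp (-Complex.I * (x : ℂ)) * conj (Complex.exp (-Complex.I * (x : ℂ))) = 1 := by
  rw [Complex.mul_conj, Complex.normSq_eq_norm_sq, norm_exp_neg_I_mul]
  simp

theorem Model.Regular.pathFactor_eq (h : P.Regular c q) (L t : ℝ) (n : ℕ)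
    (z : Fin N → Leg d) (a : Label d) : P.pathFactor L t n z a =
      (((L ^ d)⁻¹ ^ N * patternSum n z : ℝ) : ℂ) * ((P.coupling : ℂ) ^ N *
        ((P.formProduct L z * pathSign z * Real.sqrt (L ^ d) ^ N * pathAmplitude z a.2 : ℝ) : ℂ) *
        (Complex.exp (-Complex.I * ((t * P.phononEnergy L a.2 : ℝ) : ℂ)) *
          P.pathIntegral L t a.1 z)) := by
  simp only [Model.pathFactor, Model.patternFactor, h.pathWeight_eq]
  rw [← Finset.sum_mul, patternSum, Finset.mul_sum, Complex.ofReal_sum]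

/-- The phases of the initial phonon energy cancel. The volume factors L^{-2dN} of the momentum sums
and L^{dN} of the amplitudes combine to L^{-dN}. -/
theorem Model.Regular.pathFactor_mul_conj (h : P.Regular c q) (hL : 0 < L) (t : ℝ) (n : ℕ)
    (z : (Fin N → Leg d) × (Fin N → Leg d)) (a : Label d) :
    P.pathFactor L t n z.1 a * conj (P.pathFactor L t n z.2 a) =
      (P.coupling : ℂ) ^ (2 * N) * (P.commonFactor L t a.1 z *
        ((patternSum n z.1 * patternSum n z.2 * (pathSign z.1 * pathSign z.2) *
          (pathAmplitude z.1 a.2 * pathAmplitude z.2 a.2) : ℝ) : ℂ)) := by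
  have h1 := exp_mul_conj_exp (t * P.phononEnergy L a.2)
  have h2 : ((L ^ d)⁻¹ : ℝ) ^ N * (L ^ d)⁻¹ ^ N * (Real.sqrt (L ^ d) ^ N * Real.sqrt (L ^ d) ^ N) =
      (L ^ d)⁻¹ ^ N := by
    have hD : 0 < L ^ d := by positivity
    rw [← mul_pow, ← mul_pow, ← mul_pow, Real.mul_self_sqrt hD.le]
    congr 1
    field_simp
  have h3 := congrArg (fun x : ℝ => (x : ℂ)) h2
  rw [h.pathFactor_eq, h.pathFactor_eq, Model.commonFactor, two_mul, pow_add]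
  simp only [map_mul, map_pow, Complex.conj_ofReal]
  generalize Complex.exp (-Complex.I * ((t * P.phononEnergy L a.2 : ℝ) : ℂ)) = E at h1 ⊢
  simp only [Complex.ofReal_mul] at h3 ⊢
  linear_combination ((P.coupling : ℂ) ^ (2 * N) *
    (patternSum n z.1 : ℂ) * patternSum n z.2 * pathSign z.1 * pathSign z.2 *
    pathAmplitude z.1 a.2 * pathAmplitude z.2 a.2 * P.formProduct L z.1 * P.formProduct L z.2 *
    P.pathIntegral L t a.1 z.1 * conj (P.pathIntegral L t a.1 z.2)) *
      ((((L ^ d)⁻¹ ^ N : ℝ) : ℂ) ^ 2 * ((Real.sqrt (L ^ d) ^ N : ℝ) : ℂ) ^ 2 * h1 + h3)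

/-- The trace as a sum over pairs of paths. -/
theorem Model.Regular.expandedTrace_eq (h : P.Regular c q) (hL : 0 < L)
    (hZ : Summable (P.gibbsWeight L)) (hγ : IsDensityMatrix γ) {t : ℝ} (ht : 0 ≤ t) (n N : ℕ) :
    P.expandedTrace L γ t n N = (P.coupling : ℂ) ^ (2 * N) * ∑' p, electronElement γ p p *
      ∑' z : (Fin N → Leg d) × (Fin N → Leg d),
        P.commonFactor L t p z * (P.traceWeight L n z : ℂ) := by
  have hV := fun a => h.summable_pathFactor (N := N) hL ht n a
  have hP := h.summable_paths (N := N) hL hZ hγ ht n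
  have h1 : P.expandedTrace L γ t n N = ∑' f, ∑' a, P.stateWeight L γ a *
      (P.expanded L t n N f a * conj (P.expanded L t n N f a)) := by
    rw [Model.expandedTrace, kernelTrace]
    refine tsum_congr fun f => tsum_congr fun a => ?_
    rw [kernelMul, kernelAdjoint, ← tsum_mul_right, tsum_eq_single a fun a' ha' =>
      h.expanded_mul_eq_zero hL ht ha', P.initialState_self]
    ring
  have h2 := (summable_weighted_square (T := pathTarget) hV hP).of_norm
  have h3 := tsum_weighted_square (T := pathTarget) hV hP
  rw [h2.tsum_prod] at h3
  simp only [h1, h.expanded_eq hL ht]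
  refine h3.trans ?_
  have h4 : ∀ y : Label d × ((Fin N → Leg d) × (Fin N → Leg d)), (P.stateWeight L γ y.1 *
      if pathTarget y.2.1 y.1 = pathTarget y.2.2 y.1 then
        P.pathFactor L t n y.2.1 y.1 * conj (P.pathFactor L t n y.2.2 y.1) else 0) =
      (P.coupling : ℂ) ^ (2 * N) * (electronElement γ y.1.1 y.1.1 * (P.commonFactor L t y.1.1 y.2 *
        (pairCoefficient n y.2 : ℂ) *
        ((P.gibbsProb L y.1.2 *
          (pathAmplitude y.2.1 y.1.2 * pathAmplitude y.2.2 y.1.2) : ℝ) : ℂ))) := by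
    intro y
    -- If an amplitude vanishes, truncated subtraction makes the target meaningless, but both sides
    -- are zero. Otherwise equality of targets is equality of net changes, a condition free of the
    -- initial state.
    by_cases h0 : pathAmplitude y.2.1 y.1.2 * pathAmplitude y.2.2 y.1.2 = 0
    · rw [h.pathFactor_mul_conj hL, h0]
      simp
    · have h5 := pathTarget_eq_iff (a := y.1) (left_ne_zero_of_mul h0) (right_ne_zero_of_mul h0)
      rw [h.pathFactor_mul_conj hL, Model.stateWeight]
      by_cases h6 : pathNet y.2.1 = pathNet y.2.2
      · rw [if_pos (h5.2 h6), pairCoefficient, if_pos h6]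
        push_cast
        ring
      · rw [if_neg fun hT => h6 (h5.1 hT), pairCoefficient, if_neg h6]
        simp
  have h6 : Summable fun y : Label d × ((Fin N → Leg d) × (Fin N → Leg d)) =>
      P.stateWeight L γ y.1 * if pathTarget y.2.1 y.1 = pathTarget y.2.2 y.1 then
        P.pathFactor L t n y.2.1 y.1 * conj (P.pathFactor L t n y.2.2 y.1) else 0 := by
    refine Summable.of_norm_bounded hP fun y => ?_
    rw [norm_mul]
    refine mul_le_mul_of_nonneg_left ?_ (norm_nonneg _)
    split_ifs
    · rw [norm_mul, RCLike.norm_conj]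
    · rw [norm_zero]
      positivity
  simp only [h4] at h6 ⊢
  -- With electron momentum and paths fixed, the phonon configuration enters only through the
  -- amplitudes, so the innermost sum is the Gibbs moment.
  have h7 := regroup.symm.summable_iff.2 h6
  have h8 := h7.prod
  rw [← regroup.symm.tsum_eq, ← tsum_mul_left]
  refine (h7.tsum_prod.trans h8.tsum_prod).trans (tsum_congr fun p => ?_)
  rw [← tsum_mul_left, ← tsum_mul_left]
  refine tsum_congr fun z => ?_
  simp only [Function.comp_apply, regroup, Equiv.coe_fn_symm_mk]
  rw [tsum_mul_left, tsum_mul_left, tsum_mul_left, ← Complex.ofReal_tsum, Model.traceWeight,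
    mul_assoc (P.commonFactor L t p z), ← Complex.ofReal_mul]
  rfl

end Trace

/-! ### The restrictions of a pattern in terms of vertices -/

section PatternWeight

variable {d n N : ℕ} {m : Fin (n + 1) → ℕ}

theorem entry_val_add_one {X : Type*} [Zero X] (k : Fin N → X) (u : Fin N) :
    entry k (u.val + 1) = k u := by
  rw [entry, dif_pos ⟨by omega, u.isLt⟩]
  rfl

theorem entry_fst_add_two {X : Type*} [Zero X] (hm : m ∈ patterns n N) (k : Fin N → X)
    (r : Pairs m) : entry k ((fstIndex hm r).val + 1 + 1) = k (sndIndex hm r) :=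
  entry_val_add_one k (sndIndex hm r)

theorem mem_innerIndices (hm : m ∈ patterns n N) {b : ℕ} :
    b ∈ innerIndices m ↔ ∃ r : Pairs m, b = (fstIndex hm r).val + 1 := by
  constructor
  · intro hb
    obtain ⟨j, -, hj⟩ := Finset.mem_biUnion.1 hb
    obtain ⟨i, hi, rfl⟩ := Finset.mem_image.1 hj
    exact ⟨⟨j, ⟨i, Finset.mem_range.1 hi⟩⟩, rfl⟩
  · rintro ⟨r, rfl⟩
    exact Finset.mem_biUnion.2 ⟨r.1, Finset.mem_univ _, fstIndex_add_one_mem_blockInner hm r⟩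

theorem mem_external (hm : m ∈ patterns n N) {b : ℕ} :
    b ∈ external m ↔ ∃ i : Fin n, b = (extIndex hm i).val + 1 := by
  simp only [external, Finset.mem_image, Finset.mem_Icc, extIndex_mem]
  constructor
  · rintro ⟨j, hj, rfl⟩
    exact ⟨⟨j - 1, by omega⟩, by simp only; congr 1; omega⟩
  · rintro ⟨i, rfl⟩
    exact ⟨i + 1, by omega, rfl⟩

/-- The pairs of a pattern cancel, and no two of its external momenta do. -/
def Admissible (hm : m ∈ patterns n N) (k : Fin N → Mode d) : Prop :=
  (∀ r, k (fstIndex hm r) + k (sndIndex hm r) = 0) ∧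
    ∀ i i', i ≠ i' → k (extIndex hm i) + k (extIndex hm i') ≠ 0

theorem extIndex_injective (hm : m ∈ patterns n N) : Function.Injective (extIndex hm) :=
  fun i i' h => by
    have := vertexIndex_injective hm (a₁ := Sum.inl i) (a₂ := Sum.inl i') h
    simpa using this

theorem sndIndex_injective (hm : m ∈ patterns n N) : Function.Injective (sndIndex hm) :=
  fun r r' h => by
    have := vertexIndex_injective hm (a₁ := Sum.inr (Sum.inr r)) (a₂ := Sum.inr (Sum.inr r')) h
    simpa using this

theorem extIndex_ne_fstIndex (hm : m ∈ patterns n N) (i : Fin n) (r : Pairs m) :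
    extIndex hm i ≠ fstIndex hm r := fun h => by
  have := vertexIndex_injective hm (a₁ := Sum.inl i) (a₂ := Sum.inr (Sum.inl r)) h
  simp at this

theorem extIndex_ne_sndIndex (hm : m ∈ patterns n N) (i : Fin n) (r : Pairs m) :
    extIndex hm i ≠ sndIndex hm r := fun h => by
  have := vertexIndex_injective hm (a₁ := Sum.inl i) (a₂ := Sum.inr (Sum.inr r)) h
  simp at this

theorem fstIndex_ne_sndIndex (hm : m ∈ patterns n N) (r r' : Pairs m) :
    fstIndex hm r ≠ sndIndex hm r' := fun h => by
  have := vertexIndex_injective hm (a₁ := Sum.inr (Sum.inl r)) (a₂ := Sum.inr (Sum.inr r')) h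
  simp at this

-- The restrictions count momenta from one, the vertices from zero. In terms of vertices they are
-- exactly the two clauses of `Admissible`.
open Classical in
theorem patternWeight_eq (hm : m ∈ patterns n N) (k : Fin N → Mode d) :
    patternWeight m k = if Admissible hm k then 1 else 0 := by
  rw [patternWeight]
  split_ifs with h
  · rw [Finset.prod_eq_one, Finset.prod_eq_one, mul_one]
    · rintro ⟨b, b'⟩ hx
      obtain ⟨h1, h2, h3⟩ := Finset.mem_offDiag.1 hx
      obtain ⟨i, rfl⟩ := (mem_external hm).1 h1
      obtain ⟨i', rfl⟩ := (mem_external hm).1 h2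
      rw [entry_val_add_one, entry_val_add_one, chi, if_neg (h.2 i i' fun hi => h3 (by rw [hi])),
        sub_zero]
    · intro b hb
      obtain ⟨r, rfl⟩ := (mem_innerIndices hm).1 hb
      rw [entry_val_add_one, entry_fst_add_two hm, h.1, chi, if_pos rfl]
  · by_contra hne
    refine h ⟨fun r => ?_, fun i i' hi => ?_⟩
    · have h1 := Finset.prod_ne_zero_iff.1 (left_ne_zero_of_mul hne) _
        ((mem_innerIndices hm).2 ⟨r, rfl⟩)
      rw [entry_val_add_one, entry_fst_add_two hm, chi] at h1
      by_contra h2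
      exact h1 (if_neg h2)
    · have h1 := Finset.prod_ne_zero_iff.1 (right_ne_zero_of_mul hne)
        ((extIndex hm i).val + 1, (extIndex hm i').val + 1)
        (Finset.mem_offDiag.2 ⟨(mem_external hm).2 ⟨i, rfl⟩, (mem_external hm).2 ⟨i', rfl⟩,
          fun hx => hi (extIndex_injective hm (Fin.ext (by simpa using hx)))⟩)
      rw [entry_val_add_one, entry_val_add_one, chi] at h1
      intro h2
      exact h1 (by rw [if_pos h2, sub_self])

end PatternWeight

/-! ### Amplitudes of paths without accidental coincidences -/

section Amplitude

variable {d n N : ℕ} {m : Fin (n + 1) → ℕ}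

/-- The contribution of a leg to the change of the occupation number of the mode `κ`. -/
def legNet (κ : Mode d) (x : Leg d) : ℤ := if touched (-x.1) x.2 = κ then (x.2 : ℤ) else 0

theorem touched_leg_neg (x : Leg d) : touched (-(-x).1) (-x).2 = touched (-x.1) x.2 := by
  simp [touched]

theorem legNet_neg (κ : Mode d) (x : Leg d) : legNet κ (-x) = -legNet κ x := by
  simp only [legNet, touched_leg_neg]
  split_ifs <;> simp

theorem pathNet_eq_sum (w : Fin N → Leg d) (κ : Mode d) : pathNet w κ = ∑ u, legNet κ (w u) := by
  simp [pathNet, net, legNet]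

theorem pathNet_eq_of_pairs (hm : m ∈ patterns n N) {w : Fin N → Leg d}
    (hw : ∀ r, w (fstIndex hm r) = -w (sndIndex hm r)) (κ : Mode d) :
    pathNet w κ = ∑ i, legNet κ (w (extIndex hm i)) := by
  rw [pathNet_eq_sum, sum_vertices hm]
  simp [hw, legNet_neg]

theorem pathSign_eq_of_pairs (hm : m ∈ patterns n N) {w : Fin N → Leg d}
    (hw : ∀ r, w (fstIndex hm r) = -w (sndIndex hm r)) :
    pathSign w = (∏ i, (((w (extIndex hm i)).2 : ℤ) : ℝ)) * (-1) ^ (∑ j, m j) := by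
  rw [pathSign, prod_vertices hm]
  have h1 : ∀ r, (((w (fstIndex hm r)).2 : ℤ) : ℝ) * (((w (sndIndex hm r)).2 : ℤ) : ℝ) = -1 := by
    intro r
    rw [hw, Prod.snd_neg]
    rcases Int.units_eq_one_or (w (sndIndex hm r)).2 with h | h <;> rw [h] <;> norm_num
  rw [Finset.prod_congr rfl fun r _ => h1 r, Finset.prod_const, Finset.card_univ, card_pairs]

/-- The summand `(σ + 1)/2` of a leg. -/
def legShift (x : Leg d) : ℝ := (((x.2 : ℤ) : ℝ) + 1) / 2

theorem legShift_nonneg (x : Leg d) : 0 ≤ legShift x := (Model.Regular.sign_term x.2).1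

/-- If no mode is touched twice except by a pair, the running net change vanishes at external and
right vertices and equals the right sign σ at a left vertex. Since σ + (-σ + 1)/2 = (σ + 1)/2, the
two square roots of a pair coincide and multiply to ν + (σ + 1)/2. -/
theorem pathAmplitude_eq_of_pairs (hm : m ∈ patterns n N) {w : Fin N → Leg d}
    (hw : ∀ r, w (fstIndex hm r) = -w (sndIndex hm r))
    (hsep : ∀ u v, u ≠ v → pathMode w u = pathMode w v →
      ∃ r, (u = fstIndex hm r ∧ v = sndIndex hm r) ∨ (u = sndIndex hm r ∧ v = fstIndex hm r))
    (ν : Mode d →₀ ℕ) : pathAmplitude w ν =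
      (∏ i, Real.sqrt (ν (pathMode w (extIndex hm i)) + legShift (w (extIndex hm i)))) *
        ∏ r, ((ν (pathMode w (sndIndex hm r)) : ℝ) + legShift (w (sndIndex hm r))) := by
  have hnet : ∀ u, net (fun l => -(w l).1) (fun l => (w l).2) (u.val + 1)
      (touched (-(w u).1) (w u).2) =
        ∑ l : Fin N, if u.val + 1 ≤ l.val ∧ pathMode w l = pathMode w u then ((w l).2 : ℤ) else 0 :=
    fun u => rfl
  have hzero : ∀ u : Fin N, (∀ r, u ≠ fstIndex hm r) →
      net (fun l => -(w l).1) (fun l => (w l).2) (u.val + 1) (touched (-(w u).1) (w u).2) = 0 := by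
    intro u hu
    rw [hnet]
    refine Finset.sum_eq_zero fun l _ => if_neg ?_
    rintro ⟨h1, h2⟩
    have hlu : u ≠ l := by rintro rfl; omega
    obtain ⟨r, ⟨h3, -⟩ | ⟨h3, h4⟩⟩ := hsep u l hlu h2.symm
    · exact hu r h3
    · rw [h3, h4] at h1
      simp only [fstIndex, sndIndex] at h1
      omega
  have hfst : ∀ r, net (fun l => -(w l).1) (fun l => (w l).2) ((fstIndex hm r).val + 1)
      (touched (-(w (fstIndex hm r)).1) (w (fstIndex hm r)).2) = ((w (sndIndex hm r)).2 : ℤ) := by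
    intro r
    have hmode : pathMode w (sndIndex hm r) = pathMode w (fstIndex hm r) := by
      rw [pathMode, pathMode, hw, touched_leg_neg]
    rw [hnet, Finset.sum_eq_single (sndIndex hm r)]
    · exact if_pos ⟨le_refl _, hmode⟩
    · intro l _ hl
      refine if_neg ?_
      rintro ⟨h1, h2⟩
      have hlu : fstIndex hm r ≠ l := by rintro rfl; omega
      obtain ⟨r', ⟨h3, h4⟩ | ⟨h3, -⟩⟩ := hsep _ l hlu h2.symm
      · rw [← fstIndex_injective hm h3] at h4
        exact hl h4
      · exact fstIndex_ne_sndIndex hm _ _ h3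
    · exact fun hn => absurd (Finset.mem_univ _) hn
  rw [pathAmplitude, amplitude, prod_vertices hm]
  congr 1
  · refine Finset.prod_congr rfl fun i _ => ?_
    rw [hzero _ fun r => extIndex_ne_fstIndex hm i r]
    simp only [Int.cast_zero, add_zero]
    rfl
  · refine Finset.prod_congr rfl fun r _ => ?_
    rw [hzero _ fun r' => (fstIndex_ne_sndIndex hm r' r).symm, hfst, hw, touched_leg_neg,
      Prod.snd_neg]
    have h1 : (ν (touched (-(w (sndIndex hm r)).1) (w (sndIndex hm r)).2) : ℝ) +
        (((w (sndIndex hm r)).2 : ℤ) : ℝ) + (((-(w (sndIndex hm r)).2 : ℤˣ) : ℤ) + 1 : ℝ) / 2 =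
        ν (pathMode w (sndIndex hm r)) + legShift (w (sndIndex hm r)) := by
      rw [pathMode, legShift]
      push_cast
      ring
    have h2 : (ν (touched (-(w (sndIndex hm r)).1) (w (sndIndex hm r)).2) : ℝ) + ((0 : ℤ) : ℝ) +
        (((w (sndIndex hm r)).2 : ℤ) + 1 : ℝ) / 2 =
        ν (pathMode w (sndIndex hm r)) + legShift (w (sndIndex hm r)) := by
      rw [pathMode, legShift]
      push_cast
      ring
    rw [h1, h2]
    exact Real.mul_self_sqrt (add_nonneg (Nat.cast_nonneg _) (legShift_nonneg _))

end Amplitude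

/-! ### Families of legs whose changes of occupation numbers cancel -/

section Classes

variable {d : ℕ}

/-- The mode whose occupation number is changed by a leg. -/
def legMode (x : Leg d) : Mode d := touched (-x.1) x.2

/-- A momentum up to sign. -/
def legClass (x : Leg d) : Sym2 (Mode d) := s(x.1, -x.1)

theorem legClass_eq_iff {x y : Leg d} : legClass x = legClass y ↔ x.1 = y.1 ∨ x.1 = -y.1 := by
  rw [legClass, legClass, Sym2.eq_iff]
  constructor
  · rintro (h | h)
    · exact Or.inl h.1
    · exact Or.inr h.1
  · rintro (h | h)
    · exact Or.inl ⟨h, by rw [h]⟩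
    · exact Or.inr ⟨h, by rw [h, neg_neg]⟩

theorem legClass_neg (x : Leg d) : legClass (-x) = legClass x :=
  legClass_eq_iff.2 (Or.inr rfl)

theorem legMode_eq (x : Leg d) : (x.2 = 1 ∧ legMode x = -x.1) ∨ (x.2 = -1 ∧ legMode x = x.1) := by
  rcases Int.units_eq_one_or x.2 with h | h
  · exact Or.inl ⟨h, by rw [legMode, h, touched_one]⟩
  · exact Or.inr ⟨h, by rw [legMode, h, touched_neg_one, neg_neg]⟩

theorem legClass_eq_of_legMode_eq {x y : Leg d} (h : legMode x = legMode y) :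
    legClass x = legClass y := by
  rw [legClass_eq_iff]
  rcases legMode_eq x with ⟨-, h1⟩ | ⟨-, h1⟩ <;> rcases legMode_eq y with ⟨-, h2⟩ | ⟨-, h2⟩ <;>
    rw [h1, h2] at h
  · exact Or.inl (neg_injective h)
  · exact Or.inr (by rw [← h, neg_neg])
  · exact Or.inr h
  · exact Or.inl h

theorem legNet_eq_zero {κ : Mode d} {x : Leg d} (h : legMode x ≠ κ) : legNet κ x = 0 := if_neg h

/-- Cancellation means the same mode with opposite signs, and a mode together with a sign determines
the momentum of the leg. -/
theorem eq_neg_of_legNet {x y : Leg d}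
    (h : legNet (legMode x) x + legNet (legMode x) y = 0) : y = -x := by
  have h1 : legNet (legMode x) x = (x.2 : ℤ) := if_pos rfl
  rw [h1, legNet] at h
  split_ifs at h with hy
  · change legMode y = legMode x at hy
    rcases legMode_eq x with ⟨hx1, hx2⟩ | ⟨hx1, hx2⟩ <;>
      rcases legMode_eq y with ⟨hy1, hy2⟩ | ⟨hy1, hy2⟩ <;> rw [hx1, hy1] at h
    · norm_num at h
    · exact Prod.ext (by rw [← hy2, hy, hx2]; rfl) (by rw [hy1, Prod.snd_neg, hx1])
    · refine Prod.ext ?_ (by rw [hy1, Prod.snd_neg, hx1, neg_neg])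
      rw [Prod.fst_neg, ← hx2, ← hy, hy2, neg_neg]
    · norm_num at h
  · rcases Int.units_eq_one_or x.2 with h2 | h2 <;> rw [h2] at h <;> norm_num at h

variable {V : Type*} [Fintype V] {N : ℕ}

/-- With 2N points, at least N fibres and at least two points in each, a fibre of three points would
make the total exceed 2N. -/
theorem eq_of_card_image_ge {B : Type*} [DecidableEq B] {f : V → B}
    (hV : Fintype.card V = 2 * N) (hf : N ≤ (Finset.univ.image f).card)
    (hp : ∀ v, ∃ w, w ≠ v ∧ f v = f w) {v w w' : V} (hw : f v = f w) (hw' : f v = f w')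
    (h1 : v ≠ w) (h2 : v ≠ w') : w = w' := by
  classical
  by_contra h3
  have hcard := Finset.card_eq_sum_card_image f (Finset.univ : Finset V)
  have htwo : ∀ b ∈ Finset.univ.image f, 2 ≤ (Finset.univ.filter fun u => f u = b).card := by
    intro b hb
    obtain ⟨u, -, rfl⟩ := Finset.mem_image.1 hb
    obtain ⟨u', hu', hu⟩ := hp u
    exact Finset.one_lt_card.2 ⟨u, by simp, u', by simp [hu], hu'.symm⟩
  have hthree : 2 < (Finset.univ.filter fun u => f u = f v).card :=
    Finset.two_lt_card.2 ⟨v, by simp, w, by simp [hw], w', by simp [hw'], h1, h2, h3⟩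
  have hlt := Finset.sum_lt_sum htwo
    ⟨f v, Finset.mem_image_of_mem f (Finset.mem_univ v), hthree⟩
  rw [Finset.sum_const, smul_eq_mul, ← hcard, Finset.card_univ, hV] at hlt
  omega

/-- A family of legs that leaves all occupation numbers unchanged. -/
def Balanced (x : V → Leg d) : Prop := ∀ κ, ∑ v, legNet κ (x v) = 0

variable {x : V → Leg d}

/-- A leg alone in its class would change the occupation of its mode by ±1 with nothing to
compensate. -/
theorem Balanced.exists_partner (hx : Balanced x) (v : V) :
    ∃ w, w ≠ v ∧ legClass (x v) = legClass (x w) := by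
  classical
  by_contra! hn
  have h1 := hx (legMode (x v))
  rw [Finset.sum_eq_single v (fun w _ hw => legNet_eq_zero fun hm => hn w hw
    (legClass_eq_of_legMode_eq hm.symm)) fun h => absurd (Finset.mem_univ _) h] at h1
  have h2 : legNet (legMode (x v)) (x v) = ((x v).2 : ℤ) := if_pos rfl
  rw [h2] at h1
  rcases Int.units_eq_one_or (x v).2 with h | h <;> rw [h] at h1 <;> norm_num at h1

theorem Balanced.partner_unique (hx : Balanced x) (hV : Fintype.card V = 2 * N)
    (hf : N ≤ (Finset.univ.image fun v => legClass (x v)).card) {v w w' : V}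
    (hw : legClass (x v) = legClass (x w)) (hw' : legClass (x v) = legClass (x w'))
    (h1 : v ≠ w) (h2 : v ≠ w') : w = w' :=
  eq_of_card_image_ge hV hf hx.exists_partner hw hw' h1 h2

/-- Legs touching the same mode share a class, so the balance equation of this mode involves at most
the two legs of that class. -/
theorem Balanced.partner_eq_neg (hx : Balanced x) (hV : Fintype.card V = 2 * N)
    (hf : N ≤ (Finset.univ.image fun v => legClass (x v)).card) {v w : V}
    (hw : legClass (x v) = legClass (x w)) (h1 : v ≠ w) : x w = -x v := by
  classical
  refine eq_neg_of_legNet ?_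
  rw [← hx (legMode (x v)), Finset.sum_eq_add v w h1 (fun u _ hu => legNet_eq_zero fun hm => hu.2 ?_)
    (fun h => absurd (Finset.mem_univ _) h) fun h => absurd (Finset.mem_univ _) h]
  exact (hx.partner_unique hV hf hw (legClass_eq_of_legMode_eq hm.symm) h1
    hu.1.symm).symm

end Classes

/-! ### Nondegenerate pairs of paths and their contractions -/

section Pairing

variable {d : ℕ} {P : Model d} {c q : ℝ} {L : ℝ} {n N : ℕ}
  {z : (Fin N → Leg d) × (Fin N → Leg d)}

/-- The legs of a pair of paths, those of the second path being reversed. -/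
def signedLegs (z : (Fin N → Leg d) × (Fin N → Leg d)) : Fin N ⊕ Fin N → Leg d :=
  Sum.elim z.1 fun u => -z.2 u

/-- Pairs of paths whose momenta fall, up to sign, into fewer than `N` classes. -/
def Degenerate (z : (Fin N → Leg d) × (Fin N → Leg d)) : Prop :=
  (Finset.univ.image fun v => legClass (signedLegs z v)).card < N

theorem balanced_iff : Balanced (signedLegs z) ↔ pathNet z.1 = pathNet z.2 := by
  rw [Balanced, funext_iff]
  refine forall_congr' fun κ => ?_
  rw [Fintype.sum_sum_type, pathNet_eq_sum, pathNet_eq_sum]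
  simp only [signedLegs, Sum.elim_inl, Sum.elim_inr, legNet_neg, Finset.sum_neg_distrib]
  rw [← sub_eq_add_neg, sub_eq_zero]

/-- The properties of the legs of a balanced pair of paths that is not degenerate. -/
structure WellPaired (z : (Fin N → Leg d) × (Fin N → Leg d)) : Prop where
  balanced : Balanced (signedLegs z)
  unique : ∀ {v w w'}, legClass (signedLegs z v) = legClass (signedLegs z w) →
    legClass (signedLegs z v) = legClass (signedLegs z w') → v ≠ w → v ≠ w' → w = w'
  eq_neg : ∀ {v w}, legClass (signedLegs z v) = legClass (signedLegs z w) → v ≠ w →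
    signedLegs z w = -signedLegs z v

theorem wellPaired (hb : Balanced (signedLegs z)) (hz : ¬Degenerate z) : WellPaired z := by
  have hV : Fintype.card (Fin N ⊕ Fin N) = 2 * N := by simp [two_mul]
  have hf := not_lt.1 hz
  exact ⟨hb, fun h1 h2 => hb.partner_unique hV hf h1 h2, fun h1 => hb.partner_eq_neg hV hf h1⟩

variable {m m' : Fin (n + 1) → ℕ} {hm : m ∈ patterns n N} {hm' : m' ∈ patterns n N}
  {π : Equiv.Perm (Fin n)}

theorem Model.matchedWeight_eq_zero (P : Model d) (L : ℝ) (h : ¬Matched hm hm' π z) :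
    P.matchedWeight L hm hm' π z = 0 := if_neg h

theorem Matched.balanced (h : Matched hm hm' π z) : Balanced (signedLegs z) := by
  rw [balanced_iff]
  funext κ
  rw [pathNet_eq_of_pairs hm h.1, pathNet_eq_of_pairs hm' h.2.1,
    ← Equiv.sum_comp π fun i => legNet κ (z.2 (extIndex hm' i))]
  simp only [h.2.2]

theorem Matched.ext_class (h : Matched hm hm' π z) (i : Fin n) :
    legClass (signedLegs z (Sum.inl (extIndex hm i))) =
      legClass (signedLegs z (Sum.inr (extIndex hm' (π i)))) := by
  simp only [signedLegs, Sum.elim_inl, Sum.elim_inr, legClass_neg, h.2.2]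

theorem Matched.left_class (h : Matched hm hm' π z) (r : Pairs m) :
    legClass (signedLegs z (Sum.inl (fstIndex hm r))) =
      legClass (signedLegs z (Sum.inl (sndIndex hm r))) := by
  simp only [signedLegs, Sum.elim_inl, legClass_neg, h.1]

theorem Matched.right_class (h : Matched hm hm' π z) (r : Pairs m') :
    legClass (signedLegs z (Sum.inr (fstIndex hm' r))) =
      legClass (signedLegs z (Sum.inr (sndIndex hm' r))) := by
  simp only [signedLegs, Sum.elim_inr, h.2.1, legClass_neg]

/-- Both permutations send an external leg to a second member of its class, and a class has only two
members. -/
theorem Matched.perm_unique (h : Matched hm hm' π z) (hw : WellPaired z)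
    {π' : Equiv.Perm (Fin n)} (h' : Matched hm hm' π' z) : π' = π := by
  ext i
  have := hw.unique (h.ext_class i) (h'.ext_class i) Sum.inl_ne_inr Sum.inl_ne_inr
  rw [extIndex_injective hm' (Sum.inr_injective this)]

/-- Two cancelling external momenta of one path would lie in one class together with their partner
on the other path, making three members. -/
theorem Matched.admissible_left (h : Matched hm hm' π z) (hw : WellPaired z) :
    Admissible hm fun u => -(z.1 u).1 := by
  refine ⟨fun r => by simp [h.1], fun i i' hi h0 => ?_⟩
  have h1 : legClass (signedLegs z (Sum.inl (extIndex hm i))) =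
      legClass (signedLegs z (Sum.inl (extIndex hm i'))) := by
    refine legClass_eq_iff.2 (Or.inr ?_)
    exact neg_injective (add_eq_zero_iff_eq_neg.1 h0)
  exact Sum.inr_ne_inl (hw.unique (h.ext_class i) h1 Sum.inl_ne_inr
    fun he => hi (extIndex_injective hm (Sum.inl_injective he)))

theorem Matched.admissible_right (h : Matched hm hm' π z) (hw : WellPaired z) :
    Admissible hm' fun u => -(z.2 u).1 := by
  refine ⟨fun r => by simp [h.2.1], fun i i' hi h0 => ?_⟩
  have h1 : legClass (signedLegs z (Sum.inr (extIndex hm' i))) =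
      legClass (signedLegs z (Sum.inr (extIndex hm' i'))) := by
    refine legClass_eq_iff.2 (Or.inr ?_)
    have := add_eq_zero_iff_eq_neg.1 h0
    simpa [signedLegs, neg_eq_iff_eq_neg] using this
  have h2 := h.ext_class (π.symm i)
  rw [Equiv.apply_symm_apply] at h2
  exact Sum.inl_ne_inr (hw.unique h2.symm h1 Sum.inr_ne_inl
    fun he => hi (extIndex_injective hm' (Sum.inr_injective he)))

/-- External signs agree on the two sides, and each pair contributes -1. Both patterns have the same
number (N - n)/2 of pairs. -/
theorem Matched.pathSign_mul (h : Matched hm hm' π z) : pathSign z.1 * pathSign z.2 = 1 := by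
  have h0 : ∑ j, m j = ∑ j, m' j := by
    have h1 := mem_patterns.1 hm
    have h2 := mem_patterns.1 hm'
    omega
  rw [pathSign_eq_of_pairs hm h.1, pathSign_eq_of_pairs hm' h.2.1, h0,
    ← Equiv.prod_comp π fun i => (((z.2 (extIndex hm' i)).2 : ℤ) : ℝ)]
  simp only [h.2.2]
  rw [mul_mul_mul_comm, ← mul_pow, ← Finset.prod_mul_distrib]
  have h1 : ∀ τ : ℤˣ, ((τ : ℤ) : ℝ) * ((τ : ℤ) : ℝ) = 1 := fun τ => by
    rcases Int.units_eq_one_or τ with h | h <;> rw [h] <;> norm_num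
  simp [h1]

/-- Two vertices on the same mode are in the same class, whose only other member is known: for an
external vertex it lies on the other path, for a pair vertex it is its companion. -/
theorem Matched.separated_left (h : Matched hm hm' π z) (hw : WellPaired z) (u v : Fin N)
    (huv : u ≠ v) (hmode : pathMode z.1 u = pathMode z.1 v) :
    ∃ r, (u = fstIndex hm r ∧ v = sndIndex hm r) ∨ (u = sndIndex hm r ∧ v = fstIndex hm r) := by
  have hc : legClass (signedLegs z (Sum.inl u)) = legClass (signedLegs z (Sum.inl v)) :=
    legClass_eq_of_legMode_eq (x := z.1 u) (y := z.1 v) hmode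
  have hne : (Sum.inl u : Fin N ⊕ Fin N) ≠ Sum.inl v := fun he => huv (Sum.inl_injective he)
  rcases vertex_cases hm u with ⟨i, rfl⟩ | ⟨r, rfl⟩ | ⟨r, rfl⟩
  · exact absurd (hw.unique (h.ext_class i) hc Sum.inl_ne_inr hne) Sum.inr_ne_inl
  · refine ⟨r, Or.inl ⟨rfl, Sum.inl_injective (hw.unique hc (h.left_class r) hne fun he => ?_)⟩⟩
    exact fstIndex_ne_sndIndex hm _ _ (Sum.inl_injective he)
  · refine ⟨r, Or.inr ⟨rfl, Sum.inl_injective (hw.unique hc (h.left_class r).symm hne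
      fun he => ?_)⟩⟩
    exact fstIndex_ne_sndIndex hm _ _ (Sum.inl_injective he).symm

theorem Matched.separated_right (h : Matched hm hm' π z) (hw : WellPaired z) (u v : Fin N)
    (huv : u ≠ v) (hmode : pathMode z.2 u = pathMode z.2 v) :
    ∃ r, (u = fstIndex hm' r ∧ v = sndIndex hm' r) ∨
      (u = sndIndex hm' r ∧ v = fstIndex hm' r) := by
  have hc : legClass (signedLegs z (Sum.inr u)) = legClass (signedLegs z (Sum.inr v)) := by
    simp only [signedLegs, Sum.elim_inr, legClass_neg]
    exact legClass_eq_of_legMode_eq hmode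
  have hne : (Sum.inr u : Fin N ⊕ Fin N) ≠ Sum.inr v := fun he => huv (Sum.inr_injective he)
  rcases vertex_cases hm' u with ⟨i, rfl⟩ | ⟨r, rfl⟩ | ⟨r, rfl⟩
  · have h2 := h.ext_class (π.symm i)
    rw [Equiv.apply_symm_apply] at h2
    exact absurd (hw.unique h2.symm hc Sum.inr_ne_inl hne) Sum.inl_ne_inr
  · refine ⟨r, Or.inl ⟨rfl, Sum.inr_injective (hw.unique hc (h.right_class r) hne fun he => ?_)⟩⟩
    exact fstIndex_ne_sndIndex hm' _ _ (Sum.inr_injective he)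
  · refine ⟨r, Or.inr ⟨rfl, Sum.inr_injective (hw.unique hc (h.right_class r).symm hne
      fun he => ?_)⟩⟩
    exact fstIndex_ne_sndIndex hm' _ _ (Sum.inr_injective he).symm

/-- One vertex of each contraction of a matched pair of paths. -/
def contractionVertex (hm : m ∈ patterns n N) (hm' : m' ∈ patterns n N) :
    Fin n ⊕ (Pairs m ⊕ Pairs m') → Fin N ⊕ Fin N :=
  Sum.elim (fun i => Sum.inl (extIndex hm i))
    (Sum.elim (fun r => Sum.inl (sndIndex hm r)) fun r => Sum.inr (sndIndex hm' r))

/-- The leg of one vertex of each contraction of a matched pair of paths. -/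
def contractionLeg (hm : m ∈ patterns n N) (hm' : m' ∈ patterns n N)
    (z : (Fin N → Leg d) × (Fin N → Leg d)) : Fin n ⊕ (Pairs m ⊕ Pairs m') → Leg d :=
  Sum.elim (fun i => z.1 (extIndex hm i))
    (Sum.elim (fun r => z.1 (sndIndex hm r)) fun r => z.2 (sndIndex hm' r))

theorem contractionVertex_injective (hm : m ∈ patterns n N) (hm' : m' ∈ patterns n N) :
    Function.Injective (contractionVertex hm hm') := by
  rintro (i | r | r) (i' | r' | r') h <;>
    simp only [contractionVertex, Sum.elim_inl, Sum.elim_inr, Sum.inl.injEq, Sum.inr.injEq,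
      reduceCtorEq] at h
  · rw [extIndex_injective hm h]
  · exact absurd h (extIndex_ne_sndIndex hm _ _)
  · exact absurd h.symm (extIndex_ne_sndIndex hm _ _)
  · rw [sndIndex_injective hm h]
  · rw [sndIndex_injective hm' h]

theorem legClass_contractionLeg (j : Fin n ⊕ (Pairs m ⊕ Pairs m')) :
    legClass (contractionLeg hm hm' z j) =
      legClass (signedLegs z (contractionVertex hm hm' j)) := by
  rcases j with i | r | r <;>
    simp [contractionLeg, contractionVertex, signedLegs, legClass_neg]

theorem Matched.exists_other (h : Matched hm hm' π z) (j : Fin n ⊕ (Pairs m ⊕ Pairs m')) :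
    ∃ w, legClass (signedLegs z (contractionVertex hm hm' j)) = legClass (signedLegs z w) ∧
      ∀ j', contractionVertex hm hm' j' ≠ w := by
  rcases j with i | r | r
  · refine ⟨_, h.ext_class i, ?_⟩
    rintro (i' | r' | r') <;> simp [contractionVertex, (extIndex_ne_sndIndex hm' _ _).symm]
  · refine ⟨_, (h.left_class r).symm, ?_⟩
    rintro (i' | r' | r') <;> simp [contractionVertex, extIndex_ne_fstIndex hm,
      (fstIndex_ne_sndIndex hm _ _).symm]
  · refine ⟨_, (h.right_class r).symm, ?_⟩
    rintro (i' | r' | r') <;> simp [contractionVertex, (fstIndex_ne_sndIndex hm' _ _).symm]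

/-- Each contraction already fills its class with two vertices, so a shared mode would put a third
vertex into it. Distinctness of the modes is what independence in the Gibbs state requires. -/
theorem Matched.legMode_injective (h : Matched hm hm' π z) (hw : WellPaired z) :
    Function.Injective fun j => legMode (contractionLeg hm hm' z j) := by
  intro j j' hj
  by_contra hne
  have h1 := legClass_eq_of_legMode_eq hj
  rw [legClass_contractionLeg, legClass_contractionLeg] at h1
  obtain ⟨w, h2, h3⟩ := h.exists_other j
  exact h3 j' (hw.unique h1 h2 (fun he => hne (contractionVertex_injective hm hm' he)) (h3 j))

theorem Model.Regular.occupation_legMode (h : P.Regular c q) (L : ℝ) (x : Leg d) :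
    P.occupation (latticePoint L (legMode x)) + legShift x = P.occPlus L x := by
  rw [Model.occPlus, legShift]
  rcases legMode_eq x with ⟨-, h1⟩ | ⟨-, h1⟩ <;> rw [h1]
  rw [latticePoint_neg, h.occupation_neg]

/-- This is the analogue of Wick's rule. The external square roots of the two paths pair up and the
internal ones already have, leaving a product of affine functions of occupations of distinct modes,
whose expectation factorizes. -/
theorem Matched.pairMoment_eq (h : Matched hm hm' π z) (hw : WellPaired z) (hP : P.Regular c q)
    (hZ : Summable (P.gibbsWeight L)) :
    P.pairMoment L z.1 z.2 = P.matchedWeight L hm hm' π z := by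
  rw [Model.matchedWeight, if_pos h, Model.pairMoment]
  have h1 := (Model.hasSum_gibbsProb_prod hP hZ Finset.univ
    (fun j => legMode (contractionLeg hm hm' z j)) (h.legMode_injective hw).injOn
    (fun j => legShift (contractionLeg hm hm' z j)) fun j => legShift_nonneg _).tsum_eq
  simp only [hP.occupation_legMode] at h1
  rw [Fintype.prod_sum_type, Fintype.prod_sum_type, ← mul_assoc] at h1
  refine Eq.trans (tsum_congr fun ν => ?_) h1
  rw [pathAmplitude_eq_of_pairs hm h.1 (h.separated_left hw),
    pathAmplitude_eq_of_pairs hm' h.2.1 (h.separated_right hw)]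
  have h2 : ∏ i, Real.sqrt (ν (pathMode z.2 (extIndex hm' i)) + legShift (z.2 (extIndex hm' i))) =
      ∏ i, Real.sqrt (ν (pathMode z.1 (extIndex hm i)) + legShift (z.1 (extIndex hm i))) := by
    rw [← Equiv.prod_comp π]
    refine Finset.prod_congr rfl fun i _ => ?_
    simp only [pathMode, h.2.2]
  rw [h2, mul_mul_mul_comm, ← Finset.prod_mul_distrib, Fintype.prod_sum_type,
    Fintype.prod_sum_type]
  congr 2
  refine Finset.prod_congr rfl fun i _ => ?_
  exact Real.mul_self_sqrt (add_nonneg (Nat.cast_nonneg _) (legShift_nonneg _))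

/-- The partner of an external vertex cannot be external on the same path, by admissibility, nor
belong to a pair, whose two vertices already fill their class. So it is external on the other path,
and uniqueness of partners makes the assignment injective. -/
theorem WellPaired.exists_matched (hw : WellPaired z) (h1 : Admissible hm fun u => -(z.1 u).1)
    (h2 : Admissible hm' fun u => -(z.2 u).1) : ∃ π, Matched hm hm' π z := by
  have hl : ∀ r, legClass (signedLegs z (Sum.inl (fstIndex hm r))) =
      legClass (signedLegs z (Sum.inl (sndIndex hm r))) := fun r => by
    have := add_eq_zero_iff_eq_neg.1 (h1.1 r)
    exact legClass_eq_iff.2 (Or.inr (neg_injective this))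
  have hr : ∀ r, legClass (signedLegs z (Sum.inr (fstIndex hm' r))) =
      legClass (signedLegs z (Sum.inr (sndIndex hm' r))) := fun r => by
    have := add_eq_zero_iff_eq_neg.1 (h2.1 r)
    exact legClass_eq_iff.2 (Or.inr this)
  have hln : ∀ r, (Sum.inl (fstIndex hm r) : Fin N ⊕ Fin N) ≠ Sum.inl (sndIndex hm r) :=
    fun r he => fstIndex_ne_sndIndex hm _ _ (Sum.inl_injective he)
  have hrn : ∀ r, (Sum.inr (fstIndex hm' r) : Fin N ⊕ Fin N) ≠ Sum.inr (sndIndex hm' r) :=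
    fun r he => fstIndex_ne_sndIndex hm' _ _ (Sum.inr_injective he)
  have hext : ∀ i, ∃ j, legClass (signedLegs z (Sum.inl (extIndex hm i))) =
      legClass (signedLegs z (Sum.inr (extIndex hm' j))) := by
    intro i
    obtain ⟨w, hwi, hc⟩ := hw.balanced.exists_partner (Sum.inl (extIndex hm i))
    rcases w with u | u
    · rcases vertex_cases hm u with ⟨i', rfl⟩ | ⟨r, rfl⟩ | ⟨r, rfl⟩
      · exfalso
        have h3 := hw.eq_neg hc hwi.symm
        refine h1.2 i i' (fun hi => hwi (by rw [hi])) ?_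
        simp only [signedLegs, Sum.elim_inl] at h3
        simp [h3]
      · exfalso
        have := hw.unique hc.symm (hl r) hwi (hln r)
        exact extIndex_ne_sndIndex hm _ _ (Sum.inl_injective this)
      · exfalso
        have := hw.unique hc.symm (hl r).symm hwi (hln r).symm
        exact extIndex_ne_fstIndex hm _ _ (Sum.inl_injective this)
    · rcases vertex_cases hm' u with ⟨i', rfl⟩ | ⟨r, rfl⟩ | ⟨r, rfl⟩
      · exact ⟨i', hc⟩
      · exact absurd (hw.unique hc.symm (hr r) hwi (hrn r)) Sum.inl_ne_inr
      · exact absurd (hw.unique hc.symm (hr r).symm hwi (hrn r).symm) Sum.inl_ne_inr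
  choose f hf using hext
  have hinj : Function.Injective f := by
    intro i i' hi
    by_contra hne
    have h3 := hf i'
    rw [← hi] at h3
    exact hne (extIndex_injective hm (Sum.inl_injective
      (hw.unique (hf i).symm h3.symm Sum.inr_ne_inl Sum.inr_ne_inl)))
  refine ⟨Equiv.ofBijective f (Finite.injective_iff_bijective.1 hinj), fun r => ?_, fun r => ?_,
    fun i => ?_⟩
  · have := hw.eq_neg (hl r).symm (hln r).symm
    exact this
  · have := hw.eq_neg (hr r).symm (hrn r).symm
    exact neg_injective this
  · have := hw.eq_neg (hf i) Sum.inl_ne_inr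
    exact neg_injective this

/-- For nondegenerate paths the equality is exact, pattern by pattern: if some permutation matches
them it is the only one and both sides are the same expectation, and if none does, either balance or
a pattern restriction fails. -/
theorem Model.Regular.traceWeight_eq (hP : P.Regular c q) (hZ : Summable (P.gibbsWeight L))
    (hz : ¬Degenerate z) : P.traceWeight L n z = ∑ m : patterns n N, ∑ m' : patterns n N,
      ∑ π : Equiv.Perm (Fin n), P.matchedWeight L m.2 m'.2 π z := by
  classical
  have h1 : P.traceWeight L n z = ∑ m : patterns n N, ∑ m' : patterns n N,
      (if pathNet z.1 = pathNet z.2 then patternWeight m.1 (fun u => -(z.1 u).1) *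
        patternWeight m'.1 (fun u => -(z.2 u).1) * (pathSign z.1 * pathSign z.2) else 0) *
          P.pairMoment L z.1 z.2 := by
    rw [Model.traceWeight, pairCoefficient]
    simp only [← Finset.sum_mul]
    congr 1
    split_ifs
    · simp only [← Finset.sum_mul, ← Finset.mul_sum, patternSum]
      rw [Finset.sum_coe_sort (patterns n N) fun m => patternWeight m fun u => -(z.1 u).1,
        Finset.sum_coe_sort (patterns n N) fun m => patternWeight m fun u => -(z.2 u).1]
    · simp
  rw [h1]
  refine Finset.sum_congr rfl fun m _ => Finset.sum_congr rfl fun m' _ => ?_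
  by_cases hπ : ∃ π, Matched m.2 m'.2 π z
  · obtain ⟨π, hπ⟩ := hπ
    have hw := wellPaired hπ.balanced hz
    rw [Finset.sum_eq_single π (fun π' _ hne => P.matchedWeight_eq_zero L fun h => hne (hπ.perm_unique hw h))
      fun h => absurd (Finset.mem_univ _) h, if_pos (balanced_iff.1 hπ.balanced),
      patternWeight_eq m.2, patternWeight_eq m'.2, if_pos (hπ.admissible_left hw),
      if_pos (hπ.admissible_right hw), hπ.pathSign_mul, hπ.pairMoment_eq hw hP hZ]
    ring
  · rw [Finset.sum_eq_zero fun π _ => P.matchedWeight_eq_zero L fun h => hπ ⟨π, h⟩]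
    refine mul_eq_zero_of_left ?_ _
    split_ifs with hb
    · have hw := wellPaired (balanced_iff.2 hb) hz
      rw [patternWeight_eq m.2, patternWeight_eq m'.2]
      by_cases ha : Admissible m.2 fun u => -(z.1 u).1
      · rw [if_neg fun ha' => hπ (hw.exists_matched ha ha')]
        simp
      · rw [if_neg ha]
        simp
    · rfl

end Pairing

/-! ### Degenerate pairs of paths -/

section Degenerate

open scoped ENNReal

variable {d : ℕ} {P : Model d} {c q : ℝ} {L : ℝ} {n N : ℕ}

theorem signedLegs_injective : Function.Injective (signedLegs (d := d) (N := N)) := by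
  rintro ⟨w, w'⟩ ⟨v, v'⟩ h
  refine Prod.ext (funext fun u => ?_) (funext fun u => ?_)
  · exact congrFun h (Sum.inl u)
  · exact neg_injective (congrFun h (Sum.inr u))

theorem Model.Regular.formProduct_signedLegs (h : P.Regular c q) (L : ℝ)
    (z : (Fin N → Leg d) × (Fin N → Leg d)) :
    |P.formProduct L z.1| * |P.formProduct L z.2| =
      ∏ v, |P.Q (latticePoint L (signedLegs z v).1)| := by
  rw [Fintype.prod_sum_type, Model.formProduct, Model.formProduct, Finset.abs_prod,
    Finset.abs_prod]
  simp [signedLegs, latticePoint_neg, h.even_Q]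

/-- Representatives of the classes of a degenerate family, and the signs relative to them. -/
abbrev ClassData (N : ℕ) : Type :=
  Finset (Fin N ⊕ Fin N) × (Fin N ⊕ Fin N → Fin N ⊕ Fin N) × (Fin N ⊕ Fin N → ℤˣ)

/-- The families whose momenta are determined by those of fewer than `N` representatives. -/
def classSet (d : ℕ) (δ : ClassData N) : Set (Fin N ⊕ Fin N → Leg d) :=
  {x | δ.1.card < N ∧ ∀ v, δ.2.1 v ∈ δ.1 ∧ (x v).1 = (δ.2.2 v : ℤ) • (x (δ.2.1 v)).1}

/-- One representative is chosen in each class; every momentum is then plus or minus that of its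
representative. -/
theorem Degenerate.exists_classSet {z : (Fin N → Leg d) × (Fin N → Leg d)} (hz : Degenerate z) :
    ∃ δ, signedLegs z ∈ classSet d δ := by
  classical
  let S := Finset.univ.image fun v => legClass (signedLegs z v)
  have hS : ∀ v, legClass (signedLegs z v) ∈ S := fun v =>
    Finset.mem_image_of_mem _ (Finset.mem_univ v)
  choose g hg using fun b : S => Finset.mem_image.1 b.2
  have hε : ∀ v, ∃ ε : ℤˣ, (signedLegs z v).1 =
      (ε : ℤ) • (signedLegs z (g ⟨legClass (signedLegs z v), hS v⟩)).1 := by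
    intro v
    rcases legClass_eq_iff.1 (hg ⟨legClass (signedLegs z v), hS v⟩).2 with h | h
    · exact ⟨1, by rw [h]; simp⟩
    · exact ⟨-1, by rw [h]; simp⟩
  choose ε hε using hε
  refine ⟨(S.attach.image g, fun v => g ⟨_, hS v⟩, ε), ?_, fun v => ⟨?_, hε v⟩⟩
  · refine Finset.card_image_le.trans_lt ?_
    rw [Finset.card_attach]
    exact hz
  · exact Finset.mem_image_of_mem _ (Finset.mem_attach _ _)

/-- The momenta of the representatives together with all signs. -/
def classRestrict (δ : ClassData N) (x : Fin N ⊕ Fin N → Leg d) :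
    (δ.1 → Mode d) × (Fin N ⊕ Fin N → ℤˣ) := (fun r => (x r).1, fun v => (x v).2)

theorem classRestrict_injOn (δ : ClassData N) :
    Set.InjOn (classRestrict (d := d) δ) (classSet d δ) := by
  intro x hx y hy h
  funext v
  refine Prod.ext ?_ (congrFun (congrArg Prod.snd h) v)
  rw [(hx.2 v).2, (hy.2 v).2]
  congr 1
  exact congrFun (congrArg Prod.fst h) ⟨δ.2.1 v, (hx.2 v).1⟩

theorem decayBound_nonneg : 0 ≤ decayBound d :=
  (integral_nonneg fun k => (decay_pos k).le).trans (integral_decay_latticeMeasure_le le_rfl)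

theorem Model.Regular.summable_Q_mode (h : P.Regular c q) (hL : 0 < L) :
    Summable fun k : Mode d => ‖|P.Q (latticePoint L k)|‖ := by
  refine Summable.of_nonneg_of_le (fun _ => norm_nonneg _) (fun z => ?_)
    ((summable_decay hL).mul_left c)
  rw [Real.norm_eq_abs, abs_abs]
  exact h.Q_le_decay _

theorem Model.Regular.tsum_Q_le (h : P.Regular c q) (hL : 1 ≤ L) :
    ∑' k : Mode d, |P.Q (latticePoint L k)| ≤ L ^ d * (c * decayBound d) := by
  have hL0 : 0 < L := by linarith
  have h1 : Summable fun k : Mode d => |P.Q (latticePoint L k)| := (h.summable_Q_mode hL0).of_norm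
  refine (h1.tsum_le_tsum (fun k => h.Q_le_decay _) ((summable_decay hL0).mul_left c)).trans ?_
  rw [tsum_mul_left, mul_left_comm]
  exact mul_le_mul_of_nonneg_left (tsum_decay_le hL) h.c_nonneg

/-- The constant in the bound for the degenerate pairs of paths. -/
def degenerateBound (d : ℕ) (c : ℝ) (N : ℕ) : ℝ :=
  Fintype.card (ClassData N) * (2 ^ (2 * N) * ((1 + c) ^ (2 * N) * (1 + c * decayBound d) ^ N))

/-- Only the decay at the representatives is kept. The other form factors are bounded by 1 + c, the
1 allowing the exponent to be raised to 2N. -/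
theorem Model.Regular.prod_Q_le (h : P.Regular c q) (L : ℝ) (δ : ClassData N)
    (x : Fin N ⊕ Fin N → Leg d) : ∏ v, |P.Q (latticePoint L (x v).1)| ≤
      (1 + c) ^ (2 * N) * ∏ r : δ.1, |P.Q (latticePoint L ((classRestrict δ x).1 r))| := by
  classical
  rw [← Finset.prod_sdiff (Finset.subset_univ δ.1)]
  have h1 : ∏ r : δ.1, |P.Q (latticePoint L ((classRestrict δ x).1 r))| =
      ∏ v ∈ δ.1, |P.Q (latticePoint L (x v).1)| :=
    Finset.prod_coe_sort δ.1 fun v => |P.Q (latticePoint L (x v).1)|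
  rw [h1]
  refine mul_le_mul_of_nonneg_right ?_ (Finset.prod_nonneg fun _ _ => abs_nonneg _)
  have hc := h.c_nonneg
  calc ∏ v ∈ Finset.univ \ δ.1, |P.Q (latticePoint L (x v).1)|
      ≤ ∏ _v ∈ Finset.univ \ δ.1, (1 + c) := Finset.prod_le_prod (fun _ _ => abs_nonneg _)
        fun v _ => (h.Q_le_const _).trans (by linarith)
    _ = (1 + c) ^ (Finset.univ \ δ.1).card := Finset.prod_const _
    _ ≤ (1 + c) ^ (2 * N) := by
        refine pow_le_pow_right₀ (by linarith) ((Finset.card_le_univ _).trans_eq ?_)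
        simp [two_mul]

/-- Fewer than N momenta are free, each sum of |Q| costs a multiple of L^d, and the signs are
finitely many. One volume factor is thus left over. -/
theorem Model.Regular.tsum_classSet_le (h : P.Regular c q) (hL : 1 ≤ L) (δ : ClassData N) :
    ENNReal.ofReal (L ^ d) * ∑' x : classSet d δ,
        ENNReal.ofReal (∏ v, |P.Q (latticePoint L ((x : Fin N ⊕ Fin N → Leg d) v).1)|) ≤
      ENNReal.ofReal (2 ^ (2 * N) * ((1 + c) ^ (2 * N) * (1 + c * decayBound d) ^ N) *
        (L ^ d) ^ N) := by
  have hL0 : 0 < L := by linarith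
  have hD : 1 ≤ L ^ d := one_le_pow₀ hL
  have hc := h.c_nonneg
  have hb := decayBound_nonneg (d := d)
  -- The bound on the number of representatives is part of membership, so it is available only from
  -- an element of the set.
  rcases (classSet d δ).eq_empty_or_nonempty with he | ⟨x0, hx0⟩
  · have : IsEmpty (classSet d δ) := Set.isEmpty_coe_sort.2 he
    rw [tsum_empty, mul_zero]
    exact zero_le
  have hcard := hx0.1
  let H : (δ.1 → Mode d) × (Fin N ⊕ Fin N → ℤˣ) → ℝ≥0∞ := fun y =>
    ENNReal.ofReal ((1 + c) ^ (2 * N) * ∏ r : δ.1, |P.Q (latticePoint L (y.1 r))|)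
  have h1 : ∑' x : classSet d δ,
      ENNReal.ofReal (∏ v, |P.Q (latticePoint L ((x : Fin N ⊕ Fin N → Leg d) v).1)|) ≤
        ∑' y, H y := by
    refine (ENNReal.tsum_le_tsum fun x => ?_).trans
      (ENNReal.tsum_comp_le_tsum_of_injective (classRestrict_injOn δ).injective H)
    exact ENNReal.ofReal_le_ofReal (h.prod_Q_le L δ _)
  have h2 : Summable fun y : δ.1 → Mode d => ∏ r, |P.Q (latticePoint L (y r))| :=
    (summable_norm_prod (f := fun (_ : δ.1) (k : Mode d) => |P.Q (latticePoint L k)|)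
      fun _ => h.summable_Q_mode hL0).of_norm
  have h3 : ∑' y, H y = ENNReal.ofReal (2 ^ (2 * N) * ((1 + c) ^ (2 * N) *
      (∑' k, |P.Q (latticePoint L k)|) ^ δ.1.card)) := by
    rw [ENNReal.tsum_prod']
    simp only [H, tsum_fintype, Finset.sum_const, Finset.card_univ, nsmul_eq_mul]
    rw [ENNReal.tsum_mul_left, ← ENNReal.ofReal_tsum_of_nonneg
      (fun y => mul_nonneg (by positivity) (Finset.prod_nonneg fun _ _ => abs_nonneg _))
      (h2.mul_left _), tsum_mul_left, tsum_prod_eq (f := fun (_ : δ.1) (k : Mode d) =>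
        |P.Q (latticePoint L k)|) fun _ => h.summable_Q_mode hL0, Finset.prod_const,
      Finset.card_univ, Fintype.card_coe,
      ENNReal.ofReal_mul (by positivity : (0 : ℝ) ≤ 2 ^ (2 * N))]
    congr 1
    have h4 : Fintype.card (Fin N ⊕ Fin N → ℤˣ) = 2 ^ (2 * N) := by
      rw [Fintype.card_fun]
      simp [two_mul]
    rw [h4, ENNReal.ofReal_pow (by norm_num : (0 : ℝ) ≤ 2)]
    simp
  have hQ := h.tsum_Q_le hL
  have hQ0 : 0 ≤ ∑' k : Mode d, |P.Q (latticePoint L k)| := tsum_nonneg fun _ => abs_nonneg _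
  refine (mul_le_mul_right (h1.trans_eq h3) _).trans ?_
  rw [← ENNReal.ofReal_mul (by positivity)]
  refine ENNReal.ofReal_le_ofReal ?_
  -- The strict inequality card < N leaves room for the extra factor L^d, and L ≥ 1 allows raising
  -- the exponent card + 1 to N.
  have h5 : L ^ d * (∑' k : Mode d, |P.Q (latticePoint L k)|) ^ δ.1.card ≤
      (1 + c * decayBound d) ^ N * (L ^ d) ^ N := by
    have h6 : 0 ≤ c * decayBound d := mul_nonneg hc hb
    calc L ^ d * (∑' k : Mode d, |P.Q (latticePoint L k)|) ^ δ.1.card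
        ≤ L ^ d * (L ^ d * (1 + c * decayBound d)) ^ δ.1.card := by
          gcongr
          exact hQ.trans (mul_le_mul_of_nonneg_left (by linarith) (by positivity))
      _ = (1 + c * decayBound d) ^ δ.1.card * (L ^ d) ^ (δ.1.card + 1) := by
          rw [mul_pow, pow_succ]; ring
      _ ≤ (1 + c * decayBound d) ^ N * (L ^ d) ^ N := by
          refine mul_le_mul (pow_le_pow_right₀ (by linarith) hcard.le)
            (pow_le_pow_right₀ hD hcard) (by positivity) (by positivity)
  calc L ^ d * (2 ^ (2 * N) * ((1 + c) ^ (2 * N) *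
        (∑' k : Mode d, |P.Q (latticePoint L k)|) ^ δ.1.card))
      = 2 ^ (2 * N) * ((1 + c) ^ (2 * N) *
        (L ^ d * (∑' k : Mode d, |P.Q (latticePoint L k)|) ^ δ.1.card)) := by ring
    _ ≤ 2 ^ (2 * N) * ((1 + c) ^ (2 * N) * ((1 + c * decayBound d) ^ N * (L ^ d) ^ N)) := by
        gcongr
    _ = _ := by ring

-- A union bound over `ClassData N`, a finite set whose size does not depend on L.
open Classical in
theorem Model.Regular.tsum_degenerate_le (h : P.Regular c q) (hL : 1 ≤ L) (N : ℕ) :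
    L ^ d * ∑' z : (Fin N → Leg d) × (Fin N → Leg d), (if Degenerate z then
        |P.formProduct L z.1| * |P.formProduct L z.2| else 0) ≤
      degenerateBound d c N * (L ^ d) ^ N := by
  have hL0 : 0 < L := by linarith
  have hc := h.c_nonneg
  have hb := decayBound_nonneg (d := d)
  have h0 : ∀ z : (Fin N → Leg d) × (Fin N → Leg d), 0 ≤ (if Degenerate z then
        |P.formProduct L z.1| * |P.formProduct L z.2| else 0) := fun z => by
    split_ifs <;> positivity
  have hs : Summable fun z : (Fin N → Leg d) × (Fin N → Leg d) => (if Degenerate z then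
        |P.formProduct L z.1| * |P.formProduct L z.2| else 0) := by
    refine Summable.of_nonneg_of_le h0 (fun z => ?_) (h.summable_formProduct_mul hL0)
    split_ifs
    · exact le_rfl
    · positivity
  have hb' : 0 ≤ degenerateBound d c N := by unfold degenerateBound; positivity
  rw [← ENNReal.ofReal_le_ofReal_iff (by positivity), ENNReal.ofReal_mul (by positivity),
    ENNReal.ofReal_tsum_of_nonneg h0 hs]
  let G : (Fin N ⊕ Fin N → Leg d) → ℝ≥0∞ := fun x =>
    ENNReal.ofReal (∏ v, |P.Q (latticePoint L (x v).1)|)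
  have h1 : ∀ z : (Fin N → Leg d) × (Fin N → Leg d), ENNReal.ofReal (if Degenerate z then
      |P.formProduct L z.1| * |P.formProduct L z.2| else 0) ≤
        ∑ δ : ClassData N, (classSet d δ).indicator G (signedLegs z) := by
    intro z
    split_ifs with hz
    · obtain ⟨δ, hδ⟩ := hz.exists_classSet
      refine le_trans ?_ (Finset.single_le_sum (f := fun δ : ClassData N =>
        (classSet d δ).indicator G (signedLegs z)) (fun _ _ => zero_le) (Finset.mem_univ δ))
      rw [Set.indicator_of_mem hδ, h.formProduct_signedLegs]
    · simp
  have h2 : ∀ δ : ClassData N, ENNReal.ofReal (L ^ d) *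
      ∑' z : (Fin N → Leg d) × (Fin N → Leg d), (classSet d δ).indicator G (signedLegs z) ≤
      ENNReal.ofReal (2 ^ (2 * N) * ((1 + c) ^ (2 * N) * (1 + c * decayBound d) ^ N) *
        (L ^ d) ^ N) := by
    intro δ
    refine le_trans (mul_le_mul_right ?_ _) (h.tsum_classSet_le hL δ)
    rw [tsum_subtype (classSet d δ) G]
    exact ENNReal.tsum_comp_le_tsum_of_injective signedLegs_injective _
  calc ENNReal.ofReal (L ^ d) * ∑' z : (Fin N → Leg d) × (Fin N → Leg d),
        ENNReal.ofReal (if Degenerate z then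
          |P.formProduct L z.1| * |P.formProduct L z.2| else 0)
      ≤ ENNReal.ofReal (L ^ d) * ∑' z : (Fin N → Leg d) × (Fin N → Leg d),
          ∑ δ : ClassData N, (classSet d δ).indicator G (signedLegs z) :=
        mul_le_mul_right (ENNReal.tsum_le_tsum h1) _
    _ = ∑ δ : ClassData N, ENNReal.ofReal (L ^ d) *
          ∑' z : (Fin N → Leg d) × (Fin N → Leg d),
            (classSet d δ).indicator G (signedLegs z) := by
        rw [Summable.tsum_finsetSum fun _ _ => ENNReal.summable, Finset.mul_sum]
    _ ≤ ∑ _δ : ClassData N, ENNReal.ofReal (2 ^ (2 * N) * ((1 + c) ^ (2 * N) *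
          (1 + c * decayBound d) ^ N) * (L ^ d) ^ N) := Finset.sum_le_sum fun δ _ => h2 δ
    _ = ENNReal.ofReal (degenerateBound d c N * (L ^ d) ^ N) := by
        rw [Finset.sum_const, nsmul_eq_mul, Finset.card_univ, degenerateBound,
          mul_assoc (Fintype.card (ClassData N) : ℝ), ENNReal.ofReal_mul (Nat.cast_nonneg _),
          ENNReal.ofReal_natCast]

end Degenerate

/-! ### The representation formula over the dual lattice -/

section LatticeFormula

variable {d : ℕ} {P : Model d} {c q : ℝ} {L : ℝ} {n N : ℕ}
  {γ : ElectronSpace d →L[ℂ] ElectronSpace d}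

theorem IsDensityMatrix.summable_element_mul (hγ : IsDensityMatrix γ) {F : Mode d → ℂ} {B : ℝ}
    (hF : ∀ p, ‖F p‖ ≤ B) : Summable fun p => electronElement γ p p * F p := by
  refine Summable.of_norm_bounded (hγ.hasSum_norm.summable.mul_right B) fun p => ?_
  rw [norm_mul]
  exact mul_le_mul_of_nonneg_left (hF p) (norm_nonneg _)

theorem IsDensityMatrix.norm_tsum_element_mul_le (hγ : IsDensityMatrix γ) {F : Mode d → ℂ} {B : ℝ}
    (hF : ∀ p, ‖F p‖ ≤ B) : ‖∑' p, electronElement γ p p * F p‖ ≤ B := by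
  have h1 := hγ.hasSum_norm.mul_right B
  rw [one_mul] at h1
  refine tsum_of_norm_bounded h1 fun p => ?_
  rw [norm_mul]
  exact mul_le_mul_of_nonneg_left (hF p) (norm_nonneg _)

/-- The sum over patterns and permutations at fixed electron momentum. -/
def Model.cTotal (P : Model d) (κ : Measure (Momentum d)) (L t : ℝ) (n N : ℕ) (p : Mode d) : ℂ :=
  ∑ m : patterns n N, ∑ m' : patterns n N, ∑ π : Equiv.Perm (Fin n),
    P.cInner κ L N m.1 m'.1 π t p

theorem Model.Regular.sumC_eq (h : P.Regular c q) (hL : 0 < L) (hγ : IsDensityMatrix γ)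
    (κ : Measure (Momentum d)) {t : ℝ} (ht : 0 ≤ t) (n N : ℕ) :
    P.sumC κ L γ t n N = (P.coupling : ℂ) ^ (2 * N) *
      ∑' p, electronElement γ p p * P.cTotal κ L t n N p := by
  have h1 : P.sumC κ L γ t n N = ∑ m : patterns n N, ∑ m' : patterns n N,
      ∑ π : Equiv.Perm (Fin n), P.C κ L γ N m.1 m'.1 π t := by
    rw [Model.sumC, ← Finset.sum_coe_sort (patterns n N)]
    refine Finset.sum_congr rfl fun m _ => ?_
    rw [← Finset.sum_coe_sort (patterns n N)]
  have hs : ∀ (m m' : patterns n N) (π : Equiv.Perm (Fin n)), Summable fun p =>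
      electronElement γ p p * P.cInner κ L N m.1 m'.1 π t p := fun m m' π =>
    hγ.summable_element_mul fun p => h.norm_cInner_le hL m.2 m'.2 π ht p
  simp only [h1, Model.cTotal, Finset.mul_sum]
  rw [Summable.tsum_finsetSum fun m _ => summable_sum fun m' _ => summable_sum fun π _ =>
    hs m m' π, Finset.mul_sum]
  refine Finset.sum_congr rfl fun m _ => ?_
  rw [Summable.tsum_finsetSum fun m' _ => summable_sum fun π _ => hs m m' π, Finset.mul_sum]
  refine Finset.sum_congr rfl fun m' _ => ?_
  rw [Summable.tsum_finsetSum fun π _ => hs m m' π, Finset.mul_sum]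
  exact Finset.sum_congr rfl fun π _ => h.C_eq hL hγ κ m.2 m'.2 π ht

theorem Model.Regular.norm_cTotal_le (h : P.Regular c q) (hL : 0 < L) (κ : Measure (Momentum d))
    {t : ℝ} (ht : 0 ≤ t) (n N : ℕ) (p : Mode d) : ‖P.cTotal κ L t n N p‖ ≤
      ∑ _m : patterns n N, ∑ _m' : patterns n N, ∑ _π : Equiv.Perm (Fin n),
        P.massM (latticeMeasure d L) ^ n * ((1 + P.massM κ) ^ (N + 1) * t ^ N) ^ 2 :=
  norm_sum_le_of_le _ fun m _ => norm_sum_le_of_le _ fun m' _ => norm_sum_le_of_le _ fun π _ =>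
    h.norm_cInner_le hL m.2 m'.2 π ht p

/-- The total weight of a pair of paths in the representation formula. -/
def Model.totalMatchedWeight (P : Model d) (L : ℝ) (n : ℕ)
    (z : (Fin N → Leg d) × (Fin N → Leg d)) : ℝ :=
  ∑ m : patterns n N, ∑ m' : patterns n N, ∑ π : Equiv.Perm (Fin n),
    P.matchedWeight L m.2 m'.2 π z

theorem Model.Regular.occPlus_mem (h : P.Regular c q) (L : ℝ) (x : Leg d) :
    0 ≤ P.occPlus L x ∧ P.occPlus L x ≤ (1 - q)⁻¹ :=
  ⟨add_nonneg (h.occupation_nonneg _) (Model.Regular.sign_term _).1, h.occupation_add_le _ _⟩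

theorem Model.Regular.abs_matchedWeight_le (h : P.Regular c q) {m m' : Fin (n + 1) → ℕ}
    (hm : m ∈ patterns n N) (hm' : m' ∈ patterns n N) (π : Equiv.Perm (Fin n))
    (z : (Fin N → Leg d) × (Fin N → Leg d)) :
    |P.matchedWeight L hm hm' π z| ≤ (1 - q)⁻¹ ^ N := by
  have hq : 0 < 1 - q := by linarith [h.q_lt]
  rw [Model.matchedWeight]
  split_ifs
  · have h1 : ∀ {ι : Type} [Fintype ι] (x : ι → Leg d), 0 ≤ ∏ i, P.occPlus L (x i) ∧
        ∏ i, P.occPlus L (x i) ≤ (1 - q)⁻¹ ^ Fintype.card ι := fun x =>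
      ⟨Finset.prod_nonneg fun i _ => (h.occPlus_mem L _).1,
        (Finset.prod_le_prod (fun i _ => (h.occPlus_mem L _).1)
          fun i _ => (h.occPlus_mem L _).2).trans_eq (by simp)⟩
    have h2 := h1 fun i => z.1 (extIndex hm i)
    have h3 := h1 fun r => z.1 (sndIndex hm r)
    have h4 := h1 fun r => z.2 (sndIndex hm' r)
    rw [abs_of_nonneg (mul_nonneg (mul_nonneg h2.1 h3.1) h4.1)]
    conv_rhs => rw [← sum_patterns_eq hm hm', pow_add, pow_add, ← card_pairs, ← card_pairs]
    rw [Fintype.card_fin] at h2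
    exact mul_le_mul (mul_le_mul h2.2 h3.2 h3.1 (by positivity)) h4.2 h4.1 (by positivity)
  · rw [abs_zero]
    positivity

theorem Model.Regular.cTotal_lattice (h : P.Regular c q) (hL : 0 < L) {t : ℝ} (ht : 0 ≤ t)
    (n N : ℕ) (p : Mode d) :
    (Summable fun z : (Fin N → Leg d) × (Fin N → Leg d) =>
      P.commonFactor L t p z * (P.totalMatchedWeight L n z : ℂ)) ∧
    P.cTotal (latticeMeasure d L) L t n N p = ∑' z : (Fin N → Leg d) × (Fin N → Leg d),
      P.commonFactor L t p z * (P.totalMatchedWeight L n z : ℂ) := by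
  have hs : ∀ (m m' : patterns n N) (π : Equiv.Perm (Fin n)),
      Summable fun z : (Fin N → Leg d) × (Fin N → Leg d) =>
        P.commonFactor L t p z * (P.matchedWeight L m.2 m'.2 π z : ℂ) := fun m m' π =>
    (h.summable_matched hL m.2 m'.2 π ht p).of_norm
  simp only [Model.totalMatchedWeight, Complex.ofReal_sum, Finset.mul_sum]
  refine ⟨summable_sum fun m _ => summable_sum fun m' _ => summable_sum fun π _ => hs m m' π, ?_⟩
  rw [Summable.tsum_finsetSum fun m _ => summable_sum fun m' _ => summable_sum fun π _ =>
    hs m m' π, Model.cTotal]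
  refine Finset.sum_congr rfl fun m _ => ?_
  rw [Summable.tsum_finsetSum fun m' _ => summable_sum fun π _ => hs m m' π]
  refine Finset.sum_congr rfl fun m' _ => ?_
  rw [Summable.tsum_finsetSum fun π _ => hs m m' π]
  exact Finset.sum_congr rfl fun π _ => h.cInner_lattice hL m.2 m'.2 π ht p

/-- A bound for the weights of the pairs of paths. -/
def weightBound (q : ℝ) (n N : ℕ) : ℝ :=
  (patterns n N).card ^ 2 * momentBound q N +
    ∑ _m : patterns n N, ∑ _m' : patterns n N, ∑ _π : Equiv.Perm (Fin n), (1 - q)⁻¹ ^ N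

theorem Model.Regular.abs_weight_sub_le (h : P.Regular c q) (hZ : Summable (P.gibbsWeight L))
    (z : (Fin N → Leg d) × (Fin N → Leg d)) :
    |P.traceWeight L n z - P.totalMatchedWeight L n z| ≤ weightBound q n N :=
  (abs_sub _ _).trans (add_le_add (h.abs_traceWeight_le hZ n z)
    (Finset.abs_sum_le_sum_abs _ _ |>.trans <| Finset.sum_le_sum fun m _ =>
      Finset.abs_sum_le_sum_abs _ _ |>.trans <| Finset.sum_le_sum fun m' _ =>
        Finset.abs_sum_le_sum_abs _ _ |>.trans <| Finset.sum_le_sum fun π _ =>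
          h.abs_matchedWeight_le m.2 m'.2 π z))

/-- Only degenerate pairs survive in the difference. The prefactor L^{-dN} against at most
L^{d(N-1)} from the sums leaves L^{-d}, uniformly in p. -/
theorem Model.Regular.norm_trace_sub_cTotal_le (h : P.Regular c q) (hL : 1 ≤ L)
    (hZ : Summable (P.gibbsWeight L)) {t : ℝ} (ht : 0 ≤ t) (n N : ℕ) (p : Mode d) :
    ‖(∑' z : (Fin N → Leg d) × (Fin N → Leg d),
        P.commonFactor L t p z * (P.traceWeight L n z : ℂ)) -
      P.cTotal (latticeMeasure d L) L t n N p‖ ≤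
        t ^ N * t ^ N * weightBound q n N * degenerateBound d c N * (L ^ d)⁻¹ := by
  classical
  have hL0 : 0 < L := by linarith
  have hD : 0 < L ^ d := by positivity
  obtain ⟨hs, he⟩ := h.cTotal_lattice hL0 ht n N p
  have ht' := (h.summable_trace (N := N) hL0 hZ ht n p).of_norm
  rw [he, ← ht'.tsum_sub hs]
  have hd := h.tsum_degenerate_le hL N
  have hG := h.summable_formProduct_mul (N := N) hL0
  have hG' : Summable fun z : (Fin N → Leg d) × (Fin N → Leg d) => (if Degenerate z then
        |P.formProduct L z.1| * |P.formProduct L z.2| else 0) := by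
    refine Summable.of_nonneg_of_le (fun z => ?_) (fun z => ?_) hG
    · split_ifs <;> positivity
    · split_ifs
      · exact le_rfl
      · positivity
  -- Any pair of paths bounds the constant from below by an absolute value; the zero momenta serve
  -- as a witness.
  have hw : 0 ≤ weightBound q n N := (abs_nonneg _).trans
    (h.abs_weight_sub_le hZ (fun _ => (0, 1), fun _ => (0, 1)))
  have h1 : ∀ z : (Fin N → Leg d) × (Fin N → Leg d),
      ‖P.commonFactor L t p z * (P.traceWeight L n z : ℂ) -
        P.commonFactor L t p z * (P.totalMatchedWeight L n z : ℂ)‖ ≤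
      (L ^ d)⁻¹ ^ N * (t ^ N * t ^ N) * weightBound q n N *
        (if Degenerate z then |P.formProduct L z.1| * |P.formProduct L z.2| else 0) := by
    intro z
    rw [← mul_sub, ← Complex.ofReal_sub]
    split_ifs with hz
    · rw [norm_mul, Complex.norm_real, Real.norm_eq_abs]
      calc _ ≤ ((L ^ d)⁻¹ ^ N * (t ^ N * t ^ N) *
            (|P.formProduct L z.1| * |P.formProduct L z.2|)) * weightBound q n N :=
            mul_le_mul (P.norm_commonFactor_le hL0 ht p z) (h.abs_weight_sub_le hZ z)
              (abs_nonneg _) (by positivity)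
        _ = _ := by ring
    · rw [h.traceWeight_eq hZ hz, Model.totalMatchedWeight, sub_self]
      simp
  refine (tsum_of_norm_bounded (hG'.mul_left _).hasSum h1).trans ?_
  rw [tsum_mul_left]
  have h2 : ∑' z : (Fin N → Leg d) × (Fin N → Leg d), (if Degenerate z then
        |P.formProduct L z.1| * |P.formProduct L z.2| else 0) ≤
      (L ^ d)⁻¹ * (degenerateBound d c N * (L ^ d) ^ N) := by
    rwa [← div_eq_inv_mul, le_div_iff₀' hD]
  refine (mul_le_mul_of_nonneg_left h2 (by positivity)).trans_eq ?_
  have h3 : (L ^ d)⁻¹ ^ N * (L ^ d) ^ N = 1 := by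
    rw [← mul_pow, inv_mul_cancel₀ hD.ne', one_pow]
  linear_combination (t ^ N * t ^ N * weightBound q n N * degenerateBound d c N * (L ^ d)⁻¹) * h3

/-- The pointwise error of order L^{-d} is averaged against the weights γ(p, p) of total mass one. A
positive dimension makes it vanish in the limit. -/
theorem Model.Regular.tendsto_lattice_formula (h : P.Regular c q) (hd : d ≠ 0)
    (hZ : ∀ L : ℝ, 0 < L → Summable (P.gibbsWeight L))
    {γ : ℝ → ElectronSpace d →L[ℂ] ElectronSpace d}
    (hγ : ∀ L : ℝ, 0 < L → IsDensityMatrix (γ L)) {t : ℝ} (ht : 0 ≤ t) (n N : ℕ) :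
    Tendsto (fun L : ℝ =>
      ‖P.expandedTrace L (γ L) t n N - P.sumC (latticeMeasure d L) L (γ L) t n N‖)
      atTop (𝓝 0) := by
  have h0 : Tendsto (fun L : ℝ => ‖(P.coupling : ℂ) ^ (2 * N)‖ *
      (t ^ N * t ^ N * weightBound q n N * degenerateBound d c N * (L ^ d)⁻¹)) atTop (𝓝 0) := by
    have h1 : Tendsto (fun L : ℝ => (L ^ d)⁻¹) atTop (𝓝 0) :=
      tendsto_inv_atTop_zero.comp (tendsto_pow_atTop hd)
    have h2 := (h1.const_mul (t ^ N * t ^ N * weightBound q n N * degenerateBound d c N)).const_mul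
      ‖(P.coupling : ℂ) ^ (2 * N)‖
    simpa only [mul_zero] using h2
  refine squeeze_zero' (Eventually.of_forall fun L => norm_nonneg _) ?_ h0
  filter_upwards [eventually_ge_atTop (1 : ℝ)] with L hL
  have hL0 : 0 < L := by linarith
  have hg := hγ L hL0
  rw [h.expandedTrace_eq hL0 (hZ L hL0) hg ht, h.sumC_eq hL0 hg _ ht, ← mul_sub, norm_mul]
  refine mul_le_mul_of_nonneg_left ?_ (norm_nonneg _)
  -- A bound uniform in p makes the electron sum of the trace terms converge; it comes from the
  -- representation formula plus the error just estimated.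
  have hb : ∀ p, ‖∑' z : (Fin N → Leg d) × (Fin N → Leg d),
      P.commonFactor L t p z * (P.traceWeight L n z : ℂ)‖ ≤ _ := fun p =>
    (norm_le_norm_add_norm_sub' _ (P.cTotal (latticeMeasure d L) L t n N p)).trans
      (add_le_add (h.norm_cTotal_le hL0 (latticeMeasure d L) ht n N p)
        (h.norm_trace_sub_cTotal_le hL (hZ L hL0) ht n N p))
  rw [← (hg.summable_element_mul hb).tsum_sub
    (hg.summable_element_mul (h.norm_cTotal_le hL0 _ ht n N))]
  simp only [← mul_sub]
  exact hg.norm_tsum_element_mul_le fun p => h.norm_trace_sub_cTotal_le hL (hZ L hL0) ht n N p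

end LatticeFormula

/-! ### The infinite volume limit of the internal momentum integrals -/

section VolumeLimit

variable {d : ℕ} {P : Model d} {c q : ℝ} {n N : ℕ} {ι : Type*} {l : Filter ι}

theorem tendsto_exp_neg_I_mul_mul {x y : ι → ℝ} {x₀ y₀ : ℝ} (hx : Tendsto x l (𝓝 x₀))
    (hy : Tendsto y l (𝓝 y₀)) : Tendsto (fun i => Complex.exp (-Complex.I * (x i : ℂ)) * (y i : ℂ)) l
      (𝓝 (Complex.exp (-Complex.I * (x₀ : ℂ)) * (y₀ : ℂ))) := by
  have h1 : Continuous fun x : ℝ => Complex.exp (-Complex.I * (x : ℂ)) := by fun_prop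
  exact ((h1.tendsto x₀).comp hx).mul ((Complex.continuous_ofReal.tendsto y₀).comp hy)

theorem Model.Regular.tendsto_Theta_space (h : P.Regular c q) [l.IsCountablyGenerated]
    {p : ι → Momentum d} {p₀ : Momentum d} {Ω : ι → ℝ} {Ω₀ : ℝ} (hp : Tendsto p l (𝓝 p₀))
    (hΩ : Tendsto Ω l (𝓝 Ω₀)) (s : ℝ) :
    Tendsto (fun i => P.Theta (spaceMeasure d) s (p i) (Ω i)) l
      (𝓝 (P.Theta (spaceMeasure d) s p₀ Ω₀)) := by
  refine tendsto_finsetSum _ fun σ _ => ?_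
  have hM := h.continuous_M σ
  have hΦ := h.continuous_Phi σ
  refine tendsto_integral_filter_of_dominated_convergence (fun k => P.M k σ)
    (Eventually.of_forall fun i => ?_) (Eventually.of_forall fun i => ae_of_all _ fun k => ?_)
    (h.integrable_M integrable_decay_spaceMeasure σ) (ae_of_all _ fun k => ?_)
  · have : Continuous fun k => P.Phi σ (p i) k := hΦ.comp (continuous_const.prodMk continuous_id)
    exact Continuous.aestronglyMeasurable (by fun_prop)
  · rw [norm_mul, norm_exp_neg_I_mul, one_mul, Complex.norm_of_nonneg (h.M_nonneg k σ)]
  · have hΦk : Continuous fun p' : Momentum d => P.Phi σ p' k :=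
      hΦ.comp (continuous_id.prodMk continuous_const)
    exact tendsto_exp_neg_I_mul_mul ((((hΦk.tendsto p₀).comp hp).add hΩ).const_mul s)
      tendsto_const_nhds

/-- Sampling at the nearest point puts all volumes on one measure space, and a multiple of the
reference decay dominates for L ≥ 1. The momentum p and the energy Ω may vary along the filter,
which later yields locally uniform convergence. -/
theorem Model.Regular.tendsto_Theta_lattice (h : P.Regular c q) [l.IsCountablyGenerated]
    {L : ι → ℝ} (hL : Tendsto L l atTop)
    {p : ι → Momentum d} {p₀ : Momentum d} {Ω : ι → ℝ} {Ω₀ : ℝ} (hp : Tendsto p l (𝓝 p₀))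
    (hΩ : Tendsto Ω l (𝓝 Ω₀)) (s : ℝ) :
    Tendsto (fun i => P.Theta (latticeMeasure d (L i)) s (p i) (Ω i)) l
      (𝓝 (P.Theta (spaceMeasure d) s p₀ Ω₀)) := by
  refine tendsto_finsetSum _ fun σ _ => ?_
  have hM := h.continuous_M σ
  have hΦ := h.continuous_Phi σ
  have hgk : ∀ i, Continuous fun k : Momentum d =>
      Complex.exp (-Complex.I * ((s * (P.Phi σ (p i) k + Ω i) : ℝ) : ℂ)) * ((P.M k σ : ℝ) : ℂ) := by
    intro i
    have : Continuous fun k => P.Phi σ (p i) k := hΦ.comp (continuous_const.prodMk continuous_id)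
    fun_prop
  refine Tendsto.congr' (f₁ := fun i => ∫ k, (fun k : Momentum d =>
    Complex.exp (-Complex.I * ((s * (P.Phi σ (p i) k + Ω i) : ℝ) : ℂ)) * ((P.M k σ : ℝ) : ℂ))
      (latticePoint (L i) (nearest (L i) k)) ∂spaceMeasure d) ?_ ?_
  · filter_upwards [hL.eventually_gt_atTop 0] with i hi
    rw [latticeMeasure_eq_map hi, integral_map (measurable_latticePoint_nearest _).aemeasurable
      (hgk i).aestronglyMeasurable]
  refine tendsto_integral_filter_of_dominated_convergence
    (fun k => c ^ 2 * (1 - q)⁻¹ * ((1 + d * Real.sqrt (2 * Real.pi)) ^ (d + 1) * decay k))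
    (Eventually.of_forall fun i => ?_) ?_
    ((integrable_decay_spaceMeasure.const_mul _).const_mul _) (ae_of_all _ fun k => ?_)
  · exact ((hgk i).measurable.comp (measurable_latticePoint_nearest _)).aestronglyMeasurable
  · filter_upwards [hL.eventually_ge_atTop 1] with i hi
    refine ae_of_all _ fun k => ?_
    rw [norm_mul, norm_exp_neg_I_mul, one_mul, Complex.norm_of_nonneg (h.M_nonneg _ σ)]
    have hq : 0 < 1 - q := by linarith [h.q_lt]
    exact (h.M_le_decay _ σ).trans (mul_le_mul_of_nonneg_left (decay_nearest_le hi k)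
      (by positivity))
  · have hk := (tendsto_latticePoint_nearest k).comp hL
    exact tendsto_exp_neg_I_mul_mul
      ((((hΦ.tendsto (p₀, k)).comp (hp.prodMk_nhds hk)).add hΩ).const_mul s)
      ((hM.tendsto k).comp hk)

/-- Only bounded mass and convergence of Θ are required of the measures. The statement therefore
covers both lattice measures with growing L and a fixed measure, where it expresses continuity in
the external variables. -/
theorem Model.Regular.tendsto_blockIntegral (h : P.Regular c q) [l.IsCountablyGenerated]
    {κ : ι → Measure (Momentum d)} {κ₀ : Measure (Momentum d)}
    (hκ : ∀ᶠ i in l, Integrable decay (κ i)) {A : ℝ} (hA : ∀ᶠ i in l, P.massM (κ i) ≤ A)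
    (hΘ : ∀ (s : ℝ) (p : ι → Momentum d) (p₀ : Momentum d) (Ω : ι → ℝ) (Ω₀ : ℝ),
      Tendsto p l (𝓝 p₀) → Tendsto Ω l (𝓝 Ω₀) →
        Tendsto (fun i => P.Theta (κ i) s (p i) (Ω i)) l (𝓝 (P.Theta κ₀ s p₀ Ω₀)))
    {m : Fin (n + 1) → ℕ} (hm : m ∈ patterns n N) (t : ℝ) {p : ι → Momentum d}
    {p₀ : Momentum d} (hp : Tendsto p l (𝓝 p₀)) {k : ι → Fin n → Momentum d}
    {k₀ : Fin n → Momentum d} (hk : Tendsto k l (𝓝 k₀)) (σ : Fin n → ℤˣ) :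
    Tendsto (fun i => P.blockIntegral (κ i) N m t (p i) (k i) σ) l
      (𝓝 (P.blockIntegral κ₀ N m t p₀ k₀ σ)) := by
  have hk' := fun j => (tendsto_pi_nhds.1 hk) j
  have hpj : ∀ j, Tendsto (fun i => Model.electronMomentum (p i) (k i) j) l
      (𝓝 (Model.electronMomentum p₀ k₀ j)) := fun j =>
    hp.add (tendsto_finsetSum _ fun l _ => hk' l)
  have hΩj : ∀ j, Tendsto (fun i => P.Omega (k i) σ j) l (𝓝 (P.Omega k₀ σ j)) := fun j =>
    tendsto_finsetSum _ fun l _ => ((h.cont_ω.tendsto _).comp (hk' l)).const_mul _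
  have hb : ∀ b s, Tendsto (fun i => P.blockFactor (κ i) m (p i) (k i) σ b s) l
      (𝓝 (P.blockFactor κ₀ m p₀ k₀ σ b s)) := by
    intro b s
    unfold Model.blockFactor
    split_ifs
    · have hc : Continuous fun x : ℝ => Complex.exp (-Complex.I * ((s * x : ℝ) : ℂ)) := by fun_prop
      exact (hc.tendsto _).comp (((h.cont_e.tendsto _).comp (hpj _)).add (hΩj _))
    · exact hΘ s _ _ _ _ (hpj _) (hΩj _)
  simp only [P.blockIntegral_eq _ hm, simplexIntegral_eq]
  refine tendsto_integral_filter_of_dominated_convergence (fun _ => (1 + A) ^ (N + 1)) ?_ ?_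
    ?_ (ae_of_all _ fun u => tendsto_finsetProd _ fun b _ => hb b _)
  · filter_upwards [hκ] with i hi
    refine Continuous.aestronglyMeasurable (continuous_finsetProd _ fun b _ => ?_)
    exact (h.continuous_blockFactor hi m _ _ _ b).comp
      ((continuous_durations b).comp (continuous_const.prodMk continuous_id))
  · filter_upwards [hA] with i hi
    refine ae_of_all _ fun u => ?_
    rw [norm_prod]
    refine (Finset.prod_le_prod (fun b _ => norm_nonneg _) fun b _ =>
      (h.norm_blockFactor_le m _ _ _ b _).trans (by linarith)).trans_eq
        (?_ : ∏ _b ∈ Finset.range (N + 1), (1 + A) = _)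
    simp
  · exact integrableOn_const (volume_timeSimplex_lt_top N t).ne

/-- A bound for the masses of `M`, uniform for large volumes. -/
def Model.massBound (P : Model d) (c q : ℝ) : ℝ :=
  2 * (c ^ 2 * (1 - q)⁻¹ * decayBound d) + P.massM (spaceMeasure d)

theorem Model.Regular.massM_space_le (h : P.Regular c q) :
    P.massM (spaceMeasure d) ≤ P.massBound c q := by
  have hq : 0 < 1 - q := by linarith [h.q_lt]
  have := decayBound_nonneg (d := d)
  rw [Model.massBound]
  have : 0 ≤ 2 * (c ^ 2 * (1 - q)⁻¹ * decayBound d) := by positivity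
  linarith

/-- The additional bracket is absorbed by the spare decay of M, so a first moment in each external
momentum stays bounded in L. The factor 2 in the bound counts the signs. -/
theorem Model.Regular.tsum_bracket_mul_latticeM (h : P.Regular c q) {L : ℝ} (hL : 1 ≤ L) :
    (Summable fun x : Leg d => ‖P.latticeM L x * bracket (latticePoint L x.1)‖) ∧
    ∑' x : Leg d, P.latticeM L x * bracket (latticePoint L x.1) ≤ P.massBound c q := by
  have hL0 : 0 < L := by linarith
  have hq : 0 < 1 - q := by linarith [h.q_lt]
  have hD : 0 < L ^ d := by positivity
  have hs0 : Summable fun x : ℤˣ × Mode d => decay (latticePoint L x.2) := by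
    rw [summable_prod_of_nonneg fun x => (decay_pos _).le]
    exact ⟨fun _ => summable_decay hL0, Summable.of_finite⟩
  have hs : Summable fun x : Leg d =>
      (L ^ d)⁻¹ * (c ^ 2 * (1 - q)⁻¹) * decay (latticePoint L x.1) := by
    exact ((Equiv.prodComm (Mode d) ℤˣ).summable_iff.2 hs0).mul_left _
  have hn : ∀ x : Leg d, 0 ≤ P.latticeM L x * bracket (latticePoint L x.1) := fun x =>
    mul_nonneg (h.latticeM_nonneg hL0 x) (bracket_pos _).le
  have hle : ∀ x : Leg d, P.latticeM L x * bracket (latticePoint L x.1) ≤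
      (L ^ d)⁻¹ * (c ^ 2 * (1 - q)⁻¹) * decay (latticePoint L x.1) := fun x => by
    rw [Model.latticeM, mul_assoc, mul_assoc, mul_comm (P.M _ _)]
    exact mul_le_mul_of_nonneg_left (h.bracket_mul_M_le _ _) (inv_nonneg.2 hD.le)
  have hs' := Summable.of_nonneg_of_le hn hle hs
  refine ⟨hs'.norm, (hs'.tsum_le_tsum hle hs).trans ?_⟩
  rw [tsum_mul_left]
  have h2 : ∑' x : Leg d, decay (latticePoint L x.1) = 2 * ∑' z : Mode d, decay (latticePoint L z) := by
    have h3 := (Equiv.prodComm ℤˣ (Mode d)).tsum_eq fun x : Leg d => decay (latticePoint L x.1)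
    have h6 := hs0.tsum_prod' fun _ => summable_decay hL0
    refine h3.symm.trans (h6.trans ((tsum_fintype _).trans ?_))
    simp
  have h4 := tsum_decay_le (d := d) hL
  have h5 := h.massM_nonneg (spaceMeasure d)
  rw [h2, Model.massBound]
  calc _ ≤ (L ^ d)⁻¹ * (c ^ 2 * (1 - q)⁻¹) * (2 * (L ^ d * decayBound d)) := by gcongr
    _ = 2 * (c ^ 2 * (1 - q)⁻¹ * decayBound d) := by field_simp
    _ ≤ _ := by linarith

theorem Model.Regular.massM_lattice_le (h : P.Regular c q) {L : ℝ} (hL : 1 ≤ L) :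
    P.massM (latticeMeasure d L) ≤ P.massBound c q := by
  have hL0 : 0 < L := by linarith
  obtain ⟨hs, hb⟩ := h.tsum_bracket_mul_latticeM hL
  rw [← h.tsum_latticeM hL0]
  exact ((h.summable_latticeM hL0).of_norm.tsum_le_tsum (fun x =>
    le_mul_of_one_le_right (h.latticeM_nonneg hL0 x) (one_le_bracket _)) hs.of_norm).trans hb

/-- The product of the two time integrals of `Y` as a function of `p_n` and `k`. -/
def Model.blockPair (P : Model d) (κ : Measure (Momentum d)) (N : ℕ) (m m' : Fin (n + 1) → ℕ)
    (π : Equiv.Perm (Fin n)) (t : ℝ) (σ : Fin n → ℤˣ)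
    (x : Momentum d × (Fin n → Momentum d)) : ℂ :=
  P.blockIntegral κ N m t x.1 x.2 σ *
    conj (P.blockIntegral κ N m' t x.1 (fun j => x.2 (π.symm j)) fun j => σ (π.symm j))

/-- Locally uniform convergence amounts to convergence when the volume grows and the point moves
simultaneously: `h1` treats the lattice functions and `h2` the continuity of the limit function. -/
theorem Model.Regular.tendstoLocallyUniformly_blockPair (h : P.Regular c q)
    {m m' : Fin (n + 1) → ℕ} (hm : m ∈ patterns n N) (hm' : m' ∈ patterns n N)
    (π : Equiv.Perm (Fin n)) (t : ℝ) (σ : Fin n → ℤˣ) :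
    TendstoLocallyUniformly (fun L => P.blockPair (latticeMeasure d L) N m m' π t σ)
      (P.blockPair (spaceMeasure d) N m m' π t σ) atTop := by
  rw [tendstoLocallyUniformly_iff_forall_tendsto]
  intro x
  have hx : Tendsto (fun y : ℝ × Momentum d × (Fin n → Momentum d) => y.2) (atTop ×ˢ 𝓝 x) (𝓝 x) :=
    tendsto_snd
  have hp := (continuous_fst.tendsto x).comp hx
  have hk := (continuous_snd.tendsto x).comp hx
  have hkπ : Tendsto (fun (y : ℝ × Momentum d × (Fin n → Momentum d)) j => y.2.2 (π.symm j))
      (atTop ×ˢ 𝓝 x) (𝓝 fun j => x.2 (π.symm j)) :=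
    tendsto_pi_nhds.2 fun j => tendsto_pi_nhds.1 hk _
  have hL : Tendsto (fun y : ℝ × Momentum d × (Fin n → Momentum d) => y.1) (atTop ×ˢ 𝓝 x) atTop :=
    tendsto_fst
  have h1 : ∀ {m : Fin (n + 1) → ℕ}, m ∈ patterns n N → ∀ {k : _ → Fin n → Momentum d} {k₀},
      Tendsto k (atTop ×ˢ 𝓝 x) (𝓝 k₀) → ∀ σ, Tendsto (fun y => P.blockIntegral
        (latticeMeasure d y.1) N m t y.2.1 (k y) σ) (atTop ×ˢ 𝓝 x)
        (𝓝 (P.blockIntegral (spaceMeasure d) N m t x.1 k₀ σ)) := fun hm _ _ hk σ =>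
    h.tendsto_blockIntegral
      ((hL.eventually_gt_atTop 0).mono fun y hy => integrable_decay_latticeMeasure hy)
      ((hL.eventually_ge_atTop 1).mono fun y hy => h.massM_lattice_le hy)
      (fun s _ _ _ _ hp hΩ => h.tendsto_Theta_lattice hL hp hΩ s) hm t hp hk σ
  have h2 : ∀ {m : Fin (n + 1) → ℕ}, m ∈ patterns n N → ∀ {k : _ → Fin n → Momentum d} {k₀},
      Tendsto k (atTop ×ˢ 𝓝 x) (𝓝 k₀) → ∀ σ, Tendsto (fun y => P.blockIntegral
        (spaceMeasure d) N m t y.2.1 (k y) σ) (atTop ×ˢ 𝓝 x)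
        (𝓝 (P.blockIntegral (spaceMeasure d) N m t x.1 k₀ σ)) := fun hm _ _ hk σ =>
    h.tendsto_blockIntegral (Eventually.of_forall fun _ => integrable_decay_spaceMeasure)
      (Eventually.of_forall fun _ => le_rfl)
      (fun s _ _ _ _ hp hΩ => h.tendsto_Theta_space hp hΩ s) hm t hp hk σ
  -- Both components tend to the same value, and neighbourhoods of a diagonal point refine the
  -- uniformity.
  refine Tendsto.mono_right ?_ ((nhds_prod_eq.symm.le).trans
    (nhds_le_uniformity (P.blockPair (spaceMeasure d) N m m' π t σ x)))
  exact ((h2 hm hk σ).mul ((Complex.continuous_conj.tendsto _).comp (h2 hm' hkπ _))).prodMk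
    ((h1 hm hk σ).mul ((Complex.continuous_conj.tendsto _).comp (h1 hm' hkπ _)))

end VolumeLimit

/-! ### The representation formula over the whole space -/

section SpaceFormula

variable {d : ℕ} {P : Model d} {c q : ℝ} {n N : ℕ}

/-- A bound for `Y`, uniform for large volumes. -/
def Model.pairBound (P : Model d) (c q : ℝ) (N : ℕ) (t : ℝ) : ℝ :=
  ((1 + P.massBound c q) ^ (N + 1) * t ^ N) ^ 2

theorem Model.Regular.norm_blockPair_le (h : P.Regular c q) {κ : Measure (Momentum d)}
    (hκ : P.massM κ ≤ P.massBound c q) {m m' : Fin (n + 1) → ℕ} (hm : m ∈ patterns n N)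
    (hm' : m' ∈ patterns n N) (π : Equiv.Perm (Fin n)) {t : ℝ} (ht : 0 ≤ t) (σ : Fin n → ℤˣ)
    (x : Momentum d × (Fin n → Momentum d)) :
    ‖P.blockPair κ N m m' π t σ x‖ ≤ P.pairBound c q N t := by
  have h0 := h.massM_nonneg κ
  refine (h.norm_cSummand_le hm hm' ht _ _ _ _ _ _).trans ?_
  rw [Model.pairBound]
  gcongr

/-- The weight controlling large momenta. -/
def tailWeight (x : Momentum d × (Fin n → Momentum d)) : ℝ := bracket x.1 * ∏ j, bracket (x.2 j)

theorem one_le_prod_bracket (s : Finset (Fin n)) (k : Fin n → Momentum d) :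
    1 ≤ ∏ j ∈ s, bracket (k j) := by
  have h1 := Finset.prod_le_prod (s := s) (f := fun _ => (1 : ℝ))
    (fun _ _ => zero_le_one) fun j _ => one_le_bracket (k j)
  rwa [Finset.prod_const_one] at h1

theorem norm_le_tailWeight (x : Momentum d × (Fin n → Momentum d)) : ‖x‖ ≤ tailWeight x := by
  have h1 := one_le_prod_bracket Finset.univ x.2
  have h0 := one_le_bracket x.1
  have h2 : ∀ j, bracket (x.2 j) ≤ ∏ j, bracket (x.2 j) := fun j => by
    rw [← Finset.mul_prod_erase _ _ (Finset.mem_univ j)]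
    exact le_mul_of_one_le_right (bracket_pos _).le (one_le_prod_bracket _ _)
  have h3 : 0 ≤ bracket x.1 * ∏ j, bracket (x.2 j) := by nlinarith
  have h4 : ‖x.2‖ ≤ bracket x.1 * ∏ j, bracket (x.2 j) :=
    (pi_norm_le_iff_of_nonneg h3).2 fun j => ((norm_le_bracket _).trans (h2 j)).trans
      (le_mul_of_one_le_left (by linarith) h0)
  rw [tailWeight, Prod.norm_def]
  exact max_le ((norm_le_bracket _).trans (le_mul_of_one_le_right (by linarith) h1)) h4

/-- If the tail weight is at most ε⁻¹, the point lies in a fixed ball on which convergence is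
uniform. If it exceeds ε⁻¹, the trivial bound 2·`pairBound` is at most ε times the weight times that
bound. -/
theorem Model.Regular.eventually_norm_blockPair_sub_le (h : P.Regular c q)
    {m m' : Fin (n + 1) → ℕ} (hm : m ∈ patterns n N) (hm' : m' ∈ patterns n N)
    (π : Equiv.Perm (Fin n)) {t : ℝ} (ht : 0 ≤ t) {ε : ℝ} (hε : 0 < ε) :
    ∀ᶠ L : ℝ in atTop, ∀ (σ : Fin n → ℤˣ) (x : Momentum d × (Fin n → Momentum d)),
      ‖P.blockPair (latticeMeasure d L) N m m' π t σ x -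
        P.blockPair (spaceMeasure d) N m m' π t σ x‖ ≤
          ε * (1 + 2 * P.pairBound c q N t) * tailWeight x := by
  have hK : IsCompact (Metric.closedBall (0 : Momentum d × (Fin n → Momentum d)) ε⁻¹) :=
    isCompact_closedBall _ _
  have hu := fun σ : Fin n → ℤˣ => Metric.tendstoUniformlyOn_iff.1
    ((tendstoLocallyUniformlyOn_iff_tendstoUniformlyOn_of_compact hK).1
      (h.tendstoLocallyUniformly_blockPair hm hm' π t σ).tendstoLocallyUniformlyOn) ε hε
  filter_upwards [eventually_all.2 hu, eventually_ge_atTop (1 : ℝ)] with L hL hL1 σ x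
  have hB : 0 ≤ P.pairBound c q N t := sq_nonneg _
  have hW : 1 ≤ tailWeight x :=
    one_le_mul_of_one_le_of_one_le (one_le_bracket _) (one_le_prod_bracket _ _)
  rcases le_total (tailWeight x) ε⁻¹ with hx | hx
  · have h1 := hL σ x (mem_closedBall_zero_iff.2 ((norm_le_tailWeight x).trans hx))
    rw [dist_comm, dist_eq_norm] at h1
    refine h1.le.trans ?_
    calc ε = ε * 1 * 1 := by ring
      _ ≤ _ := by gcongr; linarith
  · have h1 : 1 ≤ ε * tailWeight x := by
      rwa [inv_le_iff_one_le_mul₀' hε] at hx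
    refine (norm_sub_le _ _).trans ((add_le_add
      (h.norm_blockPair_le (h.massM_lattice_le hL1) hm hm' π ht σ x)
      (h.norm_blockPair_le h.massM_space_le hm hm' π ht σ x)).trans ?_)
    calc _ = 1 * (2 * P.pairBound c q N t) := by ring
      _ ≤ (ε * tailWeight x) * (1 + 2 * P.pairBound c q N t) := by gcongr; linarith
      _ = _ := by ring

/-- The tail weight is a product, so the external sums factorize into n bracket-weighted masses and
only ⟨p⟩ is left for the electron. -/
theorem Model.Regular.norm_cInner_sub_le (h : P.Regular c q) {L : ℝ} (hL : 1 ≤ L)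
    {m m' : Fin (n + 1) → ℕ} (hm : m ∈ patterns n N) (hm' : m' ∈ patterns n N)
    (π : Equiv.Perm (Fin n)) {t : ℝ} (ht : 0 ≤ t) {B : ℝ} (hB : 0 ≤ B)
    (hx : ∀ (σ : Fin n → ℤˣ) (x : Momentum d × (Fin n → Momentum d)),
      ‖P.blockPair (latticeMeasure d L) N m m' π t σ x -
        P.blockPair (spaceMeasure d) N m m' π t σ x‖ ≤ B * tailWeight x) (p : Mode d) :
    ‖P.cInner (latticeMeasure d L) L N m m' π t p - P.cInner (spaceMeasure d) L N m m' π t p‖ ≤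
      B * P.massBound c q ^ n * bracket (latticePoint L p) := by
  have hL0 : 0 < L := by linarith
  obtain ⟨hs, hb⟩ := h.tsum_bracket_mul_latticeM hL
  have hs1 := h.summable_cInner hL0 (κ := latticeMeasure d L) hm hm' π ht (latticePoint L p)
  have hs2 := h.summable_cInner hL0 (κ := spaceMeasure d) hm hm' π ht (latticePoint L p)
  rw [Model.cInner, Model.cInner, ← hs1.of_norm.tsum_sub hs2.of_norm]
  have hn : ∀ x : Leg d, 0 ≤ P.latticeM L x * bracket (latticePoint L x.1) := fun x =>
    mul_nonneg (h.latticeM_nonneg hL0 x) (bracket_pos _).le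
  have hsum : Summable fun x : Fin n → Leg d =>
      ∏ j, P.latticeM L (x j) * bracket (latticePoint L (x j).1) :=
    (summable_norm_prod (f := fun _ : Fin n => fun x : Leg d =>
      P.latticeM L x * bracket (latticePoint L x.1)) fun _ => hs).of_norm
  refine (tsum_of_norm_bounded (hsum.mul_left (B * bracket (latticePoint L p))).hasSum
    fun x => ?_).trans ?_
  · rw [← mul_sub, norm_mul, Complex.norm_real, Real.norm_of_nonneg
      (Finset.prod_nonneg fun j _ => h.latticeM_nonneg hL0 _), Finset.prod_mul_distrib]
    refine (mul_le_mul_of_nonneg_left (hx (fun j => (x j).2)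
      (latticePoint L p, fun j => latticePoint L (x j).1))
      (Finset.prod_nonneg fun j _ => h.latticeM_nonneg hL0 _)).trans_eq ?_
    rw [tailWeight]
    ring
  · rw [tsum_mul_left, tsum_prod_eq (f := fun _ : Fin n => fun x : Leg d =>
      P.latticeM L x * bracket (latticePoint L x.1)) fun _ => hs, Finset.prod_const,
      Finset.card_univ, Fintype.card_fin]
    have h0 : 0 ≤ B * bracket (latticePoint L p) := mul_nonneg hB (bracket_pos _).le
    refine (mul_le_mul_of_nonneg_left (pow_le_pow_left₀ (tsum_nonneg hn) hb n) h0).trans_eq ?_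
    ring

/-- Only the first moment of the electron momentum is needed, and brackets are at least 1, so any
positive power controls it. The maximum with 0 reflects that `ENNReal.ofReal` truncates negative
constants. -/
theorem IsDensityMatrix.tsum_bracket_le {L : ℝ} {γ : ElectronSpace d →L[ℂ] ElectronSpace d}
    (hγ : IsDensityMatrix γ) {a : ℕ} (ha : a ≠ 0) {C : ℝ}
    (hC : ∑' p : Mode d, ENNReal.ofReal
      (bracket (latticePoint L p) ^ a * (electronElement γ p p).re) ≤ ENNReal.ofReal C) :
    (Summable fun p => ‖electronElement γ p p‖ * bracket (latticePoint L p)) ∧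
    ∑' p, ‖electronElement γ p p‖ * bracket (latticePoint L p) ≤ max C 0 := by
  have h0 : ∀ p, 0 ≤ ‖electronElement γ p p‖ * bracket (latticePoint L p) := fun p =>
    mul_nonneg (norm_nonneg _) (bracket_pos _).le
  have h1 : ∀ u : Finset (Mode d),
      ∑ p ∈ u, ‖electronElement γ p p‖ * bracket (latticePoint L p) ≤ max C 0 := by
    intro u
    have h2 : ENNReal.ofReal (∑ p ∈ u, ‖electronElement γ p p‖ * bracket (latticePoint L p)) ≤
        ENNReal.ofReal (max C 0) := by
      rw [ENNReal.ofReal_sum_of_nonneg fun p _ => h0 p]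
      refine (Finset.sum_le_sum fun p _ => ?_).trans ((ENNReal.sum_le_tsum u).trans
        (hC.trans (ENNReal.ofReal_le_ofReal (le_max_left C 0))))
      refine ENNReal.ofReal_le_ofReal ?_
      rw [hγ.norm_element, mul_comm]
      exact mul_le_mul_of_nonneg_right (le_self_pow₀ (one_le_bracket _) ha)
        (hγ.element_re_nonneg p)
    exact (ENNReal.ofReal_le_ofReal_iff (le_max_right C 0)).1 h2
  exact ⟨summable_of_sum_le h0 h1, Real.tsum_le_of_sum_le h0 h1⟩

/-- The error at momentum p is at most ε⟨p⟩ times a constant, and the moment assumption bounds the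
average of ⟨p⟩ uniformly in L. -/
theorem Model.Regular.tendsto_sumC_sub (h : P.Regular c q)
    {γ : ℝ → ElectronSpace d →L[ℂ] ElectronSpace d}
    (hγ : ∀ L : ℝ, 0 < L → IsDensityMatrix (γ L)) {a : ℕ} (ha : a ≠ 0) {C : ℝ}
    (hC : ∀ᶠ L : ℝ in atTop, ∑' p : Mode d, ENNReal.ofReal
      (bracket (latticePoint L p) ^ a * (electronElement (γ L) p p).re) ≤ ENNReal.ofReal C)
    {t : ℝ} (ht : 0 ≤ t) (n N : ℕ) :
    Tendsto (fun L : ℝ => P.sumC (latticeMeasure d L) L (γ L) t n N -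
      P.sumC (spaceMeasure d) L (γ L) t n N) atTop (𝓝 0) := by
  have key : ∀ (m m' : patterns n N) (π : Equiv.Perm (Fin n)), Tendsto (fun L : ℝ =>
      P.C (latticeMeasure d L) L (γ L) N m.1 m'.1 π t -
        P.C (spaceMeasure d) L (γ L) N m.1 m'.1 π t) atTop (𝓝 0) := by
    intro m m' π
    set K : ℝ := ‖(P.coupling : ℂ) ^ (2 * N)‖ *
      ((1 + 2 * P.pairBound c q N t) * P.massBound c q ^ n * max C 0) with hK
    have hB : 0 ≤ P.pairBound c q N t := sq_nonneg _
    have hA : 0 ≤ P.massBound c q := (h.massM_nonneg _).trans h.massM_space_le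
    have hK0 : 0 ≤ K := by positivity
    have hε : ∀ ε > 0, ∀ᶠ L : ℝ in atTop, ‖P.C (latticeMeasure d L) L (γ L) N m.1 m'.1 π t -
        P.C (spaceMeasure d) L (γ L) N m.1 m'.1 π t‖ ≤ ε * K := by
      intro ε hε
      filter_upwards [h.eventually_norm_blockPair_sub_le m.2 m'.2 π ht hε, hC,
        eventually_ge_atTop (1 : ℝ)] with L hx hCL hL
      have hL0 : 0 < L := by linarith
      have hg := hγ L hL0
      obtain ⟨hs, hb⟩ := hg.tsum_bracket_le ha hCL
      have hs1 := hg.summable_element_mul fun p =>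
        h.norm_cInner_le hL0 (κ := latticeMeasure d L) m.2 m'.2 π ht p
      have hs2 := hg.summable_element_mul fun p =>
        h.norm_cInner_le hL0 (κ := spaceMeasure d) m.2 m'.2 π ht p
      rw [h.C_eq hL0 hg _ m.2 m'.2 π ht, h.C_eq hL0 hg _ m.2 m'.2 π ht, ← mul_sub, norm_mul,
        ← hs1.tsum_sub hs2, hK, mul_left_comm]
      refine mul_le_mul_of_nonneg_left ?_ (norm_nonneg _)
      refine (tsum_of_norm_bounded (hs.mul_left
        (ε * (1 + 2 * P.pairBound c q N t) * P.massBound c q ^ n)).hasSum fun p => ?_).trans ?_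
      · rw [← mul_sub, norm_mul]
        refine (mul_le_mul_of_nonneg_left (h.norm_cInner_sub_le hL m.2 m'.2 π ht (by positivity) hx
          p) (norm_nonneg _)).trans_eq ?_
        ring
      · rw [tsum_mul_left]
        refine (mul_le_mul_of_nonneg_left hb (by positivity)).trans_eq ?_
        ring
    rw [Metric.tendsto_nhds]
    intro δ hδ
    -- K may vanish; dividing by K + 1 avoids a case distinction.
    filter_upwards [hε (δ / (K + 1)) (by positivity)] with L hL
    rw [dist_zero_right]
    refine hL.trans_lt ?_
    rw [div_mul_eq_mul_div, div_lt_iff₀ (by positivity)]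
    nlinarith
  have h1 := tendsto_finsetSum (Finset.univ : Finset (patterns n N)) fun m _ =>
    tendsto_finsetSum (Finset.univ : Finset (patterns n N)) fun m' _ =>
      tendsto_finsetSum (Finset.univ : Finset (Equiv.Perm (Fin n))) fun π _ => key m m' π
  simp only [Finset.sum_const_zero] at h1
  refine h1.congr fun L => ?_
  simp only [Finset.sum_sub_distrib, Model.sumC]
  simp only [← Finset.sum_coe_sort (patterns n N)]

theorem Model.Regular.tendsto_space_formula (h : P.Regular c q) (hd : d ≠ 0)
    (hZ : ∀ L : ℝ, 0 < L → Summable (P.gibbsWeight L))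
    {γ : ℝ → ElectronSpace d →L[ℂ] ElectronSpace d}
    (hγ : ∀ L : ℝ, 0 < L → IsDensityMatrix (γ L)) {a : ℕ} (ha : a ≠ 0) {C : ℝ}
    (hC : ∀ᶠ L : ℝ in atTop, ∑' p : Mode d, ENNReal.ofReal
      (bracket (latticePoint L p) ^ a * (electronElement (γ L) p p).re) ≤ ENNReal.ofReal C)
    {t : ℝ} (ht : 0 ≤ t) (n N : ℕ) :
    Tendsto (fun L : ℝ =>
      ‖P.expandedTrace L (γ L) t n N - P.sumC (spaceMeasure d) L (γ L) t n N‖)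
      atTop (𝓝 0) := by
  have h1 := (h.tendsto_lattice_formula hd hZ hγ ht n N).add
    (h.tendsto_sumC_sub hγ ha hC ht n N).norm
  rw [norm_zero, add_zero] at h1
  exact squeeze_zero (fun L => norm_nonneg _) (fun L => norm_sub_le_norm_sub_add_norm_sub _ _ _) h1

/-- Multiplying the gap by β gives βω - μ ≥ βC₆, so every Boltzmann factor is at most e^{-βC₆},
which is less than 1. -/
theorem Model.regular_of_gap {P : Model d} (he : Continuous P.e)
    (hω : Continuous P.ω) (hω_symm : ∀ k, P.ω (-k) = P.ω k)
    (hQ : Continuous P.Q) (hQ_symm : ∀ k, P.Q (-k) = P.Q k)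
    {C₇ : ℝ} (hQ_decay : ∀ k, |P.Q k| ≤ C₇ * (bracket k ^ (2 * d + 12))⁻¹)
    (hβ : 0 < P.β) {C₆ : ℝ} (hC₆ : 0 < C₆) (hgap : ∀ k, C₆ ≤ P.ω k - P.chem * P.β⁻¹) :
    P.Regular C₇ (Real.exp (-(P.β * C₆))) where
  cont_e := he
  cont_ω := hω
  even_ω := hω_symm
  cont_Q := hQ
  even_Q := hQ_symm
  Q_le := hQ_decay
  boltzmann_le k := by
    have h1 := mul_le_mul_of_nonneg_left (hgap k) hβ.le
    have h2 : P.β * (P.ω k - P.chem * P.β⁻¹) = P.β * P.ω k - P.chem := by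
      field_simp
    exact Real.exp_le_exp.2 (by linarith)
  q_lt := Real.exp_lt_one_iff.2 (neg_lt_zero.2 (mul_pos hβ hC₆))

end SpaceFormula

end ElectronPhonon

end

/-! ### The proposition -/

theorem mainTheorem3 {d : ℕ} (hd : 3 ≤ d) (P : Model d)
    (he : Continuous P.e)
    (hω : Continuous P.ω) (hω_symm : ∀ k, P.ω (-k) = P.ω k)
    (hQ : Continuous P.Q) (hQ_symm : ∀ k, P.Q (-k) = P.Q k)
    (C₇ : ℝ) (hQ_decay : ∀ k, |P.Q k| ≤ C₇ * (bracket k ^ (2 * d + 12))⁻¹)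
    (hβ : 0 < P.β)
    (C₆ : ℝ) (hC₆ : 0 < C₆) (hgap : ∀ k, C₆ ≤ P.ω k - P.chem * P.β⁻¹)
    (hZ : ∀ L : ℝ, 0 < L → Summable (P.gibbsWeight L))
    (γ : ℝ → ElectronSpace d →L[ℂ] ElectronSpace d)
    (hγ : ∀ L : ℝ, 0 < L → IsDensityMatrix (γ L))
    (n N : ℕ) (hnN : n ≤ N) (hparity : Even (N - n)) (t : ℝ) (ht : 0 < t) :
    -- all the series in the formula converge absolutely
    (∀ L : ℝ, 0 < L →
      P.ExpandedTraceConverges L (γ L) t n N ∧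
      ∀ κ : Measure (Momentum d), (κ = latticeMeasure d L ∨ κ = spaceMeasure d) →
        ∀ m ∈ patterns n N, ∀ m' ∈ patterns n N, ∀ (π : Equiv.Perm (Fin n)) (σ : Fin n → ℤˣ),
          Summable (fun x => P.CSummand κ L (γ L) N m m' π t σ x)) ∧
    -- the formula, the internal momentum integrals being taken over the dual lattice
    Tendsto (fun L : ℝ =>
      ‖P.expandedTrace L (γ L) t n N - P.sumC (latticeMeasure d L) L (γ L) t n N‖)
      atTop (𝓝 0) ∧
    -- the formula, the internal momentum integrals being taken over the whole space
    ((∃ C₈ : ℝ, ∀ᶠ L : ℝ in atTop,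
        ∑' p : Mode d, ENNReal.ofReal
          (bracket (latticePoint L p) ^ (3 * d + 12) * (electronElement (γ L) p p).re) ≤
        ENNReal.ofReal C₈) →
      Tendsto (fun L : ℝ =>
        ‖P.expandedTrace L (γ L) t n N - P.sumC (spaceMeasure d) L (γ L) t n N‖)
        atTop (𝓝 0)) ∧
    -- the resolvent form of the integrand
    (∀ κ : Measure (Momentum d),
      ((∃ L : ℝ, 0 < L ∧ κ = latticeMeasure d L) ∨ κ = spaceMeasure d) →
      ∀ m ∈ patterns n N, ∀ m' ∈ patterns n N, ∀ (π : Equiv.Perm (Fin n))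
        (p p' : Momentum d) (k k' : Fin n → Momentum d) (σ : Fin n → ℤˣ) (η : ℝ), 0 < η →
        (1 ≤ N →
          MeasureTheory.Integrable (P.resolventIntegrand κ m η t p k σ) ∧
          MeasureTheory.Integrable (P.resolventIntegrandTilde κ m' η t p' k' (σ ∘ π.symm))) ∧
        ∃ A A' : ℂ,
          HasImproperIntegral (P.resolventIntegrand κ m η t p k σ) A ∧
          HasImproperIntegral (P.resolventIntegrandTilde κ m' η t p' k' (σ ∘ π.symm)) A' ∧
          P.Y κ N m m' π t p p' k k' σ =
            ((Real.exp (2 * t * η) / (2 * Real.pi) ^ 2 : ℝ) : ℂ) * A * A') := by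
  have h := Model.regular_of_gap he hω hω_symm hQ hQ_symm hQ_decay hβ hC₆ hgap
  have hd0 : d ≠ 0 := by omega
  refine ⟨fun L hL => ⟨h.expandedTraceConverges hL (hZ L hL) (hγ L hL) ht.le n N,
      fun κ _ m hm m' hm' π σ => h.summable_CSummand hL (hγ L hL) κ hm hm' π ht.le σ⟩,
    h.tendsto_lattice_formula hd0 hZ hγ ht.le n N,
    fun ⟨_, hC⟩ => h.tendsto_space_formula hd0 hZ hγ (by omega) hC ht.le n N, ?_⟩
  rintro κ (⟨L, hL, rfl⟩ | rfl) m hm m' hm' π p p' k k' σ η hη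
  -- The transform of Θ rests on Fubini, which needs both momentum integrations to be s-finite.
  · have : SFinite (latticeMeasure d L) := by
      unfold latticeMeasure
      infer_instance
    exact Model.resolvent_formula h (integrable_decay_latticeMeasure hL) hm hm' π p p' k k' σ hη ht
  · have : SFinite (spaceMeasure d) := by
      unfold spaceMeasure
      infer_instance
    exact Model.resolvent_formula h integrable_decay_spaceMeasure hm hm' π p p' k k' σ hη ht
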